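/- Let $V$ be a compact oriented smooth $4$-manifold with boundary $\partial V$, where $\partial V$ carries the boundary orientation (outward vector first). Neither $V$ nor $\partial V$ is assumed connected. A \emph{Liouville structure} on $V$ is a smooth $1$-form $\lambda$ on $V$ such that $d\lambda$ is a symplectic form inducing the orientation of $V$ and $\lambda|_{\partial V}$ is a (positive) contact form on $\partial V$. A \emph{pre-Liouville structure} (exact weak filling) on $V$ is a pair $(\lambda,\xi)$, where $\lambda$ is a smooth $1$-form on $V$ such that $d\lambda$ is a symplectic form inducing the orientation of $V$, and $\xi$ is a smooth cooriented positive contact structure on $\partial V$ such that $d\lambda|_\xi$ is nondegenerate and induces on $\xi$ the same orientation as $d\alpha|_\xi$, for $\alpha$ a contact form defining the cooriented plane field $\xi$. Let $\mathfrak L(V)$ and $\mathfrak{pL}(V)$ denote the spaces of Liouville and pre-Liouville structures, with the $C^\infty$ topology, and let $\mathfrak p:\mathfrak L(V)\to\mathfrak{pL}(V)$, $\lambda\mapsto(\lambda,\ker\lambda|_{\partial V})$, be the natural map. \textbf{Theorem.} The map $\mathfrak p$ induces a well-defined map $\wp:\pi_0(\mathfrak L(V))\to\pi_0(\mathfrak{pL}(V))$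 on sets of path components, and $\wp$ is bijective. In particular, if $\lambda_0,\lambda_1\in\mathfrak L(V)$ and there is a path of pre-Liouville structures from $(\lambda_0,\ker\lambda_0|_{\partial V})$ to $(\lambda_1,\ker\lambda_1|_{\partial V})$, then $\lambda_0$ and $\lambda_1$ are joined by a path of Liouville structures, and they are exact symplectomorphic in the following sense. For $\lambda\in\mathfrak L(V)$ let $(\widehat V_\lambda,\widehat\lambda)$ be the completion, obtained by attaching to $(V,\lambda)$ the cylindrical end $\big([0,\infty)_r\times\partial V,\ e^r\lambda|_{\partial V}\big)$ along $\partial V$. Then there are a diffeomorphism $\Phi:\widehat V_{\lambda_1}\to\widehat V_{\lambda_0}$ and a compactly supported smooth function $f:\widehat V_{\lambda_1}\to\mathbb R$ such that $\widehat\lambda_1=\Phi^*\widehat\lambda_0+df$. -/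

import Mathlib

open Set Topology
open scoped Manifold ContDiff UniformConvergence

noncomputable section

universe u v

/-! ### Smooth differential 1-forms on a manifold, possibly with boundary -/

section Forms

variable {E : Type*} [NormedAddCommGroup E] [NormedSpace ℝ E]
  {H : Type*} [TopologicalSpace H]

/-- A smooth 1-form on `M`: a covector at every point, such that the associated fibrewise linear
function `(x, v) ↦ α x v` on the tangent bundle is smooth. -/
@[ext]
structure OneForm (I : ModelWithCorners ℝ E H) (M : Type*) [TopologicalSpace M]
    [ChartedSpace H M] [IsManifold I ∞ M] where
  toFun : ∀ x : M, TangentSpace I x →L[ℝ] ℝ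
  smooth : ContMDiff I.tangent 𝓘(ℝ, ℝ) ∞ (fun z : TangentBundle I M => toFun z.1 z.2)

namespace OneForm

variable {I : ModelWithCorners ℝ E H} {M : Type*} [TopologicalSpace M]
  [ChartedSpace H M] [IsManifold I ∞ M]

instance : CoeFun (OneForm I M) (fun _ => ∀ x : M, TangentSpace I x →L[ℝ] ℝ) := ⟨toFun⟩

/-- The coordinate expression of `α` in the chart at `x₀`: the pullback of `α` by the inverse of
that chart. -/
def chartRep (α : OneForm I M) (x₀ : M) (y : E) : E →L[ℝ] ℝ :=
  (α ((extChartAt I x₀).symm y)).comp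
    (mfderivWithin 𝓘(ℝ, E) I (extChartAt I x₀).symm (range I) y)

/-- The exterior derivative `dα`, as a function of a point and of two tangent vectors there. It is
computed in the chart at the point. -/
def d (α : OneForm I M) (x : M) (u w : TangentSpace I x) : ℝ :=
  extDerivWithin
    (fun y => ContinuousAlternatingMap.ofSubsingleton ℝ E ℝ (0 : Fin 1) (α.chartRep x y))
    (range I) (extChartAt I x x)
    ![mvfderiv I (extChartAt I x) x u, mvfderiv I (extChartAt I x) x w]

/-- The exact 2-form `dα` is symplectic, that is, nondegenerate at every point (it is closed). -/
def IsSymplectic (α : OneForm I M) : Prop :=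
  ∀ (x : M) (u : TangentSpace I x), (∀ w : TangentSpace I x, α.d x u w = 0) → u = 0

/-- The `C^∞` topology on 1-forms: uniform convergence on compact subsets of the charts of all
derivatives of the coordinate expressions. -/
instance : TopologicalSpace (OneForm I M) :=
  ⨅ (x₀ : M) (k : ℕ), TopologicalSpace.induced
    (fun α => UniformOnFun.ofFun {K : Set E | IsCompact K ∧ K ⊆ (extChartAt I x₀).target}
      (iteratedFDerivWithin ℝ k (α.chartRep x₀) (range I)))
    inferInstance

/-- The pullback of a 1-form by a smooth map. -/
def pullback {E' : Type*} [NormedAddCommGroup E'] [NormedSpace ℝ E']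
    {H' : Type*} [TopologicalSpace H'] {J : ModelWithCorners ℝ E' H'}
    {N : Type*} [TopologicalSpace N] [ChartedSpace H' N] [IsManifold J ∞ N]
    (α : OneForm I M) (f : N → M) (hf : ContMDiff J I ∞ f) : OneForm J N where
  toFun x := (α (f x)).comp (mfderiv J I f x)
  smooth := α.smooth.comp (hf.contMDiff_tangentMap (m := ∞) (by simp))

end OneForm

end Forms

/-! ### Oriented 4-manifolds with boundary -/

section FourManifolds

/-- An orientation of a 4-manifold `V` with boundary: an orientation of every tangent space which
is locally constant in charts. -/
structure FourOrientation (V : Type u) [TopologicalSpace V]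
    [ChartedSpace (EuclideanHalfSpace 4) V] [IsManifold (𝓡∂ 4) ∞ V] where
  orient : ∀ x : V, Orientation ℝ (TangentSpace (𝓡∂ 4) x) (Fin 4)
  locallyConstant : ∀ x₀ : V, ∀ᶠ x in 𝓝 x₀,
    ∀ (b : Module.Basis (Fin 4) ℝ (TangentSpace (𝓡∂ 4) x))
      (b₀ : Module.Basis (Fin 4) ℝ (TangentSpace (𝓡∂ 4) x₀)),
      (∀ i, mvfderiv (𝓡∂ 4) (extChartAt (𝓡∂ 4) x₀) x (b i) =
        mvfderiv (𝓡∂ 4) (extChartAt (𝓡∂ 4) x₀) x₀ (b₀ i)) →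
      (b.orientation = orient x ↔ b₀.orientation = orient x₀)

/-- An identification of the 3-manifold `M` with the boundary of the 4-manifold `V`. -/
structure BoundaryIdentification (M : Type v) [TopologicalSpace M]
    [ChartedSpace (EuclideanSpace ℝ (Fin 3)) M] [IsManifold (𝓡 3) ∞ M]
    (V : Type u) [TopologicalSpace V]
    [ChartedSpace (EuclideanHalfSpace 4) V] [IsManifold (𝓡∂ 4) ∞ V] where
  toFun : M → V
  isSmoothEmbedding : Manifold.IsSmoothEmbedding (𝓡 3) (𝓡∂ 4) ∞ toFun
  range_eq : range toFun = (𝓡∂ 4).boundary V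

variable {M : Type v} [TopologicalSpace M]
  [ChartedSpace (EuclideanSpace ℝ (Fin 3)) M] [IsManifold (𝓡 3) ∞ M]
  {V : Type u} [TopologicalSpace V]
  [ChartedSpace (EuclideanHalfSpace 4) V] [IsManifold (𝓡∂ 4) ∞ V]

namespace FourOrientation

/-- `v` is a positively oriented basis of the tangent space at `x`. -/
def Positive (o : FourOrientation V) (x : V) (v : Fin 4 → TangentSpace (𝓡∂ 4) x) : Prop :=
  ∃ b : Module.Basis (Fin 4) ℝ (TangentSpace (𝓡∂ 4) x), ⇑b = v ∧ b.orientation = o.orient x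

end FourOrientation

/-- The tangent vector `n` at the boundary point `x` points out of `V` (the model half-space is
`{y | 0 ≤ y 0}`). -/
def IsOutward (x : V) (n : TangentSpace (𝓡∂ 4) x) : Prop :=
  mvfderiv (𝓡∂ 4) (extChartAt (𝓡∂ 4) x) x n 0 < 0

namespace BoundaryIdentification

variable (bd : BoundaryIdentification M V)

/-- The restriction of a 1-form to the boundary. -/
def restrict (lam : OneForm (𝓡∂ 4) V) : OneForm (𝓡 3) M :=
  lam.pullback bd.toFun bd.isSmoothEmbedding.contMDiff

/-- `v` is a positively oriented basis of the tangent space at `p`, for the boundary orientation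
(outward vector first). -/
def Positive (o : FourOrientation V) (p : M) (v : Fin 3 → TangentSpace (𝓡 3) p) : Prop :=
  ∃ n : TangentSpace (𝓡∂ 4) (bd.toFun p), IsOutward (bd.toFun p) n ∧
    o.Positive (bd.toFun p) ![n, mfderiv (𝓡 3) (𝓡∂ 4) bd.toFun p (v 0),
      mfderiv (𝓡 3) (𝓡∂ 4) bd.toFun p (v 1), mfderiv (𝓡 3) (𝓡∂ 4) bd.toFun p (v 2)]

/-- `α` is a positive contact form on the oriented boundary: `α ∧ dα > 0`. -/
def IsContactForm (o : FourOrientation V) (α : OneForm (𝓡 3) M) : Prop :=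
  ∀ (p : M) (v : Fin 3 → TangentSpace (𝓡 3) p), bd.Positive o p v →
    0 < α p (v 0) * α.d p (v 1) (v 2) - α p (v 1) * α.d p (v 0) (v 2)
      + α p (v 2) * α.d p (v 0) (v 1)

/-- The space of positive contact forms on the boundary, with the `C^∞` topology. -/
abbrev ContactForm (o : FourOrientation V) : Type v :=
  {α : OneForm (𝓡 3) M // bd.IsContactForm o α}

/-- Two contact forms have the same cooriented kernel if and only if they differ by a positive
factor at every point. -/
instance contactSetoid (o : FourOrientation V) : Setoid (bd.ContactForm o) where
  r α β := ∀ p : M, ∃ c : ℝ, 0 < c ∧ β.1 p = c • α.1 p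
  iseqv :=
    { refl := fun _ _ => ⟨1, one_pos, by simp⟩
      symm := fun {α β} h p => by
        obtain ⟨c, hc, e⟩ := h p
        exact ⟨c⁻¹, inv_pos.2 hc, by rw [e, smul_smul, inv_mul_cancel₀ hc.ne', one_smul]⟩
      trans := fun {α β γ} h k p => by
        obtain ⟨c, hc, e⟩ := h p
        obtain ⟨c', hc', e'⟩ := k p
        exact ⟨c' * c, mul_pos hc' hc, by rw [e', e, smul_smul]⟩ }

/-- The space of (smooth, positive, cooriented) contact structures on the boundary: a contact
structure is the cooriented kernel of a contact form, that is, a class of contact forms up to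
positive functions. It carries the `C^∞` topology (the quotient topology). -/
abbrev ContactStructure (o : FourOrientation V) : Type v :=
  Quotient (bd.contactSetoid o)

end BoundaryIdentification

variable (bd : BoundaryIdentification M V) (o : FourOrientation V)

/-- `dλ` is a symplectic form inducing the orientation of `V`: it is nondegenerate and
`dλ ∧ dλ > 0`. -/
def IsPositiveSymplectic (o : FourOrientation V) (lam : OneForm (𝓡∂ 4) V) : Prop :=
  lam.IsSymplectic ∧
  ∀ (x : V) (v : Fin 4 → TangentSpace (𝓡∂ 4) x), o.Positive x v →
    0 < lam.d x (v 0) (v 1) * lam.d x (v 2) (v 3) - lam.d x (v 0) (v 2) * lam.d x (v 1) (v 3)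
      + lam.d x (v 0) (v 3) * lam.d x (v 1) (v 2)

/-- The space of Liouville structures on `V`: 1-forms `λ` such that `dλ` is symplectic and the
restriction of `λ` to the boundary is a contact form. -/
abbrev LiouvilleStructure : Type u :=
  {lam : OneForm (𝓡∂ 4) V // IsPositiveSymplectic o lam ∧ bd.IsContactForm o (bd.restrict lam)}

/-- `dλ` dominates `ξ` along the boundary: the restriction of `dλ` to `ξ` is nondegenerate and
induces the same orientation as `dα`, for a contact form `α` of `ξ` (the orientation of `ξ` does
not depend on `α`, and `u, w ∈ ker α` with `dα(u, w) > 0` are the positive bases of `ξ`). -/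
def Dominates (lam : OneForm (𝓡∂ 4) V) (ξ : bd.ContactStructure o) : Prop :=
  ∃ α : bd.ContactForm o, ⟦α⟧ = ξ ∧
    ∀ (p : M) (u w : TangentSpace (𝓡 3) p), α.1 p u = 0 → α.1 p w = 0 →
      0 < α.1.d p u w → 0 < (bd.restrict lam).d p u w

/-- The space of pre-Liouville structures on `V`: pairs `(λ, ξ)` of a 1-form on `V` and a
contact structure on the boundary such that `dλ` is symplectic and dominates `ξ`. -/
abbrev PreLiouvilleStructure : Type (max u v) :=
  {q : OneForm (𝓡∂ 4) V × bd.ContactStructure o //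
    IsPositiveSymplectic o q.1 ∧ Dominates bd o q.1 q.2}

/-- The natural map `λ ↦ (λ, ker λ|_∂V)`. -/
def LiouvilleStructure.toPreLiouville (ℓ : LiouvilleStructure bd o) :
    PreLiouvilleStructure bd o :=
  ⟨(ℓ.1, ⟦⟨bd.restrict ℓ.1, ℓ.2.2⟩⟧), ℓ.2.1, ⟨bd.restrict ℓ.1, ℓ.2.2⟩, rfl,
    fun _ _ _ _ _ h => h⟩

/-- The completion of `(V, λ)`: the manifold without boundary
`W = V ∪ ([0, ∞) × ∂V)` with the 1-form `Λ` that is `λ` on `V` and `e^r λ|_∂V` on the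
cylindrical end. The parametrization `cyl` of the end is defined slightly inside `V` as well, which
fixes the smooth structure along `∂V`. -/
structure LiouvilleCompletion (lam : OneForm (𝓡∂ 4) V) where
  W : Type u
  [topologicalSpace : TopologicalSpace W]
  [t2Space : T2Space W]
  [chartedSpace : ChartedSpace (EuclideanSpace ℝ (Fin 4)) W]
  [isManifold : IsManifold (𝓡 4) ∞ W]
  form : OneForm (𝓡 4) W
  incl : V → W
  incl_isSmoothEmbedding : Manifold.IsSmoothEmbedding (𝓡∂ 4) (𝓡 4) ∞ incl
  incl_form : ∀ (x : V) (w : TangentSpace (𝓡∂ 4) x),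
    form (incl x) (mfderiv (𝓡∂ 4) (𝓡 4) incl x w) = lam x w
  ε : ℝ
  ε_pos : 0 < ε
  /-- Only the values at the points `(p, r)` with `-ε < r` are relevant. -/
  cyl : M × ℝ → W
  cyl_smooth : ContMDiffOn ((𝓡 3).prod 𝓘(ℝ, ℝ)) (𝓡 4) ∞ cyl {q | -ε < q.2}
  cyl_injOn : InjOn cyl {q | -ε < q.2}
  cyl_immersion : ∀ q : M × ℝ, -ε < q.2 →
    Function.Injective (mfderiv ((𝓡 3).prod 𝓘(ℝ, ℝ)) (𝓡 4) cyl q)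
  cyl_form : ∀ q : M × ℝ, -ε < q.2 → ∀ w : TangentSpace ((𝓡 3).prod 𝓘(ℝ, ℝ)) q,
    form (cyl q) (mfderiv ((𝓡 3).prod 𝓘(ℝ, ℝ)) (𝓡 4) cyl q w) =
      Real.exp q.2 * bd.restrict lam q.1
        (mfderiv ((𝓡 3).prod 𝓘(ℝ, ℝ)) (𝓡 3) (Prod.fst : M × ℝ → M) q w)
  cyl_zero : ∀ p : M, cyl (p, 0) = incl (bd.toFun p)
  cyl_notMem : ∀ (p : M) (r : ℝ), 0 < r → cyl (p, r) ∉ range incl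
  cover : ∀ z : W, z ∈ range incl ∨ ∃ (p : M) (r : ℝ), 0 ≤ r ∧ z = cyl (p, r)

attribute [instance] LiouvilleCompletion.topologicalSpace LiouvilleCompletion.t2Space
  LiouvilleCompletion.chartedSpace LiouvilleCompletion.isManifold

/-- `(V, λ₀)` and `(V, λ₁)` are exact symplectomorphic: there are a diffeomorphism `Φ` between
their completions and a compactly supported smooth function `f` with `Λ₁ = Φ^* Λ₀ + df`. -/
def ExactSymplectomorphic (lam₀ lam₁ : OneForm (𝓡∂ 4) V) : Prop :=
  ∃ (C₀ : LiouvilleCompletion bd lam₀) (C₁ : LiouvilleCompletion bd lam₁)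
    (Φ : C₁.W ≃ₘ^∞⟮𝓡 4, 𝓡 4⟯ C₀.W) (f : C₁.W → ℝ),
    ContMDiff (𝓡 4) 𝓘(ℝ, ℝ) ∞ f ∧ HasCompactSupport f ∧
    ∀ (z : C₁.W) (w : TangentSpace (𝓡 4) z),
      C₁.form z w = C₀.form (Φ z) (mfderiv (𝓡 4) (𝓡 4) Φ z w)
        + mvfderiv (𝓡 4) f z w

end FourManifolds

end

noncomputable section

open Filter Metric Function
open Real (smoothTransition)
open Module (Basis finrank)

notation "ℋ" => 𝓡∂ 4
notation "ℐ" => 𝓘(ℝ, ℝ)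
notation "ℝ⁴" => EuclideanSpace ℝ (Fin 4)
notation "ℝ³" => EuclideanSpace ℝ (Fin 3)
notation "crd" => extChartAt
notation "Tan" => TangentSpace
notation "Ext" M:max => (M × ℝ) × ℝ
notation "Bil" T:max => T →ₗ[ℝ] T →ₗ[ℝ] ℝ

section LocalSemiflow

variable {E : Type*} [NormedAddCommGroup E] [NormedSpace ℝ E]

/-- The closed half-space `0 ≤ c + ℓ x`. -/
def affineHalf (c : ℝ) (ℓ : E →L[ℝ] ℝ) : Set E := {x | 0 ≤ c + ℓ x}

theorem mem_affineHalf {c : ℝ} {ℓ : E →L[ℝ] ℝ} {x : E} : x ∈ affineHalf c ℓ ↔ 0 ≤ c + ℓ x := Iff.rfl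

theorem convex_affineHalf (c : ℝ) (ℓ : E →L[ℝ] ℝ) : Convex ℝ (affineHalf c ℓ) := by
  intro x hx y hy a b ha hb hab; simp only [mem_affineHalf, map_add, map_smul, smul_eq_mul] at *
  have : c = a * c + b * c := by rw [← add_mul, hab, one_mul]
  nlinarith [mul_nonneg ha hx, mul_nonneg hb hy]

theorem interior_affineHalf_inter_ball {c : ℝ} {ℓ : E →L[ℝ] ℝ} {x₀ v : E} {r : ℝ} (hr : 0 < r)
    (hx₀ : x₀ ∈ affineHalf c ℓ) (h : 0 < c + ℓ x₀ ∨ 0 < ℓ v) : (interior (affineHalf c ℓ ∩ ball x₀ r)).Nonempty := by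
  have hopen : IsOpen {x : E | 0 < c + ℓ x} := isOpen_lt continuous_const (by fun_prop)
  have hsub : {x : E | 0 < c + ℓ x} ∩ ball x₀ r ⊆ interior (affineHalf c ℓ ∩ ball x₀ r) :=
    interior_maximal (fun x hx => ⟨mem_affineHalf.2 (le_of_lt hx.1), hx.2⟩) (hopen.inter isOpen_ball)
  rcases h with h | h
  · exact ⟨x₀, hsub ⟨h, mem_ball_self hr⟩⟩
  · have hcont : Tendsto (fun t : ℝ => x₀ + t • v) (𝓝[>] 0) (𝓝 x₀) := by
      have : ContinuousAt (fun t : ℝ => x₀ + t • v) 0 := by fun_prop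
      simpa [ContinuousAt] using this.tendsto.mono_left nhdsWithin_le_nhds
    obtain ⟨t, ht, ht0⟩ := ((hcont.eventually (ball_mem_nhds x₀ hr)).and (self_mem_nhdsWithin)).exists
    refine ⟨x₀ + t • v, hsub ⟨?_, ht⟩⟩
    change 0 < c + ℓ (x₀ + t • v); rw [map_add, map_smul, smul_eq_mul]
    nlinarith [mul_pos (show (0:ℝ) < t from ht0) h, mem_affineHalf.1 hx₀]

theorem exists_lipschitz_retraction_affineHalf {c : ℝ} {ℓ : E →L[ℝ] ℝ} (hne : (affineHalf c ℓ).Nonempty) :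
    ∃ (P : E → E) (K : NNReal), LipschitzWith K P ∧ (∀ x, P x ∈ affineHalf c ℓ) ∧ ∀ x ∈ affineHalf c ℓ, P x = x := by
  by_cases h : ℓ = 0
  · obtain ⟨y, hy⟩ := hne
    refine ⟨id, 1, LipschitzWith.id, fun x => ?_, fun _ _ => rfl⟩
    simpa [mem_affineHalf, h] using hy
  · obtain ⟨u, hu⟩ : ∃ u, ℓ u ≠ 0 := by by_contra! hc; exact h (by ext x; simpa using hc x)
    set w := (ℓ u)⁻¹ • u
    have hw : ℓ w = 1 := by simp [w, hu]
    refine ⟨fun y => y + (max 0 (-(c + ℓ y))) • w, 1 + ‖w‖₊ * ‖ℓ‖₊, ?_, fun x => ?_, fun x hx => ?_⟩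
    · refine LipschitzWith.id.add (LipschitzWith.of_dist_le_mul fun x y => ?_)
      rw [dist_eq_norm, ← sub_smul, norm_smul, mul_comm, NNReal.coe_mul, mul_assoc]
      refine mul_le_mul_of_nonneg_left ?_ (norm_nonneg _)
      rw [Real.norm_eq_abs, max_comm 0, max_comm 0]
      refine (abs_max_sub_max_le_abs _ _ _).trans ?_
      rw [show -(c + ℓ x) - -(c + ℓ y) = ℓ (y - x) by rw [map_sub]; ring, dist_comm, dist_eq_norm]
      exact ℓ.le_opNorm (y - x)
    · simp only [mem_affineHalf, map_add, map_smul, hw, smul_eq_mul, mul_one]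
      linarith [le_max_right 0 (-(c + ℓ x))]
    · have : max 0 (-(c + ℓ x)) = 0 := max_eq_left (by linarith [mem_affineHalf.1 hx])
      simp only [this, zero_smul, add_zero]

/-- `Φ` is a semiflow of `v` for the times in `[0, τ]`, defined near `x₀` in the half-space, with
values in `U`; for positive times it is in the open half-space. -/
structure IsLocalSemiflow (c : ℝ) (ℓ : E →L[ℝ] ℝ) (v : E → E) (x₀ : E) (U : Set E) (r τ : ℝ)
    (Φ : E × ℝ → E) : Prop where
  init : ∀ x ∈ affineHalf c ℓ ∩ ball x₀ r, Φ (x, 0) = x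
  mem : ∀ x ∈ affineHalf c ℓ ∩ ball x₀ r, ∀ t ∈ Icc 0 τ, Φ (x, t) ∈ affineHalf c ℓ ∩ U
  pos : ∀ x ∈ affineHalf c ℓ ∩ ball x₀ r, ∀ t ∈ Ioc 0 τ, 0 < c + ℓ (Φ (x, t))
  deriv : ∀ x ∈ affineHalf c ℓ ∩ ball x₀ r, ∀ t ∈ Icc 0 τ,
    HasDerivWithinAt (fun t => Φ (x, t)) (v (Φ (x, t))) (Icc 0 τ) t

theorem exists_isLocalSemiflow_continuousOn [CompleteSpace E] {c : ℝ} {ℓ : E →L[ℝ] ℝ} {v : E → E}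
    {x₀ : E} {U : Set E} (hU : IsOpen U) (hx₀ : x₀ ∈ affineHalf c ℓ ∩ U)
    (hv : ContDiffOn ℝ 1 v (affineHalf c ℓ ∩ U)) (hin : 0 < c + ℓ x₀ ∨ 0 < ℓ (v x₀)) :
    ∃ (r τ : ℝ) (Φ : E × ℝ → E), 0 < r ∧ 0 < τ ∧ IsLocalSemiflow c ℓ v x₀ U r τ Φ ∧
      ContinuousOn Φ ((affineHalf c ℓ ∩ ball x₀ r) ×ˢ Icc 0 τ) := by
  obtain ⟨P, KP, hP, hPS, hPid⟩ := exists_lipschitz_retraction_affineHalf ⟨x₀, hx₀.1⟩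
  have hv' : ContDiffWithinAt ℝ 1 v (affineHalf c ℓ) x₀ :=
    (hv x₀ hx₀).mono_of_mem_nhdsWithin (inter_mem_nhdsWithin _ (hU.mem_nhds hx₀.2))
  obtain ⟨K₀, t₀, ht₀, hlip⟩ := hv'.exists_lipschitzOnWith (convex_affineHalf c ℓ)
  have hPx₀ : P x₀ = x₀ := hPid _ hx₀.1
  have hPt : Tendsto P (𝓝 x₀) (𝓝[affineHalf c ℓ] x₀) := by
    refine tendsto_nhdsWithin_iff.2 ⟨?_, Eventually.of_forall hPS⟩
    simpa [hPx₀] using hP.continuous.tendsto x₀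
  have hvc : ContinuousAt (v ∘ P) x₀ := by
    have := hv'.continuousWithinAt.tendsto.comp hPt
    simpa [ContinuousAt, hPx₀] using this
  have hev : ∀ᶠ y in 𝓝 x₀, P y ∈ t₀ ∧ y ∈ U ∧ ((0 < c + ℓ x₀ → 0 < c + ℓ y) ∧ (0 < ℓ (v x₀) → 0 < ℓ (v (P y)))) := by
    have hUx : ∀ᶠ y in 𝓝 x₀, y ∈ U := hU.mem_nhds hx₀.2
    refine (hPt.eventually ht₀).and (hUx.and (Eventually.and ?_ ?_))
    · by_cases h : 0 < c + ℓ x₀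
      · have : ContinuousAt (fun y => c + ℓ y) x₀ := by fun_prop
        filter_upwards [this.eventually (lt_mem_nhds h)] with y hy _ using hy
      · exact Eventually.of_forall fun y hy => (h hy).elim
    · by_cases h : 0 < ℓ (v x₀)
      · have h1 : ContinuousAt (fun y => ℓ (v (P y))) x₀ := ℓ.continuous.continuousAt.comp hvc
        have h2 : (0:ℝ) < ℓ (v (P x₀)) := by rwa [hPx₀]
        filter_upwards [h1.eventually (lt_mem_nhds h2)] with y hy _ using hy
      · exact Eventually.of_forall fun y hy => (h hy).elim
  obtain ⟨a', ha', hball⟩ := eventually_nhds_iff_ball.1 hev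
  set a : NNReal := ⟨a' / 2, by positivity⟩
  have ha : (0:ℝ) < a := by change 0 < a' / 2; positivity
  have hsub : closedBall x₀ (a : ℝ) ⊆ ball x₀ a' := closedBall_subset_ball (by change a' / 2 < a'; linarith)
  have hlip' : LipschitzOnWith (K₀ * KP) (v ∘ P) (closedBall x₀ a) :=
    hlip.comp hP.lipschitzOnWith (fun y hy => (hball y (hsub hy)).1)
  set L : NNReal := ‖v x₀‖₊ + K₀ * KP * a + 1
  have hL : ∀ y ∈ closedBall x₀ (a : ℝ), ‖(v ∘ P) y‖ ≤ L := by
    intro y hy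
    have h1 := hlip'.norm_sub_le hy (mem_closedBall_self a.2)
    have h2 : ‖(v ∘ P) y‖ ≤ ‖(v ∘ P) y - (v ∘ P) x₀‖ + ‖(v ∘ P) x₀‖ := norm_le_norm_sub_add _ _
    have h3 : ‖y - x₀‖ ≤ a := by rwa [← dist_eq_norm]
    have h4 : ((K₀ * KP : NNReal) : ℝ) * ‖y - x₀‖ ≤ (K₀ * KP : NNReal) * a := by gcongr
    have h5 : (v ∘ P) x₀ = v x₀ := by simp [hPx₀]
    rw [h5] at h1 h2; simp only [L, NNReal.coe_add, NNReal.coe_mul, coe_nnnorm, NNReal.coe_one] at *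
    linarith
  have hLpos : (0:ℝ) < L := by simp only [L, NNReal.coe_add, NNReal.coe_one]; positivity
  set τ₁ : ℝ := a / (2 * L)
  have hτ₁ : 0 < τ₁ := by positivity
  have hPL : IsPicardLindelof (fun _ => v ∘ P) (tmin := 0) (tmax := τ₁) ⟨0, by simp [hτ₁.le]⟩ x₀
      a (a / 2) L (K₀ * KP) := by
    refine IsPicardLindelof.of_time_independent hL hlip' ?_
    simp only [sub_zero, sub_self, max_eq_left hτ₁.le, τ₁]; rw [NNReal.coe_div]; simp only [NNReal.coe_ofNat]
    field_simp; linarith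
  obtain ⟨α, hα, hαc⟩ := hPL.exists_forall_mem_closedBall_eq_hasDerivWithinAt_continuousOn
  have hr₁ : (0:ℝ) < (a / 2 : NNReal) := by rw [NNReal.coe_div]; simp only [NNReal.coe_ofNat]; positivity
  have h0 : (x₀, (0:ℝ)) ∈ closedBall x₀ ((a / 2 : NNReal) : ℝ) ×ˢ Icc 0 τ₁ :=
    ⟨mem_closedBall_self hr₁.le, by simp [hτ₁.le]⟩
  have hnear : ∀ᶠ p in 𝓝[closedBall x₀ ((a / 2 : NNReal) : ℝ) ×ˢ Icc 0 τ₁] (x₀, (0:ℝ)), α p ∈ ball x₀ a := by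
    refine (hαc _ h0).eventually ?_
    rw [(hα x₀ h0.1).1]; exact ball_mem_nhds _ ha
  rw [eventually_nhdsWithin_iff, eventually_nhds_iff_ball] at hnear
  obtain ⟨e, he, hnear⟩ := hnear
  refine ⟨min e (a / 2 : NNReal), min (e / 2) τ₁, α, lt_min he hr₁, lt_min (by positivity) hτ₁, ?_, ?_⟩
  · have hmemb : ∀ x ∈ affineHalf c ℓ ∩ ball x₀ (min e (a / 2 : NNReal)),
        x ∈ closedBall x₀ ((a / 2 : NNReal) : ℝ) := fun x hx =>
      ball_subset_closedBall (ball_subset_ball (min_le_right _ _) hx.2)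
    have hin' : ∀ x ∈ affineHalf c ℓ ∩ ball x₀ (min e (a / 2 : NNReal)),
        ∀ t ∈ Icc 0 (min (e / 2) τ₁), α (x, t) ∈ ball x₀ a := by
      intro x hx t ht
      refine hnear _ ?_ ⟨hmemb x hx, ht.1, ht.2.trans (min_le_right _ _)⟩
      rw [← ball_prod_same]
      refine ⟨ball_subset_ball (min_le_left _ _) hx.2, ?_⟩
      rw [mem_ball, Real.dist_eq, sub_zero, abs_of_nonneg ht.1]
      have := ht.2.trans (min_le_left _ _)
      linarith
    have hin2 : ∀ x ∈ affineHalf c ℓ ∩ ball x₀ (min e (a / 2 : NNReal)),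
        ∀ t ∈ Icc 0 (min (e / 2) τ₁), α (x, t) ∈ ball x₀ a' := fun x hx t ht =>
      hsub (ball_subset_closedBall (hin' x hx t ht))
    have hd : ∀ x ∈ affineHalf c ℓ ∩ ball x₀ (min e (a / 2 : NNReal)),
        ∀ t ∈ Icc 0 (min (e / 2) τ₁), HasDerivWithinAt (fun t => α (x, t)) (v (P (α (x, t))))
          (Icc 0 (min (e / 2) τ₁)) t := fun x hx t ht =>
      ((hα x (hmemb x hx)).2 t ⟨ht.1, ht.2.trans (min_le_right _ _)⟩).mono (Icc_subset_Icc le_rfl (min_le_right _ _))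
    have hpos : ∀ x ∈ affineHalf c ℓ ∩ ball x₀ (min e (a / 2 : NNReal)),
        ∀ t ∈ Ioc 0 (min (e / 2) τ₁), 0 < c + ℓ (α (x, t)) := by
      intro x hx t ht
      rcases hin with h | h
      · exact (hball _ (hin2 x hx t ⟨ht.1.le, ht.2⟩)).2.2.1 h
      · have hd' : ∀ t ∈ Icc 0 (min (e / 2) τ₁), HasDerivWithinAt (fun t => ℓ (α (x, t)))
            (ℓ (v (P (α (x, t))))) (Icc 0 (min (e / 2) τ₁)) t := fun t ht =>
          ℓ.hasFDerivAt.comp_hasDerivWithinAt t (hd x hx t ht)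
        have hm : StrictMonoOn (fun t => ℓ (α (x, t))) (Icc 0 (min (e / 2) τ₁)) := by
          refine strictMonoOn_of_deriv_pos (convex_Icc _ _) (fun t ht => (hd' t ht).continuousWithinAt) fun t ht => ?_
          rw [((hd' t (interior_subset ht)).hasDerivAt (mem_interior_iff_mem_nhds.1 ht)).deriv]
          exact (hball _ (hin2 x hx t (interior_subset ht))).2.2.2 h
        have h1 := hm (left_mem_Icc.2 (ht.1.le.trans ht.2)) ⟨ht.1.le, ht.2⟩ ht.1
        have h2 : 0 ≤ c + ℓ x := hx.1
        simp only [(hα x (hmemb x hx)).1] at h1; linarith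
    have hmem : ∀ x ∈ affineHalf c ℓ ∩ ball x₀ (min e (a / 2 : NNReal)),
        ∀ t ∈ Icc 0 (min (e / 2) τ₁), α (x, t) ∈ affineHalf c ℓ := by
      intro x hx t ht
      rcases ht.1.eq_or_lt with rfl | h
      · rw [(hα x (hmemb x hx)).1]; exact hx.1
      · exact (hpos x hx t ⟨h, ht.2⟩).le
    refine ⟨fun x hx => (hα x (hmemb x hx)).1, fun x hx t ht =>
      ⟨hmem x hx t ht, (hball _ (hin2 x hx t ht)).2.1⟩, hpos, fun x hx t ht => ?_⟩
    have := hd x hx t ht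
    rwa [hPid _ (hmem x hx t ht)] at this
  · refine hαc.mono (prod_mono ?_ (Icc_subset_Icc le_rfl (min_le_right _ _)))
    exact fun x hx => ball_subset_closedBall (ball_subset_ball (min_le_right _ _) hx.2)

end LocalSemiflow

section LocalSemiflowSmooth

theorem hasFDerivWithinAt_uncurry_of_quadratic {E F : Type*} [NormedAddCommGroup E]
    [NormedSpace ℝ E] [NormedAddCommGroup F] [NormedSpace ℝ F] {Φ : E × ℝ → F} {D : Set E}
    {T : Set ℝ} {A : ℝ → E →L[ℝ] F} {C : ℝ} {x : E} {t : ℝ} {w : F}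
    (hquad : ∀ y ∈ D, ∀ s ∈ T, ‖Φ (y, s) - Φ (x, s) - A s (y - x)‖ ≤ C * ‖y - x‖ ^ 2)
    (hA : ContinuousWithinAt A T t) (hΦ : HasDerivWithinAt (fun s => Φ (x, s)) w T t) :
    HasFDerivWithinAt Φ ((A t).comp (ContinuousLinearMap.fst ℝ E ℝ) +
      (ContinuousLinearMap.snd ℝ E ℝ).smulRight w) (D ×ˢ T) (x, t) := by
  have hsnd : Tendsto (fun p : E × ℝ => p.2) (𝓝[D ×ˢ T] (x, t)) (𝓝[T] t) :=
    tendsto_nhdsWithin_iff.2 ⟨continuous_snd.continuousWithinAt.tendsto,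
      eventually_nhdsWithin_of_forall fun p hp => hp.2⟩
  have e1 : (fun p : E × ℝ => Φ (p.1, p.2) - Φ (x, p.2) - A p.2 (p.1 - x))
      =o[𝓝[D ×ˢ T] (x, t)] fun p => p - (x, t) := by
    have h1 : (fun p : E × ℝ => Φ (p.1, p.2) - Φ (x, p.2) - A p.2 (p.1 - x))
        =O[𝓝[D ×ˢ T] (x, t)] fun p => ‖p - (x, t)‖ ^ 2 := by
      refine Asymptotics.IsBigO.of_bound |C| (eventually_nhdsWithin_of_forall fun p hp => ?_)
      refine (hquad p.1 hp.1 p.2 hp.2).trans ?_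
      rw [Real.norm_eq_abs, abs_of_nonneg (by positivity : 0 ≤ ‖p - (x, t)‖ ^ 2)]
      have : ‖p.1 - x‖ ≤ ‖p - (x, t)‖ := by simpa using norm_fst_le (p - (x, t))
      calc C * ‖p.1 - x‖ ^ 2 ≤ |C| * ‖p.1 - x‖ ^ 2 := by gcongr; exact le_abs_self C
        _ ≤ _ := by gcongr
    exact h1.trans_isLittleO ((Asymptotics.isLittleO_pow_sub_sub (x, t) one_lt_two).mono nhdsWithin_le_nhds)
  have e2 : (fun p : E × ℝ => (A p.2 - A t) (p.1 - x)) =o[𝓝[D ×ˢ T] (x, t)] fun p => p - (x, t) := by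
    refine Asymptotics.IsLittleO.of_bound fun ε hε => ?_
    have := (hA.tendsto.comp hsnd).eventually (ball_mem_nhds (A t) hε)
    filter_upwards [this] with p hp
    have h2 : ‖A p.2 - A t‖ ≤ ε := by rw [← dist_eq_norm]; exact (mem_ball.1 hp).le
    have : ‖p.1 - x‖ ≤ ‖p - (x, t)‖ := by simpa using norm_fst_le (p - (x, t))
    exact ((A p.2 - A t).le_opNorm _).trans (by gcongr)
  have e3 : (fun p : E × ℝ => Φ (x, p.2) - Φ (x, t) - (p.2 - t) • w) =o[𝓝[D ×ˢ T] (x, t)] fun p => p - (x, t) := by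
    have := (hasDerivWithinAt_iff_isLittleO.1 hΦ).comp_tendsto hsnd
    refine this.trans_isBigO (Asymptotics.IsBigO.of_bound 1 (Eventually.of_forall fun p => ?_))
    simpa using norm_snd_le (p - (x, t))
  rw [hasFDerivWithinAt_iff_isLittleO]
  refine ((e1.add e2).add e3).congr_left fun p => ?_
  simp only [add_apply, ContinuousLinearMap.coe_comp, comp_apply,
    ContinuousLinearMap.coe_fst', ContinuousLinearMap.smulRight_apply, ContinuousLinearMap.coe_snd',
    sub_apply, Prod.fst_sub, Prod.snd_sub, Prod.mk.eta]
  abel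

theorem norm_trajectory_sub_le {E : Type*} [NormedAddCommGroup E] [NormedSpace ℝ E]
    {v : E → E} {Dv : E → E →L[ℝ] E} {D : Set E} (hD : Convex ℝ D) {K₁ K₂ : NNReal} {K τ : ℝ}
    (hv : ∀ y ∈ D, HasFDerivWithinAt v (Dv y) D y) (hlip : LipschitzOnWith K₁ v D)
    (hlip2 : LipschitzOnWith K₂ Dv D) (hK : 0 < K) (hbound : ∀ y ∈ D, ‖Dv y‖ ≤ K)
    {f g : ℝ → E} {A : ℝ → E →L[ℝ] E} (hf : ∀ t ∈ Icc 0 τ, f t ∈ D) (hg : ∀ t ∈ Icc 0 τ, g t ∈ D)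
    (hf' : ∀ t ∈ Icc 0 τ, HasDerivWithinAt f (v (f t)) (Icc 0 τ) t)
    (hg' : ∀ t ∈ Icc 0 τ, HasDerivWithinAt g (v (g t)) (Icc 0 τ) t)
    (hA : ∀ t ∈ Icc 0 τ, HasDerivWithinAt A ((Dv (f t)).comp (A t)) (Icc 0 τ) t) (hA0 : A 0 = 1) :
    ∀ t ∈ Icc 0 τ, ‖g t - f t - A t (g 0 - f 0)‖ ≤
      (K₂ * Real.exp (K₁ * τ) ^ 2 / K * Real.exp (K * τ)) * ‖g 0 - f 0‖ ^ 2 := by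
  have hIci : ∀ {h : ℝ → E} {h' : E} {t : ℝ}, t ∈ Ico 0 τ → HasDerivWithinAt h h' (Icc 0 τ) t →
      HasDerivWithinAt h h' (Ici t) t := fun {h h' t} ht hh =>
    (hh.mono (Icc_subset_Icc_left ht.1)).mono_of_mem_nhdsWithin (Icc_mem_nhdsGE ht.2)
  have hdist : ∀ t ∈ Icc 0 τ, ‖g t - f t‖ ≤ Real.exp (K₁ * τ) * ‖g 0 - f 0‖ := by
    intro t ht
    have := dist_le_of_trajectories_ODE_of_mem (v := fun _ => v) (s := fun _ => D) (K := K₁)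
      (fun _ _ => hlip) (fun t ht => (hg' t ht).continuousWithinAt)
      (fun t ht => hIci ht (hg' t (Ico_subset_Icc_self ht))) (fun t ht => hg t (Ico_subset_Icc_self ht))
      (fun t ht => (hf' t ht).continuousWithinAt)
      (fun t ht => hIci ht (hf' t (Ico_subset_Icc_self ht))) (fun t ht => hf t (Ico_subset_Icc_self ht))
      le_rfl t ht
    rw [dist_eq_norm, dist_eq_norm, sub_zero] at this
    refine this.trans ?_
    rw [mul_comm]; gcongr; exact ht.2
  intro t ht
  set ε := K₂ * (Real.exp (K₁ * τ) * ‖g 0 - f 0‖) ^ 2 with hε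
  have hq : ∀ t ∈ Icc 0 τ, HasDerivWithinAt (fun t => g t - f t - A t (g 0 - f 0))
      (v (g t) - v (f t) - (Dv (f t)) (A t (g 0 - f 0))) (Icc 0 τ) t := fun t ht => by
    have h1 := ((ContinuousLinearMap.apply ℝ E (g 0 - f 0)).hasFDerivAt.comp_hasDerivWithinAt t (hA t ht))
    exact ((hg' t ht).sub (hf' t ht)).sub h1
  have hb : ∀ t ∈ Ico 0 τ, ‖v (g t) - v (f t) - (Dv (f t)) (A t (g 0 - f 0))‖ ≤
      K * ‖g t - f t - A t (g 0 - f 0)‖ + ε := by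
    intro t ht
    have ht' := Ico_subset_Icc_self ht
    have h1 : ‖v (g t) - v (f t) - Dv (f t) (g t - f t)‖ ≤ (K₂ * ‖g t - f t‖) * ‖g t - f t‖ := by
      have hseg : segment ℝ (f t) (g t) ⊆ D := hD.segment_subset (hf t ht') (hg t ht')
      refine Convex.norm_image_sub_le_of_norm_hasFDerivWithin_le' (s := segment ℝ (f t) (g t))
        (f' := Dv) (fun y hy => (hv y (hseg hy)).mono hseg) (fun y hy => ?_) (convex_segment _ _)
        (left_mem_segment _ _ _) (right_mem_segment _ _ _)
      refine (hlip2.norm_sub_le (hseg hy) (hf t ht')).trans ?_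
      gcongr; exact norm_sub_le_of_mem_segment hy
    have h2 : v (g t) - v (f t) - (Dv (f t)) (A t (g 0 - f 0)) =
        (v (g t) - v (f t) - Dv (f t) (g t - f t)) + Dv (f t) (g t - f t - A t (g 0 - f 0)) := by
      rw [map_sub (Dv (f t)) (g t - f t)]; abel
    rw [h2, add_comm (K * _)]
    refine (norm_add_le _ _).trans (add_le_add (h1.trans ?_) ?_)
    · rw [mul_assoc, ← sq, hε]; gcongr; exact hdist t ht'
    · exact ((Dv (f t)).le_opNorm _).trans (by gcongr; exact hbound _ (hf t ht'))
  have := norm_le_gronwallBound_of_norm_deriv_right_le (δ := 0) (K := K) (ε := ε)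
    (fun t ht => (hq t ht).continuousWithinAt)
    (fun t ht => hIci ht (hq t (Ico_subset_Icc_self ht))) (by simp [hA0]) hb t ht
  rw [gronwallBound_of_K_ne_0 hK.ne'] at this; simp only [zero_mul, zero_add, sub_zero] at this
  refine this.trans ?_
  have hexp : Real.exp (K * t) - 1 ≤ Real.exp (K * τ) := by
    have : Real.exp (K * t) ≤ Real.exp (K * τ) := by gcongr; exact ht.2
    linarith
  calc ε / K * (Real.exp (K * t) - 1) ≤ ε / K * Real.exp (K * τ) := by gcongr
    _ = _ := by rw [hε]; ring

theorem exists_isLocalSemiflow_succ_aux {E : Type*} [NormedAddCommGroup E] [NormedSpace ℝ E] [CompleteSpace E] (n : ℕ)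
    (IH : ∀ {c : ℝ} {ℓ : (E × (E →L[ℝ] E)) →L[ℝ] ℝ} {v : E × (E →L[ℝ] E) → E × (E →L[ℝ] E)}
      {x₀ : E × (E →L[ℝ] E)} {U : Set (E × (E →L[ℝ] E))}, IsOpen U → x₀ ∈ affineHalf c ℓ ∩ U →
      ContDiffOn ℝ ∞ v (affineHalf c ℓ ∩ U) → (0 < c + ℓ x₀ ∨ 0 < ℓ (v x₀)) →
      ∃ (r τ : ℝ) (Φ : (E × (E →L[ℝ] E)) × ℝ → E × (E →L[ℝ] E)), 0 < r ∧ 0 < τ ∧ IsLocalSemiflow c ℓ v x₀ U r τ Φ ∧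
        ContDiffOn ℝ n Φ ((affineHalf c ℓ ∩ ball x₀ r) ×ˢ Icc 0 τ))
    {c : ℝ} {ℓ : E →L[ℝ] ℝ} {v : E → E} {x₀ : E} {U : Set E} (hU : IsOpen U)
    (hx₀ : x₀ ∈ affineHalf c ℓ ∩ U) (hv : ContDiffOn ℝ ∞ v (affineHalf c ℓ ∩ U))
    (hin : 0 < c + ℓ x₀ ∨ 0 < ℓ (v x₀)) :
    ∃ (r τ : ℝ) (Φ : E × ℝ → E), 0 < r ∧ 0 < τ ∧ IsLocalSemiflow c ℓ v x₀ U r τ Φ ∧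
      ContDiffOn ℝ (n + 1 : ℕ) Φ ((affineHalf c ℓ ∩ ball x₀ r) ×ˢ Icc 0 τ) ∧
      ∀ x ∈ affineHalf c ℓ ∩ ball x₀ r, ∀ t ∈ Icc 0 τ, ∃ A : E →L[ℝ] E, Injective A ∧
        HasFDerivWithinAt (fun y => Φ (y, t)) A (affineHalf c ℓ ∩ ball x₀ r) x := by
  set S := affineHalf c ℓ with hS
  have hSconv : Convex ℝ S := convex_affineHalf c ℓ
  obtain ⟨a, ha, haU⟩ := isOpen_iff.1 hU x₀ hx₀.2
  have hconv : ∀ b, Convex ℝ (S ∩ ball x₀ b) := fun b => hSconv.inter (convex_ball _ _)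
  have hud : ∀ b, 0 < b → UniqueDiffOn ℝ (S ∩ ball x₀ b) := fun b hb =>
    uniqueDiffOn_convex (hconv b) (interior_affineHalf_inter_ball hb hx₀.1 hin)
  set Dv := fderivWithin ℝ v (S ∩ ball x₀ a) with hDv
  have hva : ContDiffOn ℝ ∞ v (S ∩ ball x₀ a) := hv.mono (inter_subset_inter_right _ haU)
  have hDvs : ContDiffOn ℝ ∞ Dv (S ∩ ball x₀ a) := hva.fderivWithin (hud a ha) (by simp)
  have hx₀a : x₀ ∈ S ∩ ball x₀ a := ⟨hx₀.1, mem_ball_self ha⟩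
  obtain ⟨K₁, t₁, ht₁, hl₁⟩ := ((hva x₀ hx₀a).of_le (by simp : (1 : WithTop ℕ∞) ≤ ∞)).exists_lipschitzOnWith (hconv a)
  obtain ⟨K₂, t₂, ht₂, hl₂⟩ := ((hDvs x₀ hx₀a).of_le (by simp : (1 : WithTop ℕ∞) ≤ ∞)).exists_lipschitzOnWith (hconv a)
  obtain ⟨b₀, hb₀, hb₀t⟩ := mem_nhdsWithin_iff.1 (inter_mem ht₁ ht₂)
  set b := min a b₀ with hb
  have hbpos : 0 < b := lt_min ha hb₀
  set D := S ∩ ball x₀ b with hDdef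
  have hDa : D ⊆ S ∩ ball x₀ a := inter_subset_inter_right _ (ball_subset_ball (min_le_left _ _))
  have hDt : D ⊆ t₁ ∩ t₂ := fun y hy => hb₀t ⟨ball_subset_ball (min_le_right _ _) hy.2, hDa hy⟩
  have hx₀D : x₀ ∈ D := ⟨hx₀.1, mem_ball_self hbpos⟩
  have hlv : LipschitzOnWith K₁ v D := hl₁.mono fun y hy => (hDt hy).1
  have hlD : LipschitzOnWith K₂ Dv D := hl₂.mono fun y hy => (hDt hy).2
  have hvD : ∀ y ∈ D, HasFDerivWithinAt v (Dv y) D y := fun y hy =>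
    ((hva.differentiableOn (by simp) y (hDa hy)).hasFDerivWithinAt).mono hDa
  set K : ℝ := ‖Dv x₀‖ + K₂ * b + 1 with hKdef
  have hK : 0 < K := by positivity
  have hbound : ∀ y ∈ D, ‖Dv y‖ ≤ K := by
    intro y hy
    have h1 := hlD.norm_sub_le hy hx₀D
    have h2 : ‖Dv y‖ ≤ ‖Dv y - Dv x₀‖ + ‖Dv x₀‖ := norm_le_norm_sub_add _ _
    have h3 : ‖y - x₀‖ ≤ b := by rw [← dist_eq_norm]; exact (mem_ball.1 hy.2).le
    have h4 : (K₂ : ℝ) * ‖y - x₀‖ ≤ K₂ * b := by gcongr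
    linarith
  set w : E × (E →L[ℝ] E) → E × (E →L[ℝ] E) := fun p => (v p.1, (Dv p.1).comp p.2) with hw
  set ℓ' : (E × (E →L[ℝ] E)) →L[ℝ] ℝ := ℓ.comp (ContinuousLinearMap.fst ℝ E (E →L[ℝ] E))
  set U' : Set (E × (E →L[ℝ] E)) := ball x₀ b ×ˢ ball 1 (1 / 2) with hU'
  have hmaps : MapsTo Prod.fst (affineHalf c ℓ' ∩ U') D := fun p hp => ⟨hp.1, hp.2.1⟩
  have hw' : ContDiffOn ℝ ∞ w (affineHalf c ℓ' ∩ U') := by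
    refine ContDiffOn.prodMk ((hva.mono hDa).comp contDiffOn_fst hmaps) ?_
    exact ((hDvs.mono hDa).comp contDiffOn_fst hmaps).clm_comp contDiffOn_snd
  obtain ⟨r, τ, Φ', hr, hτ, hΦ', hΦs⟩ := IH (c := c) (ℓ := ℓ') (v := w) (x₀ := (x₀, 1)) (U := U')
    (isOpen_ball.prod isOpen_ball)
    ⟨hx₀.1, mem_ball_self hbpos, mem_ball_self (by norm_num)⟩ hw' hin
  set D' := S ∩ ball x₀ r with hD'
  have hmem : ∀ x ∈ D', (x, (1 : E →L[ℝ] E)) ∈ affineHalf c ℓ' ∩ ball ((x₀, 1) : E × (E →L[ℝ] E)) r := by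
    intro x hx
    refine ⟨hx.1, ?_⟩
    rw [← ball_prod_same]; exact ⟨hx.2, mem_ball_self hr⟩
  set Φ : E × ℝ → E := fun p => (Φ' ((p.1, 1), p.2)).1 with hΦ
  set A : E × ℝ → E →L[ℝ] E := fun p => (Φ' ((p.1, 1), p.2)).2 with hA
  have hΦD : ∀ x ∈ D', ∀ t ∈ Icc 0 τ, Φ (x, t) ∈ D := fun x hx t ht => hmaps (hΦ'.mem _ (hmem x hx) t ht)
  have hΦd : ∀ x ∈ D', ∀ t ∈ Icc 0 τ,
      HasDerivWithinAt (fun t => Φ (x, t)) (v (Φ (x, t))) (Icc 0 τ) t := fun x hx t ht =>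
    (hΦ'.deriv _ (hmem x hx) t ht).fst
  have hAd : ∀ x ∈ D', ∀ t ∈ Icc 0 τ, HasDerivWithinAt (fun t => A (x, t))
      ((Dv (Φ (x, t))).comp (A (x, t))) (Icc 0 τ) t := fun x hx t ht => (hΦ'.deriv _ (hmem x hx) t ht).snd
  have hΦ0 : ∀ x ∈ D', Φ (x, 0) = x := fun x hx => by simp only [hΦ]; rw [hΦ'.init _ (hmem x hx)]
  have hA0 : ∀ x ∈ D', A (x, 0) = 1 := fun x hx => by simp only [hA]; rw [hΦ'.init _ (hmem x hx)]
  have hflow : IsLocalSemiflow c ℓ v x₀ U r τ Φ :=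
    ⟨hΦ0, fun x hx t ht => ⟨(hΦD x hx t ht).1, haU (hDa (hΦD x hx t ht)).2⟩,
      fun x hx t ht => hΦ'.pos _ (hmem x hx) t ht, hΦd⟩
  have hsmooth : ContDiffOn ℝ n (fun p : E × ℝ => Φ' ((p.1, 1), p.2)) (D' ×ˢ Icc 0 τ) := by
    refine hΦs.comp (t := (affineHalf c ℓ' ∩ ball ((x₀, 1) : E × (E →L[ℝ] E)) r) ×ˢ Icc 0 τ)
      (ContDiff.contDiffOn (by fun_prop)) fun p hp => ⟨hmem _ hp.1, hp.2⟩
  have hjoint : ∀ p ∈ D' ×ˢ Icc 0 τ, HasFDerivWithinAt Φ ((A p).comp (ContinuousLinearMap.fst ℝ E ℝ) +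
        (ContinuousLinearMap.snd ℝ E ℝ).smulRight (v (Φ p))) (D' ×ˢ Icc 0 τ) p := by
    rintro ⟨x, t⟩ ⟨hx, ht⟩
    refine hasFDerivWithinAt_uncurry_of_quadratic (A := fun s => A (x, s))
      (C := K₂ * Real.exp (K₁ * τ) ^ 2 / K * Real.exp (K * τ)) (fun y hy s hs => ?_)
      (hAd x hx t ht).continuousWithinAt (hΦd x hx t ht)
    have := norm_trajectory_sub_le (f := fun s => Φ (x, s)) (g := fun s => Φ (y, s))
      (A := fun s => A (x, s)) (hconv b) hvD hlv hlD hK hbound (hΦD x hx) (hΦD y hy) (hΦd x hx)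
      (hΦd y hy) (hAd x hx) (hA0 x hx) s hs
    simpa only [hΦ0 x hx, hΦ0 y hy] using this
  refine ⟨r, τ, Φ, hr, hτ, hflow, ?_, fun x hx t ht => ⟨A (x, t), ?_, ?_⟩⟩
  · rw [Nat.cast_add, Nat.cast_one, contDiffOn_succ_iff_hasFDerivWithinAt_of_uniqueDiffOn
      ((hud r hr).prod (uniqueDiffOn_Icc hτ))]
    refine ⟨fun h => by simp at h, _, ?_, hjoint⟩
    have hAs : ContDiffOn ℝ n A (D' ×ˢ Icc 0 τ) := hsmooth.snd
    have hΦs' : ContDiffOn ℝ n Φ (D' ×ˢ Icc 0 τ) := hsmooth.fst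
    have hvΦ : ContDiffOn ℝ n (fun p => v (Φ p)) (D' ×ˢ Icc 0 τ) :=
      ((hva.mono hDa).of_le (by exact_mod_cast le_top)).comp hΦs' fun p hp => hΦD _ hp.1 _ hp.2
    exact (hAs.clm_comp contDiffOn_const).add (((ContinuousLinearMap.smulRightL ℝ (E × ℝ) E
        (ContinuousLinearMap.snd ℝ E ℝ)).contDiff.comp_contDiffOn hvΦ))
  · have h1 : ‖A (x, t) - 1‖ < 1 / 2 := by
      have := (hΦ'.mem _ (hmem x hx) t ht).2.2
      rwa [mem_ball, dist_eq_norm] at this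
    rw [injective_iff_map_eq_zero]; intro u hu
    by_contra hne
    have h2 : ‖u‖ ≤ 1 / 2 * ‖u‖ := by
      have h3 := (A (x, t) - 1).le_opNorm u
      have h4 : (A (x, t) - 1) u = -u := by simp [hu]
      rw [h4, norm_neg] at h3; exact h3.trans (by gcongr)
    have := norm_pos_iff.2 hne
    linarith
  · have h1 : HasFDerivWithinAt (fun y : E => (y, t)) (ContinuousLinearMap.inl ℝ E ℝ) D' x :=
      ((hasFDerivAt_id x).prodMk (hasFDerivAt_const t x)).hasFDerivWithinAt.congr_fderiv (by ext <;> simp)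
    have := (hjoint (x, t) ⟨hx, ht⟩).comp x h1
      (show MapsTo (fun y : E => (y, t)) D' (D' ×ˢ Icc 0 τ) from fun y hy => ⟨hy, ht⟩)
    refine this.congr_fderiv ?_
    ext u; simp

universe uE in
theorem exists_isLocalSemiflow_contDiffOn (n : ℕ) {E : Type uE} [NormedAddCommGroup E]
    [NormedSpace ℝ E] [CompleteSpace E] {c : ℝ} {ℓ : E →L[ℝ] ℝ} {v : E → E} {x₀ : E} {U : Set E}
    (hU : IsOpen U) (hx₀ : x₀ ∈ affineHalf c ℓ ∩ U) (hv : ContDiffOn ℝ ∞ v (affineHalf c ℓ ∩ U))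
    (hin : 0 < c + ℓ x₀ ∨ 0 < ℓ (v x₀)) :
    ∃ (r τ : ℝ) (Φ : E × ℝ → E), 0 < r ∧ 0 < τ ∧ IsLocalSemiflow c ℓ v x₀ U r τ Φ ∧
      ContDiffOn ℝ n Φ ((affineHalf c ℓ ∩ ball x₀ r) ×ˢ Icc 0 τ) := by
  induction n generalizing E c with
  | zero =>
    obtain ⟨r, τ, Φ, h1, h2, h3, h4⟩ := exists_isLocalSemiflow_continuousOn hU hx₀ (hv.of_le (by simp)) hin
    exact ⟨r, τ, Φ, h1, h2, h3, contDiffOn_zero.2 h4⟩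
  | succ n ih =>
    obtain ⟨r, τ, Φ, h1, h2, h3, h4, -⟩ := exists_isLocalSemiflow_succ_aux n
      (fun k1 k2 k3 k4 => ih (E := E × (E →L[ℝ] E)) k1 k2 k3 k4) hU hx₀ hv hin
    exact ⟨r, τ, Φ, h1, h2, h3, h4⟩

theorem exists_isLocalSemiflow_injective (n : ℕ) {E : Type*} [NormedAddCommGroup E]
    [NormedSpace ℝ E] [CompleteSpace E] {c : ℝ} {ℓ : E →L[ℝ] ℝ} {v : E → E} {x₀ : E} {U : Set E}
    (hU : IsOpen U) (hx₀ : x₀ ∈ affineHalf c ℓ ∩ U) (hv : ContDiffOn ℝ ∞ v (affineHalf c ℓ ∩ U))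
    (hin : 0 < c + ℓ x₀ ∨ 0 < ℓ (v x₀)) :
    ∃ (r τ : ℝ) (Φ : E × ℝ → E), 0 < r ∧ 0 < τ ∧ IsLocalSemiflow c ℓ v x₀ U r τ Φ ∧
      ContDiffOn ℝ (n + 1 : ℕ) Φ ((affineHalf c ℓ ∩ ball x₀ r) ×ˢ Icc 0 τ) ∧
      ∀ x ∈ affineHalf c ℓ ∩ ball x₀ r, ∀ t ∈ Icc 0 τ, ∃ A : E →L[ℝ] E, Injective A ∧
        HasFDerivWithinAt (fun y => Φ (y, t)) A (affineHalf c ℓ ∩ ball x₀ r) x :=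
  exists_isLocalSemiflow_succ_aux n (fun h1 h2 h3 h4 => exists_isLocalSemiflow_contDiffOn n h1 h2 h3 h4) hU hx₀ hv hin

end LocalSemiflowSmooth

/-! ### Exterior algebra in dimensions 3 and 4 -/

section ExteriorAlgebra

variable {T : Type*} [AddCommGroup T] [Module ℝ T]

/-- The wedge product of two covectors. -/
def wedge (a b : T →ₗ[ℝ] ℝ) : Bil T := LinearMap.mk₂ ℝ (fun u w => a u * b w - a w * b u)
    (fun _ _ _ => by simp only [map_add]; ring)
    (fun _ _ _ => by simp only [map_smul, smul_eq_mul]; ring)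
    (fun _ _ _ => by simp only [map_add]; ring)
    (fun _ _ _ => by simp only [map_smul, smul_eq_mul]; ring)

theorem wedge_apply (a b : T →ₗ[ℝ] ℝ) (u w : T) : wedge a b u w = a u * b w - a w * b u := rfl

theorem wedge_self (a b : T →ₗ[ℝ] ℝ) (u : T) : wedge a b u u = 0 := by rw [wedge_apply]; ring

/-- The wedge product of two 2-forms in dimension 4. -/
def pf2 (A B : Bil T) (v : Fin 4 → T) : ℝ :=
  A (v 0) (v 1) * B (v 2) (v 3) - A (v 0) (v 2) * B (v 1) (v 3) + A (v 0) (v 3) * B (v 1) (v 2)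
    + A (v 2) (v 3) * B (v 0) (v 1) - A (v 1) (v 3) * B (v 0) (v 2) + A (v 1) (v 2) * B (v 0) (v 3)

/-- The Pfaffian of a 2-form in dimension 4. -/
def pf (A : Bil T) (v : Fin 4 → T) : ℝ :=
  A (v 0) (v 1) * A (v 2) (v 3) - A (v 0) (v 2) * A (v 1) (v 3) + A (v 0) (v 3) * A (v 1) (v 2)

/-- The wedge product of a 1-form and a 2-form in dimension 3. -/
def t3 (a : T →ₗ[ℝ] ℝ) (B : Bil T) (v : Fin 3 → T) : ℝ :=
  a (v 0) * B (v 1) (v 2) - a (v 1) * B (v 0) (v 2) + a (v 2) * B (v 0) (v 1)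

theorem skew_of_alt {A : Bil T} (hA : ∀ u, A u u = 0) (u w : T) : A u w = -A w u := by
  have h := hA (u + w)
  simp only [map_add, LinearMap.add_apply, hA] at h; linarith

theorem pf2_self (A : Bil T) (v : Fin 4 → T) : pf2 A A v = 2 * pf A v := by simp only [pf2, pf]; ring

/-- `pf2` as an alternating map. -/
def pf2Alt {A B : Bil T} (hA : ∀ u, A u u = 0) (hB : ∀ u, B u u = 0) : T [⋀^Fin 4]→ₗ[ℝ] ℝ where
  toFun := pf2 A B
  map_update_add' := by
    intro inst m i x y
    obtain rfl : inst = instDecidableEqFin 4 := Subsingleton.elim _ _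
    fin_cases i <;> simp [pf2, update] <;> ring
  map_update_smul' := by
    intro inst m i c x
    obtain rfl : inst = instDecidableEqFin 4 := Subsingleton.elim _ _
    fin_cases i <;> simp [pf2, update] <;> ring
  map_eq_zero_of_eq' := by
    intro v i j hij hne
    have a1 := skew_of_alt hA (v 1) (v 0)
    have a2 := skew_of_alt hA (v 2) (v 0)
    have a3 := skew_of_alt hA (v 3) (v 0)
    have a4 := skew_of_alt hA (v 2) (v 1)
    have a5 := skew_of_alt hA (v 3) (v 1)
    have a6 := skew_of_alt hA (v 3) (v 2)
    have b1 := skew_of_alt hB (v 1) (v 0)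
    have b2 := skew_of_alt hB (v 2) (v 0)
    have b3 := skew_of_alt hB (v 3) (v 0)
    have b4 := skew_of_alt hB (v 2) (v 1)
    have b5 := skew_of_alt hB (v 3) (v 1)
    have b6 := skew_of_alt hB (v 3) (v 2)
    have key : ∀ i j : Fin 4, i < j → v i = v j → pf2 A B v = 0 := by
      intro i j hij h
      fin_cases i <;> fin_cases j <;> simp at hij <;> simp only [pf2] <;>
        simp only [Fin.isValue, Fin.reduceFinMk, Fin.zero_eta, Fin.mk_one] at h <;>
        rw [h] at * <;> simp only [hA, hB, a1, a2, a3, a4, a5, a6, b1, b2, b3, b4, b5, b6] <;> ring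
    rcases lt_or_gt_of_ne hne with h | h
    · exact key i j h hij
    · exact key j i h hij.symm

/-- `t3` as an alternating map. -/
def t3Alt (a : T →ₗ[ℝ] ℝ) {B : Bil T} (hB : ∀ u, B u u = 0) : T [⋀^Fin 3]→ₗ[ℝ] ℝ where
  toFun := t3 a B
  map_update_add' := by
    intro inst m i x y
    obtain rfl : inst = instDecidableEqFin 3 := Subsingleton.elim _ _
    fin_cases i <;> simp [t3, update] <;> ring
  map_update_smul' := by
    intro inst m i c x
    obtain rfl : inst = instDecidableEqFin 3 := Subsingleton.elim _ _
    fin_cases i <;> simp [t3, update] <;> ring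
  map_eq_zero_of_eq' := by
    intro v i j hij hne
    have b1 := skew_of_alt hB (v 1) (v 0)
    have b2 := skew_of_alt hB (v 2) (v 0)
    have b4 := skew_of_alt hB (v 2) (v 1)
    have key : ∀ i j : Fin 3, i < j → v i = v j → t3 a B v = 0 := by
      intro i j hij h
      fin_cases i <;> fin_cases j <;> simp at hij <;> simp only [t3] <;>
        simp only [Fin.isValue, Fin.reduceFinMk, Fin.zero_eta, Fin.mk_one] at h <;>
        rw [h] at * <;> simp only [hB, b1, b2, b4] <;> ring
    rcases lt_or_gt_of_ne hne with h | h
    · exact key i j h hij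
    · exact key j i h hij.symm

theorem pf2_eq_det_mul {A B : Bil T} (hA : ∀ u, A u u = 0) (hB : ∀ u, B u u = 0)
    (b : Basis (Fin 4) ℝ T) (v : Fin 4 → T) : pf2 A B v = b.det v * pf2 A B b := by
  have h := congrArg (fun f : T [⋀^Fin 4]→ₗ[ℝ] ℝ => f v) (AlternatingMap.eq_smul_basis_det b (pf2Alt hA hB))
  simp only [AlternatingMap.smul_apply, smul_eq_mul] at h; rw [mul_comm]; exact h

theorem t3_eq_det_mul (a : T →ₗ[ℝ] ℝ) {B : Bil T} (hB : ∀ u, B u u = 0)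
    (b : Basis (Fin 3) ℝ T) (v : Fin 3 → T) : t3 a B v = b.det v * t3 a B b := by
  have h := congrArg (fun f : T [⋀^Fin 3]→ₗ[ℝ] ℝ => f v) (AlternatingMap.eq_smul_basis_det b (t3Alt a hB))
  simp only [AlternatingMap.smul_apply, smul_eq_mul] at h; rw [mul_comm]; exact h

theorem sum_repr_apply (b : Basis (Fin 4) ℝ T) (a : T →ₗ[ℝ] ℝ) (u : T) :
    a u = b.repr u 0 * a (b 0) + b.repr u 1 * a (b 1) + b.repr u 2 * a (b 2) + b.repr u 3 * a (b 3) := by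
  calc a u = a (∑ i, b.repr u i • b i) := by rw [b.sum_repr]
    _ = _ := by rw [map_sum, Fin.sum_univ_four]; simp only [map_smul, smul_eq_mul]

theorem mul_pf_eq_pf2 {A : Bil T} (hA : ∀ u, A u u = 0) (σ θ : T →ₗ[ℝ] ℝ) {Z : T}
    (hZ : ∀ w, A Z w = θ w) (b : Basis (Fin 4) ℝ T) : σ Z * pf A b = pf2 (wedge σ θ) A b := by
  have a1 := skew_of_alt hA (b 1) (b 0)
  have a2 := skew_of_alt hA (b 2) (b 0)
  have a3 := skew_of_alt hA (b 3) (b 0)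
  have a4 := skew_of_alt hA (b 2) (b 1)
  have a5 := skew_of_alt hA (b 3) (b 1)
  have a6 := skew_of_alt hA (b 3) (b 2)
  have hθ : ∀ j, θ (b j) = b.repr Z 0 * A (b 0) (b j) + b.repr Z 1 * A (b 1) (b j)
      + b.repr Z 2 * A (b 2) (b j) + b.repr Z 3 * A (b 3) (b j) := fun j => by
    rw [← hZ]; exact sum_repr_apply b (A.flip (b j)) Z
  have e0 := hθ 0
  have e1 := hθ 1
  have e2 := hθ 2
  have e3 := hθ 3
  rw [hA, a1, a2, a3] at e0; rw [hA, a4, a5] at e1; rw [hA, a6] at e2; rw [hA] at e3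
  rw [sum_repr_apply b σ Z]; simp only [pf2, pf, wedge_apply, e0, e1, e2, e3]; ring

theorem eq_zero_of_pf_ne_zero {A : Bil T} (hA : ∀ u, A u u = 0)
    (b : Basis (Fin 4) ℝ T) (h : pf A b ≠ 0) {u : T} (hu : ∀ w, A u w = 0) : u = 0 := by
  refine b.ext_elem fun i => ?_
  have h1 := mul_pf_eq_pf2 hA (b.coord i) 0 (Z := u) (fun w => by simp [hu w]) b
  have h2 : pf2 (wedge (b.coord i) 0) A b = 0 := by simp [pf2, wedge_apply]
  rw [h2] at h1; simpa using (mul_eq_zero.1 h1).resolve_right h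

theorem pf_expand (A B : Bil T) (σ τ : T →ₗ[ℝ] ℝ) (g g' : ℝ) (v : Fin 4 → T) :
    pf (A + g' • wedge σ τ + g • B) v = pf A v + g' * (pf2 (wedge σ τ) A v
      + g * pf2 (wedge σ τ) B v) + g * pf2 A B v + g ^ 2 * pf B v := by
  simp only [pf, pf2, LinearMap.add_apply, LinearMap.smul_apply, wedge_apply, smul_eq_mul]; ring

theorem pf2_wedge_expand (A B : Bil T) (σ τ : T →ₗ[ℝ] ℝ) (σ' τ' : T →ₗ[ℝ] ℝ) (c c' d d' : ℝ) (v : Fin 4 → T) :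
    pf2 (wedge σ (c • τ + c' • τ')) (d • A + d' • B) v = c * d * pf2 (wedge σ τ) A v + c * d' * pf2 (wedge σ τ) B v
        + c' * d * pf2 (wedge σ τ') A v + c' * d' * pf2 (wedge σ τ') B v := by
  simp only [pf2, LinearMap.add_apply, LinearMap.smul_apply, wedge_apply, smul_eq_mul]; ring

theorem pf2_wedge_boundary (B : Bil T) (σ τ : T →ₗ[ℝ] ℝ) {n b₀ b₁ b₂ : T}
    (h0 : σ b₀ = 0) (h1 : σ b₁ = 0) (h2 : σ b₂ = 0) :
    pf2 (wedge σ τ) B ![n, b₀, b₁, b₂] = σ n * t3 τ B ![b₀, b₁, b₂] := by simp [pf2, t3, wedge_apply, h0, h1, h2]; ring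

theorem t3_smul_wedge (a f : T →ₗ[ℝ] ℝ) (B : Bil T) (c : ℝ) (v : Fin 3 → T) :
    t3 (c • a) (wedge f a + c • B) v = c ^ 2 * t3 a B v := by
  simp only [t3, LinearMap.add_apply, LinearMap.smul_apply, wedge_apply, smul_eq_mul]; ring

theorem t3_cycle (a : T →ₗ[ℝ] ℝ) {B : Bil T} (hB : ∀ u, B u u = 0) (v : Fin 3 → T) :
    t3 a B ![v 1, v 2, v 0] = t3 a B v := by
  have b1 := skew_of_alt hB (v 1) (v 0)
  have b2 := skew_of_alt hB (v 2) (v 0)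
  simp [t3, b1, b2]; ring

theorem t3_pos_of_dominates {a : T →ₗ[ℝ] ℝ} {A B : Bil T} (hA : ∀ u, A u u = 0)
    (hB : ∀ u, B u u = 0) {v : Fin 3 → T} (hpos : 0 < t3 a A v)
    (h : ∀ u w, a u = 0 → a w = 0 → 0 < A u w → 0 < B u w) : 0 < t3 a B v := by
  have key : ∀ v : Fin 3 → T, 0 < t3 a A v → a (v 0) ≠ 0 → 0 < t3 a B v := by
    intro v hpos h0
    set u := a (v 0) • v 1 - a (v 1) • v 0 with hu
    set w := a (v 0) • v 2 - a (v 2) • v 0 with hw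
    have hu0 : a u = 0 := by simp [hu]; ring
    have hw0 : a w = 0 := by simp [hw]; ring
    have e : ∀ C : Bil T, (∀ u, C u u = 0) → C u w = a (v 0) * t3 a C v := by
      intro C hC
      simp only [hu, hw, map_sub, map_smul, LinearMap.sub_apply, LinearMap.smul_apply, hC,
        smul_eq_mul, t3, skew_of_alt hC (v 1) (v 0)]
      ring
    rcases lt_or_gt_of_ne h0 with h1 | h1
    · have h2 := h w u hw0 hu0 (by
        rw [skew_of_alt hA, e A hA]; nlinarith)
      rw [skew_of_alt hB, e B hB] at h2; nlinarith
    · have h2 := h u w hu0 hw0 (by rw [e A hA]; positivity)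
      rw [e B hB] at h2; exact (mul_pos_iff_of_pos_left h1).1 h2
  by_cases h0 : a (v 0) = 0
  · by_cases h1 : a (v 1) = 0
    · by_cases h2 : a (v 2) = 0
      · simp [t3, h0, h1, h2] at hpos
      · have e := t3_cycle a hA v
        have e' := t3_cycle a hA ![v 1, v 2, v 0]
        have f := t3_cycle a hB v
        have f' := t3_cycle a hB ![v 1, v 2, v 0]
        have := key ![v 2, v 0, v 1] (by
          have : t3 a A ![v 2, v 0, v 1] = t3 a A v := by rw [← e, ← e']; simp
          rw [this]; exact hpos) (by simpa using h2)
        have g : t3 a B ![v 2, v 0, v 1] = t3 a B v := by rw [← f, ← f']; simp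
        rwa [g] at this
    · have e := t3_cycle a hA v
      have f := t3_cycle a hB v
      have := key ![v 1, v 2, v 0] (by rw [e]; exact hpos) (by simpa using h1)
      rwa [f] at this
  · exact key v hpos h0

theorem dominates_of_t3_pos {a : T →ₗ[ℝ] ℝ} {A B : Bil T} (hA : ∀ u, A u u = 0)
    (hB : ∀ u, B u u = 0) {b : Basis (Fin 3) ℝ T} (hpos : 0 < t3 a A b)
    (hpos' : 0 < t3 a B b) {u w : T} (hu : a u = 0) (hw : a w = 0) (h : 0 < A u w) : 0 < B u w := by
  obtain ⟨n, hn⟩ : ∃ n, a n ≠ 0 := by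
    by_contra! hcon
    simp [t3, hcon] at hpos
  set n' := (a n)⁻¹ • n with hn'
  have ha : a n' = 1 := by simp [hn', hn]
  have e : ∀ C : Bil T, t3 a C ![n', u, w] = C u w := by intro C; simp [t3, hu, hw, ha]
  have h1 := t3_eq_det_mul a hA b ![n', u, w]
  have h2 := t3_eq_det_mul a hB b ![n', u, w]
  rw [e] at h1 h2; rw [h2]
  have h3 : 0 < b.det ![n', u, w] := by rw [h1] at h; exact (pos_iff_pos_of_mul_pos h).2 hpos
  exact mul_pos h3 hpos'

open Classical in
/-- The quotient `2 (A ∧ B) / (C ∧ C)` of 4-forms on a 4-dimensional space. -/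
def volRatio (A B C : Bil T) : ℝ := if h : Nonempty (Basis (Fin 4) ℝ T) then pf2 A B h.some / pf C h.some else 0

theorem volRatio_eq {A B C : Bil T} (hA : ∀ u, A u u = 0) (hB : ∀ u, B u u = 0)
    (hC : ∀ u, C u u = 0) (b : Basis (Fin 4) ℝ T) : volRatio A B C = pf2 A B b / pf C b := by
  have h : Nonempty (Basis (Fin 4) ℝ T) := ⟨b⟩
  rw [volRatio, dif_pos h, pf2_eq_det_mul hA hB b h.some]
  have h1 := pf2_eq_det_mul hC hC b h.some
  rw [pf2_self, pf2_self] at h1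
  have h2 : pf C h.some = b.det h.some * pf C b := by linarith
  rw [h2, mul_div_mul_left _ _ (b.isUnit_det h.some).ne_zero]

theorem volRatio_pos_iff {A B C : Bil T} (hA : ∀ u, A u u = 0) (hB : ∀ u, B u u = 0)
    (hC : ∀ u, C u u = 0) {b : Basis (Fin 4) ℝ T} (hb : 0 < pf C b) : 0 < volRatio A B C ↔ 0 < pf2 A B b := by
  rw [volRatio_eq hA hB hC b, div_pos_iff_of_pos_right hb]

theorem volRatio_wedge_expand {A B C : Bil T}
    (hA : ∀ u, A u u = 0) (hB : ∀ u, B u u = 0) (hC : ∀ u, C u u = 0) (b : Basis (Fin 4) ℝ T)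
    (σ τ τ' : T →ₗ[ℝ] ℝ) (c c' d d' : ℝ) : volRatio (wedge σ (c • τ + c' • τ')) (d • A + d' • B) C =
      c * d * volRatio (wedge σ τ) A C + c * d' * volRatio (wedge σ τ) B C
        + c' * d * volRatio (wedge σ τ') A C + c' * d' * volRatio (wedge σ τ') B C := by
  rw [volRatio_eq (wedge_self _ _) (fun u => by simp [hA, hB]) hC b, pf2_wedge_expand,
    volRatio_eq (wedge_self _ _) hA hC b, volRatio_eq (wedge_self _ _) hB hC b,
    volRatio_eq (wedge_self _ _) hA hC b, volRatio_eq (wedge_self _ _) hB hC b]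
  · ring
  · exact 0

theorem volRatio_self_expand {A B : Bil T}
    (hA : ∀ u, A u u = 0) (hB : ∀ u, B u u = 0) (b : Basis (Fin 4) ℝ T) (hne : pf A b ≠ 0)
    (σ τ : T →ₗ[ℝ] ℝ) (g g' : ℝ) : volRatio (A + g' • wedge σ τ + g • B) (A + g' • wedge σ τ + g • B) A =
      2 + 2 * g' * (volRatio (wedge σ τ) A A + g * volRatio (wedge σ τ) B A)
        + 2 * g * volRatio A B A + g ^ 2 * volRatio B B A := by
  have h : ∀ u, (A + g' • wedge σ τ + g • B) u u = 0 := fun u => by simp [hA, hB, wedge_self]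
  rw [volRatio_eq h h hA b, pf2_self, pf_expand, volRatio_eq (wedge_self _ _) hA hA b,
    volRatio_eq (wedge_self _ _) hB hA b, volRatio_eq hA hB hA b, volRatio_eq hB hB hA b, pf2_self]
  field_simp

end ExteriorAlgebra

/-! ### Profiles and estimates at the cylindrical end -/

section EndEstimates

theorem deriv_smoothTransition_eq_zero {t : ℝ} (ht : t ∉ Ioo (0 : ℝ) 1) : deriv smoothTransition t = 0 := by
  have hc : IsLocalExtr smoothTransition t := by
    rcases le_or_gt t 0 with h | h
    · exact Or.inl (Eventually.of_forall fun y => by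
        rw [smoothTransition.zero_of_nonpos h]; exact smoothTransition.nonneg y)
    · exact Or.inr (Eventually.of_forall fun y => by
        rw [smoothTransition.one_of_one_le (not_lt.1 fun h1 => ht ⟨h, h1⟩)]
        exact smoothTransition.le_one y)
  exact hc.deriv_eq_zero

/-- The profile function of the thickening. -/
def profile (δ C r : ℝ) : ℝ := C * expNegInvGlue (r + δ)

theorem contDiff_profile (δ C : ℝ) : ContDiff ℝ ∞ (profile δ C) :=
  contDiff_const.mul (expNegInvGlue.contDiff.comp (contDiff_id.add contDiff_const))

theorem profile_nonneg (δ : ℝ) {C : ℝ} (hC : 0 ≤ C) (r : ℝ) : 0 ≤ profile δ C r :=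
  mul_nonneg hC (expNegInvGlue.nonneg _)

theorem hasDerivAt_expNegInvGlue {x : ℝ} (hx : 0 < x) : HasDerivAt expNegInvGlue (expNegInvGlue x / x ^ 2) x := by
  have h1 : HasDerivAt (fun y : ℝ => Real.exp (-y⁻¹)) (Real.exp (-x⁻¹) * -(-(x ^ 2)⁻¹)) x :=
    ((hasDerivAt_inv hx.ne').neg).exp
  have h2 : expNegInvGlue =ᶠ[𝓝 x] fun y => Real.exp (-y⁻¹) := by
    filter_upwards [eventually_gt_nhds hx] with y hy
    rw [expNegInvGlue, if_neg (not_le.2 hy)]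
  have h3 := h1.congr_of_eventuallyEq h2
  rw [h2.self_of_nhds]
  have e : Real.exp (-x⁻¹) * -(-(x ^ 2)⁻¹) = Real.exp (-x⁻¹) / x ^ 2 := by rw [div_eq_mul_inv]; ring
  rwa [e] at h3

theorem deriv_profile {δ C r : ℝ} (hr : -δ < r) : deriv (profile δ C) r = profile δ C r / (r + δ) ^ 2 := by
  have h := ((hasDerivAt_expNegInvGlue (show 0 < r + δ by linarith)).comp_add_const r δ).const_mul C
  rw [show profile δ C = fun r => C * expNegInvGlue (r + δ) from rfl, h.deriv]; ring

theorem profile_eq_zero {δ C r : ℝ} (hr : r ≤ -δ) : profile δ C r = 0 := by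
  rw [profile, expNegInvGlue.zero_of_nonpos (by linarith), mul_zero]

theorem deriv_profile_eq_zero {δ C r : ℝ} (hr : r ≤ -δ) : deriv (profile δ C) r = 0 := by
  have h1 : HasDerivWithinAt (profile δ C) (deriv (profile δ C) r) (Iic r) r :=
    ((contDiff_profile δ C).differentiable (by simp) r).hasDerivAt.hasDerivWithinAt
  have h2 : HasDerivWithinAt (profile δ C) 0 (Iic r) r :=
    (hasDerivWithinAt_const r (Iic r) (0 : ℝ)).congr (fun y hy => profile_eq_zero (le_trans hy hr)) (profile_eq_zero hr)
  exact (uniqueDiffWithinAt_Iic r).eq_deriv _ h1 h2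

/-- Cut-off functions `χ` and `g` on `(-∞, 0)`: the form `χ(s) λ + g(s) β` is `λ` for `s ≤ -δ` and
is of cone type near `s = 0`. -/
structure EndProfile (a K δ : ℝ) where
  χ : ℝ → ℝ
  g : ℝ → ℝ
  g' : ℝ → ℝ
  contDiff_χ : ContDiff ℝ ∞ χ
  contDiffOn_g : ContDiffOn ℝ ∞ g (Iio 0)
  hasDerivAt_g : ∀ r < 0, HasDerivAt g (g' r) r
  of_le : ∀ r ≤ -δ, χ r = 1 ∧ deriv χ r = 0 ∧ g r = 0 ∧ g' r = 0
  of_lt : ∀ r ∈ Ioo (-δ) 0, 0 ≤ χ r ∧ 0 < g r ∧ 0 < g' r ∧ 4 * K * g r ≤ a * g' r ∧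
    4 * K * |deriv χ r| ≤ a * g' r ∧ g r ≤ r ^ 2 * g' r
  of_end : ∀ r, -(δ / 3) < r → χ r = 0 ∧ deriv χ r = 0

theorem exists_endProfile {a K δ : ℝ} (ha : 0 < a) (hK : 0 < K) (hδ : 0 < δ) (h : 4 * K * δ ^ 2 ≤ a) :
    Nonempty (EndProfile a K δ) := by
  set χ : ℝ → ℝ := fun r => smoothTransition (-1 - 3 / δ * r) with hχ
  have hχs : ContDiff ℝ ∞ χ := smoothTransition.contDiff.comp (by fun_prop)
  have hd : ∀ r, deriv χ r = deriv smoothTransition (-1 - 3 / δ * r) * -(3 / δ) := fun r => by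
    have h1 : HasDerivAt (fun r : ℝ => -1 - 3 / δ * r) (-(3 / δ)) r := by
      simpa using ((hasDerivAt_id r).const_mul (3 / δ)).const_sub (-1)
    exact (((smoothTransition.contDiff (n := 1)).differentiable (by simp) _).hasDerivAt.comp r h1).deriv
  have hz : ∀ r, -1 - 3 / δ * r ∉ Ioo (0 : ℝ) 1 → deriv χ r = 0 := fun r hr => by
    rw [hd]; rw [deriv_smoothTransition_eq_zero hr, zero_mul]
  set p := profile δ 1 with hp
  have hp0 : ∀ r, 0 ≤ p r := profile_nonneg δ zero_le_one
  have hps : ContDiff ℝ ∞ p := contDiff_profile δ 1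
  have hp1 : ∀ r, -δ < r → 0 < p r := fun r hr => by
    rw [hp, profile, one_mul]; exact expNegInvGlue.pos_of_pos (by linarith)
  have hp' : ∀ r, -δ < r → deriv p r = p r / (r + δ) ^ 2 := fun r hr => deriv_profile hr
  obtain ⟨m, hm, hm'⟩ : ∃ m > (0 : ℝ), ∀ r ∈ Icc (-(2 * δ / 3)) (-(δ / 3)), m ≤ deriv p r := by
    obtain ⟨r₀, hr₀, h0⟩ := isCompact_Icc.exists_isMinOn (nonempty_Icc.2 (by linarith : -(2 * δ / 3) ≤ -(δ / 3)))
      (hps.continuous_deriv (by simp)).continuousOn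
    have : -δ < r₀ := by linarith [hr₀.1]
    have h2 : 0 < r₀ + δ := by linarith
    exact ⟨deriv p r₀, by rw [hp' _ this]; have := hp1 _ this; positivity, fun r hr => h0 hr⟩
  obtain ⟨L, hL⟩ := (isCompact_Icc (a := -(2 * δ / 3)) (b := -(δ / 3))).exists_bound_of_continuousOn
    (hχs.continuous_deriv (by simp)).continuousOn
  set C : ℝ := 4 * K * |L| / (a * m) + 1 with hC
  have hC0 : 0 < C := by positivity
  have hCm : 4 * K * |L| ≤ a * (C * m) := by rw [hC]; field_simp; nlinarith [mul_pos ha hm]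
  have hinv : ∀ r < (0 : ℝ), HasDerivAt (fun r : ℝ => Real.exp (-r⁻¹)) (Real.exp (-r⁻¹) * (r ^ 2)⁻¹) r := fun r hr => by
      have := (hasDerivAt_inv hr.ne).neg.exp
      rwa [neg_neg] at this
  refine ⟨⟨χ, fun r => C * (p r * Real.exp (-r⁻¹)), fun r => C * (deriv p r * Real.exp (-r⁻¹) +
    p r * (Real.exp (-r⁻¹) * (r ^ 2)⁻¹)), hχs, ?_, fun r hr => ?_, fun r hr => ?_, fun r hr => ?_, fun r hr => ?_⟩⟩
  · exact contDiffOn_const.mul (hps.contDiffOn.mul (Real.contDiff_exp.comp_contDiffOn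
      (contDiffOn_id.inv fun r hr => (mem_Iio.1 hr).ne).neg))
  · exact (((hps.differentiable (by simp) r).hasDerivAt).mul (hinv r hr)).const_mul C
  · have h3 : 1 ≤ -1 - 3 / δ * r := by
      have : 3 / δ * r ≤ 3 / δ * -δ := mul_le_mul_of_nonneg_left hr (by positivity)
      have : 3 / δ * -δ = -3 := by field_simp
      linarith
    have h4 : p r = 0 := profile_eq_zero hr
    have h5 : deriv p r = 0 := deriv_profile_eq_zero hr
    exact ⟨smoothTransition.one_of_one_le h3, hz r fun h => by linarith [h.2], by rw [h4]; ring, by rw [h4, h5]; ring⟩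
  · obtain ⟨h1, h2⟩ := hr
    have hE : 1 ≤ Real.exp (-r⁻¹) := Real.one_le_exp (by rw [neg_nonneg, inv_nonpos]; exact h2.le)
    have hpr := hp1 r h1
    have h3 : 0 < r + δ := by linarith
    have hr0 : r ≠ 0 := h2.ne
    have h4 : 0 < r ^ 2 := by positivity
    set e := Real.exp (-r⁻¹)
    have he : 0 < e := by linarith
    have hq : 0 < deriv p r := by rw [hp' r h1]; positivity
    have h5 : p r ≤ δ ^ 2 * deriv p r := by
      rw [hp' r h1, mul_div_assoc', le_div_iff₀ (by positivity)]
      nlinarith [mul_le_mul_of_nonneg_left (show (r + δ) ^ 2 ≤ δ ^ 2 by nlinarith) hpr.le]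
    have h6 : deriv p r * e ≤ deriv p r * e + p r * (e * (r ^ 2)⁻¹) := by
      have : 0 < p r * (e * (r ^ 2)⁻¹) := by positivity
      linarith
    refine ⟨smoothTransition.nonneg _, by positivity, by positivity, ?_, ?_, ?_⟩
    · calc 4 * K * (C * (p r * e)) ≤ 4 * K * (C * (δ ^ 2 * deriv p r * e)) := by gcongr
        _ = (4 * K * δ ^ 2) * (C * (deriv p r * e)) := by ring
        _ ≤ a * (C * (deriv p r * e)) := by gcongr
        _ ≤ _ := by gcongr
    · by_cases hr : r ∈ Icc (-(2 * δ / 3)) (-(δ / 3))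
      · calc 4 * K * |deriv χ r| ≤ 4 * K * |L| := 
            mul_le_mul_of_nonneg_left ((hL r hr).trans (le_abs_self L)) (by positivity)
          _ ≤ a * (C * m) := hCm
          _ ≤ a * (C * (deriv p r * e)) := by gcongr; exact (hm' r hr).trans (le_mul_of_one_le_right hq.le hE)
          _ ≤ _ := by gcongr
      · rw [hz r fun h => hr ?_, abs_zero, mul_zero]
        · positivity
        · have e1 : r = -δ / 3 * (3 / δ * -r) := by field_simp
          have h7 := h.1; have h8 := h.2
          constructor <;> nlinarith
    · have : r ^ 2 * (C * (deriv p r * e + p r * (e * (r ^ 2)⁻¹))) =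
          C * (p r * e) + r ^ 2 * (C * (deriv p r * e)) := by field_simp; ring
      rw [this]
      have : 0 < r ^ 2 * (C * (deriv p r * e)) := by positivity
      linarith
  · have h3 : -1 - 3 / δ * r ≤ 0 := by
      have : 3 / δ * -(δ / 3) ≤ 3 / δ * r := mul_le_mul_of_nonneg_left hr.le (by positivity)
      have : 3 / δ * -(δ / 3) = -1 := by field_simp
      linarith
    exact ⟨smoothTransition.zero_of_nonpos h3, hz r fun h => by linarith [h.1]⟩

variable {T : Type*} [AddCommGroup T] [Module ℝ T]

/-- The differential of `χ μ + g β`. -/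
def endBilin (c g c' g' : ℝ) (σ μ β : T →ₗ[ℝ] ℝ) (A B : Bil T) : Bil T := c • A + g • B + wedge σ (c' • μ + g' • β)

/-- Bounds for the 4-forms entering the estimates at the end, in a basis. -/
structure EndBound (a K P : ℝ) (near : Prop) (σ μ β γ : T →ₗ[ℝ] ℝ) (A B : Bil T)
    (b : Fin 4 → T) : Prop where
  pos : 0 < P
  pf_A : a * P ≤ pf A b
  pf2_AB : |pf2 A B b| ≤ K * P
  pf_B : |pf B b| ≤ K * P
  μ_A : |pf2 (wedge σ μ) A b| ≤ K * P
  μ_B : |pf2 (wedge σ μ) B b| ≤ K * P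
  γ_B : |pf2 (wedge σ γ) B b| ≤ K * P
  near_μ_A : near → a * P ≤ pf2 (wedge σ μ) A b
  near_μ_B : near → a * P ≤ pf2 (wedge σ μ) B b
  near_β_A : near → a * P ≤ pf2 (wedge σ β) A b
  near_β_B : near → a * P ≤ pf2 (wedge σ β) B b

variable {a K P : ℝ} {near : Prop} {σ μ β γ : T →ₗ[ℝ] ℝ} {A B : Bil T} {b : Fin 4 → T}

theorem EndBound.pf_ge (h : EndBound a K P near σ μ β γ A B b) (hn : near) {c g c' g' : ℝ} (ha : 0 < a)
    (hK : 0 < K) (hc : 0 ≤ c) (hg : 0 ≤ g) (hg' : 0 ≤ g') (h1 : 4 * K * g ≤ a * g')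
    (h2 : 4 * K * |c'| ≤ a * g') :
    c ^ 2 * (a * P) + (c + g) * (a * g' / 2) * P ≤ pf (endBilin c g c' g' σ μ β A B) b := by
  have e : pf (endBilin c g c' g' σ μ β A B) b = c ^ 2 * pf A b + c * g * pf2 A B b + g ^ 2 * pf B b +
      c' * (c * pf2 (wedge σ μ) A b + g * pf2 (wedge σ μ) B b) +
      (c * (g' * pf2 (wedge σ β) A b) + g * (g' * pf2 (wedge σ β) B b)) := by
    simp only [endBilin, pf, pf2, LinearMap.add_apply, LinearMap.smul_apply, wedge_apply, smul_eq_mul]; ring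
  have hP := h.pos
  have hcg := mul_nonneg hc hg
  have k0 := mul_le_mul_of_nonneg_left h.pf_A (sq_nonneg c)
  have k1 := mul_le_mul_of_nonneg_left (abs_le.1 h.pf2_AB).1 hcg
  have k2 := mul_le_mul_of_nonneg_left (abs_le.1 h.pf_B).1 (sq_nonneg g)
  have k3 := mul_le_mul_of_nonneg_left (mul_le_mul_of_nonneg_left (h.near_β_A hn) hg') hc
  have k4 := mul_le_mul_of_nonneg_left (mul_le_mul_of_nonneg_left (h.near_β_B hn) hg') hg
  have k5 : -(|c'| * (c + g) * (K * P)) ≤ c' * (c * pf2 (wedge σ μ) A b + g * pf2 (wedge σ μ) B b) := by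
    refine (abs_le.1 ?_).1
    rw [abs_mul, mul_assoc]
    refine mul_le_mul_of_nonneg_left ((abs_add_le _ _).trans ?_) (abs_nonneg _)
    rw [abs_mul, abs_mul, abs_of_nonneg hc, abs_of_nonneg hg, add_mul]
    exact add_le_add (mul_le_mul_of_nonneg_left h.μ_A hc) (mul_le_mul_of_nonneg_left h.μ_B hg)
  have k6 : 0 ≤ (c + g) * P * (a * g' / 2 - K * g - K * |c'|) :=
    mul_nonneg (mul_nonneg (by linarith) hP.le) (by linarith)
  rw [e]; nlinarith

theorem EndBound.pf2_pos (h : EndBound a K P near σ μ β γ A B b) (hn : near) {c g c' g' : ℝ} (ha : 0 < a)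
    (hc : 0 ≤ c) (hg : 0 ≤ g) (hcg : 0 < c + g) :
    0 < pf2 (wedge σ (c • μ + g • β)) (endBilin c g c' g' σ μ β A B) b := by
  have e : pf2 (wedge σ (c • μ + g • β)) (endBilin c g c' g' σ μ β A B) b =
      c ^ 2 * pf2 (wedge σ μ) A b + c * g * pf2 (wedge σ μ) B b + c * g * pf2 (wedge σ β) A b +
        g ^ 2 * pf2 (wedge σ β) B b := by
    simp only [endBilin, pf2, LinearMap.add_apply, LinearMap.smul_apply, wedge_apply, smul_eq_mul]; ring
  have k0 := mul_le_mul_of_nonneg_left (h.near_μ_A hn) (sq_nonneg c)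
  have k1 := mul_le_mul_of_nonneg_left (h.near_μ_B hn) (mul_nonneg hc hg)
  have k2 := mul_le_mul_of_nonneg_left (h.near_β_A hn) (mul_nonneg hc hg)
  have k3 := mul_le_mul_of_nonneg_left (h.near_β_B hn) (sq_nonneg g)
  have k4 : 0 < (c + g) ^ 2 * (a * P) := mul_pos (pow_pos hcg 2) (mul_pos ha h.pos)
  rw [e]; nlinarith

theorem EndBound.abs_le {b : Basis (Fin 4) ℝ T} (h : EndBound a K P near σ μ β γ A B b)
    (hA : ∀ u, A u u = 0) (hB : ∀ u, B u u = 0) (hn : near) {g g' : ℝ} (ha : 0 < a)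
    (hK : 0 < K) (hg : 0 < g) (hg' : 0 < g') (h1 : 4 * K * g ≤ a * g') {y : T}
    (hy : ∀ w, endBilin 0 g 0 g' σ μ β A B y w = g * γ w) : |σ y| ≤ 2 * K / a * (g / g') := by
  have k1 := h.pf_ge hn (c := 0) (c' := 0) ha hK le_rfl hg.le hg'.le h1 (by simp; positivity)
  have k2 := mul_pf_eq_pf2 (A := endBilin 0 g 0 g' σ μ β A B) (fun u => by simp [endBilin, hB, wedge_self])
    σ (g • γ) (fun w => hy w) b
  have e : pf2 (wedge σ (g • γ)) (endBilin 0 g 0 g' σ μ β A B) b = g ^ 2 * pf2 (wedge σ γ) B b := by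
    simp only [endBilin, pf2, LinearMap.add_apply, LinearMap.smul_apply, wedge_apply, smul_eq_mul]; ring
  have hP := h.pos
  set Q := pf (endBilin 0 g 0 g' σ μ β A B) b
  have hQ : 0 < g * (a * g' / 2) * P := by positivity
  have k3 : |σ y| * Q ≤ g ^ 2 * (K * P) := by
    rw [← abs_of_pos (show 0 < Q by linarith), ← abs_mul, k2, e, abs_mul, abs_of_pos (pow_pos hg 2)]
    exact mul_le_mul_of_nonneg_left h.γ_B (sq_nonneg g)
  have k4 : |σ y| * (g * (a * g' / 2) * P) ≤ g ^ 2 * (K * P) :=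
    (mul_le_mul_of_nonneg_left (by linarith) (abs_nonneg _)).trans k3
  have k5 : 2 * K / a * (g / g') * (g * (a * g' / 2) * P) = g ^ 2 * (K * P) := by field_simp
  exact le_of_mul_le_mul_right (k4.trans k5.ge) hQ

end EndEstimates

section Manifolds

variable {E : Type} [NormedAddCommGroup E] [NormedSpace ℝ E] [FiniteDimensional ℝ E]
  {H : Type*} [TopologicalSpace H] {I : ModelWithCorners ℝ E H}
  {M : Type*} [TopologicalSpace M] [ChartedSpace H M] [IsManifold I ∞ M]
  {E' : Type} [NormedAddCommGroup E'] [NormedSpace ℝ E'] [FiniteDimensional ℝ E']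
  {H' : Type*} [TopologicalSpace H'] {J : ModelWithCorners ℝ E' H'}
  {N : Type*} [TopologicalSpace N] [ChartedSpace H' N] [IsManifold J ∞ N]

/-! ### Flows of vector fields -/

/-- `v` is a smooth vector field. -/
abbrev SmoothField (v : ∀ x : M, Tan I x) : Prop := ContMDiff I I.tangent ∞ (fun x => (⟨x, v x⟩ : TangentBundle I M))

variable {v : ∀ x : M, Tan I x} {Φ : ℝ → M → M} {c : ℝ} {ℓ : E →L[ℝ] ℝ}

variable (I) in
/-- The derivative at `x` of the chart at `x₀`. -/
def chartD (x₀ x : M) : E →L[ℝ] E := mfderiv I 𝓘(ℝ, E) (crd I x₀) x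

variable (I) in
/-- The derivative at `y` of the inverse of the chart at `x₀`. -/
def chartDSymm (x₀ : M) (y : E) : E →L[ℝ] E := mfderivWithin 𝓘(ℝ, E) I (crd I x₀).symm (range I) y

instance isManifold_one_of_infty : IsManifold I 1 M := IsManifold.of_le (n := ∞) (by simp)

theorem chartD_self (x : M) (w : E) : chartD I x x w = w :=
  DFunLike.congr_fun (mfderiv_extChartAt_self (I := I) (x := x)) w

theorem chartD_chartDSymm {x₀ : M} {y : E} (hy : y ∈ (crd I x₀).target) (u : E) :
    chartD I x₀ ((crd I x₀).symm y) (chartDSymm I x₀ y u) = u :=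
  DFunLike.congr_fun (mfderiv_extChartAt_comp_mfderivWithin_extChartAt_symm hy) u

theorem chartDSymm_chartD {x₀ x : M} (hx : x ∈ (crd I x₀).source) (w : E) :
    chartDSymm I x₀ (crd I x₀ x) (chartD I x₀ x w) = w :=
  DFunLike.congr_fun (mfderivWithin_extChartAt_symm_comp_mfderiv_extChartAt' hx) w

theorem chartD_chartDSymm' {x₀ x : M} (hx : x ∈ (crd I x₀).source) (u : E) :
    chartD I x₀ x (chartDSymm I x₀ (crd I x₀ x) u) = u := by
  have h := chartD_chartDSymm (I := I) ((crd I x₀).map_source hx) u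
  rwa [(crd I x₀).left_inv hx] at h

theorem chartD_injective {x₀ x : M} (hx : x ∈ (crd I x₀).source) : Injective (chartD I x₀ x) :=
  Function.LeftInverse.injective (chartDSymm_chartD hx)

theorem chartD_surjective {x₀ x : M} (hx : x ∈ (crd I x₀).source) : Surjective (chartD I x₀ x) :=
  Function.RightInverse.surjective (chartD_chartDSymm' hx)

/-- The coordinate expression of a vector field. -/
def vectorRep (v : ∀ x : M, Tan I x) (x₀ : M) (y : E) : E := chartD I x₀ ((crd I x₀).symm y) (v ((crd I x₀).symm y))

theorem contMDiff_vectorField_iff : SmoothField v ↔ ∀ x₀, ContDiffOn ℝ ∞ (vectorRep v x₀) (crd I x₀).target := by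
  have key : ∀ x₀ : M, ContMDiffOn I I.tangent ∞ (fun x => (⟨x, v x⟩ : TangentBundle I M))
      (chartAt H x₀).source ↔ ContDiffOn ℝ ∞ (vectorRep v x₀) (crd I x₀).target := by
    intro x₀
    have h1 := (trivializationAt E (Tan I) x₀).contMDiffOn_section_baseSet_iff (IB := I) (n := ∞) (s := v)
    rw [TangentBundle.trivializationAt_baseSet] at h1; rw [h1]
    have h2 : ∀ x ∈ (chartAt H x₀).source, ((trivializationAt E (Tan I) x₀) ⟨x, v x⟩).2 = chartD I x₀ x (v x) := by
      intro x hx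
      have := TangentBundle.continuousLinearMapAt_trivializationAt (I := I) hx
      have h3 := DFunLike.congr_fun this (v x)
      rw [Bundle.Trivialization.continuousLinearMapAt_apply,
        Bundle.Trivialization.coe_linearMapAt_of_mem _ (by simpa using hx)] at h3
      exact h3
    rw [contMDiffOn_congr h2]; constructor
    · intro h; rw [← contMDiffOn_iff_contDiffOn]
      refine h.comp (contMDiffOn_extChartAt_symm x₀) fun y hy => ?_
      rw [mem_preimage, ← extChartAt_source I]; exact (crd I x₀).map_target hy
    · intro h; rw [← contMDiffOn_iff_contDiffOn] at h
      refine (h.comp (contMDiffOn_extChartAt (x := x₀)) fun x hx => ?_).congr fun x hx => ?_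
      · rw [← extChartAt_source I] at hx; exact (crd I x₀).map_source hx
      · rw [← extChartAt_source I] at hx; simp only [vectorRep, comp_apply]; rw [(crd I x₀).left_inv hx]
  constructor
  · exact fun h x₀ => (key x₀).1 h.contMDiffOn
  · intro h x; exact ((key x).2 (h x)).contMDiffAt ((chartAt H x).open_source.mem_nhds (mem_chart_source H x))

/-- `γ` has the velocity `w` at `t`, within `s`. -/
def HasVelocity (γ : ℝ → M) (s : Set ℝ) (t : ℝ) (w : Tan I (γ t)) : Prop :=
  HasMFDerivWithinAt ℐ I γ s t ((1 : ℝ →L[ℝ] ℝ).smulRight (show E from w))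

theorem HasVelocity.hasDerivWithinAt {γ : ℝ → M} {s : Set ℝ} {t : ℝ}
    {w : Tan I (γ t)} (h : HasVelocity γ s t w) {x₀ : M}
    (hx : γ t ∈ (crd I x₀).source) : HasDerivWithinAt (fun t => crd I x₀ (γ t)) (chartD I x₀ (γ t) w) s t := by
  rw [extChartAt_source] at hx
  have h1 := (mdifferentiableAt_extChartAt (I := I) hx).hasMFDerivAt.comp_hasMFDerivWithinAt t h
  have e : (chartD I x₀ (γ t)).comp ((1 : ℝ →L[ℝ] ℝ).smulRight (show E from w)) =
      (1 : ℝ →L[ℝ] ℝ).smulRight (chartD I x₀ (γ t) w) := by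
    ext; change chartD I x₀ (γ t) ((1 : ℝ) • (show E from w)) = (1 : ℝ) • chartD I x₀ (γ t) w; rw [map_smul]
  have h2 : HasFDerivWithinAt (fun t => crd I x₀ (γ t))
      ((1 : ℝ →L[ℝ] ℝ).smulRight (chartD I x₀ (γ t) w)) s t := by rw [← e]; exact h1.hasFDerivWithinAt
  have h3 := h2.hasDerivWithinAt
  rwa [ContinuousLinearMap.smulRight_apply, show (1 : ℝ →L[ℝ] ℝ) 1 = 1 from rfl, one_smul] at h3

theorem hasVelocity_of_hasDerivWithinAt {x₀ : M} {f : ℝ → E} {s : Set ℝ} {t : ℝ} {u : E}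
    (h : HasDerivWithinAt f u s t) (hf : MapsTo f s (crd I x₀).target) (ht : t ∈ s) :
    HasVelocity (I := I) (fun t => (crd I x₀).symm (f t)) s t (chartDSymm I x₀ (f t) u) := by
  have h1 := (mdifferentiableWithinAt_extChartAt_symm (I := I) (hf ht)).hasMFDerivWithinAt
  have h2 := h1.comp t h.hasFDerivWithinAt.hasMFDerivWithinAt (fun r hr => extChartAt_target_subset_range x₀ (hf hr))
  refine h2.congr_mfderiv ?_
  ext; change chartDSymm I x₀ (f t) ((1 : ℝ) • u) = (1 : ℝ) • (chartDSymm I x₀ (f t) u); rw [map_smul]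

theorem isOpen_target_inter (I : ModelWithCorners ℝ E H) (x₀ : M) :
    ∃ U : Set E, IsOpen U ∧ (crd I x₀).target = range I ∩ U :=
  ⟨I.symm ⁻¹' (chartAt H x₀).target, (chartAt H x₀).open_target.preimage I.continuous_symm, by
    rw [extChartAt_target, inter_comm]⟩

/-- A forward local flow of class `C^n` on `W`, up to time `τ`. -/
structure LocalFlowOn (v : ∀ x : M, Tan I x) (n : ℕ) (W : Set M) (τ : ℝ)
    (Ψ : ℝ → M → M) : Prop where
  isOpen : IsOpen W
  init : ∀ x ∈ W, Ψ 0 x = x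
  curve : ∀ x ∈ W, ∀ t ∈ Icc 0 τ, HasVelocity (fun t => Ψ t x) (Icc 0 τ) t (v (Ψ t x))
  smooth : ContMDiffOn ((ℐ).prod I) I n (fun p : ℝ × M => Ψ p.1 p.2) (Icc 0 τ ×ˢ W)
  inj : ∀ x ∈ W, ∀ t ∈ Icc 0 τ, Injective (mfderiv I I (Ψ t) x)

theorem LocalFlowOn.mono {n : ℕ} {W : Set M} {τ τ' : ℝ}
    {Ψ : ℝ → M → M} (h : LocalFlowOn v n W τ Ψ) (hτ : τ' ≤ τ) : LocalFlowOn v n W τ' Ψ where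
  isOpen := h.isOpen
  init := h.init
  curve := fun x hx t ht => (h.curve x hx t ⟨ht.1, ht.2.trans hτ⟩).mono (Icc_subset_Icc le_rfl hτ)
  smooth := h.smooth.mono (prod_mono (Icc_subset_Icc le_rfl hτ) subset_rfl)
  inj := fun x hx t ht => h.inj x hx t ⟨ht.1, ht.2.trans hτ⟩

theorem exists_localFlowOn [FiniteDimensional ℝ E] (hI : range I = affineHalf c ℓ) (hv : SmoothField v) {x₀ : M}
    (hin : 0 < c + ℓ (crd I x₀ x₀) ∨ 0 < ℓ (v x₀)) (n : ℕ) :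
    ∃ (W : Set M) (τ : ℝ) (Ψ : ℝ → M → M), x₀ ∈ W ∧ 0 < τ ∧ LocalFlowOn v n W τ Ψ ∧
      ∀ x ∈ W, ∀ t ∈ Ioc 0 τ, I.IsInteriorPoint (Ψ t x) := by
  haveI : CompleteSpace E := FiniteDimensional.complete ℝ E
  obtain ⟨U, hU, hUt⟩ := isOpen_target_inter I x₀
  rw [hI] at hUt
  set φ := crd I x₀ with hφ
  have hvs : ContDiffOn ℝ ∞ (vectorRep v x₀) (affineHalf c ℓ ∩ U) := by
    rw [← hUt]; exact contMDiff_vectorField_iff.1 hv x₀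
  have hx₀ : φ x₀ ∈ affineHalf c ℓ ∩ U := by rw [← hUt]; exact mem_extChartAt_target x₀
  have hin' : 0 < c + ℓ (φ x₀) ∨ 0 < ℓ (vectorRep v x₀ (φ x₀)) := by
    have : vectorRep v x₀ (φ x₀) = v x₀ := by
      rw [vectorRep, extChartAt_to_inv]; exact chartD_self (E := E) (I := I) x₀ (v x₀)
    rwa [this]
  obtain ⟨r, τ, Φ, hr, hτ, hΦ, hΦs, hΦi⟩ := exists_isLocalSemiflow_injective n hU hx₀ hvs hin'
  set D := affineHalf c ℓ ∩ ball (φ x₀) r with hD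
  set W : Set M := (chartAt H x₀).source ∩ φ ⁻¹' (ball (φ x₀) r) with hW
  have hWo : IsOpen W := by
    have := (continuousOn_extChartAt (I := I) x₀).isOpen_inter_preimage
      (isOpen_extChartAt_source x₀) (isOpen_ball (x := φ x₀) (ε := r))
    rwa [extChartAt_source] at this
  have hsrc : ∀ x ∈ W, x ∈ φ.source := fun x hx => by rw [hφ, extChartAt_source]; exact hx.1
  have hWD : ∀ x ∈ W, φ x ∈ D := fun x hx =>
    ⟨by rw [← hI]; exact extChartAt_target_subset_range x₀ (φ.map_source (hsrc x hx)), hx.2⟩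
  have htar : ∀ x ∈ W, ∀ t ∈ Icc 0 τ, Φ (φ x, t) ∈ φ.target := fun x hx t ht => by
    rw [hUt]; exact hΦ.mem _ (hWD x hx) t ht
  refine ⟨W, τ, fun t x => φ.symm (Φ (φ x, t)), ⟨mem_chart_source H x₀, mem_ball_self hr⟩,
    hτ, ⟨hWo, fun x hx => ?_, fun x hx t ht => ?_, ?_, fun x hx t ht => ?_⟩, fun x hx t ht => ?_⟩
  · simp only [hΦ.init _ (hWD x hx)]; exact φ.left_inv (hsrc x hx)
  · have h := hasVelocity_of_hasDerivWithinAt (I := I) (x₀ := x₀)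
      (hΦ.deriv _ (hWD x hx) t ht) (fun s hs => htar x hx s hs) ht
    have h2 : chartDSymm I x₀ (Φ (φ x, t)) (vectorRep v x₀ (Φ (φ x, t))) = v (φ.symm (Φ (φ x, t))) := by
      have h3 := chartDSymm_chartD (E := E) (I := I) (x₀ := x₀) (φ.map_target (htar x hx t ht))
        (v (φ.symm (Φ (φ x, t))))
      rw [← hφ, φ.right_inv (htar x hx t ht)] at h3; exact h3
    rw [h2] at h; exact h
  · have h1 : ContMDiffOn 𝓘(ℝ, E × ℝ) 𝓘(ℝ, E) n Φ (D ×ˢ Icc 0 τ) := (hΦs.of_le (by norm_cast; omega)).contMDiffOn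
    have h2 : ContMDiffOn ((ℐ).prod I) 𝓘(ℝ, E × ℝ) n (fun p : ℝ × M => (φ p.2, p.1)) (Icc 0 τ ×ˢ W) :=
      (((contMDiffOn_extChartAt (x := x₀) (n := n)).comp contMDiffOn_snd
        (fun p hp => hp.2.1))).prodMk_space contMDiffOn_fst
    exact ((contMDiffOn_extChartAt_symm x₀).comp (h1.comp h2 fun p hp => ⟨hWD _ hp.2, hp.1⟩)
      fun p hp => htar _ hp.2 _ hp.1)
  · obtain ⟨A, hA, hAd⟩ := hΦi _ (hWD x hx) t ht
    have h1 : HasMFDerivWithinAt I 𝓘(ℝ, E) φ W x (chartD (E := E) I x₀ x) :=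
      (mdifferentiableAt_extChartAt (I := I) hx.1).hasMFDerivAt.hasMFDerivWithinAt
    have h3 : HasMFDerivWithinAt 𝓘(ℝ, E) I φ.symm (range I) (Φ (φ x, t)) (chartDSymm (E := E) I x₀ (Φ (φ x, t))) :=
      (mdifferentiableWithinAt_extChartAt_symm (I := I) (htar x hx t ht)).hasMFDerivWithinAt
    have h4 := (h3.comp (φ x) hAd.hasMFDerivWithinAt fun y hy => by
      rw [mem_preimage, hI]; exact (hΦ.mem _ hy t ht).1).comp x h1 fun y hy => hWD y hy
    have h5 : HasMFDerivAt I I (fun x => φ.symm (Φ (φ x, t))) x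
      ((chartDSymm (E := E) I x₀ (Φ (φ x, t))).comp (A.comp (chartD (E := E) I x₀ x))) :=
      h4.hasMFDerivAt (hWo.mem_nhds hx)
    have h6 : Injective (chartDSymm I x₀ (Φ (φ x, t))) :=
      Function.LeftInverse.injective (chartD_chartDSymm (htar x hx t ht))
    rw [h5.mfderiv]; exact h6.comp (hA.comp (chartD_injective (E := E) (hsrc x hx)))
  · have ht' := Ioc_subset_Icc_self ht
    have hs : φ.symm (Φ (φ x, t)) ∈ (chartAt H x₀).source := by
      rw [← extChartAt_source I]; exact φ.map_target (htar x hx t ht')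
    rw [ModelWithCorners.isInteriorPoint_iff_of_mem_atlas (n := ∞) (by simp) (chart_mem_atlas H x₀) hs]
    change φ (φ.symm (Φ (φ x, t))) ∈ interior φ.target; rw [φ.right_inv (htar x hx t ht')]
    refine interior_maximal (s := φ.target) (t := {y | 0 < c + ℓ y} ∩ U) ?_
      ((isOpen_lt continuous_const (by fun_prop)).inter hU)
      ⟨hΦ.pos _ (hWD x hx) t ht, (hΦ.mem _ (hWD x hx) t ht').2⟩
    rw [hUt]; exact inter_subset_inter_left _ fun y hy => mem_affineHalf.2 (le_of_lt hy)

theorem HasVelocity.continuousWithinAt {γ : ℝ → M} {s : Set ℝ} {t : ℝ}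
    {w : Tan I (γ t)} (h : HasVelocity γ s t w) : ContinuousWithinAt γ s t :=
  HasMFDerivWithinAt.continuousWithinAt h

theorem eqOn_of_hasVelocity [T2Space M] (hI : range I = affineHalf c ℓ) (hv : SmoothField v) {a b : ℝ}
    {γ γ' : ℝ → M} (hγ : ∀ t ∈ Icc a b, HasVelocity γ (Icc a b) t (v (γ t)))
    (hγ' : ∀ t ∈ Icc a b, HasVelocity γ' (Icc a b) t (v (γ' t)))
    (h0 : γ a = γ' a) : EqOn γ γ' (Icc a b) := by
  rcases lt_or_ge b a with hab | hab
  · intro t ht; exact absurd (ht.1.trans ht.2) (not_le.2 hab)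
  have hc : ContinuousOn γ (Icc a b) := fun t ht => (hγ t ht).continuousWithinAt
  have hc' : ContinuousOn γ' (Icc a b) := fun t ht => (hγ' t ht).continuousWithinAt
  have hclosed : IsClosed ({t | γ t = γ' t} ∩ Icc a b) := by
    have h1 := (hc.prodMk hc').preimage_isClosed_of_isClosed isClosed_Icc (isClosed_diagonal (X := M))
    convert h1 using 1
    ext t; simp [and_comm]
  refine hclosed.Icc_subset_of_forall_mem_nhdsWithin h0 ?_
  rintro t ⟨htt, ht⟩
  have htI := Ico_subset_Icc_self ht
  obtain ⟨U, hU, hUt⟩ := isOpen_target_inter I (γ t)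
  have hvs := contMDiff_vectorField_iff.1 hv (γ t)
  set φ := crd I (γ t) with hφ
  have hconv : Convex ℝ (range I) := by rw [hI]; exact convex_affineHalf c ℓ
  have h1 : ContDiffWithinAt ℝ 1 (vectorRep v (γ t)) (range I) (φ (γ t)) := by
    have h2 := (hvs (φ (γ t)) (mem_extChartAt_target _)).of_le (by simp : (1 : WithTop ℕ∞) ≤ ∞)
    rw [hUt] at h2
    have h3 : φ (γ t) ∈ range I ∩ U := by rw [← hUt]; exact mem_extChartAt_target _
    exact h2.mono_of_mem_nhdsWithin (inter_mem_nhdsWithin _ (hU.mem_nhds h3.2))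
  obtain ⟨K, s, hs, hlip⟩ := h1.exists_lipschitzOnWith hconv
  have hsrc : φ.source ∈ 𝓝 (γ t) := extChartAt_source_mem_nhds (γ t)
  have hpre : ∀ᶠ x in 𝓝 (γ t), x ∈ φ.source ∧ φ x ∈ s := by
    have h4 : Tendsto φ (𝓝 (γ t)) (𝓝[range I] (φ (γ t))) := by
      rw [hφ, ← map_extChartAt_nhds (I := I) (γ t)]; exact tendsto_map
    have h5 : ∀ᶠ x in 𝓝 (γ t), x ∈ φ.source := hsrc
    exact h5.and (h4.eventually hs)
  have hnear : ∀ {δ : ℝ → M}, ContinuousOn δ (Icc a b) → δ t = γ t → ∀ᶠ r in 𝓝[≥] t, δ r ∈ φ.source ∧ φ (δ r) ∈ s := by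
    intro δ hδ h
    have h6 : Tendsto δ (𝓝[≥] t) (𝓝 (γ t)) := by
      rw [← h]
      exact ((hδ t htI).mono (Icc_subset_Icc_left ht.1)).mono_left (nhdsWithin_le_of_mem (Icc_mem_nhdsGE ht.2))
    exact h6.eventually hpre
  obtain ⟨d, hd, hIcc⟩ := mem_nhdsGE_iff_exists_Icc_subset.1
    (((hnear hc rfl).and (hnear hc' htt.symm)).and (Icc_mem_nhdsGE ht.2))
  have hd' : t < d := hd
  have hIccb : ∀ r ∈ Icc t d, r ∈ Icc a b := fun r hr => ⟨ht.1.trans hr.1, (hIcc hr).2.2⟩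
  have hder : ∀ {δ : ℝ → M}, (∀ r ∈ Icc a b, HasVelocity δ (Icc a b) r (v (δ r))) →
      (∀ r ∈ Icc t d, δ r ∈ φ.source) → ∀ r ∈ Icc t d,
      HasDerivWithinAt (fun r => φ (δ r)) (vectorRep v (γ t) (φ (δ r))) (Icc t d) r := by
    intro δ hδ hδs r hr
    have h7 := ((hδ r (hIccb r hr)).hasDerivWithinAt (hδs r hr)).mono (fun r hr => hIccb r hr)
    have h8 : vectorRep v (γ t) (φ (δ r)) = chartD I (γ t) (δ r) (v (δ r)) := by rw [vectorRep, φ.left_inv (hδs r hr)]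
    rwa [h8]
  have hs1 : ∀ r ∈ Icc t d, γ r ∈ φ.source := fun r hr => (hIcc hr).1.1.1
  have hs2 : ∀ r ∈ Icc t d, γ' r ∈ φ.source := fun r hr => (hIcc hr).1.2.1
  have hIci : ∀ {h : ℝ → E} {h' : E} {r : ℝ}, r ∈ Ico t d → HasDerivWithinAt h h' (Icc t d) r →
      HasDerivWithinAt h h' (Ici r) r := fun {h h' r} ht hh =>
    (hh.mono (Icc_subset_Icc_left ht.1)).mono_of_mem_nhdsWithin (Icc_mem_nhdsGE ht.2)
  have huniq := ODE_solution_unique_of_mem_Icc_right (v := fun _ => vectorRep v (γ t))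
    (s := fun _ => s) (K := K) (a := t) (b := d) (f := fun r => φ (γ r)) (g := fun r => φ (γ' r))
    (fun _ _ => hlip) (fun r hr => (hder hγ hs1 r hr).continuousWithinAt)
    (fun r hr => hIci hr (hder hγ hs1 r (Ico_subset_Icc_self hr)))
    (fun r hr => (hIcc (Ico_subset_Icc_self hr)).1.1.2)
    (fun r hr => (hder hγ' hs2 r hr).continuousWithinAt)
    (fun r hr => hIci hr (hder hγ' hs2 r (Ico_subset_Icc_self hr)))
    (fun r hr => (hIcc (Ico_subset_Icc_self hr)).1.2.2) (by simp only [show γ t = γ' t from htt])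
  refine mem_of_superset (Icc_mem_nhdsGT hd') fun r hr => ?_
  exact φ.injOn (hs1 r hr) (hs2 r hr) (huniq hr)

theorem HasVelocity.mono {γ : ℝ → M} {s s' : Set ℝ} {t : ℝ} {w : Tan I (γ t)}
    (h : HasVelocity γ s t w) (hs : s' ⊆ s) : HasVelocity γ s' t w :=
  HasMFDerivWithinAt.mono h hs

theorem HasVelocity.mono_of_mem {γ : ℝ → M} {s s' : Set ℝ} {t : ℝ}
    {w : Tan I (γ t)} (h : HasVelocity γ s t w) (hs : s ∈ 𝓝[s'] t) : HasVelocity γ s' t w :=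
  HasMFDerivWithinAt.mono_of_mem_nhdsWithin h hs

theorem HasVelocity.congr {γ γ' : ℝ → M} {s : Set ℝ} {t : ℝ}
    {w : Tan I (γ t)} (h : HasVelocity γ s t w) (hs : ∀ r ∈ s, γ' r = γ r)
    (ht : γ' t = γ t) {w' : Tan I (γ' t)} (hw : (w' : E) = w) : HasVelocity γ' s t w' := by
  have := HasMFDerivWithinAt.congr_of_eventuallyEq h (eventually_of_mem self_mem_nhdsWithin hs) ht
  unfold HasVelocity; rw [show (show E from w') = (show E from w) from hw]; exact this

theorem HasVelocity.comp_real {γ : ℝ → M} {f : ℝ → ℝ} {s s' : Set ℝ} {t f' : ℝ}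
    {w : Tan I (γ (f t))} (h : HasVelocity γ s (f t) w)
    (hf : HasDerivWithinAt f f' s' t) (hs : MapsTo f s' s) :
    HasVelocity (I := I) (fun t => γ (f t)) s' t (f' • (show E from w)) := by
  have h1 := HasMFDerivWithinAt.comp t h hf.hasFDerivWithinAt.hasMFDerivWithinAt hs
  refine h1.congr_mfderiv ?_
  ext; change (((1 : ℝ) • f') • (show E from w) : E) = (1 : ℝ) • (f' • (show E from w)); simp

theorem HasVelocity.map {γ : ℝ → M} {s : Set ℝ} {t : ℝ} {w : Tan I (γ t)} (h : HasVelocity γ s t w) {g : M → N}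
    (hg : MDifferentiableAt I J g (γ t)) : HasVelocity (fun t => g (γ t)) s t (mfderiv I J g (γ t) w) := by
  have h1 := hg.hasMFDerivAt.comp_hasMFDerivWithinAt t h
  refine h1.congr_mfderiv ?_
  ext; change mfderiv I J g (γ t) ((1 : ℝ) • (show E from w)) = (1 : ℝ) • (show E' from mfderiv I J g (γ t) w)
  rw [one_smul, one_smul]

theorem HasVelocity.hasDerivWithinAt_comp {γ : ℝ → M} {s : Set ℝ} {t : ℝ}
    {w : Tan I (γ t)} (h : HasVelocity γ s t w) {g : M → E'}
    (hg : MDifferentiableAt I 𝓘(ℝ, E') g (γ t)) : HasDerivWithinAt (fun t => g (γ t)) (mvfderiv I g (γ t) w) s t := by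
  have h1 := (HasVelocity.map h hg)
  have h2 : HasFDerivWithinAt (fun t => g (γ t)) ((1 : ℝ →L[ℝ] ℝ).smulRight (mvfderiv I g (γ t) w)) s t :=
    HasMFDerivWithinAt.hasFDerivWithinAt h1
  have h3 := h2.hasDerivWithinAt
  rwa [ContinuousLinearMap.smulRight_apply, show (1 : ℝ →L[ℝ] ℝ) 1 = 1 from rfl, one_smul] at h3

theorem HasVelocity.union {γ : ℝ → M} {s s' : Set ℝ} {t : ℝ} {w : Tan I (γ t)}
    (h : HasVelocity γ s t w) (h' : HasVelocity γ s' t w) : HasVelocity γ (s ∪ s') t w :=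
  HasMFDerivWithinAt.union h h'

/-- `Φ` is a forward flow of `v` up to the time `T`. -/
structure IsSemiflow (v : ∀ x : M, Tan I x) (T : ℝ) (Φ : ℝ → M → M) : Prop where
  init : ∀ x, Φ 0 x = x
  curve : ∀ x, ∀ t ∈ Icc 0 T, HasVelocity (fun t => Φ t x) (Icc 0 T) t (v (Φ t x))

theorem velocity_shift {γ : ℝ → M} {a : ℝ} {s s' : Set ℝ}
    (h : ∀ t ∈ s, HasVelocity γ s t (v (γ t))) (hs : MapsTo (fun t => t - a) s' s) :
    ∀ t ∈ s', HasVelocity (fun t => γ (t - a)) s' t (v (γ (t - a))) := fun t ht => by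
  have h1 := HasVelocity.comp_real (f := fun t => t - a) (h _ (hs ht)) (((hasDerivWithinAt_id t s').sub_const a)) hs
  rwa [one_smul] at h1

theorem IsSemiflow.smooth_aux [T2Space M] [FiniteDimensional ℝ E] (hI : range I = affineHalf c ℓ) (hv : SmoothField v)
    (hin : ∀ x, 0 < c + ℓ (crd I x x) ∨ 0 < ℓ (v x)) {T : ℝ}
    (hΦ : IsSemiflow v T Φ) (n : ℕ) (x : M) : ∀ t ∈ Icc 0 T,
      ContMDiffWithinAt ((ℐ).prod I) I (n + 1 : ℕ) (fun p : ℝ × M => Φ p.1 p.2)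
        (Icc 0 T ×ˢ univ) (t, x) ∧ Injective (mfderiv I I (Φ t) x) := by
  set P : ℝ → Prop := fun t => ContMDiffWithinAt ((ℐ).prod I) I (n + 1 : ℕ) (fun p : ℝ × M => Φ p.1 p.2)
        (Icc 0 T ×ˢ univ) (t, x) ∧ Injective (mfderiv I I (Φ t) x) with hP
  have hslice : ∀ a ∈ Icc 0 T, P a → ContMDiffAt I I (n + 1 : ℕ) (Φ a) x := by
    intro a ha hPa
    have h1 : ContMDiffWithinAt I ((ℐ).prod I) (n + 1 : ℕ) (fun y : M => (a, y)) univ x :=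
      (contMDiff_const.prodMk contMDiff_id).contMDiffAt
    exact (hPa.1.comp x h1 (fun y _ => ⟨ha, mem_univ _⟩))
  -- propagation by a local flow
  have key : ∀ a ∈ Icc 0 T, ∀ (W : Set M) (τ : ℝ) (Ψ : ℝ → M → M), 0 < τ → Φ a x ∈ W →
      LocalFlowOn v (n + 1) W τ Ψ → ContMDiffAt I I (n + 1 : ℕ) (Φ a) x →
      Injective (mfderiv I I (Φ a) x) → ∀ t ∈ Icc 0 T, a < t ∨ a = 0 ∧ a ≤ t → t < a + τ → P t := by
    intro a ha W τ Ψ hτ hW hΨ hsm hinj t ht hat htτ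
    have hat' : a ≤ t := hat.elim le_of_lt And.right
    have hO : ∀ᶠ y in 𝓝 x, Φ a y ∈ W := hsm.continuousAt.eventually (hΨ.isOpen.mem_nhds hW)
    have heq : ∀ y, Φ a y ∈ W → ∀ r ∈ Icc a (min T (a + τ)), Φ r y = Ψ (r - a) (Φ a y) := by
      intro y hy
      refine eqOn_of_hasVelocity hI hv (fun r hr => ?_) (fun r hr => ?_) ?_
      · exact (hΦ.curve y r ⟨ha.1.trans hr.1, hr.2.trans (min_le_left _ _)⟩).mono
          (Icc_subset_Icc ha.1 (min_le_left _ _))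
      · exact velocity_shift (γ := fun t => Ψ t (Φ a y)) (hΨ.curve _ hy)
          (fun r hr => ⟨by have := hr.1; simp only; linarith, by
            have := hr.2.trans (min_le_right _ _); simp only; linarith⟩) r hr
      · simp only [sub_self, hΨ.init _ hy]
    have htm : t ∈ Icc a (min T (a + τ)) := ⟨hat', le_min ht.2 htτ.le⟩
    constructor
    · have hev : ∀ᶠ p : ℝ × M in 𝓝[Icc 0 T ×ˢ univ] (t, x),
          p.1 - a ∈ Icc 0 τ ∧ Φ a p.2 ∈ W ∧ p.1 ∈ Icc a (min T (a + τ)) := by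
        have e1 : ∀ᶠ p : ℝ × M in 𝓝[Icc 0 T ×ˢ univ] (t, x), p.1 ∈ Icc 0 T :=
          eventually_of_mem self_mem_nhdsWithin fun p hp => hp.1
        have e2 : ∀ᶠ p : ℝ × M in 𝓝[Icc 0 T ×ˢ univ] (t, x), p.1 < a + τ :=
          mem_nhdsWithin_of_mem_nhds (continuousAt_fst.eventually (Iio_mem_nhds htτ))
        have e3 : ∀ᶠ p : ℝ × M in 𝓝[Icc 0 T ×ˢ univ] (t, x), Φ a p.2 ∈ W :=
          mem_nhdsWithin_of_mem_nhds ((continuousAt_snd (p := (t, x))).eventually hO)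
        have e4 : ∀ᶠ p : ℝ × M in 𝓝[Icc 0 T ×ˢ univ] (t, x), a ≤ p.1 := by
          rcases hat with h | ⟨h, -⟩
          · exact mem_nhdsWithin_of_mem_nhds ((continuousAt_fst.eventually (Ioi_mem_nhds h)).mono
              fun p hp => le_of_lt hp)
          · filter_upwards [e1] with p hp
            rw [h]; exact hp.1
        filter_upwards [e1, e2, e3, e4] with p h1 h2 h3 h4
        exact ⟨⟨by linarith, by linarith⟩, h3, h4, le_min h1.2 h2.le⟩
      have hcomp : ContMDiffWithinAt ((ℐ).prod I) ((ℐ).prod I) (n + 1 : ℕ)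
          (fun p : ℝ × M => (p.1 - a, Φ a p.2)) (Icc 0 T ×ˢ univ) (t, x) := by
        refine ContMDiffWithinAt.prodMk ?_ ?_
        · have : ContMDiff ℐ ℐ (n + 1 : ℕ) (fun r : ℝ => r - a) := (contDiff_id.sub contDiff_const).contMDiff
          exact (this.comp contMDiff_fst).contMDiffAt.contMDiffWithinAt
        · exact (hsm.comp (t, x) contMDiffAt_snd).contMDiffWithinAt
      have hΨs : ContMDiffWithinAt ((ℐ).prod I) I (n + 1 : ℕ) (fun p : ℝ × M => Ψ p.1 p.2)
          (Icc 0 τ ×ˢ W) (t - a, Φ a x) :=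
        hΨ.smooth _ ⟨⟨by linarith, by linarith⟩, hW⟩
      have hc := (ContMDiffWithinAt.comp' (f := fun p : ℝ × M => (p.1 - a, Φ a p.2)) (t, x) hΨs
        hcomp).mono_of_mem_nhdsWithin (inter_mem self_mem_nhdsWithin
          (by filter_upwards [hev] with p hp using ⟨hp.1, hp.2.1⟩))
      refine hc.congr_of_eventuallyEq ?_ (heq x hW t htm)
      filter_upwards [hev] with p hp
      exact heq p.2 hp.2.1 p.1 hp.2.2
    · have he : Φ t =ᶠ[𝓝 x] fun y => Ψ (t - a) (Φ a y) := by filter_upwards [hO] with y hy using heq y hy t htm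
      have hta : t - a ∈ Icc 0 τ := ⟨by linarith, by linarith⟩
      have h1 : ContMDiffAt I I (n + 1 : ℕ) (Ψ (t - a)) (Φ a x) := by
        have h2 : ContMDiffWithinAt I ((ℐ).prod I) (n + 1 : ℕ) (fun y : M => (t - a, y)) W
            (Φ a x) := (contMDiff_const.prodMk contMDiff_id).contMDiffAt.contMDiffWithinAt
        exact ((hΨ.smooth _ ⟨hta, hW⟩).comp (Φ a x) h2 fun y hy => ⟨hta, hy⟩).contMDiffAt (hΨ.isOpen.mem_nhds hW)
      rw [he.mfderiv_eq]
      have h3 := mfderiv_comp x (h1.mdifferentiableAt (by simp)) (hsm.mdifferentiableAt (by simp))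
      have h4 : mfderiv I I (fun y => Ψ (t - a) (Φ a y)) x =
        (mfderiv I I (Ψ (t - a)) (Φ a x)).comp (mfderiv I I (Φ a) x) := h3
      rw [h4]; exact (hΨ.inj _ hW _ hta).comp hinj
  have hid : Φ 0 = id := funext hΦ.init
  intro t₁ ht₁
  have hT : 0 ≤ T := ht₁.1.trans ht₁.2
  have h0 : (0 : ℝ) ∈ Icc 0 T := ⟨le_rfl, hT⟩
  obtain ⟨W₀, τ₀, Ψ₀, hxW, hτ₀, hΨ₀, -⟩ := exists_localFlowOn hI hv (hin x) (n + 1)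
  have hstart : ∀ t ∈ Icc 0 T, t < τ₀ → P t := fun t ht htτ =>
    key 0 h0 W₀ τ₀ Ψ₀ hτ₀ (by rw [hid]; exact hxW) hΨ₀ (by rw [hid]; exact contMDiffAt_id)
      (by rw [hid, mfderiv_id]; exact Function.injective_id) t ht (Or.inr ⟨rfl, ht.1⟩) (by simpa)
  set S : Set ℝ := {t | t ∈ Icc 0 T ∧ ∀ r ∈ Icc 0 t, P r} with hS
  have hSb : BddAbove S := ⟨T, fun t ht => ht.1.2⟩
  have hS0 : (0 : ℝ) ∈ S := ⟨h0, fun r hr => by rw [le_antisymm hr.2 hr.1]; exact hstart 0 h0 hτ₀⟩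
  set b := sSup S with hb
  have hb0 : 0 ≤ b := le_csSup hSb hS0
  have hbT : b ≤ T := csSup_le ⟨0, hS0⟩ fun t ht => ht.1.2
  -- a strict extension past `b`
  have hext : ∃ d > b, ∀ t ∈ Icc 0 T, t < d → P t := by
    rcases hb0.eq_or_lt with h | h
    · exact ⟨τ₀, by rwa [← h], hstart⟩
    obtain ⟨W, τ, Ψ, hW, hτ, hΨ, -⟩ := exists_localFlowOn hI hv (hin (Φ b x)) (n + 1)
    have hcont : ContinuousWithinAt (fun t => Φ t x) (Icc 0 T) b := (hΦ.curve x b ⟨hb0, hbT⟩).continuousWithinAt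
    have hpre := hcont.preimage_mem_nhdsWithin (hΨ.isOpen.mem_nhds hW)
    obtain ⟨ε, hε, hball⟩ := mem_nhdsWithin_iff.1 hpre
    obtain ⟨a, haS, hab⟩ := exists_lt_of_lt_csSup ⟨0, hS0⟩ (show max (b - ε) (b - τ) < b by apply max_lt <;> linarith)
    have hab' : a ≤ b := le_csSup hSb haS
    have h1 := (le_max_left _ _).trans_lt hab
    have h2 := (le_max_right _ _).trans_lt hab
    have haW : Φ a x ∈ W := hball ⟨by rw [mem_ball, Real.dist_eq, abs_lt]; constructor <;> linarith, haS.1⟩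
    refine ⟨a + τ, by linarith, fun t ht htd => ?_⟩
    rcases le_or_gt t a with hta | hta
    · exact haS.2 t ⟨ht.1, hta⟩
    · have hPa := haS.2 a ⟨haS.1.1, le_rfl⟩
      exact key a haS.1 W τ Ψ hτ haW hΨ (hslice a haS.1 hPa) hPa.2 t ht (Or.inl hta) htd
  obtain ⟨d, hd, hPd⟩ := hext
  rcases lt_or_ge t₁ d with h | h
  · exact hPd t₁ ht₁ h
  · exfalso
    have : (b + d) / 2 ∈ S := ⟨⟨by linarith, by linarith [ht₁.2]⟩, fun r hr =>
      hPd r ⟨hr.1, by linarith [hr.2, ht₁.2]⟩ (by linarith [hr.2])⟩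
    have := le_csSup hSb this
    linarith

theorem IsSemiflow.contMDiffOn [T2Space M] [FiniteDimensional ℝ E] (hI : range I = affineHalf c ℓ) (hv : SmoothField v)
    (hin : ∀ x, 0 < c + ℓ (crd I x x) ∨ 0 < ℓ (v x)) {T : ℝ}
    (hΦ : IsSemiflow v T Φ) : ContMDiffOn ((ℐ).prod I) I ∞ (fun p : ℝ × M => Φ p.1 p.2) (Icc 0 T ×ˢ univ) := by
  rw [contMDiffOn_infty]; intro n p hp
  exact ((hΦ.smooth_aux hI hv hin n p.2 p.1 hp.1).1).of_le (by norm_cast; omega)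

theorem IsSemiflow.injective_mfderiv [T2Space M] [FiniteDimensional ℝ E] (hI : range I = affineHalf c ℓ)
    (hv : SmoothField v)
    (hin : ∀ x, 0 < c + ℓ (crd I x x) ∨ 0 < ℓ (v x)) {T : ℝ}
    (hΦ : IsSemiflow v T Φ) {t : ℝ} (ht : t ∈ Icc 0 T) (x : M) : Injective (mfderiv I I (Φ t) x) :=
  (hΦ.smooth_aux hI hv hin 0 x t ht).2

theorem exists_isSemiflow [T2Space M] [CompactSpace M] [FiniteDimensional ℝ E] (hI : range I = affineHalf c ℓ)
    (hv : SmoothField v)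
    (hin : ∀ x, 0 < c + ℓ (crd I x x) ∨ 0 < ℓ (v x)) : ∃ (T : ℝ) (Φ : ℝ → M → M), 0 < T ∧ IsSemiflow v T Φ ∧
      ∀ x, ∀ t ∈ Ioc 0 T, I.IsInteriorPoint (Φ t x) := by
  choose W τ Ψ hxW hτ hΨ hint using fun x => exists_localFlowOn hI hv (hin x) 1
  obtain ⟨A, hA⟩ := isCompact_univ.elim_finite_subcover W (fun x => (hΨ x).isOpen) (fun x _ => mem_iUnion.2 ⟨x, hxW x⟩)
  have hcov : ∀ x : M, ∃ a ∈ A, x ∈ W a := fun x => by simpa using hA (mem_univ x)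
  choose i hiA hi using hcov
  obtain ⟨T, hT, hTA⟩ : ∃ T > 0, ∀ a ∈ A, T ≤ τ a := by
    rcases A.eq_empty_or_nonempty with rfl | hne
    · exact ⟨1, one_pos, by simp⟩
    · exact ⟨A.inf' hne τ, by rw [gt_iff_lt, Finset.lt_inf'_iff]; exact fun a _ => hτ a,
        fun a ha => Finset.inf'_le _ ha⟩
  refine ⟨T, fun t x => Ψ (i x) t x, hT, ⟨fun x => (hΨ _).init x (hi x), fun x t ht => ?_⟩,
    fun x t ht => hint _ x (hi x) t ⟨ht.1, ht.2.trans (hTA _ (hiA x))⟩⟩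
  exact ((hΨ (i x)).mono (hTA _ (hiA x))).curve x (hi x) t ht

section CompleteFlows

variable [I.Boundaryless] [T2Space M]

/-- `Φ` is the flow of the complete vector field `v`. -/
structure IsFlow (v : ∀ x : M, Tan I x) (Φ : ℝ → M → M) : Prop where
  init : ∀ x, Φ 0 x = x
  curve : ∀ x t, HasVelocity (fun t => Φ t x) univ t (v (Φ t x))

omit [FiniteDimensional ℝ E] [T2Space M] [IsManifold I ∞ M] in
theorem range_eq_affineHalf : range I = affineHalf (1 : ℝ) (0 : E →L[ℝ] ℝ) := by
  rw [I.range_eq_univ]; ext x; simp [mem_affineHalf]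

theorem contMDiff_neg_vectorField (hv : SmoothField v) : SmoothField (fun x => -v x) := ContMDiff.neg_section hv

theorem IsFlow.isSemiflow (hΦ : IsFlow v Φ) (T : ℝ) : IsSemiflow v T Φ :=
  ⟨hΦ.init, fun x t _ => (hΦ.curve x t).mono (subset_univ _)⟩

theorem IsFlow.neg (hΦ : IsFlow v Φ) : IsFlow (fun x => -v x) (fun t => Φ (-t)) := by
  refine ⟨fun x => by simp [hΦ.init], fun x t => ?_⟩
  have h := HasVelocity.comp_real (f := fun t => -t) (hΦ.curve x (-t))
    ((hasDerivWithinAt_id t univ).neg) (mapsTo_univ _ _)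
  rwa [neg_one_smul] at h

theorem IsFlow.add (hΦ : IsFlow v Φ) (hv : SmoothField v) (s t : ℝ) (x : M) : Φ (s + t) x = Φ s (Φ t x) := by
  have h1 : IsMIntegralCurve (fun s => Φ (s + t) x) v := fun s => by
    have h := HasVelocity.comp_real (f := fun s => s + t) (hΦ.curve x (s + t))
      ((hasDerivWithinAt_id s univ).add_const t) (mapsTo_univ _ _)
    rw [one_smul] at h; exact HasMFDerivWithinAt.hasMFDerivAt h univ_mem
  have h2 : IsMIntegralCurve (fun s => Φ s (Φ t x)) v := fun s =>
    HasMFDerivWithinAt.hasMFDerivAt (hΦ.curve _ s) univ_mem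
  exact congrFun (isMIntegralCurve_Ioo_eq_of_contMDiff_boundaryless (t₀ := 0)
    (hv.of_le (by simp)) h1 h2 (by simp [hΦ.init])) s

theorem IsFlow.contMDiff (hΦ : IsFlow v Φ) (hv : SmoothField v) :
    ContMDiff ((ℐ).prod I) I ∞ (fun p : ℝ × M => Φ p.1 p.2) := by
  rintro ⟨t, x⟩
  set T := |t| + 1 with hT
  have hT0 : 0 ≤ T := by positivity
  have h1 := (hΦ.neg.isSemiflow T).contMDiffOn range_eq_affineHalf (contMDiff_neg_vectorField hv)
    (fun x => Or.inl (by simp))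
  have h2 : ContMDiff I I ∞ (Φ (-T)) := by
    have h3 : ContMDiff I ((ℐ).prod I) ∞ (fun y : M => (T, y)) := contMDiff_const.prodMk contMDiff_id
    rw [← contMDiffOn_univ] at h3 ⊢; exact h1.comp h3 fun y _ => ⟨⟨hT0, le_rfl⟩, mem_univ _⟩
  have h4 := (hΦ.isSemiflow (2 * T)).contMDiffOn range_eq_affineHalf hv (fun x => Or.inl (by simp))
  have h5 : ContMDiff ((ℐ).prod I) ((ℐ).prod I) ∞ (fun p : ℝ × M => (p.1 + T, Φ (-T) p.2)) := by
    refine ContMDiff.prodMk ?_ (h2.comp contMDiff_snd)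
    have : ContMDiff ℐ ℐ ∞ (fun r : ℝ => r + T) := (contDiff_id.add contDiff_const).contMDiff
    exact this.comp contMDiff_fst
  have ht := abs_lt.1 (show |t| < T by linarith)
  have h6 : ContMDiffAt ((ℐ).prod I) I ∞ (fun p : ℝ × M => Φ p.1 p.2) (t + T, Φ (-T) x) :=
    (h4 _ ⟨⟨by linarith, by linarith⟩, mem_univ _⟩).contMDiffAt
      (prod_mem_nhds (Icc_mem_nhds (by linarith) (by linarith)) univ_mem)
  have h7 := ContMDiffAt.comp (f := fun p : ℝ × M => (p.1 + T, Φ (-T) p.2)) (t, x) h6 h5.contMDiffAt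
  refine h7.congr_of_eventuallyEq (Eventually.of_forall fun p => ?_)
  simp only [comp_apply]; rw [← hΦ.add hv, add_neg_cancel_right]

theorem IsFlow.injective_mfderiv (hΦ : IsFlow v Φ) (hv : SmoothField v) (t : ℝ) (x : M) :
    Injective (mfderiv I I (Φ t) x) := by
  rcases le_total 0 t with ht | ht
  · exact (hΦ.isSemiflow t).injective_mfderiv range_eq_affineHalf hv (fun x => Or.inl (by simp)) ⟨ht, le_rfl⟩ x
  · have := (hΦ.neg.isSemiflow (-t)).injective_mfderiv range_eq_affineHalf
      (contMDiff_neg_vectorField hv) (fun x => Or.inl (by simp)) ⟨by linarith, le_rfl⟩ x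
    have e : -(-t) = t := neg_neg t
    rw [e] at this; exact this

theorem exists_isMIntegralCurve_of_compact_support (hv : SmoothField v) {K : Set M}
    (hK : IsCompact K) (hvK : ∀ x ∉ K, v x = 0) (x : M) : ∃ γ : ℝ → M, γ 0 = x ∧ IsMIntegralCurve γ v := by
  have hv' := contMDiff_neg_vectorField hv
  choose W τ Ψ hxW hτ hΨ _ using fun x : M => exists_localFlowOn range_eq_affineHalf hv (x₀ := x) (Or.inl (by simp)) 1
  choose W' τ' Ψ' hxW' hτ' hΨ' _ using fun x : M => exists_localFlowOn range_eq_affineHalf hv'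
    (x₀ := x) (Or.inl (by simp)) 1
  obtain ⟨A, hA⟩ := hK.elim_finite_subcover (fun x => W x ∩ W' x) (fun x => (hΨ x).isOpen.inter (hΨ' x).isOpen)
    (fun x _ => mem_iUnion.2 ⟨x, hxW x, hxW' x⟩)
  obtain ⟨ε, hε, hεA⟩ : ∃ ε > 0, ∀ a ∈ A, ε ≤ τ a ∧ ε ≤ τ' a := by
    rcases A.eq_empty_or_nonempty with rfl | hne
    · exact ⟨1, one_pos, by simp⟩
    · refine ⟨A.inf' hne fun a => min (τ a) (τ' a), ?_, fun a ha => ?_⟩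
      · rw [gt_iff_lt, Finset.lt_inf'_iff]; exact fun a _ => lt_min (hτ a) (hτ' a)
      · have := Finset.inf'_le (fun a => min (τ a) (τ' a)) ha
        exact ⟨this.trans (min_le_left _ _), this.trans (min_le_right _ _)⟩
  refine exists_isMIntegralCurve_of_isMIntegralCurveOn (hv.of_le (by simp)) hε (fun y => ?_) x
  by_cases hy : y ∈ K
  · obtain ⟨a, haA, hya, hya'⟩ : ∃ a ∈ A, y ∈ W a ∧ y ∈ W' a := by
      obtain ⟨a, ha, h⟩ := mem_iUnion₂.1 (hA hy)
      exact ⟨a, ha, h.1, h.2⟩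
    have h1 := ((hΨ a).mono (hεA a haA).1).curve y hya
    have h2 : ∀ t ∈ Icc (-ε) 0, HasVelocity (fun t => Ψ' a (-t) y) (Icc (-ε) 0) t (v (Ψ' a (-t) y)) := fun t ht => by
      have h := HasVelocity.comp_real (f := fun t => -t) (s' := Icc (-ε) 0)
        (((hΨ' a).mono (hεA a haA).2).curve y hya' (-t) ⟨by linarith [ht.2], by linarith [ht.1]⟩)
        ((hasDerivWithinAt_id t _).neg)
        (fun r hr => ⟨by linarith [hr.2], by linarith [hr.1]⟩)
      have e : ((-1 : ℝ) • (show E from -v (Ψ' a (-t) y)) : E) = v (Ψ' a (-t) y) := by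
        rw [neg_one_smul]; exact neg_neg (show E from v (Ψ' a (-t) y))
      rwa [e] at h
    have h0 : Ψ a 0 y = y := (hΨ a).init y hya
    have h0' : Ψ' a 0 y = y := (hΨ' a).init y hya'
    set γ : ℝ → M := fun t => if 0 ≤ t then Ψ a t y else Ψ' a (-t) y with hγ
    have hp : ∀ t, 0 ≤ t → γ t = Ψ a t y := fun t ht => if_pos ht
    have hn : ∀ t, t ≤ 0 → γ t = Ψ' a (-t) y := fun t ht => by
      rcases ht.eq_or_lt with rfl | ht
      · rw [hp 0 le_rfl, neg_zero, h0, h0']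
      · exact if_neg (not_le.2 ht)
    have k1 : ∀ t ∈ Icc 0 ε, HasVelocity γ (Icc 0 ε) t (v (γ t)) := fun t ht =>
      (h1 t ht).congr (fun r hr => hp r hr.1) (hp t ht.1) (by rw [hp t ht.1])
    have k2 : ∀ t ∈ Icc (-ε) 0, HasVelocity γ (Icc (-ε) 0) t (v (γ t)) := fun t ht =>
      (h2 t ht).congr (fun r hr => hn r hr.2) (hn t ht.2) (by rw [hn t ht.2])
    refine ⟨γ, by rw [hp 0 le_rfl, h0], fun t ht => ?_⟩
    change HasVelocity γ _ t _
    rcases lt_trichotomy t 0 with h | h | h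
    · exact (k2 t ⟨ht.1.le, h.le⟩).mono_of_mem (mem_nhdsWithin_of_mem_nhds (Icc_mem_nhds ht.1 h))
    · subst h
      refine ((k2 0 ⟨by linarith, le_rfl⟩).union (k1 0 ⟨le_rfl, hε.le⟩)).mono fun r hr => ?_
      rcases le_total 0 r with h | h
      · exact Or.inr ⟨h, hr.2.le⟩
      · exact Or.inl ⟨hr.1.le, h⟩
    · exact (k1 t ⟨h.le, ht.2.le⟩).mono_of_mem (mem_nhdsWithin_of_mem_nhds (Icc_mem_nhds h ht.2))
  · refine ⟨fun _ => y, rfl, fun t _ => ?_⟩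
    simp only [hvK y hy]
    have := hasMFDerivWithinAt_const (I := ℐ) (I' := I) y (Ioo (-ε) ε) t
    refine this.congr_mfderiv ?_
    ext; exact (smul_zero (1 : ℝ) : (1 : ℝ) • (0 : E) = 0).symm

theorem exists_isFlow (hv : SmoothField v)
    {ρ : M → ℝ} (hρ : ContMDiff I ℐ ∞ ρ) (hproper : ∀ R, IsCompact {x | ρ x ≤ R}) {C : ℝ}
    (hC : ∀ x, |mvfderiv I ρ x (v x)| ≤ C) : ∃ Φ : ℝ → M → M, IsFlow v Φ := by
  have hcurve : ∀ x, ∃ γ : ℝ → M, γ 0 = x ∧ IsMIntegralCurve γ v := by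
    intro x; rw [exists_isMIntegralCurve_iff_exists_isMIntegralCurveOn_Ioo (hv.of_le (by simp))]; intro a
    set R := ρ x + C * |a| with hR
    set χ : M → ℝ := fun y => smoothTransition (R + 1 - ρ y) with hχ
    have hχs : ContMDiff I ℐ ∞ χ := by
      have h1 : ContMDiff ℐ ℐ ∞ (fun r : ℝ => smoothTransition (R + 1 - r)) :=
        (smoothTransition.contDiff.comp (contDiff_const.sub contDiff_id)).contMDiff
      exact h1.comp hρ
    have hC0 : 0 ≤ C := (abs_nonneg _).trans (hC x)
    obtain ⟨γ, hγ0, hγ⟩ := exists_isMIntegralCurve_of_compact_support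
      (v := fun y => χ y • v y) (ContMDiff.smul_section hχs hv) (hproper (R + 1)) (fun y hy => by
        have : χ y = 0 := smoothTransition.zero_of_nonpos (by
          have : ¬ ρ y ≤ R + 1 := hy
          linarith)
        rw [this]; exact zero_smul ℝ (show E from v y)) x
    have hvel : ∀ t, HasVelocity γ univ t (χ (γ t) • v (γ t)) := fun t => (hγ t).hasMFDerivWithinAt
    have hder : ∀ t, HasDerivWithinAt (fun t => ρ (γ t)) (mvfderiv I ρ (γ t) (χ (γ t) • v (γ t))) univ t := fun t =>
      (hvel t).hasDerivWithinAt_comp (hρ.mdifferentiableAt (by simp))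
    have hbound : ∀ t, ‖mvfderiv I ρ (γ t) (χ (γ t) • v (γ t))‖ ≤ C := fun t => by
      rw [map_smul, smul_eq_mul, norm_mul, Real.norm_eq_abs, Real.norm_eq_abs,
        abs_of_nonneg (smoothTransition.nonneg _)]
      calc _ ≤ 1 * |mvfderiv I ρ (γ t) (v (γ t))| :=
            mul_le_mul_of_nonneg_right (smoothTransition.le_one _) (abs_nonneg _)
        _ ≤ C := by rw [one_mul]; exact hC _
    have hle : ∀ t ∈ Ioo (-a) a, χ (γ t) = 1 := fun t ht => by
      have h := (convex_univ (𝕜 := ℝ) (E := ℝ)).norm_image_sub_le_of_norm_hasDerivWithin_le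
        (fun r _ => hder r) (fun r _ => hbound r) (mem_univ 0) (mem_univ t)
      rw [hγ0, sub_zero, Real.norm_eq_abs, Real.norm_eq_abs] at h
      have h1 : |t| ≤ |a| := by rw [abs_of_pos (show 0 < a by linarith [ht.1, ht.2])]; exact (abs_lt.2 ht).le
      have h2 := (le_abs_self _).trans (h.trans (mul_le_mul_of_nonneg_left h1 hC0))
      exact smoothTransition.one_of_one_le (by rw [hR]; linarith)
    refine ⟨γ, hγ0, fun t ht => ?_⟩
    have := (hγ t).hasMFDerivWithinAt (s := Ioo (-a) a)
    simp only [hle t ht] at this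
    refine this.congr_mfderiv ?_
    congr 1; exact one_smul ℝ (show E from v (γ t))
  choose Φ h0 hΦ using hcurve
  exact ⟨fun t x => Φ x t, h0, fun x t => (hΦ x t).hasMFDerivWithinAt⟩

end CompleteFlows

section Semiflow

variable [T2Space M] {T : ℝ}

theorem IsSemiflow.add (hI : range I = affineHalf c ℓ) (hv : SmoothField v) (hΦ : IsSemiflow v T Φ)
    {s t : ℝ} (hs : 0 ≤ s) (ht : 0 ≤ t) (hst : s + t ≤ T) (x : M) : Φ (s + t) x = Φ s (Φ t x) := by
  have h1 : ∀ r ∈ Icc 0 s, HasVelocity (fun r => Φ (r + t) x) (Icc 0 s) r (v (Φ (r + t) x)) := by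
    intro r hr
    have h := HasVelocity.comp_real (f := fun r => r + t) (s' := Icc 0 s)
      (hΦ.curve x (r + t) ⟨by linarith [hr.1], by linarith [hr.2]⟩)
      ((hasDerivWithinAt_id r _).add_const t)
      (fun r hr => ⟨by linarith [hr.1], by linarith [hr.2]⟩)
    rwa [one_smul] at h
  have h2 : ∀ r ∈ Icc 0 s, HasVelocity (fun r => Φ r (Φ t x)) (Icc 0 s) r (v (Φ r (Φ t x))) := fun r hr =>
    (hΦ.curve (Φ t x) r ⟨hr.1, by linarith [hr.2]⟩).mono (Icc_subset_Icc le_rfl (by linarith))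
  exact eqOn_of_hasVelocity hI hv h1 h2 (by simp [hΦ.init]) ⟨hs, le_rfl⟩

theorem IsSemiflow.injective (hI : range I = affineHalf c ℓ) (hv : SmoothField v) (hΦ : IsSemiflow v T Φ)
    {t : ℝ} (ht : t ∈ Icc 0 T) : Injective (Φ t) := by
  intro x y hxy
  have h : ∀ z : M, ∀ r ∈ Icc 0 t, HasVelocity (fun r => Φ (t - r) z) (Icc 0 t) r (-v (Φ (t - r) z)) := by
    intro z r hr
    have h := HasVelocity.comp_real (f := fun r => t - r) (s' := Icc 0 t)
      (hΦ.curve z (t - r) ⟨by linarith [hr.2], by linarith [hr.1, ht.2]⟩)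
      ((hasDerivWithinAt_id r _).const_sub t)
      (fun r hr => ⟨by linarith [hr.2], by linarith [hr.1, ht.2]⟩)
    rwa [neg_one_smul] at h
  have := eqOn_of_hasVelocity hI (ContMDiff.neg_section hv) (h x) (h y) (by simpa using hxy) ⟨ht.1, le_rfl⟩
  simpa [hΦ.init] using this

theorem IsSemiflow.mfderiv_apply_self (hI : range I = affineHalf c ℓ) (hv : SmoothField v) (hΦ : IsSemiflow v T Φ)
    {t : ℝ} (ht : t ∈ Ico 0 T) {x : M} (hd : MDifferentiableAt I I (Φ t) x) :
    mfderiv I I (Φ t) x (v x) = v (Φ t x) := by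
  have hT : 0 < T - t := by linarith [ht.2]
  have h1 : HasVelocity (fun r => Φ (r + t) x) (Icc 0 (T - t)) 0 (v (Φ (0 + t) x)) := by
    have h := HasVelocity.comp_real (f := fun r => r + t) (s' := Icc 0 (T - t))
      (hΦ.curve x (0 + t) ⟨by linarith [ht.1], by linarith⟩)
      ((hasDerivWithinAt_id (0 : ℝ) _).add_const t)
      (fun r hr => ⟨by linarith [hr.1, ht.1], by linarith [hr.2]⟩)
    rwa [one_smul] at h
  have h2 : HasVelocity (fun r => Φ t (Φ r x)) (Icc 0 (T - t)) 0 (mfderiv I I (Φ t) (Φ 0 x) (v (Φ 0 x))) :=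
    ((hΦ.curve x 0 ⟨le_rfl, by linarith [ht.1]⟩).mono
      (Icc_subset_Icc le_rfl (by linarith [ht.1]))).map (g := Φ t) (by rwa [hΦ.init])
  have h2' : HasVelocity (I := I) (fun r => Φ (r + t) x) (Icc 0 (T - t)) 0
      (show E from mfderiv I I (Φ t) (Φ 0 x) (v (Φ 0 x))) := by
    refine h2.congr (fun r hr => ?_) ?_ rfl
    · rw [add_comm]; exact hΦ.add hI hv ht.1 hr.1 (by linarith [hr.2]) x
    · rw [zero_add, hΦ.init]
  have h3 := HasVelocity.hasDerivWithinAt (I := I) h1 (mem_extChartAt_source (I := I) (Φ (0 + t) x))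
  have h4 := HasVelocity.hasDerivWithinAt (I := I) h2' (mem_extChartAt_source (I := I) (Φ (0 + t) x))
  have hu : UniqueDiffWithinAt ℝ (Icc 0 (T - t)) 0 := uniqueDiffOn_Icc hT 0 ⟨le_rfl, hT.le⟩
  have h5 := (chartD_injective (I := I) (mem_extChartAt_source (I := I) (Φ (0 + t) x)) (x₀ := Φ (0 + t) x)
    (x := Φ (0 + t) x)) (hu.eq_deriv _ h3 h4)
  have h6 : ∀ y z : M, y = x → z = Φ t x → (v z : E) = (mfderiv I I (Φ t) y (v y) : E) →
      mfderiv I I (Φ t) x (v x) = v (Φ t x) := by rintro _ _ rfl rfl h; exact h.symm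
  exact h6 (Φ 0 x) (Φ (0 + t) x) (hΦ.init x) (by rw [zero_add]) h5

end Semiflow

section InverseFunction

variable [I.Boundaryless]

theorem exists_contMDiffAt_localInverse {f : M → N} {x : M} (hf : ContMDiffAt I J ∞ f x)
    (hinj : Injective (mfderiv I J f x))
    (hdim : finrank ℝ E = finrank ℝ E') :
    ∃ g : N → M, ContMDiffAt J I ∞ g (f x) ∧ g (f x) = x ∧ (∀ᶠ z in 𝓝 (f x), f (g z) = z) ∧
      ∀ᶠ y in 𝓝 x, g (f y) = y := by
  haveI : CompleteSpace E := FiniteDimensional.complete ℝ E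
  set φ := crd I x with hφ
  set ψ := crd J (f x) with hψ
  set F : E → E' := fun y => ψ (f (φ.symm y)) with hF
  have hx := mem_extChartAt_source (I := I) x
  have hfx := mem_extChartAt_source (I := J) (f x)
  have hFs : ContDiffAt ℝ ∞ F (φ x) := by
    have := (contMDiffAt_iff.1 hf).2
    rwa [I.range_eq_univ, contDiffWithinAt_univ] at this
  have hFd : HasFDerivAt F (show E →L[ℝ] E' from mfderiv I J f x) (φ x) := by
    have : HasFDerivWithinAt F (show E →L[ℝ] E' from mfderiv I J f x) (range I) (φ x) :=
      (hf.mdifferentiableAt (by simp)).hasMFDerivAt.2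
    rwa [I.range_eq_univ, hasFDerivWithinAt_univ] at this
  set L : E ≃L[ℝ] E' := (LinearEquiv.ofInjectiveOfFinrankEq
    (show E →L[ℝ] E' from mfderiv I J f x).toLinearMap hinj hdim).toContinuousLinearEquiv with hL
  have hFL : HasFDerivAt F (L : E →L[ℝ] E') (φ x) := by
    have h : (L : E →L[ℝ] E') = (show E →L[ℝ] E' from mfderiv I J f x) := ContinuousLinearMap.ext fun u => rfl
    rw [h]; exact hFd
  set G := hFs.localInverse hFL (by simp) with hG
  have hGs : ContDiffAt ℝ ∞ G (F (φ x)) := hFs.to_localInverse hFL (by simp)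
  have hst := hFs.hasStrictFDerivAt' hFL (by simp)
  have hl : ∀ᶠ y in 𝓝 (φ x), G (F y) = y := hst.eventually_left_inverse
  have hr : ∀ᶠ z in 𝓝 (F (φ x)), F (G z) = z := hst.eventually_right_inverse
  have hG0 : G (F (φ x)) = φ x := hl.self_of_nhds
  have hF0 : F (φ x) = ψ (f x) := by simp only [hF, φ.left_inv hx]
  rw [hF0] at hGs hG0 hr
  have hgs : ContMDiffAt J I ∞ (fun z => φ.symm (G (ψ z))) (f x) := by
    have h1 : ContMDiffAt J 𝓘(ℝ, E') ∞ ψ (f x) := contMDiffAt_extChartAt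
    have h2 : ContMDiffAt J 𝓘(ℝ, E) ∞ (fun z => G (ψ z)) (f x) := hGs.contMDiffAt.comp (f x) h1
    have h3 : ContMDiffAt 𝓘(ℝ, E) I ∞ φ.symm (G (ψ (f x))) := by
      rw [hG0]
      have := contMDiffWithinAt_extChartAt_symm_range (I := I) (n := ∞) x (φ.map_source hx)
      rwa [I.range_eq_univ, contMDiffWithinAt_univ] at this
    exact ContMDiffAt.comp (f x) (g := φ.symm) h3 h2
  have hg0 : φ.symm (G (ψ (f x))) = x := by rw [hG0, φ.left_inv hx]
  refine ⟨fun z => φ.symm (G (ψ z)), hgs, hg0, ?_, ?_⟩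
  · have h1 : Tendsto (fun z => f (φ.symm (G (ψ z)))) (𝓝 (f x)) (𝓝 (f x)) := by
      have h2 : ContinuousAt f (φ.symm (G (ψ (f x)))) := by rw [hg0]; exact hf.continuousAt
      have := (ContinuousAt.comp (f := fun z => φ.symm (G (ψ z))) h2 hgs.continuousAt).tendsto
      simpa only [Function.comp_def, hg0] using this
    filter_upwards [h1.eventually (extChartAt_source_mem_nhds (I := J) (f x)),
      (continuousAt_extChartAt (I := J) (f x)).eventually hr,
      extChartAt_source_mem_nhds (I := J) (f x)] with z hz1 hz2 hz3
    exact ψ.injOn hz1 hz3 hz2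
  · filter_upwards [extChartAt_source_mem_nhds (I := I) x,
      (continuousAt_extChartAt (I := I) x).eventually hl] with y hy1 hy2
    have h1 : F (φ y) = ψ (f y) := by simp only [hF, φ.left_inv hy1]
    change G (F (φ y)) = φ y at hy2; rw [← h1, hy2, φ.left_inv hy1]

variable {b : M → N}

theorem isOpenMap_of_injective_mfderiv (hb : ContMDiff I J ∞ b) (himm : ∀ x, Injective (mfderiv I J b x))
    (hdim : finrank ℝ E = finrank ℝ E') : IsOpenMap b := by
  refine IsOpenMap.of_nhds_le fun x => ?_
  obtain ⟨g, h1, h2, h3, -⟩ := exists_contMDiffAt_localInverse (hb x) (himm x) hdim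
  intro s hs
  have h4 : ∀ᶠ z in 𝓝 (b x), g z ∈ b ⁻¹' s := h1.continuousAt.eventually (by rw [h2]; exact hs)
  filter_upwards [h3, h4] with z hz hz'
  rw [← hz]; exact hz'

theorem contMDiffAt_of_leftInverse (hb : ContMDiff I J ∞ b) (hinj : Injective b)
    (himm : ∀ x, Injective (mfderiv I J b x))
    (hdim : finrank ℝ E = finrank ℝ E') {g : N → M} (hg : ∀ x, g (b x) = x) (x : M) : ContMDiffAt J I ∞ g (b x) := by
  obtain ⟨g', h1, h2, h3, -⟩ := exists_contMDiffAt_localInverse (hb x) (himm x) hdim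
  refine h1.congr_of_eventuallyEq ?_
  filter_upwards [h3] with z hz
  conv_lhs => rw [← hz]
  exact hg _

variable {f : M → N}

theorem injective_mfderiv_of_charts {F : Type*} [NormedAddCommGroup F] [NormedSpace ℝ F]
    {e : OpenPartialHomeomorph M H} (he : e ∈ IsManifold.maximalAtlas I ∞ M)
    {e' : OpenPartialHomeomorph N H'} (he' : e' ∈ IsManifold.maximalAtlas J ∞ N)
    (L : (E × F) ≃L[ℝ] E') {x : M} (hs : x ∈ e.source) (hs' : f x ∈ e'.source)
    (hw : ∀ y ∈ e.source, e'.extend J (f y) = L (e.extend I y, 0))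
    (hf : MDifferentiableAt I J f x) : Injective (mfderiv I J f x) := by
  set g : N → M := fun z => (e.extend I).symm (L.symm (e'.extend J z)).1 with hg
  have hgf : (g ∘ f) =ᶠ[𝓝 x] id := by
    filter_upwards [e.open_source.mem_nhds hs] with y hy
    simp only [hg, comp_apply, hw y hy, ContinuousLinearEquiv.symm_apply_apply, id]; exact e.extend_left_inv hy
  have h2 : ContMDiffAt J 𝓘(ℝ, E) ∞ (fun z => (L.symm (e'.extend J z)).1) (f x) := by
    have h3 : ContMDiffAt J 𝓘(ℝ, E') ∞ (e'.extend J) (f x) :=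
      J.contMDiff.contMDiffAt.comp _ (contMDiffAt_of_mem_maximalAtlas he' hs')
    have h4 : ContMDiff 𝓘(ℝ, E') 𝓘(ℝ, E) ∞ (fun z => (L.symm z).1) := (ContDiff.fst L.symm.contDiff).contMDiff
    exact h4.contMDiffAt.comp _ h3
  have h5 : (L.symm (e'.extend J (f x))).1 = e.extend I x := by rw [hw x hs, ContinuousLinearEquiv.symm_apply_apply]
  have h6 : ContMDiffAt 𝓘(ℝ, E) I ∞ (e.extend I).symm (e.extend I x) := by
    have h := contMDiffOn_extend_symm (I := I) he
    have ho : IsOpen (I '' e.target) := I.toHomeomorph.isOpenMap _ e.open_target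
    exact h.contMDiffAt (ho.mem_nhds ⟨e x, e.map_source hs, rfl⟩)
  have h7 : MDifferentiableAt J I g (f x) := by
    have : ContMDiffAt J I ∞ g (f x) := by
      refine ContMDiffAt.comp (f x) (g := (e.extend I).symm) ?_ h2
      rw [h5]; exact h6
    exact this.mdifferentiableAt (by simp)
  have h9 : mfderiv I I (g ∘ f) x = mfderiv I I (id : M → M) x := hgf.mfderiv_eq
  rw [mfderiv_comp x h7 hf, mfderiv_id] at h9; intro u w huw
  have h10 := congrArg (mfderiv J I g (f x)) huw
  have := DFunLike.congr_fun h9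
  exact ((this u).symm.trans h10).trans (this w)

theorem Manifold.IsSmoothEmbedding.injective_mfderiv
    (hf : Manifold.IsSmoothEmbedding I J ∞ f) (x : M) : Injective (mfderiv I J f x) := by
  have h := hf.isImmersion.isImmersionAt x
  refine injective_mfderiv_of_charts h.domChart_mem_maximalAtlas h.codChart_mem_maximalAtlas
    h.equiv h.mem_domChart_source h.mem_codChart_source (fun y hy => ?_)
    (hf.contMDiff.mdifferentiableAt (by simp))
  have h1 := h.writtenInCharts ((h.domChart.extend I).map_source (by rwa [OpenPartialHomeomorph.extend_source]))
  simp only [comp_apply] at h1; rwa [OpenPartialHomeomorph.extend_left_inv _ hy] at h1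

end InverseFunction

theorem mem_maximalAtlas_of_contMDiffOn {e : OpenPartialHomeomorph M H}
    (h1 : ContMDiffOn I I ∞ e e.source) (h2 : ContMDiffOn I I ∞ e.symm e.target) :
    e ∈ IsManifold.maximalAtlas I ∞ M := by
  have key : ∀ e' ∈ atlas H M, e.symm ≫ₕ e' ∈ contDiffGroupoid ∞ I := fun e' he' => by
    have m1 := contMDiffOn_of_mem_maximalAtlas (I := I) (n := ∞) (IsManifold.subset_maximalAtlas (I := I) (n := ∞) he')
    have m2 := contMDiffOn_symm_of_mem_maximalAtlas (I := I) (n := ∞)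
      (IsManifold.subset_maximalAtlas (I := I) (n := ∞) he')
    rw [contDiffGroupoid, mem_groupoid_of_pregroupoid]; constructor
    · have h3 : ContMDiffOn I I ∞ (e.symm ≫ₕ e') (e.symm ≫ₕ e').source := by
        rw [OpenPartialHomeomorph.trans_source]; exact m1.comp (h2.mono inter_subset_left) fun y hy => hy.2
      exact (contMDiffOn_iff_contDiffOn.1 (I.contMDiff.comp_contMDiffOn (h3.comp
        (I.contMDiffOn_symm.mono inter_subset_right) fun y hy => hy.1)))
    · have h3 : ContMDiffOn I I ∞ (e.symm ≫ₕ e').symm (e.symm ≫ₕ e').target := by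
        rw [OpenPartialHomeomorph.trans_target]; exact h1.comp (m2.mono inter_subset_left) fun y hy => hy.2
      exact (contMDiffOn_iff_contDiffOn.1 (I.contMDiff.comp_contMDiffOn (h3.comp
        (I.contMDiffOn_symm.mono inter_subset_right) fun y hy => hy.1)))
  refine fun e' he' => ⟨key e' he', ?_⟩
  have := (contDiffGroupoid ∞ I).symm (key e' he')
  rwa [OpenPartialHomeomorph.trans_symm_eq_symm_trans_symm, OpenPartialHomeomorph.symm_symm] at this

/-! ### Calculus of 1-forms -/

/-- The exterior derivative, within `s`, of the form `P` on a normed space. -/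
def antiD (P : E → E →L[ℝ] ℝ) (s : Set E) (y u w : E) : ℝ := fderivWithin ℝ P s y u w - fderivWithin ℝ P s y w u

theorem extDerivWithin_ofSubsingleton {P : E → E →L[ℝ] ℝ} {s : Set E} {y : E}
    (hP : DifferentiableWithinAt ℝ P s y) (hs : UniqueDiffWithinAt ℝ s y) (u w : E) :
    extDerivWithin (fun y => ContinuousAlternatingMap.ofSubsingleton ℝ E ℝ (0 : Fin 1) (P y)) s y
      ![u, w] = antiD P s y u w := by
  rw [extDerivWithin_apply _ hs]
  · have key : ∀ v : Fin 1 → E, fderivWithin ℝ (fun y => P y (v 0)) s y = (fderivWithin ℝ P s y).flip (v 0) := fun v =>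
      (hP.hasFDerivWithinAt.clm_apply (hasFDerivWithinAt_const (v 0) y s)).fderivWithin hs |>.trans (by ext; simp)
    have key' : ∀ z : E, fderivWithin ℝ (fun y => P y z) s y = (fderivWithin ℝ P s y).flip z := fun z => key ![z]
    simp [Fin.sum_univ_two, antiD, key', Fin.removeNth, sub_eq_add_neg]
  · have := (ContinuousAlternatingMap.ofSubsingletonLIE (𝕜 := ℝ) (E := E) (F := ℝ) (0 : Fin 1)).toContinuousLinearEquiv.toContinuousLinearMap.differentiableAt.comp_differentiableWithinAt y
        hP
    exact this

theorem antiD_pullback {η : E' → E' →L[ℝ] ℝ} {f : E → E'} {h : E → ℝ} {s : Set E} {t : Set E'} {x : E}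
    (hη : DifferentiableWithinAt ℝ η t (f x)) (hf : ContDiffWithinAt ℝ ∞ f s x)
    (hh : DifferentiableWithinAt ℝ h s x) (hs : UniqueDiffOn ℝ s) (hx : x ∈ s)
    (hxc : x ∈ closure (interior s)) (hft : ∀ᶠ y in 𝓝[s] x, f y ∈ t)
    {P : E → E →L[ℝ] ℝ}
    (hP : ∀ᶠ y in 𝓝[s] x, P y = h y • (η (f y)).comp (fderivWithin ℝ f s y)) (u w : E) : antiD P s x u w =
      fderivWithin ℝ h s x u * η (f x) (fderivWithin ℝ f s x w)
        - fderivWithin ℝ h s x w * η (f x) (fderivWithin ℝ f s x u)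
        + h x * antiD η t (f x) (fderivWithin ℝ f s x u) (fderivWithin ℝ f s x w) := by
  have h1 : HasFDerivWithinAt f (fderivWithin ℝ f s x) s x := (hf.differentiableWithinAt (by simp)).hasFDerivWithinAt
  have e2 : (1 : WithTop ℕ∞) + 1 ≤ ∞ := by rw [one_add_one_eq_two]; exact WithTop.coe_le_coe.2 le_top
  have h2 : HasFDerivWithinAt (fderivWithin ℝ f s) (fderivWithin ℝ (fderivWithin ℝ f s) s x) s x :=
    ((hf.fderivWithin_right (m := 1) hs e2 hx).differentiableWithinAt (by simp)).hasFDerivWithinAt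
  have h3 : HasFDerivWithinAt (fun y => η (f y)) ((fderivWithin ℝ η t (f x)).comp (fderivWithin ℝ f s x)) s x := by
    have h4 : HasFDerivWithinAt f (fderivWithin ℝ f s x) (s ∩ f ⁻¹' t) x := h1.mono inter_subset_left
    have h5 := hη.hasFDerivWithinAt.comp x h4 (fun y hy => hy.2)
    exact h5.mono_of_mem_nhdsWithin (inter_mem self_mem_nhdsWithin hft)
  have h6 := hh.hasFDerivWithinAt.smul (h3.clm_comp h2)
  have h7 := h6.congr_of_eventuallyEq hP (hP.self_of_nhdsWithin hx)
  have hsymm := hf.isSymmSndFDerivWithinAt (by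
    rw [minSmoothness_of_isRCLikeNormedField, ← one_add_one_eq_two]; exact e2) hs hxc hx
  have e := hsymm.eq u w
  simp only [antiD, h7.fderivWithin (hs x hx)]; simp [e]; ring

namespace OneForm

variable (α : OneForm I M)

theorem chartRep_apply (x₀ : M) (y e : E) : α.chartRep x₀ y e = α ((crd I x₀).symm y) (chartDSymm I x₀ y e) := rfl

theorem chartRep_chartD {x₀ x : M} (hx : x ∈ (crd I x₀).source)
    (w : E) : α.chartRep x₀ (crd I x₀ x) (chartD I x₀ x w) = α x w := by
  rw [chartRep_apply, chartDSymm_chartD hx]; rw [(crd I x₀).left_inv hx]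

variable (I) in
/-- The vector field with constant coordinates in the chart at `x₀`. -/
def constSection (x₀ : M) (e : E) (x : M) : Tan I x := chartDSymm I x₀ (crd I x₀ x) e

theorem contMDiffOn_constSection (x₀ : M) (e : E) :
    ContMDiffOn I I.tangent ∞ (fun x => (⟨x, constSection I x₀ e x⟩ : TangentBundle I M)) (chartAt H x₀).source := by
  have h1 := (trivializationAt E (Tan I) x₀).contMDiffOn_section_baseSet_iff
    (IB := I) (n := ∞) (s := constSection I x₀ e)
  rw [TangentBundle.trivializationAt_baseSet] at h1; rw [h1]
  refine (contMDiffOn_const (c := e)).congr fun x hx => ?_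
  have h3 := DFunLike.congr_fun (TangentBundle.continuousLinearMapAt_trivializationAt (I := I) hx)
    (constSection I x₀ e x)
  rw [Bundle.Trivialization.continuousLinearMapAt_apply,
    Bundle.Trivialization.coe_linearMapAt_of_mem _ (by simpa using hx)] at h3
  refine h3.trans ?_
  exact chartD_chartDSymm' (by rwa [extChartAt_source]) e

theorem contDiffOn_chartRep (x₀ : M) : ContDiffOn ℝ ∞ (α.chartRep x₀) (crd I x₀).target := by
  rw [contDiffOn_clm_apply]; intro e; rw [← contMDiffOn_iff_contDiffOn]
  have h1 : ContMDiffOn I ℐ ∞ (fun x => α x (constSection I x₀ e x)) (chartAt H x₀).source :=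
    α.smooth.comp_contMDiffOn (contMDiffOn_constSection x₀ e)
  refine (h1.comp (contMDiffOn_extChartAt_symm x₀) fun y hy => ?_).congr fun y hy => ?_
  · rw [mem_preimage, ← extChartAt_source I]; exact (crd I x₀).map_target hy
  · rw [chartRep_apply, comp_apply, constSection, (crd I x₀).right_inv hy]

theorem contDiffWithinAt_chartRep {x₀ : M} {y : E} (hy : y ∈ (crd I x₀).target) :
    ContDiffWithinAt ℝ ∞ (α.chartRep x₀) (range I) y :=
  (α.contDiffOn_chartRep x₀ y hy).mono_of_mem_nhdsWithin (extChartAt_target_mem_nhdsWithin_of_mem hy)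

/-- The exterior derivative of the coordinate expression. -/
def dRep (x₀ : M) (y u w : E) : ℝ := antiD (α.chartRep x₀) (range I) y u w

theorem d_eq_dRep_self (x : M) (u w : E) : α.d x u w = α.dRep x (crd I x x) u w := by
  have h : ∀ w : E, mvfderiv I (crd I x) x w = w := fun w => chartD_self (I := I) x w
  have h' : α.d x u w = extDerivWithin (fun y => ContinuousAlternatingMap.ofSubsingleton ℝ E ℝ
      (0 : Fin 1) (α.chartRep x y)) (range I) (crd I x x)
      ![mvfderiv I (crd I x) x u, mvfderiv I (crd I x) x w] := rfl
  rw [h', h, h]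
  exact extDerivWithin_ofSubsingleton ((α.contDiffWithinAt_chartRep
    (mem_extChartAt_target x)).differentiableWithinAt (by simp))
    (I.uniqueDiffOn _ (mem_range_self _)) u w

theorem dRep_weighted_pullback {α : OneForm I M} {β : OneForm J N} {f : N → M} {h : N → ℝ} {x x₀ : N}
    {z₀ : M} (hf : ContMDiffAt J I ∞ f x) (hh : ContMDiffAt J ℐ ∞ h x)
    (hβ : ∀ᶠ y in 𝓝 x, β y = h y • (α (f y)).comp (mfderiv J I f y))
    (hx : x ∈ (crd J x₀).source) (hz : f x ∈ (crd I z₀).source) (u w : E') :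
    β.dRep x₀ (crd J x₀ x) (chartD J x₀ x u) (chartD J x₀ x w) = mvfderiv J h x u * α (f x) (mfderiv J I f x w)
        - mvfderiv J h x w * α (f x) (mfderiv J I f x u)
        + h x * α.dRep z₀ (crd I z₀ (f x)) (chartD I z₀ (f x) (mfderiv J I f x u))
          (chartD I z₀ (f x) (mfderiv J I f x w)) := by
  set φ := crd J x₀ with hφ
  set ψ := crd I z₀ with hψ
  set y₀ := φ x with hy₀
  have hy₀t : y₀ ∈ φ.target := φ.map_source hx
  have hinv : φ.symm y₀ = x := φ.left_inv hx
  set F : E' → E := fun y => ψ (f (φ.symm y)) with hF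
  have hsymm : ContMDiffWithinAt 𝓘(ℝ, E') J ∞ φ.symm (range J) y₀ := contMDiffWithinAt_extChartAt_symm_range x₀ hy₀t
  have htend : Tendsto φ.symm (𝓝[range J] y₀) (𝓝 x) := by rw [← hinv]; exact hsymm.continuousWithinAt
  have hev : ∀ᶠ y in 𝓝 x, ContMDiffAt J I 1 f y ∧ f y ∈ ψ.source ∧ β y = h y • (α (f y)).comp (mfderiv J I f y) :=
    ((contMDiffAt_iff_contMDiffAt_nhds (by simp)).1 (hf.of_le (by simp : (1 : WithTop ℕ∞) ≤ ∞))).and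
      ((hf.continuousAt.eventually ((isOpen_extChartAt_source z₀).mem_nhds hz)).and hβ)
  have hev' : ∀ᶠ y in 𝓝[range J] y₀, y ∈ φ.target ∧ (ContMDiffAt J I 1 f (φ.symm y) ∧
      f (φ.symm y) ∈ ψ.source ∧ β (φ.symm y) = h (φ.symm y) • (α (f (φ.symm y))).comp (mfderiv J I f (φ.symm y))) := by
    have e1 : ∀ᶠ y in 𝓝[range J] y₀, y ∈ φ.target := extChartAt_target_mem_nhdsWithin_of_mem hy₀t
    exact e1.and (htend.eventually hev)
  have huniq : UniqueDiffOn ℝ (range J) := J.uniqueDiffOn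
  -- the derivative of the coordinate expression of `f`
  have hDF : ∀ y ∈ φ.target, MDifferentiableAt J I f (φ.symm y) → f (φ.symm y) ∈ ψ.source →
      ∀ e : E', fderivWithin ℝ F (range J) y e =
        chartD I z₀ (f (φ.symm y)) (mfderiv J I f (φ.symm y) (chartDSymm J x₀ y e)) := by
    intro y hy hd hs e; rw [hψ, extChartAt_source] at hs
    have h1 := (mdifferentiableWithinAt_extChartAt_symm (I := J) hy).hasMFDerivWithinAt
    have h2 := (mdifferentiableAt_extChartAt (I := I) hs).hasMFDerivAt.comp_hasMFDerivWithinAt y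
      (hd.hasMFDerivAt.comp_hasMFDerivWithinAt y h1)
    have h3 : HasFDerivWithinAt F ((chartD I z₀ (f (φ.symm y))).comp
        ((show E' →L[ℝ] E from mfderiv J I f (φ.symm y)).comp (chartDSymm J x₀ y)))
        (range J) y := HasMFDerivWithinAt.hasFDerivWithinAt h2
    exact DFunLike.congr_fun (h3.fderivWithin (huniq y (extChartAt_target_subset_range x₀ hy))) e
  have hFs : ContDiffWithinAt ℝ ∞ F (range J) y₀ := by
    rw [← contMDiffWithinAt_iff_contDiffWithinAt]
    have h1 : ContMDiffAt I 𝓘(ℝ, E) ∞ ψ (f x) := contMDiffAt_extChartAt' (by rwa [hψ, extChartAt_source] at hz)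
    have h2 : ContMDiffAt J 𝓘(ℝ, E) ∞ (fun y => ψ (f y)) (φ.symm y₀) := by rw [hinv]; exact h1.comp x hf
    exact h2.comp_contMDiffWithinAt y₀ hsymm
  have hhs : MDifferentiableAt J ℐ h (φ.symm y₀) := by rw [hinv]; exact hh.mdifferentiableAt (by simp)
  have hDh := (hhs.hasMFDerivAt.comp_hasMFDerivWithinAt y₀
    (mdifferentiableWithinAt_extChartAt_symm (I := J) hy₀t).hasMFDerivWithinAt).hasFDerivWithinAt
  have hy₀r : y₀ ∈ range J := extChartAt_target_subset_range x₀ hy₀t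
  have hFx : F y₀ = ψ (f x) := by rw [hF]; simp only [hinv]
  have hηd : DifferentiableWithinAt ℝ (α.chartRep z₀) (range I) (F y₀) := by
    rw [hFx]; exact (α.contDiffWithinAt_chartRep (ψ.map_source hz)).differentiableWithinAt (by simp)
  have key := antiD_pullback (η := α.chartRep z₀) (f := F) (h := fun y => h (φ.symm y))
    (s := range J) (t := range I) (x := y₀) hηd hFs hDh.differentiableWithinAt huniq hy₀r
    (J.range_subset_closure_interior hy₀r)
    (hev'.mono fun y hy => extChartAt_target_subset_range z₀ (ψ.map_source hy.2.2.1))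
    (P := β.chartRep x₀) (hev'.mono fun y hy => by
      ext e; rw [chartRep_apply, hy.2.2.2]
      have h8 := hDF y hy.1 (hy.2.1.mdifferentiableAt (by simp)) hy.2.2.1 e
      have h9 := α.chartRep_chartD hy.2.2.1 (mfderiv J I f (φ.symm y) (chartDSymm J x₀ y e))
      rw [← h8] at h9
      exact congrArg (h (φ.symm y) * ·) h9.symm)
    (chartD J x₀ x u) (chartD J x₀ x w)
  have hfd : MDifferentiableAt J I f (φ.symm y₀) := by rw [hinv]; exact hf.mdifferentiableAt (by simp)
  have hDF₀ : ∀ u : E', fderivWithin ℝ F (range J) y₀ (chartD J x₀ x u) = chartD I z₀ (f x) (mfderiv J I f x u) := by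
    intro u; rw [hDF y₀ hy₀t hfd (by rw [hinv]; exact hz), hy₀, chartDSymm_chartD hx, ← hy₀, hinv]
  have hDh₀ : ∀ u : E', fderivWithin ℝ (fun y => h (φ.symm y)) (range J) y₀ (chartD J x₀ x u) = mvfderiv J h x u := by
    intro u
    have h3 : HasFDerivWithinAt (fun y => h (φ.symm y))
        ((show E' →L[ℝ] ℝ from mvfderiv J h (φ.symm y₀)).comp (chartDSymm J x₀ y₀))
        (range J) y₀ := hDh
    have h4 : fderivWithin ℝ (fun y => h (φ.symm y)) (range J) y₀ (chartD J x₀ x u) =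
      mvfderiv J h (φ.symm y₀) (chartDSymm J x₀ y₀ (chartD J x₀ x u)) :=
      DFunLike.congr_fun (h3.fderivWithin (huniq y₀ hy₀r)) _
    rw [h4, hy₀, chartDSymm_chartD hx, ← hy₀, hinv]
  have hα : ∀ u : E', α.chartRep z₀ (F y₀) (chartD I z₀ (f x) (mfderiv J I f x u)) =
      α (f x) (mfderiv J I f x u) := fun u => by rw [hFx]; exact α.chartRep_chartD hz _
  rw [hDF₀, hDF₀, hDh₀, hDh₀, hα, hα, hFx, hinv] at key; exact key

theorem d_eq_dRep {x x₀ : M} (hx : x ∈ (crd I x₀).source) (u w : E) :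
    α.d x u w = α.dRep x₀ (crd I x₀ x) (chartD I x₀ x u) (chartD I x₀ x w) := by
  have h := dRep_weighted_pullback (α := α) (β := α) (f := id) (h := fun _ => (1 : ℝ)) (x := x)
    (x₀ := x₀) (z₀ := x) contMDiffAt_id contMDiffAt_const (Eventually.of_forall fun y => by
      rw [one_smul, mfderiv_id]; rfl) hx (mem_extChartAt_source x) u w
  have h0 : mvfderiv I (fun _ : M => (1 : ℝ)) x = 0 := mvfderiv_const (I := I) (1 : ℝ)
  rw [h, h0, mfderiv_id, d_eq_dRep_self]
  have e : ∀ u : E, chartD I (id x) (id x) u = u := fun u => chartD_self (id x) u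
  change _ = 0 * _ - 0 * _ + 1 * α.dRep x _ (chartD I x x u) (chartD I x x w); rw [chartD_self, chartD_self]; simp

theorem d_weighted_pullback {α : OneForm I M} {β : OneForm J N} {f : N → M} {h : N → ℝ} {x : N}
    (hf : ContMDiffAt J I ∞ f x) (hh : ContMDiffAt J ℐ ∞ h x)
    (hβ : ∀ᶠ y in 𝓝 x, β y = h y • (α (f y)).comp (mfderiv J I f y))
    (u w : Tan J x) : β.d x u w = mvfderiv J h x u * α (f x) (mfderiv J I f x w)
        - mvfderiv J h x w * α (f x) (mfderiv J I f x u)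
        + h x * α.d (f x) (mfderiv J I f x u) (mfderiv J I f x w) := by
  have h1 := dRep_weighted_pullback hf hh hβ (mem_extChartAt_source x) (mem_extChartAt_source (f x)) u w
  have h2 := d_eq_dRep α (mem_extChartAt_source (f x)) (mfderiv J I f x u) (mfderiv J I f x w)
  have h3 := d_eq_dRep β (mem_extChartAt_source x) u w
  exact h3.trans (h1.trans (by rw [← h2]))

instance : Add (OneForm I M) where
  add α β := ⟨fun x => α x + β x, α.smooth.add β.smooth⟩

instance : SMul ℝ (OneForm I M) where
  smul c α := ⟨fun x => c • α x, by
    have h : ContMDiff ℐ ℐ ∞ (fun r : ℝ => c * r) := (contDiff_const.mul contDiff_id).contMDiff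
    exact h.comp α.smooth⟩

theorem add_apply (α β : OneForm I M) (x : M) (w : Tan I x) : (α + β) x w = α x w + β x w := rfl

theorem smul_apply (c : ℝ) (α : OneForm I M) (x : M) (w : Tan I x) : (c • α) x w = c * α x w := rfl

theorem pullback_apply (f : N → M) (hf : ContMDiff J I ∞ f) (x : N)
    (w : Tan J x) : α.pullback f hf x w = α (f x) (mfderiv J I f x w) := rfl

/-- The exterior derivative in a chart, as a bilinear map. -/
def dBil (x₀ : M) (y : E) : E →L[ℝ] E →L[ℝ] ℝ :=
  fderivWithin ℝ (α.chartRep x₀) (range I) y - (fderivWithin ℝ (α.chartRep x₀) (range I) y).flip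

theorem d_eq_dBil (x : M) (u w : Tan I x) : α.d x u w = α.dBil x (crd I x x) u w := d_eq_dRep_self α x u w

theorem d_add_left (x : M) (u u' w : Tan I x) : α.d x (u + u') w = α.d x u w + α.d x u' w := by
  simp only [d_eq_dBil]; exact congrArg (· w) ((α.dBil x (crd I x x)).map_add u u')

theorem d_smul_left (x : M) (c : ℝ) (u w : Tan I x) : α.d x (c • u) w = c * α.d x u w := by
  simp only [d_eq_dBil]; exact congrArg (· w) ((α.dBil x (crd I x x)).map_smul c u)

theorem d_swap (x : M) (u w : Tan I x) : α.d x u w = -α.d x w u := by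
  have e := d_eq_dRep_self α x
  have h1 := e u w
  have h2 := e w u
  simp only [dRep, antiD] at h1 h2; rw [h1, h2]; ring

theorem d_self (x : M) (u : Tan I x) : α.d x u u = 0 := by linarith [d_swap α x u u]

theorem d_add_right (x : M) (u w w' : Tan I x) :
    α.d x u (w + w') = α.d x u w + α.d x u w' := by rw [d_swap, d_add_left, d_swap α x w, d_swap α x w']; ring

theorem d_smul_right (x : M) (c : ℝ) (u w : Tan I x) : α.d x u (c • w) = c * α.d x u w := by
  rw [d_swap, d_smul_left, d_swap α x w]; ring

theorem chartRep_add (α β : OneForm I M) (x₀ : M) : (α + β).chartRep x₀ = α.chartRep x₀ + β.chartRep x₀ := rfl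

theorem differentiableWithinAt_chartRep_self (x : M) : DifferentiableWithinAt ℝ (α.chartRep x) (range I) (crd I x x) :=
  (α.contDiffWithinAt_chartRep (mem_extChartAt_target x)).differentiableWithinAt (by simp)

theorem d_add (α β : OneForm I M) (x : M) (u w : Tan I x) : (α + β).d x u w = α.d x u w + β.d x u w := by
  have e := fun α : OneForm I M => d_eq_dRep_self α x u w
  have h : fderivWithin ℝ (α.chartRep x + β.chartRep x) (range I) (crd I x x) =
      fderivWithin ℝ (α.chartRep x) (range I) (crd I x x) + fderivWithin ℝ (β.chartRep x) (range I) (crd I x x) :=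
    fderivWithin_add (I.uniqueDiffOn _ (mem_range_self _)) (α.differentiableWithinAt_chartRep_self x) (β.differentiableWithinAt_chartRep_self x)
  rw [(e α :), (e β :), (e (α + β) :)]; simp only [dRep, antiD, chartRep_add, h]; exact add_sub_add_comm _ _ _ _

theorem d_smul (c : ℝ) (α : OneForm I M) (x : M) (u w : Tan I x) : (c • α).d x u w = c * α.d x u w := by
  have h := d_weighted_pullback (α := α) (β := c • α) (f := id) (h := fun _ => c) (x := x)
    contMDiffAt_id contMDiffAt_const (Eventually.of_forall fun y => by rw [mfderiv_id]; rfl) u w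
  have h0 : mvfderiv I (fun _ : M => c) x = 0 := mvfderiv_const (I := I) c
  rw [h, h0, mfderiv_id]; change 0 * _ - 0 * _ + c * α.d x u w = _; ring

theorem d_pullback (f : N → M) (hf : ContMDiff J I ∞ f) (x : N) (u w : Tan J x) :
    (α.pullback f hf).d x u w = α.d (f x) (mfderiv J I f x u) (mfderiv J I f x w) := by
  have h := d_weighted_pullback (α := α) (β := α.pullback f hf) (f := f) (h := fun _ => (1 : ℝ))
    (x := x) (hf x) contMDiffAt_const (Eventually.of_forall fun y => by rw [one_smul]; rfl) u w
  have h0 : mvfderiv J (fun _ : N => (1 : ℝ)) x = 0 := mvfderiv_const (I := J) (1 : ℝ)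
  rw [h, h0]; change 0 * _ - 0 * _ + 1 * _ = _; ring

/-- The form `h · f^* α`, for a map `f` which is smooth on a neighbourhood of the support of `h`. -/
def weightedPullback (h : N → ℝ) (hh : ContMDiff J ℐ ∞ h) (f : N → M)
    {U : Set N} (hU : IsOpen U) (hf : ContMDiffOn J I ∞ f U) (hsupp : tsupport h ⊆ U) : OneForm J N where
  toFun x := h x • (α (f x)).comp (mfderiv J I f x)
  smooth := by
    intro z
    by_cases hz : z.1 ∈ U
    · have hopen : IsOpen (Bundle.TotalSpace.proj ⁻¹' U : Set (TangentBundle J N)) :=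
        hU.preimage (FiberBundle.continuous_proj E' (Tan J))
      have h1 : ContMDiffOn J.tangent I.tangent ∞ (tangentMap J I f) (Bundle.TotalSpace.proj ⁻¹' U) := by
        refine (hf.contMDiffOn_tangentMapWithin (m := ∞) (by simp) hU.uniqueMDiffOn).congr fun p hp => ?_
        exact (tangentMapWithin_eq_tangentMap (hU.uniqueMDiffOn p.1 hp)
          ((hf.contMDiffAt (hU.mem_nhds hp)).mdifferentiableAt (by simp))).symm
      have h2 : ContMDiffOn J.tangent ℐ ∞ (fun z : TangentBundle J N => α (f z.1) (mfderiv J I f z.1 z.2))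
          (Bundle.TotalSpace.proj ⁻¹' U) := α.smooth.comp_contMDiffOn h1
      have h3 : ContMDiff J.tangent ℐ ∞ (fun z : TangentBundle J N => h z.1) := hh.comp (Bundle.contMDiff_proj (Tan J))
      exact (h3.contMDiffOn.smul h2).contMDiffAt (hopen.mem_nhds hz)
    · have hopen : IsOpen (Bundle.TotalSpace.proj ⁻¹' (tsupport h)ᶜ : Set (TangentBundle J N)) :=
        (isClosed_tsupport h).isOpen_compl.preimage (FiberBundle.continuous_proj E' (Tan J))
      have hz' : z ∈ (Bundle.TotalSpace.proj ⁻¹' (tsupport h)ᶜ : Set (TangentBundle J N)) := fun h' => hz (hsupp h')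
      refine (contMDiffAt_const (c := (0 : ℝ))).congr_of_eventuallyEq ?_
      filter_upwards [hopen.mem_nhds hz'] with p hp
      have : h p.1 = 0 := image_eq_zero_of_notMem_tsupport hp
      change h p.1 * _ = 0; rw [this, zero_mul]

section WeightedPullback

variable {h : N → ℝ} (hh : ContMDiff J ℐ ∞ h) {f : N → M}
  {U : Set N} (hU : IsOpen U) (hf : ContMDiffOn J I ∞ f U) (hsupp : tsupport h ⊆ U)

theorem weightedPullback_apply (x : N) (w : Tan J x) :
    α.weightedPullback h hh f hU hf hsupp x w = h x * α (f x) (mfderiv J I f x w) := rfl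

theorem d_weightedPullback {x : N} (hx : x ∈ U) (u w : Tan J x) :
    (α.weightedPullback h hh f hU hf hsupp).d x u w = mvfderiv J h x u * α (f x) (mfderiv J I f x w)
        - mvfderiv J h x w * α (f x) (mfderiv J I f x u)
        + h x * α.d (f x) (mfderiv J I f x u) (mfderiv J I f x w) :=
  d_weighted_pullback (hf.contMDiffAt (hU.mem_nhds hx)) (hh x) (Eventually.of_forall fun _ => rfl) u w

end WeightedPullback

/-- The product of a form with a function. -/
def fmul (h : M → ℝ) (hh : ContMDiff I ℐ ∞ h) (α : OneForm I M) : OneForm I M :=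
  α.weightedPullback h hh id isOpen_univ contMDiffOn_id (subset_univ _)

theorem fmul_apply (h : M → ℝ) (hh : ContMDiff I ℐ ∞ h) (α : OneForm I M) (x : M)
    (w : Tan I x) : fmul h hh α x w = h x * α x w := by
  have := weightedPullback_apply α hh isOpen_univ contMDiffOn_id (subset_univ _) x w
  rw [mfderiv_id] at this; exact this

theorem d_fmul (h : M → ℝ) (hh : ContMDiff I ℐ ∞ h) (α : OneForm I M) (x : M) (u w : Tan I x) : (fmul h hh α).d x u w =
      mvfderiv I h x u * α x w - mvfderiv I h x w * α x u + h x * α.d x u w := by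
  have := d_weightedPullback α hh isOpen_univ contMDiffOn_id (subset_univ _) (mem_univ x) u w
  rw [mfderiv_id] at this; exact this

/-- The differential of a function. -/
def ofFun (g : M → ℝ) (hg : ContMDiff I ℐ ∞ g) : OneForm I M where
  toFun x := mvfderiv I g x
  smooth := by
    have h1 := hg.contMDiff_tangentMap (m := ∞) (by simp)
    exact (contMDiff_snd_tangentBundle_modelSpace ℝ ℐ).comp h1

theorem ofFun_apply (g : M → ℝ) (hg : ContMDiff I ℐ ∞ g) (x : M) (w : Tan I x) :
    ofFun g hg x w = mvfderiv I g x w := rfl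

theorem d_ofFun (g : M → ℝ) (hg : ContMDiff I ℐ ∞ g) (x : M) (u w : Tan I x) : (ofFun g hg).d x u w = 0 := by
  set β : OneForm ℐ ℝ := ofFun id contMDiff_id with hβ
  have h1 : ofFun g hg = β.pullback g hg := by
    ext y w; rw [pullback_apply, hβ, ofFun_apply, ofFun_apply, mvfderiv, mvfderiv, mfderiv_id]; rfl
  rw [h1, d_pullback]
  have e : ∀ a b : ℝ, β.d (g x) a b = 0 := by
    intro a b
    have h2 := d_smul_left β (g x) a (1 : ℝ) b
    have h3 := d_smul_right β (g x) b (1 : ℝ) (1 : ℝ)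
    rw [d_self β (g x) (1 : ℝ)] at h3
    have ha : (a • (1 : ℝ) : ℝ) = a := mul_one a
    have hb : (b • (1 : ℝ) : ℝ) = b := mul_one b
    have h3' : β.d (g x) (1 : ℝ) b = b * 0 := by rw [← h3]; exact congrArg (β.d (g x) (1 : ℝ)) hb.symm
    have h2' : β.d (g x) a b = a * β.d (g x) (1 : ℝ) b := by rw [← h2]; exact congrArg (fun c => β.d (g x) c b) ha.symm
    rw [h2', h3']; ring
  exact e _ _

theorem exists_vectorField (α σ τ σ' τ' θ : OneForm I M) (hnd : ∀ (x : M) (u : Tan I x),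
      (∀ w : Tan I x, α.d x u w + σ x u * τ x w + σ' x u * τ' x w = 0) → u = 0) :
    ∃ Y : ∀ x : M, Tan I x, SmoothField Y ∧ ∀ (x : M) (w : Tan I x),
        α.d x (Y x) w + σ x (Y x) * τ x w + σ' x (Y x) * τ' x w = θ x w := by
  let B : M → E → E →L[ℝ] E →L[ℝ] ℝ := fun x₀ y => α.dBil x₀ y +
    (σ.chartRep x₀ y).smulRight (τ.chartRep x₀ y) + (σ'.chartRep x₀ y).smulRight (τ'.chartRep x₀ y)
  have hB : ∀ x₀ x : M, x ∈ (crd I x₀).source → ∀ u w : E,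
      B x₀ (crd I x₀ x) (chartD I x₀ x u) (chartD I x₀ x w) = α.d x u w + σ x u * τ x w + σ' x u * τ' x w := by
    intro x₀ x hx u w
    have h1 := d_eq_dRep α hx u w
    have h2 := fun θ : OneForm I M => chartRep_chartD θ hx
    change α.dRep x₀ _ _ _ + σ.chartRep x₀ _ _ * τ.chartRep x₀ _ _ + σ'.chartRep x₀ _ _ * τ'.chartRep x₀ _ _ = _
    rw [h1, h2, h2, h2, h2]
  have hinj : ∀ x₀ x : M, x ∈ (crd I x₀).source → Injective (B x₀ (crd I x₀ x)) := by
    intro x₀ x hx; rw [injective_iff_map_eq_zero]; intro a ha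
    obtain ⟨u, rfl⟩ := chartD_surjective hx a
    have : (u : E) = 0 := hnd x u fun w => by rw [← hB x₀ x hx u w, ha]; rfl
    rw [this, map_zero]
  have hfin : finrank ℝ E = finrank ℝ (E →L[ℝ] ℝ) := by
    rw [LinearMap.toContinuousLinearMap.finrank_eq.symm]; exact (Subspace.dual_finrank_eq (K := ℝ) (V := E)).symm
  have hbij : ∀ x₀ x : M, x ∈ (crd I x₀).source →
      ∃ e : E ≃L[ℝ] (E →L[ℝ] ℝ), (e : E →L[ℝ] E →L[ℝ] ℝ) = B x₀ (crd I x₀ x) :=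
    fun x₀ x hx => ⟨(LinearEquiv.ofInjectiveOfFinrankEq (B x₀ (crd I x₀ x)).toLinearMap
      (hinj x₀ x hx) hfin).toContinuousLinearEquiv, by ext; rfl⟩
  have hex : ∀ x : M, ∃ Y : E, ∀ w : E, α.d x Y w + σ x Y * τ x w + σ' x Y * τ' x w = θ x w := by
    intro x
    obtain ⟨e, he⟩ := hbij x x (mem_extChartAt_source x)
    refine ⟨e.symm (θ x), fun w => ?_⟩
    rw [← hB x x (mem_extChartAt_source x), chartD_self, chartD_self, ← he]
    exact congrArg (fun A : E →L[ℝ] ℝ => A w) (e.apply_symm_apply (θ x))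
  choose Y hY using hex
  refine ⟨Y, contMDiff_vectorField_iff.2 fun x₀ => ?_, hY⟩
  have hrep : ∀ y ∈ (crd I x₀).target,
      vectorRep (I := I) Y x₀ y = ContinuousLinearMap.inverse (B x₀ y) (θ.chartRep x₀ y) := by
    intro y hy
    set x := (crd I x₀).symm y with hx
    have hxs : x ∈ (crd I x₀).source := (crd I x₀).map_target hy
    have hyx : crd I x₀ x = y := (crd I x₀).right_inv hy
    obtain ⟨e, he⟩ := hbij x₀ x hxs
    have h1 : B x₀ (crd I x₀ x) (vectorRep (I := I) Y x₀ y) = θ.chartRep x₀ (crd I x₀ x) := by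
      ext a
      obtain ⟨w, rfl⟩ := chartD_surjective hxs a
      have h2 := hB x₀ x hxs (Y x) w
      rw [chartRep_chartD θ hxs, ← hY x w, ← h2]; rfl
    rw [← hyx, ← h1, ← he, ContinuousLinearMap.inverse_equiv]; rw [hyx]; exact (e.symm_apply_apply _).symm
  refine ContDiffOn.congr (fun y hy => ?_) hrep
  have hdB : ContDiffWithinAt ℝ ∞ (B x₀) (crd I x₀).target y := by
    have h1 : ∀ θ : OneForm I M, ContDiffWithinAt ℝ ∞ (θ.chartRep x₀) (crd I x₀).target y :=
      fun θ => θ.contDiffOn_chartRep x₀ y hy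
    have h2 : ContDiffWithinAt ℝ ∞ (fderivWithin ℝ (α.chartRep x₀) (range I)) (range I) y :=
      (α.contDiffWithinAt_chartRep hy).fderivWithin_right I.uniqueDiffOn (by simp)
        (extChartAt_target_subset_range x₀ hy)
    have h3 := h2.mono (extChartAt_target_subset_range x₀)
    have h4 : ContDiffWithinAt ℝ ∞ (fun y => (fderivWithin ℝ (α.chartRep x₀) (range I) y).flip)
        (crd I x₀).target y := by
      have hL : IsBoundedLinearMap ℝ (fun A : E →L[ℝ] E →L[ℝ] ℝ => A.flip) :=
        IsLinearMap.with_bound ⟨fun _ _ => rfl, fun _ _ => rfl⟩ 1 fun A => by simp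
      have hL' : ContDiff ℝ ∞ (fun A : E →L[ℝ] E →L[ℝ] ℝ => A.flip) :=
        IsBoundedLinearMap.contDiff (F := E →L[ℝ] E →L[ℝ] ℝ) hL
      exact hL'.comp_contDiffWithinAt h3
    exact ((h3.sub h4).add ((h1 σ).smulRight (h1 τ))).add ((h1 σ').smulRight (h1 τ'))
  obtain ⟨e, he⟩ := hbij x₀ _ ((crd I x₀).map_target hy)
  rw [(crd I x₀).right_inv hy] at he
  have h5 : ContDiffAt ℝ ∞ ContinuousLinearMap.inverse (B x₀ y) := by rw [← he]; exact contDiffAt_map_inverse e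
  exact (h5.comp_contDiffWithinAt y hdB).clm_apply (θ.contDiffOn_chartRep x₀ y hy)

end OneForm

section FlowForms

variable {T : ℝ}

  {v : ∀ x : M, Tan I x} {Φ : ℝ → M → M} {T : ℝ}

theorem contMDiff_slice (hΦ : ContMDiffOn ((ℐ).prod I) I ∞ (fun p : ℝ × M => Φ p.1 p.2)
    (Icc 0 T ×ˢ univ)) {r : ℝ} (hr : r ∈ Icc 0 T) : ContMDiff I I ∞ (Φ r) := by
  have h3 : ContMDiff I ((ℐ).prod I) ∞ (fun y : M => (r, y)) := contMDiff_const.prodMk contMDiff_id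
  rw [← contMDiffOn_univ] at h3 ⊢; exact hΦ.comp h3 fun y _ => ⟨hr, mem_univ _⟩

theorem IsSemiflow.hasDerivWithinAt_form (hT : 0 < T) (hΦ : IsSemiflow v T Φ)
    (hsm : ContMDiffOn ((ℐ).prod I) I ∞ (fun p : ℝ × M => Φ p.1 p.2) (Icc 0 T ×ˢ univ))
    {α : OneForm I M} (hα : ∀ x, α x (v x) = 0) (x : M) (w : Tan I x) {r₀ : ℝ}
    (hr₀ : r₀ ∈ Icc 0 T) : HasDerivWithinAt (fun r => α (Φ r x) (mfderiv I I (Φ r) x w))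
      (α.d (Φ r₀ x) (v (Φ r₀ x)) (mfderiv I I (Φ r₀) x w)) (Icc 0 T) r₀ := by
  set φ := crd I x with hφ
  set z₀ := Φ r₀ x with hz₀
  set ψ := crd I z₀ with hψ
  set F : ℝ × E → E := fun p => ψ (Φ p.1 (φ.symm p.2)) with hF
  set s : Set (ℝ × E) := Icc 0 T ×ˢ range I with hs
  set p₀ : ℝ × E := (r₀, φ x) with hp₀
  have hφx : φ.symm (φ x) = x := extChartAt_to_inv x
  have hp₀s : p₀ ∈ s := ⟨hr₀, extChartAt_target_subset_range x (mem_extChartAt_target x)⟩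
  have huI : UniqueDiffOn ℝ (Icc 0 T) := uniqueDiffOn_Icc hT
  have hus : UniqueDiffOn ℝ s := huI.prod I.uniqueDiffOn
  have hsc : p₀ ∈ closure (interior s) := by
    rw [hs, interior_prod_eq, closure_prod_eq]
    refine ⟨?_, I.range_subset_closure_interior hp₀s.2⟩
    rw [interior_Icc, closure_Ioo hT.ne]; exact hr₀
  -- smoothness of the coordinate expression
  have hinner : ContMDiffWithinAt 𝓘(ℝ, ℝ × E) ((ℐ).prod I) ∞ (fun p : ℝ × E => (p.1, φ.symm p.2)) s p₀ := by
    refine ContMDiffWithinAt.prodMk contDiff_fst.contMDiff.contMDiffAt.contMDiffWithinAt ?_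
    have h1 : ContMDiffWithinAt 𝓘(ℝ, E) I ∞ φ.symm (range I) (φ x) :=
      contMDiffWithinAt_extChartAt_symm_range x (mem_extChartAt_target x)
    exact h1.comp p₀ contDiff_snd.contMDiff.contMDiffAt.contMDiffWithinAt (fun p hp => hp.2)
  have hG : ContMDiffWithinAt 𝓘(ℝ, ℝ × E) I ∞ (fun p : ℝ × E => Φ p.1 (φ.symm p.2)) s p₀ := by
    refine ContMDiffWithinAt.comp (g := fun q : ℝ × M => Φ q.1 q.2)
      (t := Icc 0 T ×ˢ univ) p₀ ?_ hinner (fun p hp => ⟨hp.1, mem_univ _⟩)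
    exact hsm _ ⟨hr₀, mem_univ _⟩
  have hGp : Φ p₀.1 (φ.symm p₀.2) = z₀ := by simp only [hp₀, hφx, hz₀]
  have hFs : ContDiffWithinAt ℝ ∞ F s p₀ := by
    rw [← contMDiffWithinAt_iff_contDiffWithinAt]
    have h1 : ContMDiffAt I 𝓘(ℝ, E) ∞ ψ (Φ p₀.1 (φ.symm p₀.2)) := by rw [hGp]; exact contMDiffAt_extChartAt
    exact h1.comp_contMDiffWithinAt p₀ hG
  have hgood : ∀ᶠ p in 𝓝[s] p₀, p ∈ s ∧ p.2 ∈ φ.target ∧ Φ p.1 (φ.symm p.2) ∈ ψ.source := by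
    have e1 : ∀ᶠ p in 𝓝[s] p₀, p ∈ s := self_mem_nhdsWithin
    have e2 : ∀ᶠ p in 𝓝[s] p₀, p.2 ∈ φ.target := by
      have h1 : Tendsto (fun p : ℝ × E => p.2) (𝓝[s] p₀) (𝓝[range I] (φ x)) :=
        tendsto_nhdsWithin_iff.2 ⟨(continuousAt_snd (p := p₀)).tendsto.mono_left
          nhdsWithin_le_nhds, e1.mono fun p hp => hp.2⟩
      exact h1.eventually (extChartAt_target_mem_nhdsWithin x)
    have e3 : ∀ᶠ p in 𝓝[s] p₀, Φ p.1 (φ.symm p.2) ∈ ψ.source := by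
      have := hG.continuousWithinAt
      rw [ContinuousWithinAt, hGp] at this; exact this.eventually (extChartAt_source_mem_nhds z₀)
    exact e1.and (e2.and e3)
  have hFd : ∀ᶠ p in 𝓝[s] p₀, DifferentiableWithinAt ℝ F s p := by
    have h1 := (hFs.of_le (show (1 : WithTop ℕ∞) ≤ ∞ by simp)).eventually (by simp)
    rw [insert_eq_of_mem hp₀s] at h1; exact h1.mono fun p hp => hp.differentiableWithinAt (by simp)
  -- the derivative in the direction of time
  have hFt : ∀ p ∈ s, p.2 ∈ φ.target → Φ p.1 (φ.symm p.2) ∈ ψ.source →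
      DifferentiableWithinAt ℝ F s p → fderivWithin ℝ F s p (1, 0) =
        chartD I z₀ (Φ p.1 (φ.symm p.2)) (v (Φ p.1 (φ.symm p.2))) := by
    rintro ⟨r, y⟩ hp hy hsrc hd
    have h1 := (hΦ.curve (φ.symm y) r hp.1).hasDerivWithinAt (x₀ := z₀) hsrc
    have h2 : HasDerivWithinAt (fun r' : ℝ => ((r', y) : ℝ × E)) (1, 0) (Icc 0 T) r :=
      (hasDerivWithinAt_id r _).prodMk (hasDerivWithinAt_const r _ y)
    have h3 := hd.hasFDerivWithinAt.comp_hasDerivWithinAt r h2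
      (show MapsTo (fun r' : ℝ => ((r', y) : ℝ × E)) (Icc 0 T) s from fun r' hr' => ⟨hr', hp.2⟩)
    exact (huI r hp.1).eq_deriv (Icc 0 T) h3 h1
  -- the derivative in the direction of `w`
  have hFw : ∀ r ∈ Icc 0 T, Φ r x ∈ ψ.source → DifferentiableWithinAt ℝ F s (r, φ x) →
      fderivWithin ℝ F s (r, φ x) ((0, w) : ℝ × E) = chartD I z₀ (Φ r x) (mfderiv I I (Φ r) x w) := by
    intro r hr hsrc hd
    have h2 : HasFDerivWithinAt (fun y : E => ((r, y) : ℝ × E)) (ContinuousLinearMap.inr ℝ ℝ E) (range I) (φ x) :=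
      (hasFDerivWithinAt_const r (φ x) _).prodMk (hasFDerivWithinAt_id (φ x) _)
    have h3 : HasFDerivWithinAt (fun y : E => F (r, y))
        ((fderivWithin ℝ F s (r, φ x)).comp (ContinuousLinearMap.inr ℝ ℝ E)) (range I) (φ x) :=
      hd.hasFDerivWithinAt.comp (φ x) h2 (fun y hy => ⟨hr, hy⟩)
    have h4 : HasMFDerivAt I I (Φ r) (φ.symm (φ x)) (mfderiv I I (Φ r) (φ.symm (φ x))) := by
      rw [hφx]; exact ((contMDiff_slice hsm hr).mdifferentiableAt (by simp)).hasMFDerivAt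
    have h5 := (mdifferentiableWithinAt_extChartAt_symm (I := I) (mem_extChartAt_target x)).hasMFDerivWithinAt
    have hsrc' : Φ r (φ.symm (φ x)) ∈ (chartAt H z₀).source := by rw [hφx, ← extChartAt_source I]; exact hsrc
    have h6 := (mdifferentiableAt_extChartAt (I := I) hsrc').hasMFDerivAt.comp_hasMFDerivWithinAt
      (φ x) (h4.comp_hasMFDerivWithinAt (φ x) h5)
    have h7 : HasFDerivWithinAt (fun y : E => F (r, y)) ((chartD I z₀ (Φ r (φ.symm (φ x)))).comp
          ((show E →L[ℝ] E from mfderiv I I (Φ r) (φ.symm (φ x))).comp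
            (chartDSymm I x (φ x)))) (range I) (φ x) := HasMFDerivWithinAt.hasFDerivWithinAt h6
    have h8 := DFunLike.congr_fun ((I.uniqueDiffOn _ hp₀s.2).eq h3 h7) (w : E)
    have h9 : chartDSymm I x (φ x) (w : E) = w := by
      have h := chartDSymm_chartD (E := E) (I := I) (mem_extChartAt_source x) w
      rwa [chartD_self (E := E) (I := I) x w] at h
    have h10 : fderivWithin ℝ F s (r, φ x) ((0, w) : ℝ × E) =
      chartD I z₀ (Φ r (φ.symm (φ x))) (mfderiv I I (Φ r) (φ.symm (φ x)) (chartDSymm I x (φ x) (w : E))) := h8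
    rw [h10, h9, hφx]
  set A := α.chartRep z₀ with hA
  set P : ℝ × E → (ℝ × E) →L[ℝ] ℝ := fun p => (1 : ℝ) • (A (F p)).comp (fderivWithin ℝ F s p) with hP
  have hFp₀ : F p₀ = ψ z₀ := by simp only [hF, hGp]
  have hAs : ContDiffWithinAt ℝ ∞ A (range I) (F p₀) := by
    rw [hFp₀]; exact α.contDiffWithinAt_chartRep (mem_extChartAt_target z₀)
  have hFr : ∀ᶠ p in 𝓝[s] p₀, F p ∈ range I := hgood.mono fun p hp =>
    extChartAt_target_subset_range z₀ (ψ.map_source hp.2.2)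
  have hPd : DifferentiableWithinAt ℝ P s p₀ := by
    have h1 : ContDiffWithinAt ℝ 1 (fun p => A (F p)) s p₀ := by
      have h2 := (hAs.comp_of_preimage_mem_nhdsWithin p₀ hFs hFr)
      exact h2.of_le (by simp)
    have e2 : (1 : WithTop ℕ∞) + 1 ≤ ∞ := by rw [one_add_one_eq_two]; exact WithTop.coe_le_coe.2 le_top
    have h3 := hFs.fderivWithin_right (m := 1) hus e2 hp₀s
    simp only [hP, one_smul]; exact (h1.clm_comp h3).differentiableWithinAt (by simp)
  have key := antiD_pullback (η := A) (f := F) (h := fun _ => (1 : ℝ)) (s := s) (t := range I)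
    (x := p₀) (hAs.differentiableWithinAt (by simp)) hFs (differentiableWithinAt_const _) hus hp₀s
    hsc hFr (P := P) (Eventually.of_forall fun _ => rfl) (1, 0) ((0, w) : ℝ × E)
  have hz₀s : z₀ ∈ ψ.source := mem_extChartAt_source z₀
  have hFd₀ : DifferentiableWithinAt ℝ F s p₀ := hFd.self_of_nhdsWithin hp₀s
  have hFt₀ := hFt p₀ hp₀s (mem_extChartAt_target x) (by rw [hGp]; exact hz₀s) hFd₀
  rw [hGp] at hFt₀; rw [hFt₀, hFw r₀ hr₀ hz₀s hFd₀, hFp₀] at key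
  -- the terms of the formula
  have hP0 : ∀ u : ℝ × E, fderivWithin ℝ P s p₀ u (1, 0) = 0 := by
    intro u
    have h1 : (fun p => P p (1, 0)) =ᶠ[𝓝[s] p₀] fun _ => 0 := by
      filter_upwards [hgood, hFd] with p hp hd
      change (1 : ℝ) • A (F p) (fderivWithin ℝ F s p (1, 0)) = 0; rw [hFt p hp.1 hp.2.1 hp.2.2 hd]
      have := α.chartRep_chartD hp.2.2 (v (Φ p.1 (φ.symm p.2)))
      have h2 : A (F p) (chartD I z₀ (Φ p.1 (φ.symm p.2)) (v (Φ p.1 (φ.symm p.2)))) = 0 := this.trans (hα _)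
      rw [h2, smul_zero]
    have h2 := (hPd.hasFDerivWithinAt.clm_apply (hasFDerivWithinAt_const ((1, 0) : ℝ × E) p₀ s))
    have h3 := h2.congr_of_eventuallyEq h1.symm (h1.self_of_nhdsWithin hp₀s).symm
    have h4 := (hus p₀ hp₀s).eq h3 (hasFDerivWithinAt_const (0 : ℝ) p₀ s)
    have h5 := DFunLike.congr_fun h4 u
    simpa using h5
  have hP1 : HasDerivWithinAt (fun r => P (r, φ x) ((0, w) : ℝ × E))
      (fderivWithin ℝ P s p₀ (1, 0) ((0, w) : ℝ × E)) (Icc 0 T) r₀ := by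
    have h2 : HasDerivWithinAt (fun r' : ℝ => ((r', φ x) : ℝ × E)) (1, 0) (Icc 0 T) r₀ :=
      (hasDerivWithinAt_id r₀ _).prodMk (hasDerivWithinAt_const r₀ _ (φ x))
    have h3 := hPd.hasFDerivWithinAt.comp_hasDerivWithinAt r₀ h2
      (show MapsTo (fun r' : ℝ => ((r', φ x) : ℝ × E)) (Icc 0 T) s from fun r' hr' => ⟨hr', hp₀s.2⟩)
    have h4 := h3.clm_apply (hasDerivWithinAt_const r₀ _ ((0, w) : ℝ × E))
    simpa using h4
  have hev : (fun r => α (Φ r x) (mfderiv I I (Φ r) x w)) =ᶠ[𝓝[Icc 0 T] r₀] fun r => P (r, φ x) ((0, w) : ℝ × E) := by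
    have ht : Tendsto (fun r : ℝ => ((r, φ x) : ℝ × E)) (𝓝[Icc 0 T] r₀) (𝓝[s] p₀) :=
      tendsto_nhdsWithin_iff.2 ⟨((by fun_prop : Continuous fun r : ℝ => ((r, φ x) : ℝ × E)).tendsto
        r₀).mono_left nhdsWithin_le_nhds, eventually_of_mem self_mem_nhdsWithin fun r hr => ⟨hr, hp₀s.2⟩⟩
    filter_upwards [ht.eventually hgood, ht.eventually hFd] with r hr hd
    have hsrc : Φ r x ∈ ψ.source := by have := hr.2.2; simp only [hφx] at this; exact this
    change _ = (1 : ℝ) • A (F (r, φ x)) (fderivWithin ℝ F s (r, φ x) ((0, w) : ℝ × E))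
    rw [hFw r hr.1.1 hsrc hd, one_smul]
    have h1 : F (r, φ x) = ψ (Φ r x) := by simp only [hF, hφx]
    rw [h1]; exact (α.chartRep_chartD hsrc _).symm
  have hfin : fderivWithin ℝ P s p₀ (1, 0) ((0, w) : ℝ × E) = α.d z₀ (v z₀) (mfderiv I I (Φ r₀) x w) := by
    have h1 := α.d_eq_dRep hz₀s (v z₀) (mfderiv I I (Φ r₀) x w)
    rw [h1]; rw [antiD, hP0] at key; simp only [fderivWithin_const_apply, hGp] at key
    have h2 : antiD A (range I) (ψ z₀) (chartD I z₀ z₀ (v z₀))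
      (chartD I z₀ z₀ (mfderiv I I (Φ r₀) x w)) = α.dRep z₀ (ψ z₀) (chartD I z₀ z₀ (v z₀))
      (chartD I z₀ z₀ (mfderiv I I (Φ r₀) x w)) := rfl
    rw [← h2]; simpa [hGp] using key
  rw [← hfin]; exact hP1.congr_of_eventuallyEq hev (hev.self_of_nhdsWithin hr₀)

theorem IsSemiflow.form_eq_exp (hΦ : IsSemiflow v T Φ)
    (hsm : ContMDiffOn ((ℐ).prod I) I ∞ (fun p : ℝ × M => Φ p.1 p.2) (Icc 0 T ×ˢ univ))
    {α : OneForm I M} (hα : ∀ x, α x (v x) = 0) {c : ℝ}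
    (hd : ∀ (x : M) (w : Tan I x), α.d x (v x) w = c * α x w)
    (x : M) (w : Tan I x) {r : ℝ} (hr : r ∈ Icc 0 T) :
    α (Φ r x) (mfderiv I I (Φ r) x w) = Real.exp (c * r) * α x w := by
  have h0 : α (Φ 0 x) (mfderiv I I (Φ 0) x w) = α x w := by rw [show Φ 0 = id from funext hΦ.init, mfderiv_id]; rfl
  rcases hr.1.eq_or_lt with h | h
  · rw [← h, h0]; simp
  have hT : 0 < T := h.trans_le hr.2
  set g : ℝ → ℝ := fun r => Real.exp (-(c * r)) * α (Φ r x) (mfderiv I I (Φ r) x w) with hg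
  have hder : ∀ r ∈ Icc 0 T, HasDerivWithinAt g 0 (Icc 0 T) r := by
    intro r hr
    have h1 := hΦ.hasDerivWithinAt_form hT hsm hα x w hr
    rw [hd] at h1
    have h2 : HasDerivWithinAt (fun r => Real.exp (-(c * r))) (Real.exp (-(c * r)) * (-(c * 1)))
      (Icc 0 T) r := (((hasDerivWithinAt_id r _).const_mul c).neg).exp
    refine (h2.mul h1).congr_deriv ?_
    ring
  have h3 := (convex_Icc (0 : ℝ) T).norm_image_sub_le_of_norm_hasDerivWithin_le (C := 0) hder
    (fun r _ => by simp) ⟨le_rfl, hT.le⟩ hr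
  rw [zero_mul, norm_le_zero_iff, sub_eq_zero] at h3
  simp only [hg, mul_zero, neg_zero, Real.exp_zero, one_mul, h0] at h3
  rw [← h3, ← mul_assoc, ← Real.exp_add, add_neg_cancel, Real.exp_zero, one_mul]

end FlowForms

/-! ### Continuous families of forms -/

section Families

variable {T : Type*} [TopologicalSpace T]

/-- `f` is a family of maps of class `C^n` on `u`, whose derivatives up to order `n` are jointly
continuous. -/
def Fam (u : Set E) : ℕ → ∀ (G : Type) [NormedAddCommGroup G] [NormedSpace ℝ G], (T → E → G) → Prop
  | 0, _, _, _, f => ContinuousOn (fun p : T × E => f p.1 p.2) (univ ×ˢ u)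
  | n + 1, G, _, _, f => ContinuousOn (fun p : T × E => f p.1 p.2) (univ ×ˢ u) ∧
      (∀ t, DifferentiableOn ℝ (f t) u) ∧ Fam u n (E →L[ℝ] G) (fun t => fderivWithin ℝ (f t) u)

variable {G G' G'' : Type} [NormedAddCommGroup G] [NormedSpace ℝ G]
  [NormedAddCommGroup G'] [NormedSpace ℝ G'] [NormedAddCommGroup G''] [NormedSpace ℝ G'']
  {u : Set E} {u' : Set E'} {n : ℕ}

theorem Fam.continuousOn {f : T → E → G} (h : Fam u n G f) : ContinuousOn (fun p : T × E => f p.1 p.2) (univ ×ˢ u) := by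
  cases n with
  | zero => exact h
  | succ n => exact h.1

theorem Fam.of_succ {f : T → E → G} (h : Fam u (n + 1) G f) : Fam u n G f := by
  induction n generalizing G with
  | zero => exact h.1
  | succ n ih => exact ⟨h.1, h.2.1, ih h.2.2⟩

theorem Fam.congr {f g : T → E → G} (h : Fam u n G f) (hfg : ∀ t, ∀ y ∈ u, g t y = f t y) : Fam u n G g := by
  induction n generalizing G with
  | zero => exact ContinuousOn.congr h fun p hp => hfg p.1 p.2 hp.2
  | succ n ih =>
    refine ⟨h.1.congr fun p hp => hfg p.1 p.2 hp.2, fun t => (h.2.1 t).congr (hfg t),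
      ih h.2.2 fun t y hy => fderivWithin_congr (hfg t) (hfg t y hy)⟩

theorem Fam.const {g : E → G} (hu : UniqueDiffOn ℝ u) (hg : ContDiffOn ℝ ∞ g u) : Fam u n G (fun _ : T => g) := by
  induction n generalizing G with
  | zero => exact hg.continuousOn.comp continuousOn_snd fun p hp => hp.2
  | succ n ih =>
    exact ⟨hg.continuousOn.comp continuousOn_snd fun p hp => hp.2,
      fun _ => hg.differentiableOn (by simp), ih (hg.fderivWithin hu (by simp))⟩

theorem Fam.add (hu : UniqueDiffOn ℝ u) {f g : T → E → G} (hf : Fam u n G f) (hg : Fam u n G g) :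
    Fam u n G (fun t y => f t y + g t y) := by
  induction n generalizing G with
  | zero => exact ContinuousOn.add hf hg
  | succ n ih =>
    refine ⟨hf.1.add hg.1, fun t => (hf.2.1 t).add (hg.2.1 t), (ih hf.2.2 hg.2.2).congr fun t y hy => ?_⟩
    exact fderivWithin_add (hu y hy) (hf.2.1 t y hy) (hg.2.1 t y hy)

theorem Fam.sum {ι : Type*} (A : Finset ι) (hu : UniqueDiffOn ℝ u) {f : ι → T → E → G}
    (hf : ∀ i ∈ A, Fam u n G (f i)) : Fam u n G (fun t y => ∑ i ∈ A, f i t y) := by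
  classical
  induction A using Finset.induction_on with
  | empty => simpa using Fam.const (T := T) (n := n) (g := fun _ => (0 : G)) hu contDiffOn_const
  | insert i A hi ih =>
    simp only [Finset.sum_insert hi]
    exact (hf i (Finset.mem_insert_self _ _)).add hu (ih fun j hj => hf j (Finset.mem_insert_of_mem hj))

theorem Fam.bilin (hu : UniqueDiffOn ℝ u) (B : G →L[ℝ] G' →L[ℝ] G'') {f : T → E → G}
    {g : T → E → G'} (hf : Fam u n G f) (hg : Fam u n G' g) : Fam u n G'' (fun t y => B (f t y) (g t y)) := by
  induction n generalizing G G' G'' with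
  | zero =>
    exact B.continuous₂.comp_continuousOn (ContinuousOn.prodMk hf hg)
  | succ n ih =>
    refine ⟨B.continuous₂.comp_continuousOn (ContinuousOn.prodMk hf.1 hg.1), fun t y hy => ?_, ?_⟩
    · exact (B.hasFDerivWithinAt_of_bilinear (hf.2.1 t y hy).hasFDerivWithinAt
        (hg.2.1 t y hy).hasFDerivWithinAt).differentiableWithinAt
    · refine ((ih (B.precompR E) hf.of_succ hg.2.2).add hu (ih (B.precompL E) hf.2.2 hg.of_succ)).congr fun t y hy => ?_
      exact (B.hasFDerivWithinAt_of_bilinear (hf.2.1 t y hy).hasFDerivWithinAt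
        (hg.2.1 t y hy).hasFDerivWithinAt).fderivWithin (hu y hy)

theorem Fam.smul (hu : UniqueDiffOn ℝ u) {f : T → E → ℝ} {g : T → E → G} (hf : Fam u n ℝ f)
    (hg : Fam u n G g) : Fam u n G (fun t y => f t y • g t y) :=
  Fam.bilin hu (ContinuousLinearMap.lsmul ℝ ℝ) hf hg

theorem Fam.comp_inner (hu : UniqueDiffOn ℝ u) (hu' : UniqueDiffOn ℝ u') {f : T → E → G}
    (hf : Fam u n G f) {g : E' → E} (hg : ContDiffOn ℝ ∞ g u') (hm : MapsTo g u' u) :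
    Fam u' n G (fun t y => f t (g y)) := by
  have hc : ContinuousOn (fun p : T × E' => f p.1 (g p.2)) (univ ×ˢ u') :=
    hf.continuousOn.comp (continuousOn_fst.prodMk (hg.continuousOn.comp continuousOn_snd
      fun p hp => hp.2)) fun p hp => ⟨mem_univ _, hm hp.2⟩
  induction n generalizing G with
  | zero => exact hc
  | succ n ih =>
    have hgd : ∀ y ∈ u', HasFDerivWithinAt g (fderivWithin ℝ g u' y) u' y := fun y hy =>
      (hg.differentiableOn (by simp) y hy).hasFDerivWithinAt
    have key : ∀ t, ∀ y ∈ u', HasFDerivWithinAt (fun y => f t (g y))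
        ((fderivWithin ℝ (f t) u (g y)).comp (fderivWithin ℝ g u' y)) u' y := fun t y hy =>
      (hf.2.1 t (g y) (hm hy)).hasFDerivWithinAt.comp y (hgd y hy) hm
    refine ⟨hc, fun t y hy => (key t y hy).differentiableWithinAt, ?_⟩
    have h1 := ih hf.2.2 (hf.2.2.continuousOn.comp (continuousOn_fst.prodMk
      (hg.continuousOn.comp continuousOn_snd fun p hp => hp.2)) fun p hp => ⟨mem_univ _, hm hp.2⟩)
    have h2 : Fam u' n (E' →L[ℝ] E) (fun _ : T => fderivWithin ℝ g u') := Fam.const hu' (hg.fderivWithin hu' (by simp))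
    exact (Fam.bilin hu' (ContinuousLinearMap.compL ℝ E' E G) h1 h2).congr fun t y hy =>
      (key t y hy).fderivWithin (hu' y hy)

theorem Fam.comp_outer (hu : UniqueDiffOn ℝ u) {f : T → E → ℝ} (hf : Fam u n ℝ f) {O : Set ℝ}
    (hO : IsOpen O) {g : ℝ → ℝ} (hg : ContDiffOn ℝ ∞ g O) (hm : ∀ t, ∀ y ∈ u, f t y ∈ O) :
    Fam u n ℝ (fun t y => g (f t y)) := by
  have hc : ∀ {g : ℝ → ℝ}, ContDiffOn ℝ ∞ g O → ContinuousOn (fun p : T × E => g (f p.1 p.2)) (univ ×ˢ u) := fun hg =>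
    hg.continuousOn.comp hf.continuousOn fun p hp => hm p.1 p.2 hp.2
  induction n generalizing g with
  | zero => exact hc hg
  | succ n ih =>
    have key : ∀ t, ∀ y ∈ u, HasFDerivWithinAt (fun y => g (f t y))
        (deriv g (f t y) • fderivWithin ℝ (f t) u y) u y := fun t y hy =>
      (((hg.differentiableOn (by simp)).differentiableAt (hO.mem_nhds (hm t y hy))).hasDerivAt).comp_hasFDerivWithinAt y
        (hf.2.1 t y hy).hasFDerivWithinAt
    refine ⟨hc hg, fun t y hy => (key t y hy).differentiableWithinAt, ?_⟩
    have h1 := ih hf.of_succ (hg.deriv_of_isOpen hO (m := ∞) (by simp))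
    exact (h1.smul hu hf.2.2).congr fun t y hy => (key t y hy).fderivWithin (hu y hy)

theorem fam_iff (hu : UniqueDiffOn ℝ u) {f : T → E → G} : Fam u n G f ↔
    (∀ t, ContDiffOn ℝ n (f t) u) ∧ ∀ k ≤ n, ContinuousOn
      (fun p : T × E => iteratedFDerivWithin ℝ k (f p.1) u p.2) (univ ×ˢ u) := by
  have h0 : ∀ {G : Type} [NormedAddCommGroup G] [NormedSpace ℝ G] (f : T → E → G),
      ContinuousOn (fun p : T × E => iteratedFDerivWithin ℝ 0 (f p.1) u p.2) (univ ×ˢ u) ↔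
      ContinuousOn (fun p : T × E => f p.1 p.2) (univ ×ˢ u) := by
    intro G _ _ f; simp only [iteratedFDerivWithin_zero_eq_comp, comp_apply]
    exact ((continuousMultilinearCurryFin0 ℝ E G).symm.toHomeomorph.isInducing.continuousOn_iff
      (f := fun p : T × E => f p.1 p.2)).symm
  have hs : ∀ {G : Type} [NormedAddCommGroup G] [NormedSpace ℝ G] (f : T → E → G) (k : ℕ),
      ContinuousOn (fun p : T × E => iteratedFDerivWithin ℝ (k + 1) (f p.1) u p.2) (univ ×ˢ u) ↔
      ContinuousOn (fun p : T × E => iteratedFDerivWithin ℝ k (fderivWithin ℝ (f p.1) u) u p.2) (univ ×ˢ u) := by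
    intro G _ _ f k
    have e : EqOn (fun p : T × E => iteratedFDerivWithin ℝ (k + 1) (f p.1) u p.2)
        (fun p => (continuousMultilinearCurryRightEquiv' ℝ k E G).symm
          (iteratedFDerivWithin ℝ k (fderivWithin ℝ (f p.1) u) u p.2)) (univ ×ˢ u) := fun p hp =>
      iteratedFDerivWithin_succ_eq_comp_right (f := f p.1) hu hp.2
    rw [continuousOn_congr e]
    exact ((continuousMultilinearCurryRightEquiv' ℝ k E G).symm.toHomeomorph.isInducing.continuousOn_iff
      (f := fun p : T × E => iteratedFDerivWithin ℝ k (fderivWithin ℝ (f p.1) u) u p.2)).symm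
  induction n generalizing G with
  | zero =>
    constructor
    · intro h
      refine ⟨fun t => ?_, fun k hk => ?_⟩
      · have : ContinuousOn (f t) u := ContinuousOn.comp (f := fun y : E => (t, y)) h
          (by fun_prop) fun y hy => ⟨mem_univ _, hy⟩
        simpa using (contDiffOn_zero (𝕜 := ℝ)).2 this
      · obtain rfl : k = 0 := by omega
        exact (h0 f).2 h
    · intro h; exact (h0 f).1 (h.2 0 le_rfl)
  | succ n ih =>
    have hcd : (∀ t, ContDiffOn ℝ (n + 1 : ℕ) (f t) u) ↔ (∀ t, DifferentiableOn ℝ (f t) u) ∧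
        ∀ t, ContDiffOn ℝ n (fderivWithin ℝ (f t) u) u := by
      rw [← forall_and]
      refine forall_congr' fun t => ?_
      have := contDiffOn_succ_iff_fderivWithin (𝕜 := ℝ) (n := (n : WithTop ℕ∞)) (f := f t) hu
      push_cast; rw [this]; simp
    change _ ∧ _ ∧ _ ↔ _
    have ih' := ih (G := E →L[ℝ] G) (f := fun t => fderivWithin ℝ (f t) u)
    rw [hcd]; constructor
    · rintro ⟨h1, h2, h3⟩
      refine ⟨⟨h2, (ih'.1 h3).1⟩, fun k hk => ?_⟩
      cases k with
      | zero => exact (h0 f).2 h1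
      | succ k => exact (hs f k).2 ((ih'.1 h3).2 k (by omega))
    · rintro ⟨⟨h2, h3⟩, h4⟩
      exact ⟨(h0 f).1 (h4 0 (by omega)), h2, ih'.2 ⟨h3, fun k hk => (hs f k).1 (h4 (k + 1) (by omega))⟩⟩

theorem Fam.of_local (hu : UniqueDiffOn ℝ u) {f : T → E → G}
    (h : ∀ y ∈ u, ∃ O : Set E, IsOpen O ∧ y ∈ O ∧ Fam (u ∩ O) n G f) : Fam u n G f := by
  rw [fam_iff hu]
  refine ⟨fun t y hy => ?_, fun k hk => ?_⟩
  · obtain ⟨O, hO, hyO, hF⟩ := h y hy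
    have := ((fam_iff (hu.inter hO)).1 hF).1 t y ⟨hy, hyO⟩
    exact this.mono_of_mem_nhdsWithin (inter_mem_nhdsWithin _ (hO.mem_nhds hyO))
  · rintro ⟨t, y⟩ hp
    obtain ⟨O, hO, hyO, hF⟩ := h y hp.2
    have h1 := ((fam_iff (hu.inter hO)).1 hF).2 k hk
    have h2 : ContinuousOn (fun p : T × E => iteratedFDerivWithin ℝ k (f p.1) u p.2)
        (univ ×ˢ (u ∩ O)) := h1.congr fun p hp => (iteratedFDerivWithin_inter_open hO hp.2.2).symm
    refine (h2 (t, y) ⟨mem_univ _, hp.2, hyO⟩).mono_of_mem_nhdsWithin ?_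
    have : univ ×ˢ (u ∩ O) = (univ ×ˢ u) ∩ (univ ×ˢ O : Set (T × E)) := by rw [prod_inter_prod, univ_inter]
    rw [this]; exact inter_mem_nhdsWithin _ ((isOpen_univ.prod hO).mem_nhds ⟨mem_univ _, hyO⟩)

namespace OneForm

theorem uniqueDiffOn_target (x₀ : M) : UniqueDiffOn ℝ (crd I x₀).target := by
  obtain ⟨U, hU, h⟩ := isOpen_target_inter I x₀
  rw [h]; exact I.uniqueDiffOn.inter hU

theorem exists_compact_nhds_target (x₀ : M) {y : E} (hy : y ∈ (crd I x₀).target) :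
    ∃ K : Set E, IsCompact K ∧ K ⊆ (crd I x₀).target ∧ y ∈ K ∧ K ∈ 𝓝[(crd I x₀).target] y := by
  obtain ⟨U, hU, h⟩ := isOpen_target_inter I x₀
  rw [h] at hy ⊢
  obtain ⟨r, hr, hrU⟩ := nhds_basis_closedBall.mem_iff.1 (hU.mem_nhds hy.2)
  refine ⟨range I ∩ closedBall y r, ?_, inter_subset_inter_right _ hrU, ⟨hy.1, mem_closedBall_self hr.le⟩, ?_⟩
  · rw [inter_comm]; exact (isCompact_closedBall y r).inter_right I.isClosed_range
  · filter_upwards [self_mem_nhdsWithin, mem_nhdsWithin_of_mem_nhds (closedBall_mem_nhds y hr)] with z hz hz'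
    exact ⟨hz.1, hz'⟩

theorem iteratedFDerivWithin_chartRep_eq (α : OneForm I M) (x₀ : M) (k : ℕ) {y : E}
    (hy : y ∈ (crd I x₀).target) : iteratedFDerivWithin ℝ k (α.chartRep x₀) (crd I x₀).target y =
      iteratedFDerivWithin ℝ k (α.chartRep x₀) (range I) y := by
  obtain ⟨U, hU, h⟩ := isOpen_target_inter I x₀
  rw [h] at hy ⊢; exact iteratedFDerivWithin_inter_open hU hy.2

theorem continuous_iff_fam {F : T → OneForm I M} : Continuous F ↔ ∀ (x₀ : M) (n : ℕ),
      Fam (crd I x₀).target n (E →L[ℝ] ℝ) (fun t => (F t).chartRep x₀) := by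
  have h1 : Continuous F ↔ ∀ (x₀ : M) (k : ℕ), ContinuousOn
      (fun p : T × E => iteratedFDerivWithin ℝ k ((F p.1).chartRep x₀) (range I) p.2) (univ ×ˢ (crd I x₀).target) := by
    rw [continuous_iInf_rng]
    refine forall_congr' fun x₀ => ?_
    rw [continuous_iInf_rng]
    refine forall_congr' fun k => ?_
    rw [continuous_induced_rng]
    set g : T → E → _ := fun t => iteratedFDerivWithin ℝ k ((F t).chartRep x₀) (range I) with hg
    have hgc : ∀ t, ContinuousOn (g t) (crd I x₀).target := by
      intro t
      have h := ((F t).contDiffOn_chartRep x₀).continuousOn_iteratedFDerivWithin (m := k)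
        (by exact_mod_cast le_top) (uniqueDiffOn_target x₀)
      exact h.congr fun y hy => (iteratedFDerivWithin_chartRep_eq (F t) x₀ k hy).symm
    rw [continuous_iff_continuousAt]; constructor
    · rintro h ⟨t, y⟩ ⟨-, hy⟩
      obtain ⟨K, hK, hKt, hyK, hKn⟩ := exists_compact_nhds_target x₀ hy
      have h2 := UniformOnFun.tendsto_iff_tendstoUniformlyOn.1 (h t) K ⟨hK, hKt⟩
      have h3 : ContinuousWithinAt (g t) K y := (hgc t y hy).mono hKt
      have h4 : Tendsto (fun p : T × E => g p.1 p.2) (𝓝 t ×ˢ 𝓝[K] y) (𝓝 (g t y)) := tendsto_nhds.2 fun ε hε => by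
          have h6 := tendstoUniformlyOn_iff.1 h2 (ε / 2) (half_pos hε)
          have h7 := tendsto_nhds.1 h3 (ε / 2) (half_pos hε)
          filter_upwards [h6.prod_mk (h7.and self_mem_nhdsWithin)] with p hp
          calc dist (g p.1 p.2) (g t y) ≤ dist (g p.1 p.2) (g t p.2) + dist (g t p.2) (g t y) :=
                dist_triangle _ _ _
            _ < ε := by
                have h8 : dist (g t p.2) (g p.1 p.2) < ε / 2 := hp.1 p.2 hp.2.2
                rw [dist_comm] at h8; linarith [hp.2.1]
      have h5 : 𝓝[univ ×ˢ (crd I x₀).target] (t, y) = 𝓝 t ×ˢ 𝓝[K] y := by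
        rw [nhdsWithin_prod_eq, nhdsWithin_univ]; congr 1
        exact le_antisymm (nhdsWithin_le_of_mem hKn) (nhdsWithin_mono _ hKt)
      rw [ContinuousWithinAt, h5]; exact h4
    · intro h t
      refine UniformOnFun.tendsto_iff_tendstoUniformlyOn.2 fun K hK => ?_
      refine tendstoUniformlyOn_iff.2 fun ε hε => ?_
      obtain ⟨v, hv, hvW⟩ := hK.1.mem_uniformity_of_prod (f := g) (s := univ)
        (h.mono (prod_mono_right hK.2)) (mem_univ t) (dist_mem_uniformity hε)
      rw [nhdsWithin_univ] at hv
      filter_upwards [hv] with p hp y hy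
      have h8 : dist (g p y) (g t y) < ε := hvW p hp y hy
      rw [dist_comm] at h8; exact h8
  rw [h1]
  refine forall_congr' fun x₀ => ?_
  have key : ∀ k : ℕ, ContinuousOn (fun p : T × E => iteratedFDerivWithin ℝ k ((F p.1).chartRep x₀) (range I) p.2)
        (univ ×ˢ (crd I x₀).target) ↔ ContinuousOn
      (fun p : T × E => iteratedFDerivWithin ℝ k ((F p.1).chartRep x₀) (crd I x₀).target p.2)
        (univ ×ˢ (crd I x₀).target) := fun k =>
    continuousOn_congr fun p hp => (iteratedFDerivWithin_chartRep_eq (F p.1) x₀ k hp.2).symm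
  constructor
  · intro h n; rw [fam_iff (uniqueDiffOn_target x₀)]
    exact ⟨fun t => ((F t).contDiffOn_chartRep x₀).of_le (by exact_mod_cast le_top), fun k _ => (key k).1 (h k)⟩
  · intro h k; exact (key k).2 (((fam_iff (uniqueDiffOn_target x₀)).1 (h k)).2 k le_rfl)

theorem fam_of_continuous {u : Set E} (hu : UniqueDiffOn ℝ u) {c : T → ℝ} (hc : Continuous c)
    (n : ℕ) : Fam u n ℝ (fun t _ => c t) := by
  cases n with
  | zero => exact (hc.comp continuous_fst).continuousOn
  | succ n =>
    refine ⟨(hc.comp continuous_fst).continuousOn, fun t => differentiableOn_const _, ?_⟩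
    refine (Fam.const (g := fun _ => 0) hu contDiffOn_const).congr fun t y hy => ?_
    simp

theorem continuous_add {F G : T → OneForm I M} (hF : Continuous F) (hG : Continuous G) :
    Continuous fun t => F t + G t := by
  rw [continuous_iff_fam] at *
  exact fun x₀ n => (hF x₀ n).add (uniqueDiffOn_target x₀) (hG x₀ n)

theorem continuous_smul {c : T → ℝ} (hc : Continuous c) {F : T → OneForm I M}
    (hF : Continuous F) : Continuous fun t => c t • F t := by
  rw [continuous_iff_fam] at *
  exact fun x₀ n => (fam_of_continuous (uniqueDiffOn_target x₀) hc n).smul (uniqueDiffOn_target x₀) (hF x₀ n)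

theorem contDiffWithinAt_coord {f : N → M} {x₀ : N} {z₀ : M} {y : E'}
    (hy : y ∈ (crd J x₀).target) (hf : ContMDiffAt J I ∞ f ((crd J x₀).symm y))
    (hs : f ((crd J x₀).symm y) ∈ (crd I z₀).source) :
    ContDiffWithinAt ℝ ∞ (fun y => crd I z₀ (f ((crd J x₀).symm y))) (range J) y := by
  rw [← contMDiffWithinAt_iff_contDiffWithinAt]
  have h1 : ContMDiffAt I 𝓘(ℝ, E) ∞ (crd I z₀) (f ((crd J x₀).symm y)) :=
    contMDiffAt_extChartAt' (by rwa [extChartAt_source] at hs)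
  exact (h1.comp _ hf).comp_contMDiffWithinAt y (contMDiffWithinAt_extChartAt_symm_range x₀ hy)

theorem fderivWithin_coord {f : N → M} {x₀ : N} {z₀ : M} {y : E'}
    (hy : y ∈ (crd J x₀).target) (hd : MDifferentiableAt J I f ((crd J x₀).symm y))
    (hs : f ((crd J x₀).symm y) ∈ (crd I z₀).source) (e : E') :
    fderivWithin ℝ (fun y => crd I z₀ (f ((crd J x₀).symm y))) (range J) y e =
      chartD I z₀ (f ((crd J x₀).symm y)) (mfderiv J I f ((crd J x₀).symm y) (chartDSymm J x₀ y e)) := by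
  rw [extChartAt_source] at hs
  have h1 := (mdifferentiableWithinAt_extChartAt_symm (I := J) hy).hasMFDerivWithinAt
  have h2 := (mdifferentiableAt_extChartAt (I := I) hs).hasMFDerivAt.comp_hasMFDerivWithinAt y
    (hd.hasMFDerivAt.comp_hasMFDerivWithinAt y h1)
  have h3 : HasFDerivWithinAt (fun y => crd I z₀ (f ((crd J x₀).symm y))) ((chartD I z₀ (f ((crd J x₀).symm y))).comp
        ((show E' →L[ℝ] E from mfderiv J I f ((crd J x₀).symm y)).comp (chartDSymm J x₀ y)))
      (range J) y := HasMFDerivWithinAt.hasFDerivWithinAt h2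
  exact DFunLike.congr_fun (h3.fderivWithin (J.uniqueDiffOn y (extChartAt_target_subset_range x₀ hy))) e

theorem chartRep_weightedPullback (α : OneForm I M) {h : N → ℝ} (hh : ContMDiff J ℐ ∞ h)
    {f : N → M} {U : Set N} (hU : IsOpen U) (hf : ContMDiffOn J I ∞ f U) (hsupp : tsupport h ⊆ U)
    {x₀ : N} {z₀ : M} {y : E'} (hy : y ∈ (crd J x₀).target)
    (hyU : (crd J x₀).symm y ∈ U)
    (hs : f ((crd J x₀).symm y) ∈ (crd I z₀).source) :
    (α.weightedPullback h hh f hU hf hsupp).chartRep x₀ y = h ((crd J x₀).symm y) •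
      (α.chartRep z₀ (crd I z₀ (f ((crd J x₀).symm y)))).comp
        (fderivWithin ℝ (fun y => crd I z₀ (f ((crd J x₀).symm y))) (range J) y) := by
  ext e
  have hd : MDifferentiableAt J I f ((crd J x₀).symm y) :=
    (hf.contMDiffAt (hU.mem_nhds hyU)).mdifferentiableAt (by simp)
  have h9 := α.chartRep_chartD hs (mfderiv J I f ((crd J x₀).symm y) (chartDSymm J x₀ y e))
  have h10 := fderivWithin_coord (I := I) (z₀ := z₀) hy hd hs e
  rw [← h10] at h9; exact congrArg (h ((crd J x₀).symm y) * ·) h9.symm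

theorem exists_open_coord (x₀ : N) {U : Set N} (hU : IsOpen U) :
    ∃ O : Set E', IsOpen O ∧ ∀ y ∈ (crd J x₀).target, (y ∈ O ↔ (crd J x₀).symm y ∈ U) := by
  obtain ⟨O, hO, h⟩ := continuousOn_iff'.1 (continuousOn_extChartAt_symm (I := J) x₀) U hU
  refine ⟨O, hO, fun y hy => ?_⟩
  have := Set.ext_iff.1 h y
  simp only [mem_inter_iff, hy, and_true, mem_preimage] at this; exact this.symm

theorem continuous_weightedPullback {F : T → OneForm I M} (hF : Continuous F) {h : N → ℝ}
    (hh : ContMDiff J ℐ ∞ h) {f : N → M} {U : Set N} (hU : IsOpen U)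
    (hf : ContMDiffOn J I ∞ f U) (hsupp : tsupport h ⊆ U) :
    Continuous fun t => (F t).weightedPullback h hh f hU hf hsupp := by
  rw [continuous_iff_fam] at *
  intro x₀ n
  have hut := uniqueDiffOn_target (I := J) x₀
  refine Fam.of_local hut fun y hy => ?_
  by_cases hx : (crd J x₀).symm y ∈ U
  · set z₀ := f ((crd J x₀).symm y) with hz₀
    have hU' : IsOpen (U ∩ f ⁻¹' (crd I z₀).source) :=
      hf.continuousOn.isOpen_inter_preimage hU (isOpen_extChartAt_source z₀)
    obtain ⟨O, hO, hOiff⟩ := exists_open_coord (J := J) x₀ hU'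
    refine ⟨O, hO, (hOiff y hy).2 ⟨hx, mem_extChartAt_source z₀⟩, ?_⟩
    have huO := hut.inter hO
    have hmem : ∀ y ∈ (crd J x₀).target ∩ O, (crd J x₀).symm y ∈ U ∧
        f ((crd J x₀).symm y) ∈ (crd I z₀).source := fun y hy => (hOiff y hy.1).1 hy.2
    set G : E' → E := fun y => crd I z₀ (f ((crd J x₀).symm y)) with hG
    have hGs : ∀ y ∈ (crd J x₀).target ∩ O, ContDiffWithinAt ℝ ∞ G (range J) y :=
      fun y hy => contDiffWithinAt_coord hy.1 (hf.contMDiffAt (hU.mem_nhds (hmem y hy).1)) (hmem y hy).2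
    have hsub : (crd J x₀).target ∩ O ⊆ range J := fun y hy => extChartAt_target_subset_range x₀ hy.1
    have hA : ContDiffOn ℝ ∞ (fderivWithin ℝ G (range J)) ((crd J x₀).target ∩ O) :=
      fun y hy => ((hGs y hy).fderivWithin_right J.uniqueDiffOn (by simp) (hsub hy)).mono hsub
    have hGO : ContDiffOn ℝ ∞ G ((crd J x₀).target ∩ O) := fun y hy => (hGs y hy).mono hsub
    have hhO : ContDiffOn ℝ ∞ (fun y => h ((crd J x₀).symm y)) ((crd J x₀).target ∩ O) := by
      rw [← contMDiffOn_iff_contDiffOn]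
      exact (hh.comp_contMDiffOn (contMDiffOn_extChartAt_symm x₀)).mono inter_subset_left
    have h1 := (hF z₀ n).comp_inner (uniqueDiffOn_target z₀) huO hGO (fun y hy => (crd I z₀).map_source (hmem y hy).2)
    have h2 : Fam ((crd J x₀).target ∩ O) n (E' →L[ℝ] E) (fun _ : T => fderivWithin ℝ G (range J)) := Fam.const huO hA
    have h3 := (Fam.const (T := T) (n := n) huO hhO).smul huO (Fam.bilin huO (ContinuousLinearMap.compL ℝ E' E ℝ) h1 h2)
    exact h3.congr fun t y hy => chartRep_weightedPullback (F t) hh hU hf hsupp hy.1 (hmem y hy).1 (hmem y hy).2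
  · obtain ⟨O, hO, hOiff⟩ := exists_open_coord (J := J) x₀ (isClosed_tsupport h).isOpen_compl
    refine ⟨O, hO, (hOiff y hy).2 fun h' => hx (hsupp h'), ?_⟩
    refine (Fam.const (g := fun _ => 0) (hut.inter hO) contDiffOn_const).congr fun t y hy => ?_
    have h0 : h ((crd J x₀).symm y) = 0 := image_eq_zero_of_notMem_tsupport ((hOiff y hy.1).1 hy.2)
    ext e; rw [chartRep_apply]; change h ((crd J x₀).symm y) * _ = 0; rw [h0, zero_mul]

theorem pullback_eq_weightedPullback (α : OneForm I M) {f : N → M} (hf : ContMDiff J I ∞ f) :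
    α.pullback f hf = α.weightedPullback (fun _ => 1) contMDiff_const f isOpen_univ hf.contMDiffOn (subset_univ _) := by
  ext x w; rw [weightedPullback_apply, one_mul, pullback_apply]

theorem continuous_pullback {F : T → OneForm I M} (hF : Continuous F) {f : N → M}
    (hf : ContMDiff J I ∞ f) : Continuous fun t => (F t).pullback f hf := by
  simp only [pullback_eq_weightedPullback]; exact continuous_weightedPullback hF _ _ _ _

theorem chartRep_fmul (α : OneForm I M) {h : M → ℝ} (hh : ContMDiff I ℐ ∞ h) (x₀ : M)
    (y : E) : (fmul h hh α).chartRep x₀ y = h ((crd I x₀).symm y) • α.chartRep x₀ y := by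
  ext e; exact fmul_apply h hh α ((crd I x₀).symm y) (chartDSymm I x₀ y e)

theorem continuous_fmul {F : T → OneForm I M} (hF : Continuous F) {h : T → M → ℝ} (hh : ∀ t, ContMDiff I ℐ ∞ (h t))
    (hfam : ∀ (x₀ : M) (n : ℕ), Fam (crd I x₀).target n ℝ (fun t y => h t ((crd I x₀).symm y))) :
    Continuous fun t => fmul (h t) (hh t) (F t) := by
  rw [continuous_iff_fam] at *
  exact fun x₀ n => ((hfam x₀ n).smul (uniqueDiffOn_target x₀) (hF x₀ n)).congr
    fun t y _ => chartRep_fmul (F t) (hh t) x₀ y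

/-! ### Joint continuity of the values -/

theorem apply_constSection (α : OneForm I M) {x₀ x : M} (hx : x ∈ (crd I x₀).source)
    (e : E) : α x (constSection I x₀ e x) = α.chartRep x₀ (crd I x₀ x) e := by
  rw [chartRep_apply, (crd I x₀).left_inv hx]; rfl

theorem d_constSection (α : OneForm I M) {x₀ x : M} (hx : x ∈ (crd I x₀).source)
    (e e' : E) : α.d x (constSection I x₀ e x) (constSection I x₀ e' x) = α.dRep x₀ (crd I x₀ x) e e' := by
  have h := d_eq_dRep α hx (constSection I x₀ e x) (constSection I x₀ e' x)
  rw [h]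
  have h1 : ∀ e : E, chartD I x₀ x (constSection I x₀ e x) = e := fun e => chartD_chartDSymm' hx e
  rw [h1, h1]

theorem continuousOn_apply {F : T → OneForm I M} (hF : Continuous F) (x₀ : M) (e : E) :
    ContinuousOn (fun p : T × M => F p.1 p.2 (constSection I x₀ e p.2)) (univ ×ˢ (crd I x₀).source) := by
  have h1 := (continuous_iff_fam.1 hF x₀ 0).continuousOn
  have h2 : ContinuousOn (fun p : T × M => (p.1, crd I x₀ p.2)) (univ ×ˢ (crd I x₀).source) :=
    continuousOn_fst.prodMk ((continuousOn_extChartAt x₀).comp continuousOn_snd fun p hp => hp.2)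
  refine ((h1.comp h2 fun p hp => ⟨mem_univ _, (crd I x₀).map_source hp.2⟩).clm_apply
    (continuousOn_const (c := e))).congr fun p hp => ?_
  exact apply_constSection (F p.1) hp.2 e

theorem continuousOn_d {F : T → OneForm I M} (hF : Continuous F) (x₀ : M) (e e' : E) :
    ContinuousOn (fun p : T × M => (F p.1).d p.2 (constSection I x₀ e p.2)
      (constSection I x₀ e' p.2)) (univ ×ˢ (crd I x₀).source) := by
  have h1 := (continuous_iff_fam.1 hF x₀ 1).2.2.continuousOn
  have h2 : ContinuousOn (fun p : T × M => (p.1, crd I x₀ p.2)) (univ ×ˢ (crd I x₀).source) :=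
    continuousOn_fst.prodMk ((continuousOn_extChartAt x₀).comp continuousOn_snd fun p hp => hp.2)
  have h3 := h1.comp h2 fun p hp => ⟨mem_univ _, (crd I x₀).map_source hp.2⟩
  have h4 : ∀ e e' : E, ContinuousOn (fun p : T × M => fderivWithin ℝ ((F p.1).chartRep x₀)
      (crd I x₀).target (crd I x₀ p.2) e e') (univ ×ˢ (crd I x₀).source) :=
    fun e e' => (h3.clm_apply (continuousOn_const (c := e))).clm_apply (continuousOn_const (c := e'))
  refine ((h4 e e').sub (h4 e' e)).congr fun p hp => ?_
  rw [d_constSection (F p.1) hp.2]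
  have hy := (crd I x₀).map_source hp.2
  obtain ⟨U, hU, h⟩ := isOpen_target_inter I x₀
  have h5 : fderivWithin ℝ ((F p.1).chartRep x₀) (crd I x₀).target (crd I x₀ p.2) =
      fderivWithin ℝ ((F p.1).chartRep x₀) (range I) (crd I x₀ p.2) := by
    rw [h] at hy ⊢; exact fderivWithin_inter (hU.mem_nhds hy.2)
  change _ = fderivWithin ℝ ((F p.1).chartRep x₀) (crd I x₀).target
    (crd I x₀ p.2) e e' - fderivWithin ℝ ((F p.1).chartRep x₀) (crd I x₀).target
    (crd I x₀ p.2) e' e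
  rw [h5]; rfl

/-- The value of a 1-form at a point, as a linear map. -/
def cov (α : OneForm I M) (x : M) : Tan I x →ₗ[ℝ] ℝ := (α x).toLinearMap

theorem cov_apply (α : OneForm I M) (x : M) (u : Tan I x) : α.cov x u = α x u := rfl

/-- The exterior derivative at a point, as a bilinear map. -/
def dLin (α : OneForm I M) (x : M) : Bil (Tan I x) := LinearMap.mk₂ ℝ (α.d x) (fun u u' w => d_add_left α x u u' w)
    (fun c u w => d_smul_left α x c u w) (fun u w w' => d_add_right α x u w w')
    (fun c u w => d_smul_right α x c u w)

theorem dLin_apply (α : OneForm I M) (x : M) (u w : Tan I x) : α.dLin x u w = α.d x u w := rfl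

theorem dLin_self (α : OneForm I M) (x : M) (u : Tan I x) : α.dLin x u u = 0 := d_self α x u

variable (I) in
/-- A basis of the tangent space with constant coordinates in the chart at `x₀`. -/
def frame {ι : Type*} (b : Basis ι ℝ E) {x₀ x : M} (hx : x ∈ (crd I x₀).source) : Basis ι ℝ (Tan I x) :=
  b.map (LinearEquiv.ofBijective (chartD I x₀ x).toLinearMap ⟨chartD_injective hx, chartD_surjective hx⟩).symm

theorem frame_apply {ι : Type*} (b : Basis ι ℝ E) {x₀ x : M}
    (hx : x ∈ (crd I x₀).source) (i : ι) : frame I b hx i = constSection I x₀ (b i) x := by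
  apply chartD_injective hx
  have h1 : chartD I x₀ x (constSection I x₀ (b i) x) = b i := chartD_chartDSymm' hx (b i)
  rw [h1]
  exact LinearEquiv.apply_symm_apply (LinearEquiv.ofBijective (chartD I x₀ x).toLinearMap
    ⟨chartD_injective hx, chartD_surjective hx⟩) (b i)

/-- A family of bilinear forms on the tangent spaces which is continuous in charts. -/
def ContBilin (A : T → ∀ x : M, Bil (Tan I x)) : Prop :=
  ∀ (x₀ : M) (e e' : E), ContinuousOn (fun p : T × M => A p.1 p.2 (constSection I x₀ e p.2)
      (constSection I x₀ e' p.2)) (univ ×ˢ (crd I x₀).source)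

theorem contBilin_dLin {F : T → OneForm I M} (hF : Continuous F) :
    ContBilin (fun t x => (F t).dLin x) := fun x₀ e e' => continuousOn_d hF x₀ e e'

theorem contBilin_wedge {F G : T → OneForm I M} (hF : Continuous F) (hG : Continuous G) :
    ContBilin (fun t x => wedge ((F t).cov x) ((G t).cov x)) := fun x₀ e e' =>
  ((continuousOn_apply hF x₀ e).mul (continuousOn_apply hG x₀ e')).sub
    ((continuousOn_apply hF x₀ e').mul (continuousOn_apply hG x₀ e))

theorem continuous_volRatio {A B C : T → ∀ x : M, Bil (Tan I x)} (bE : Basis (Fin 4) ℝ E)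
    (hA : ContBilin A) (hB : ContBilin B) (hC : ContBilin C)
    (hA' : ∀ t x u, A t x u u = 0) (hB' : ∀ t x u, B t x u u = 0)
    (hC' : ∀ t x u, C t x u u = 0)
    (hne : ∀ t x (b : Basis (Fin 4) ℝ (Tan I x)), pf (C t x) b ≠ 0) :
    Continuous fun p : T × M => volRatio (A p.1 p.2) (B p.1 p.2) (C p.1 p.2) := by
  rw [continuous_iff_continuousAt]; rintro ⟨t, x₀⟩
  have hm : (univ ×ˢ (crd I x₀).source : Set (T × M)) ∈ 𝓝 (t, x₀) :=
    prod_mem_nhds univ_mem (extChartAt_source_mem_nhds x₀)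
  refine ContinuousOn.continuousAt ?_ hm
  have key : ContinuousOn (fun p : T × M => pf2 (A p.1 p.2) (B p.1 p.2) (fun i => constSection I x₀ (bE i) p.2) /
        pf (C p.1 p.2) (fun i => constSection I x₀ (bE i) p.2))
      (univ ×ˢ (crd I x₀).source) := by
    refine ContinuousOn.div ?_ ?_ ?_
    · exact (((((((hA x₀ _ _).mul (hB x₀ _ _)).sub ((hA x₀ _ _).mul (hB x₀ _ _))).add
        ((hA x₀ _ _).mul (hB x₀ _ _))).add ((hA x₀ _ _).mul (hB x₀ _ _))).sub
        ((hA x₀ _ _).mul (hB x₀ _ _))).add ((hA x₀ _ _).mul (hB x₀ _ _)))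
    · exact (((hC x₀ _ _).mul (hC x₀ _ _)).sub ((hC x₀ _ _).mul (hC x₀ _ _))).add ((hC x₀ _ _).mul (hC x₀ _ _))
    · intro p hp
      have := hne p.1 p.2 (frame I bE hp.2)
      rwa [show ⇑(frame I bE hp.2) = fun i => constSection I x₀ (bE i) p.2 from
        funext fun i => frame_apply bE hp.2 i] at this
  refine key.congr fun p hp => ?_
  have h := volRatio_eq (hA' p.1 p.2) (hB' p.1 p.2) (hC' p.1 p.2) (frame I bE hp.2)
  rwa [show ⇑(frame I bE hp.2) = fun i => constSection I x₀ (bE i) p.2 from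
        funext fun i => frame_apply bE hp.2 i] at h

end OneForm

end Families

section VectorFields

theorem OneForm.contMDiff_apply (α : OneForm I M) {Y : ∀ x : M, Tan I x} (hY : SmoothField Y) :
    ContMDiff I ℐ ∞ (fun x => α x (Y x)) := α.smooth.comp hY

variable [T2Space M] [CompactSpace M]

theorem exists_vectorField_eq_constSection (x₀ : M) (e : E) : ∃ Y : ∀ x : M, Tan I x, SmoothField Y ∧
      ∀ᶠ x in 𝓝 x₀, Y x = OneForm.constSection I x₀ e x := by
  obtain ⟨K, hK, hKc, hKs⟩ := exists_mem_nhds_isClosed_subset (chart_source_mem_nhds H x₀)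
  set t : ∀ x : M, Set (Tan I x) := fun x => {w | x ∈ K → w = OneForm.constSection I x₀ e x}
  suffices h : (∀ x, Convex ℝ (t x)) ∧ ∀ x₁ : M, ∃ U ∈ 𝓝 x₁, ∃ Y : ∀ x : M, Tan I x,
      ContMDiffOn I I.tangent ∞ (fun x => (⟨x, Y x⟩ : TangentBundle I M)) U ∧ ∀ y ∈ U, Y y ∈ t y by
    obtain ⟨Y, hY⟩ := exists_contMDiffSection_forall_mem_convex_of_local (n := ⊤)
      (F_fiber := E) I (fun x : M => Tan I x) t h.1 h.2
    exact ⟨Y, Y.contMDiff, eventually_of_mem hK fun x hx => hY x hx⟩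
  refine ⟨fun x w hw w' hw' a b ha hb hab hx => ?_, fun x₁ => ?_⟩
  · rw [hw hx, hw' hx, ← add_smul, hab, one_smul]
  · by_cases h : x₁ ∈ K
    · exact ⟨(chartAt H x₀).source, (chartAt H x₀).open_source.mem_nhds (hKs h),
        OneForm.constSection I x₀ e, OneForm.contMDiffOn_constSection x₀ e, fun y _ _ => rfl⟩
    · refine ⟨Kᶜ, hKc.isOpen_compl.mem_nhds h, fun _ => 0, ?_, fun y hy h' => absurd h' hy⟩
      exact (Bundle.contMDiff_zeroSection ℝ (Tan I : M → Type _)).contMDiffOn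

theorem OneForm.fam_apply {T : Type*} [TopologicalSpace T] {F : T → OneForm I M} (hF : Continuous F)
    {Y : ∀ x : M, Tan I x}
    (hY : SmoothField Y) (x₀ : M) (n : ℕ) : Fam (crd I x₀).target n ℝ
      (fun t y => F t ((crd I x₀).symm y) (Y ((crd I x₀).symm y))) := by
  have hu := OneForm.uniqueDiffOn_target (I := I) x₀
  refine ((OneForm.continuous_iff_fam.1 hF x₀ n).bilin hu (ContinuousLinearMap.id ℝ (E →L[ℝ] ℝ))
    (Fam.const hu (contMDiff_vectorField_iff.1 hY x₀))).congr fun t y hy => ?_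
  have h := OneForm.chartRep_chartD (F t) (x₀ := x₀) ((crd I x₀).map_target hy) (Y ((crd I x₀).symm y))
  rw [(crd I x₀).right_inv hy] at h; exact h.symm

variable (I M) in
theorem exists_spanning_vectorFields : ∃ (m : ℕ) (Y : Fin m → ∀ x : M, Tan I x), (∀ i, SmoothField (Y i)) ∧
      ∀ (α : OneForm I M) (x : M), (∀ i, α x (Y i x) = 0) → α x = 0 := by
  set b := Module.finBasis ℝ E
  choose Y hY hY' using fun (x₀ : M) (i : Fin (finrank ℝ E)) =>
    exists_vectorField_eq_constSection (I := I) x₀ (b i)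
  have h1 : ∀ x₀ : M, ∀ᶠ x in 𝓝 x₀, x ∈ (crd I x₀).source ∧
      ∀ i, Y x₀ i x = OneForm.constSection I x₀ (b i) x := fun x₀ =>
    Eventually.and (extChartAt_source_mem_nhds (I := I) x₀) (eventually_all.2 (hY' x₀))
  obtain ⟨A, -, hA⟩ := isCompact_univ.elim_nhds_subcover _ fun x₀ (_ : x₀ ∈ (univ : Set M)) => h1 x₀
  set e := Fintype.equivFin (A × Fin (finrank ℝ E))
  refine ⟨_, fun i => Y (e.symm i).1 (e.symm i).2, fun i => hY _ _, fun α x hx => ?_⟩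
  obtain ⟨x₀, hx₀, hs, hx'⟩ := mem_iUnion₂.1 (hA (mem_univ x))
  have h2 : (α x).toLinearMap = 0 := by
    refine (OneForm.frame I b hs).ext fun i => ?_
    rw [OneForm.frame_apply, ← hx' i]; simpa using hx (e (⟨x₀, hx₀⟩, i))
  ext w; exact LinearMap.congr_fun h2 w

end VectorFields

/-! ### Moser's method for exact symplectic forms -/

theorem mvfderiv_comp_hasDerivAt {g : ℝ → ℝ} {s : M → ℝ} {x : M} {c : ℝ} (hg : HasDerivAt g c (s x))
    (hs : MDifferentiableAt I ℐ s x) (w : Tan I x) : mvfderiv I (fun x => g (s x)) x w = c * mvfderiv I s x w :=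
  (DFunLike.congr_fun (HasMFDerivAt.comp x hg.hasFDerivAt.hasMFDerivAt hs.hasMFDerivAt).mfderiv w).trans
    (mul_comm (mvfderiv I s x w : ℝ) c)

theorem mvfderiv_comp_real {g : ℝ → ℝ} (hg : ContDiff ℝ ∞ g) {s : M → ℝ} {x : M}
    (hs : MDifferentiableAt I ℐ s x) (w : Tan I x) :
    mvfderiv I (fun x => g (s x)) x w = deriv g (s x) * mvfderiv I s x w :=
  mvfderiv_comp_hasDerivAt (hg.differentiable (by simp) (s x)).hasDerivAt hs w

theorem abs_mvfderiv_sqrt {f : M → ℝ} {x : M} (hf : MDifferentiableAt I ℐ f x) (w : Tan I x) :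
    |mvfderiv I (fun x => √(1 + f x ^ 2)) x w| ≤ |mvfderiv I f x w| := by
  have hp : ∀ r : ℝ, 0 < 1 + r ^ 2 := fun r => by positivity
  have h : ContDiff ℝ ∞ fun r : ℝ => √(1 + r ^ 2) := ContDiff.sqrt (by fun_prop) fun r => (hp r).ne'
  have h1 : deriv (fun r : ℝ => √(1 + r ^ 2)) (f x) = f x / √(1 + f x ^ 2) := by
    have h2 : HasDerivAt (fun r : ℝ => 1 + r ^ 2) (2 * f x) (f x) := by simpa using (hasDerivAt_pow 2 (f x)).const_add 1
    rw [(h2.sqrt (hp _).ne').deriv]; field_simp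
  rw [mvfderiv_comp_real (g := fun r : ℝ => √(1 + r ^ 2)) h hf, h1, abs_mul]
  refine mul_le_of_le_one_left (abs_nonneg _) ?_
  rw [abs_div, abs_of_pos (Real.sqrt_pos.2 (hp _)), div_le_one (Real.sqrt_pos.2 (hp _))]
  exact Real.abs_le_sqrt (by linarith)

section Moser

open OneForm

variable [I.Boundaryless] [T2Space M]

/-- The model of `Ext M`. -/
abbrev extModel (I : ModelWithCorners ℝ E H) : ModelWithCorners ℝ ((E × ℝ) × ℝ) (ModelProd (ModelProd H ℝ) ℝ) :=
  (I.prod ℐ).prod ℐ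

theorem mfderiv_components (n : Ext M) (w : Tan (extModel I) n) :
    mfderiv (extModel I) I (fun n : Ext M => n.1.1) n w = w.1.1 ∧
    mvfderiv (extModel I) (fun n : Ext M => n.1.2) n w = w.1.2 ∧
    mvfderiv (extModel I) (fun n : Ext M => n.2) n w = w.2 := by
  have h1 : HasMFDerivAt (extModel I) I (fun n : Ext M => n.1.1) n _ :=
    HasMFDerivAt.comp n (hasMFDerivAt_fst (x := n.1)) (hasMFDerivAt_fst (x := n))
  have h2 : HasMFDerivAt (extModel I) ℐ (fun n : Ext M => n.1.2) n _ :=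
    HasMFDerivAt.comp n (hasMFDerivAt_snd (x := n.1)) (hasMFDerivAt_fst (x := n))
  exact ⟨DFunLike.congr_fun h1.mfderiv w, DFunLike.congr_fun h2.mfderiv w,
    DFunLike.congr_fun (hasMFDerivAt_snd (x := n)).mfderiv w⟩

/-- The situation of Moser's method: a linear family of exact symplectic forms with the same
Liouville vector field outside a compact set. -/
structure MoserData (Λ₀ Λ₁ : OneForm I M) where
  nondegenerate : ∀ κ ∈ Icc (0 : ℝ) 1, ∀ (x : M) (u : Tan I x),
    (∀ w, Λ₀.d x u w + κ * (Λ₁.d x u w - Λ₀.d x u w) = 0) → u = 0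
  ρ : M → ℝ
  contMDiff_ρ : ContMDiff I ℐ ∞ ρ
  nonneg : ∀ x, 0 ≤ ρ x
  isCompact_le : ∀ R, IsCompact {x | ρ x ≤ R}
  R : ℝ
  liouville : ∀ x, R < ρ x → ∃ ζ : Tan I x, ∀ w, Λ₀.d x ζ w = Λ₀ x w ∧ Λ₁.d x ζ w = Λ₁ x w
  B : ℝ
  bound : ∀ x, R < ρ x → ∀ κ ∈ Icc (0 : ℝ) 1, ∀ y : Tan I x,
    (∀ w, Λ₀.d x y w + κ * (Λ₁.d x y w - Λ₀.d x y w) = Λ₀ x w - Λ₁ x w) → |mvfderiv I ρ x y| ≤ B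

theorem IsFlow.apply_eq {v : ∀ x : M, Tan I x} {Φ : ℝ → M → M} (hΦ : IsFlow v Φ) (hv : SmoothField v)
    {f : M → M} (hf : ContMDiff I I ∞ f) (h : ∀ x, mfderiv I I f x (v x) = v (f x)) (s : ℝ) (x : M) :
    Φ s (f x) = f (Φ s x) := by
  have h1 : IsMIntegralCurve (fun s => f (Φ s x)) v := fun s => by
    have h1 := (hΦ.curve x s).map (hf.mdifferentiableAt (x := Φ s x) (by simp))
    rw [h] at h1; exact HasMFDerivWithinAt.hasMFDerivAt h1 univ_mem
  have h2 : IsMIntegralCurve (fun s => Φ s (f x)) v := fun s => HasMFDerivWithinAt.hasMFDerivAt (hΦ.curve _ s) univ_mem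
  exact congrFun (isMIntegralCurve_Ioo_eq_of_contMDiff_boundaryless (t₀ := 0)
    (hv.of_le (by simp)) h2 h1 (by simp [hΦ.init])) s

theorem IsFlow.hasDerivAt {v : ∀ x : M, Tan I x} {Φ : ℝ → M → M} (hΦ : IsFlow v Φ)
    {f : M → ℝ} (hf : ContMDiff I ℐ ∞ f) (x : M) (t : ℝ) :
    HasDerivAt (fun t => f (Φ t x)) (mvfderiv I f (Φ t x) (v (Φ t x))) t :=
  ((hΦ.curve x t).hasDerivWithinAt_comp (hf.mdifferentiableAt (by simp))).hasDerivAt univ_mem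

/-- `Λ₁` is the pullback of `Λ₀` by a diffeomorphism, up to the differential of a compactly
supported function. -/
def ExactlyConjugate (Λ₀ Λ₁ : OneForm I M) : Prop :=
  ∃ (Φ : M ≃ₘ^∞⟮I, I⟯ M) (f : M → ℝ), ContMDiff I ℐ ∞ f ∧ HasCompactSupport f ∧
    ∀ (z : M) (w : Tan I z), Λ₁ z w = Λ₀ (Φ z) (mfderiv I I Φ z w) + mvfderiv I f z w

theorem ExactlyConjugate.refl (Λ : OneForm I M) : ExactlyConjugate Λ Λ := by
  refine ⟨Diffeomorph.refl I M ∞, fun _ => 0, contMDiff_const, HasCompactSupport.zero, fun z w => ?_⟩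
  rw [mvfderiv_const, Diffeomorph.coe_refl, mfderiv_id]; exact (add_zero _).symm

theorem ExactlyConjugate.trans {Λ₀ Λ₁ Λ₂ : OneForm I M} (h : ExactlyConjugate Λ₀ Λ₁)
    (h' : ExactlyConjugate Λ₁ Λ₂) : ExactlyConjugate Λ₀ Λ₂ := by
  obtain ⟨Φ, f, hf, hfs, h⟩ := h
  obtain ⟨Φ', f', hf', hfs', h'⟩ := h'
  refine ⟨Φ'.trans Φ, fun z => f (Φ' z) + f' z, (hf.comp Φ'.contMDiff).add hf',
    (hfs.comp_homeomorph Φ'.toHomeomorph).add hfs', fun z w => ?_⟩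
  have h1 : mfderiv I I (Φ'.trans Φ) z w = mfderiv I I Φ (Φ' z) (mfderiv I I Φ' z w) :=
    DFunLike.congr_fun (mfderiv_comp z (Φ.contMDiff.mdifferentiableAt (by simp))
      (Φ'.contMDiff.mdifferentiableAt (by simp))) w
  have h2 : mvfderiv I (fun z => f (Φ' z) + f' z) z w =
      mvfderiv I f (Φ' z) (mfderiv I I Φ' z w) + mvfderiv I f' z w := by
    have e1 := HasMFDerivAt.comp z (hf.mdifferentiableAt (x := Φ' z) (by simp)).hasMFDerivAt
      (Φ'.contMDiff.mdifferentiableAt (x := z) (by simp)).hasMFDerivAt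
    have e2 := (hf'.mdifferentiableAt (x := z) (by simp)).hasMFDerivAt
    exact DFunLike.congr_fun (e1.add e2).mfderiv w
  have h3 : (Φ'.trans Φ) z = Φ (Φ' z) := rfl
  have key : ∀ y, y = Φ (Φ' z) → Λ₀ y (mfderiv I I (Φ'.trans Φ) z w : E) =
      Λ₀ (Φ (Φ' z)) (mfderiv I I Φ (Φ' z) (mfderiv I I Φ' z w)) := by rintro _ rfl; exact congrArg (Λ₀ (Φ (Φ' z))) h1
  rw [h', h, h2, add_assoc]; exact congrArg (· + _) (key _ h3).symm

namespace MoserData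

variable {Λ₀ Λ₁ : OneForm I M} (D : MoserData Λ₀ Λ₁)

theorem contMDiff_base : ContMDiff (extModel I) I ∞ fun n : Ext M => n.1.1 := contMDiff_fst.comp contMDiff_fst

theorem contMDiff_time : ContMDiff (extModel I) ℐ ∞ fun n : Ext M => n.1.2 := contMDiff_snd.comp contMDiff_fst

theorem contMDiff_transition : ContMDiff (extModel I) ℐ ∞ fun n : Ext M => smoothTransition n.1.2 :=
  smoothTransition.contDiff.contMDiff.comp (f := fun n : Ext M => n.1.2) (contMDiff_time (I := I))

/-- The contact form `Λ_κ(t) - dz`. -/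
def form (Λ₀ Λ₁ : OneForm I M) : OneForm (extModel I) (Ext M) :=
  (Λ₀.pullback _ contMDiff_base + OneForm.fmul (fun n => smoothTransition n.1.2)
    contMDiff_transition ((Λ₁ + (-1 : ℝ) • Λ₀).pullback _ contMDiff_base)) +
    (-1 : ℝ) • OneForm.ofFun (fun n => n.2) contMDiff_snd

theorem form_apply (n : Ext M) (w : Tan (extModel I) n) : form Λ₀ Λ₁ n w =
    Λ₀ n.1.1 w.1.1 + smoothTransition n.1.2 * (Λ₁ n.1.1 w.1.1 - Λ₀ n.1.1 w.1.1) - w.2 := by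
  obtain ⟨h1, -, h3⟩ := mfderiv_components n w
  rw [form, OneForm.add_apply, OneForm.add_apply, OneForm.smul_apply, fmul_apply, pullback_apply, pullback_apply, OneForm.add_apply,
    OneForm.smul_apply, ofFun_apply, h1, h3]
  ring

theorem d_form (n : Ext M) (u w : Tan (extModel I) n) : (form Λ₀ Λ₁).d n u w =
    Λ₀.d n.1.1 u.1.1 w.1.1 + smoothTransition n.1.2 * (Λ₁.d n.1.1 u.1.1 w.1.1 - Λ₀.d n.1.1 u.1.1 w.1.1) +
      deriv smoothTransition n.1.2 * (u.1.2 * (Λ₁ n.1.1 w.1.1 - Λ₀ n.1.1 w.1.1) -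
        w.1.2 * (Λ₁ n.1.1 u.1.1 - Λ₀ n.1.1 u.1.1)) := by
  have h : ∀ u : Tan (extModel I) n, mvfderiv (extModel I) (fun n : Ext M => smoothTransition n.1.2) n u = deriv smoothTransition n.1.2 * u.1.2 :=
    fun u => (mvfderiv_comp_real smoothTransition.contDiff
      (contMDiff_time.mdifferentiableAt (by simp)) u).trans (congrArg _ (mfderiv_components n u).2.1)
  rw [form, d_add, d_add, d_fmul, d_smul, d_ofFun, d_pullback, d_pullback, h, h, pullback_apply, pullback_apply,
    (mfderiv_components n u).1, (mfderiv_components n w).1]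
  have e : ∀ a b : Tan I n.1.1, (Λ₁ + (-1 : ℝ) • Λ₀).d n.1.1 a b = Λ₁.d n.1.1 a b + -1 * Λ₀.d n.1.1 a b :=
    fun a b => by rw [d_add, d_smul]
  have e' : ∀ a : Tan I n.1.1, (Λ₁ + (-1 : ℝ) • Λ₀) n.1.1 a = Λ₁ n.1.1 a + -1 * Λ₀ n.1.1 a :=
    fun a => by rw [OneForm.add_apply, OneForm.smul_apply]
  linear_combination smoothTransition n.1.2 * e u.1.1 w.1.1 +
    deriv smoothTransition n.1.2 * u.1.2 * e' w.1.1 - deriv smoothTransition n.1.2 * w.1.2 * e' u.1.1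

/-- The tangent vector of `Ext M` with given components. -/
def vec (n : Ext M) (w : Tan I n.1.1) (a b : ℝ) : Tan (extModel I) n := (((w : E), a), b)

theorem apply_eq_zero (α : OneForm I M) (x : M) {w : Tan I x} (hw : w = 0) : α x w = 0 := by
  rw [hw]; exact map_zero _

theorem d_zero_left (α : OneForm I M) (x : M) (w : Tan I x) : α.d x (0 : Tan I x) w = 0 := by
  have := d_smul_left α x 0 0 w
  rwa [zero_smul, zero_mul] at this

theorem d_zero_right (α : OneForm I M) (x : M) (w : Tan I x) : α.d x w (0 : Tan I x) = 0 := by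
  rw [d_swap, d_zero_left, neg_zero]

theorem d_sub_left (α : OneForm I M) (x : M) (u u' w : Tan I x) : α.d x (u - u') w = α.d x u w - α.d x u' w := by
  have h1 := d_smul_left α x (-1) u' w
  rw [sub_eq_add_neg, d_add_left, ← neg_one_smul ℝ u', h1]; ring

theorem smoothTransition_mem (t : ℝ) : smoothTransition t ∈ Icc (0 : ℝ) 1 :=
  ⟨smoothTransition.nonneg t, smoothTransition.le_one t⟩

include D in
theorem exists_field : ∃ v : ∀ n : Ext M, Tan (extModel I) n, SmoothField v ∧
    ∀ n, (v n).1.2 = 1 ∧ form Λ₀ Λ₁ n (v n) = 0 ∧ ∀ w, (form Λ₀ Λ₁).d n (v n) w = 0 := by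
  set dt : OneForm (extModel I) (Ext M) := OneForm.ofFun (fun n => n.1.2) contMDiff_time
  set dz : OneForm (extModel I) (Ext M) := OneForm.ofFun (fun n => n.2) contMDiff_snd
  have hdt : ∀ n (w : Tan (extModel I) n), dt n w = w.1.2 := fun n w => (mfderiv_components n w).2.1
  have hdz : ∀ n (w : Tan (extModel I) n), dz n w = w.2 := fun n w => (mfderiv_components n w).2.2
  have hbase : ∀ n (u : Tan (extModel I) n), u.1.2 = 0 →
      (∀ w : Tan (extModel I) n, w.1.2 = 0 → (form Λ₀ Λ₁).d n u w = 0) → u.1.1 = 0 := by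
    intro n u hu h
    refine D.nondegenerate (smoothTransition n.1.2) (smoothTransition_mem _) n.1.1 u.1.1 fun w₁ => ?_
    have h1 := (d_form n u (vec n w₁ 0 0)).symm.trans (h (vec n w₁ 0 0) rfl)
    rw [hu] at h1; simp only [vec, zero_mul, sub_zero, mul_zero, add_zero] at h1; exact h1
  have hvert : ∀ n (u : Tan (extModel I) n), (form Λ₀ Λ₁).d n u (vec n (0 : Tan I n.1.1) 0 1) = 0 := by
    intro n u
    refine (d_form n u _).trans ?_
    have h1 : ∀ α : OneForm I M, α.d n.1.1 u.1.1 (0 : Tan I n.1.1) = 0 := fun α => d_zero_right α _ _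
    have h2 : ∀ α : OneForm I M, α n.1.1 (0 : Tan I n.1.1) = 0 := fun α => map_zero _
    change Λ₀.d n.1.1 u.1.1 (0 : Tan I n.1.1) + smoothTransition n.1.2 *
      (Λ₁.d n.1.1 u.1.1 (0 : Tan I n.1.1) - Λ₀.d n.1.1 u.1.1 (0 : Tan I n.1.1)) +
      deriv smoothTransition n.1.2 * (u.1.2 * (Λ₁ n.1.1 (0 : Tan I n.1.1) -
        Λ₀ n.1.1 (0 : Tan I n.1.1)) - 0 * (Λ₁ n.1.1 u.1.1 - Λ₀ n.1.1 u.1.1)) = 0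
    rw [h1, h1, h2, h2]; ring
  have hv2 : ∀ n : Ext M, dt n (vec n (0 : Tan I n.1.1) 0 1) = 0 ∧
      dz n (vec n (0 : Tan I n.1.1) 0 1) = 1 := fun n => ⟨hdt n _, hdz n _⟩
  obtain ⟨v, hv, heq⟩ := exists_vectorField (form Λ₀ Λ₁) dt dt (form Λ₀ Λ₁) dz dt (fun n u h => by
    have h0 := h (vec n (0 : Tan I n.1.1) 0 1)
    rw [hvert, (hv2 n).1, (hv2 n).2] at h0
    have hα : form Λ₀ Λ₁ n u = 0 := by linarith
    have h1 := h u
    rw [d_self, hα, hdt] at h1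
    have ht : u.1.2 = 0 := mul_self_eq_zero.1 (by linarith)
    have h11 := hbase n u ht fun w hw => by
      have := h w
      rw [hα, hdt, ht] at this; linarith
    have hz : u.2 = 0 := by rw [form_apply, apply_eq_zero _ _ h11, apply_eq_zero _ _ h11] at hα; linarith
    exact Prod.ext (Prod.ext h11 ht) hz)
  refine ⟨v, hv, fun n => ?_⟩
  have h0 := heq n (vec n (0 : Tan I n.1.1) 0 1)
  rw [hvert, (hv2 n).1, (hv2 n).2] at h0
  have hα : form Λ₀ Λ₁ n (v n) = 0 := by linarith
  have h1 : ∀ w, (form Λ₀ Λ₁).d n (v n) w = (1 - (v n).1.2) * w.1.2 := fun w => by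
    have := heq n w
    rw [hα, hdt, hdt] at this; linarith
  have h2 := h1 (v n)
  rw [d_self] at h2
  have ht : (v n).1.2 = 1 := by
    rcases mul_eq_zero.1 h2.symm with h | h
    · linarith
    · exfalso
      have h11 := hbase n (v n) h fun w hw => by rw [h1, hw, mul_zero]
      have h3 := (d_form n (v n) (vec n (0 : Tan I n.1.1) 1 0)).symm.trans (h1 _)
      rw [h11, h] at h3
      have h2 : ∀ α : OneForm I M, α n.1.1 (0 : Tan I n.1.1) = 0 := fun α => map_zero _
      change Λ₀.d n.1.1 (0 : Tan I n.1.1) (0 : Tan I n.1.1) + smoothTransition n.1.2 *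
        (Λ₁.d n.1.1 (0 : Tan I n.1.1) (0 : Tan I n.1.1) - Λ₀.d n.1.1 (0 : Tan I n.1.1) (0 : Tan I n.1.1)) +
        deriv smoothTransition n.1.2 * (0 * (Λ₁ n.1.1 (0 : Tan I n.1.1) -
          Λ₀ n.1.1 (0 : Tan I n.1.1)) - 1 * (Λ₁ n.1.1 (0 : Tan I n.1.1) -
          Λ₀ n.1.1 (0 : Tan I n.1.1))) = (1 - 0) * 1 at h3
      rw [d_zero_left, d_zero_left, h2, h2] at h3; linarith
  exact ⟨ht, hα, fun w => by rw [h1, ht, sub_self, zero_mul]⟩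

variable {v : ∀ n : Ext M, Tan (extModel I) n} (hv : SmoothField v)
  (h : ∀ n, (v n).1.2 = 1 ∧ form Λ₀ Λ₁ n (v n) = 0 ∧ ∀ w, (form Λ₀ Λ₁).d n (v n) w = 0)

include h in
theorem base_eq (n : Ext M) (w : Tan I n.1.1) :
    Λ₀.d n.1.1 (v n).1.1 w + smoothTransition n.1.2 * (Λ₁.d n.1.1 (v n).1.1 w - Λ₀.d n.1.1 (v n).1.1 w) =
      deriv smoothTransition n.1.2 * (Λ₀ n.1.1 w - Λ₁ n.1.1 w) := by
  have h1 := (d_form n (v n) (vec n w 0 0)).symm.trans ((h n).2.2 _)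
  rw [(h n).1] at h1; simp only [vec, zero_mul] at h1; linarith

include h in
theorem height_eq (n : Ext M) : (v n).2 =
    Λ₀ n.1.1 (v n).1.1 + smoothTransition n.1.2 * (Λ₁ n.1.1 (v n).1.1 - Λ₀ n.1.1 (v n).1.1) := by
  have := (h n).2.1
  rw [form_apply] at this; linarith

include D h in
theorem invariant (x : M) (t z z' : ℝ) : (v ((x, t), z) : (E × ℝ) × ℝ) = v ((x, t), z') := by
  have h1 : (v ((x, t), z)).1.1 = ((v ((x, t), z')).1.1 : E) := by
    refine sub_eq_zero.1 (D.nondegenerate (smoothTransition t) (smoothTransition_mem t) x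
      ((v ((x, t), z)).1.1 - (v ((x, t), z')).1.1 : Tan I x) fun w => ?_)
    have e := base_eq h ((x, t), z) w
    have e' := base_eq h ((x, t), z') w
    have hs : ∀ (α : OneForm I M), α.d x ((v ((x, t), z)).1.1 - (v ((x, t), z')).1.1 : Tan I x) w =
        α.d x (v ((x, t), z)).1.1 w - α.d x (v ((x, t), z')).1.1 w := fun α => d_sub_left α x _ _ w
    rw [hs, hs]; simp only at e e'; linarith
  have h2 : (v ((x, t), z)).2 = (v ((x, t), z')).2 := by
    rw [height_eq h, height_eq h]; simp only
    rw [show (v ((x, t), z)).1.1 = ((v ((x, t), z')).1.1 : Tan I x) from h1]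
  exact Prod.ext (Prod.ext h1 ((h _).1.trans (h _).1.symm)) h2

include D h in
theorem base_eq_zero (n : Ext M) (hκ : deriv smoothTransition n.1.2 = 0) : (v n).1.1 = 0 ∧ (v n).2 = 0 := by
  have h1 : (v n).1.1 = 0 := D.nondegenerate (smoothTransition n.1.2) (smoothTransition_mem _) n.1.1 _ fun w => by
    rw [base_eq h, hκ, zero_mul]
  exact ⟨h1, by rw [height_eq h, apply_eq_zero _ _ h1, apply_eq_zero _ _ h1]; ring⟩

include D h in
theorem end_bound (n : Ext M) (hn : D.R < D.ρ n.1.1) :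
    |mvfderiv I D.ρ n.1.1 (v n).1.1| ≤ |deriv smoothTransition n.1.2| * D.B ∧ (v n).2 = 0 := by
  by_cases hκ : deriv smoothTransition n.1.2 = 0
  · obtain ⟨h1, h2⟩ := D.base_eq_zero h n hκ
    rw [hκ, abs_zero, zero_mul, abs_nonpos_iff]
    exact ⟨(congrArg (mvfderiv I D.ρ n.1.1) h1).trans (map_zero _), h2⟩
  obtain ⟨a, ha⟩ : ∃ a : Tan I n.1.1, a = (v n).1.1 := ⟨_, rfl⟩
  have e : ∀ w, Λ₀.d n.1.1 a w + smoothTransition n.1.2 * (Λ₁.d n.1.1 a w - Λ₀.d n.1.1 a w) =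
      deriv smoothTransition n.1.2 * (Λ₀ n.1.1 w - Λ₁ n.1.1 w) := fun w => by rw [ha]; exact base_eq h n w
  have e2 : (v n).2 = Λ₀ n.1.1 a + smoothTransition n.1.2 * (Λ₁ n.1.1 a - Λ₀ n.1.1 a) := by rw [ha]; exact height_eq h n
  constructor
  · suffices H : |mvfderiv I D.ρ n.1.1 a| ≤ |deriv smoothTransition n.1.2| * D.B by rw [ha] at H; exact H
    have h1 := D.bound n.1.1 hn (smoothTransition n.1.2) (smoothTransition_mem _)
      ((deriv smoothTransition n.1.2)⁻¹ • a) fun w => by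
        rw [d_smul_left, d_smul_left]
        have := e w
        field_simp; linarith
    rw [map_smul, smul_eq_mul, abs_mul, abs_inv, inv_mul_le_iff₀ (abs_pos.2 hκ)] at h1; exact h1
  · obtain ⟨ζ, hζ⟩ := D.liouville n.1.1 hn
    have h0 : Λ₀ n.1.1 ζ = 0 := by rw [← (hζ ζ).1, d_self]
    have h1 : Λ₁ n.1.1 ζ = 0 := by rw [← (hζ ζ).2, d_self]
    have h2 := e ζ
    rw [d_swap, d_swap Λ₁, (hζ _).1, (hζ _).2, h0, h1] at h2; rw [e2]; linarith

include D hv h in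
theorem exists_bound : ∃ C : ℝ, ∀ n, |mvfderiv I D.ρ n.1.1 (v n).1.1| ≤ C ∧ |(v n).2| ≤ C := by
  have hf1 : ContMDiff (extModel I) ℐ ∞ fun n : Ext M => D.ρ n.1.1 := D.contMDiff_ρ.comp contMDiff_base
  have e1 : ∀ n, mvfderiv (extModel I) (fun n : Ext M => D.ρ n.1.1) n (v n) =
      mvfderiv I D.ρ n.1.1 (v n).1.1 := fun n => by
    have h1 := HasMFDerivAt.comp n (D.contMDiff_ρ.mdifferentiableAt (x := n.1.1) (by simp)).hasMFDerivAt
      (contMDiff_base.mdifferentiableAt (x := n) (by simp)).hasMFDerivAt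
    refine (DFunLike.congr_fun h1.mfderiv (v n)).trans ?_
    exact congrArg (mvfderiv I D.ρ n.1.1) (mfderiv_components n (v n)).1
  have hc1 : Continuous fun n => mvfderiv I D.ρ n.1.1 (v n).1.1 :=
    ((OneForm.contMDiff_apply (OneForm.ofFun _ hf1) hv).continuous).congr e1
  have hc2 : Continuous fun n => (v n).2 :=
    ((OneForm.contMDiff_apply (OneForm.ofFun (fun n : Ext M => n.2) contMDiff_snd) hv).continuous).congr
      fun n => (mfderiv_components n (v n)).2.2
  have hK : IsCompact (({x | D.ρ x ≤ D.R} ×ˢ Icc (0 : ℝ) 1) ×ˢ {(0 : ℝ)}) :=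
    ((D.isCompact_le _).prod isCompact_Icc).prod isCompact_singleton
  obtain ⟨C1, h1⟩ := hK.exists_bound_of_continuousOn hc1.continuousOn
  obtain ⟨C2, h2⟩ := hK.exists_bound_of_continuousOn hc2.continuousOn
  obtain ⟨K, hK⟩ := isCompact_Icc.exists_bound_of_continuousOn (s := Icc (0 : ℝ) 1)
    ((smoothTransition.contDiff (n := 1)).continuous_deriv le_rfl).continuousOn
  set C := max (max C1 C2) (max (K * |D.B|) 0) with hC
  have hC0 : 0 ≤ C := (le_max_right _ _).trans (le_max_right _ _)
  refine ⟨C, fun n => ?_⟩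
  obtain ⟨⟨x, t⟩, z⟩ := n
  by_cases ht : t ∈ Icc (0 : ℝ) 1
  · rcases lt_or_ge D.R (D.ρ x) with hx | hx
    · obtain ⟨h3, h4⟩ := D.end_bound h ((x, t), z) hx
      rw [h4, abs_zero]
      refine ⟨h3.trans (le_trans ?_ ((le_max_left _ _).trans (le_max_right _ _))), hC0⟩
      exact (mul_le_mul_of_nonneg_left (le_abs_self _) (abs_nonneg _)).trans
        (mul_le_mul_of_nonneg_right (hK t ht) (abs_nonneg _))
    · have hm : ((x, t), (0 : ℝ)) ∈ ({x | D.ρ x ≤ D.R} ×ˢ Icc (0 : ℝ) 1) ×ˢ {(0 : ℝ)} := ⟨⟨hx, ht⟩, rfl⟩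
      have h5 := D.invariant h x t z 0
      have h6 : (v ((x, t), z)).1.1 = ((v ((x, t), 0)).1.1 : Tan I x) := congrArg (fun p : (E × ℝ) × ℝ => p.1.1) h5
      have h7 : (v ((x, t), z)).2 = (v ((x, t), 0)).2 := congrArg (fun p : (E × ℝ) × ℝ => p.2) h5
      rw [h7]; simp only [h6]
      exact ⟨(h1 _ hm).trans ((le_max_left _ _).trans (le_max_left _ _)),
        (h2 _ hm).trans ((le_max_right _ _).trans (le_max_left _ _))⟩
  · obtain ⟨h3, h4⟩ := D.base_eq_zero h ((x, t), z) (deriv_smoothTransition_eq_zero fun h => ht ⟨h.1.le, h.2.le⟩)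
    rw [h4, abs_zero, (congrArg (mvfderiv I D.ρ x) h3).trans (map_zero _), abs_zero]; exact ⟨hC0, hC0⟩

theorem contMDiff_height : ContMDiff (extModel I) ℐ ∞ fun n : Ext M => n.2 := contMDiff_snd

theorem contMDiff_vert : ContMDiff I (extModel I) ∞ fun x : M => ((x, (0 : ℝ)), (0 : ℝ)) :=
  (contMDiff_id.prodMk contMDiff_const).prodMk contMDiff_const

theorem mfderiv_vert (x : M) (w : Tan I x) :
    mfderiv I (extModel I) (fun x : M => ((x, (0 : ℝ)), (0 : ℝ))) x w = vec ((x, (0 : ℝ)), (0 : ℝ)) w 0 0 := by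
  have h := ((hasMFDerivAt_id (I := I) x).prodMk (hasMFDerivAt_const (I := I) (I' := ℐ) (0 : ℝ) x)).prodMk
    (hasMFDerivAt_const (I := I) (I' := ℐ) (0 : ℝ) x)
  exact DFunLike.congr_fun h.mfderiv w

theorem contMDiff_shift (z : ℝ) : ContMDiff (extModel I) (extModel I) ∞ fun n : Ext M => (n.1, n.2 + z) :=
  contMDiff_fst.prodMk (contMDiff_snd.add contMDiff_const)

theorem mfderiv_shift (z : ℝ) (n : Ext M) (w : Tan (extModel I) n) :
    mfderiv (extModel I) (extModel I) (fun n : Ext M => (n.1, n.2 + z)) n w = w := by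
  have h2 : HasMFDerivAt (extModel I) ℐ (fun n : Ext M => n.2 + z) n _ :=
    HasMFDerivAt.add (hasMFDerivAt_snd (x := n)) (hasMFDerivAt_const z n)
  have h := (hasMFDerivAt_fst (I := I.prod ℐ) (I' := ℐ) (x := n)).prodMk h2
  refine (DFunLike.congr_fun h.mfderiv w).trans (Prod.ext rfl (add_zero _))

include D in
theorem exists_flow : ∃ (v : ∀ n : Ext M, Tan (extModel I) n) (Θ : ℝ → Ext M → Ext M) (C : ℝ), SmoothField v ∧
    (∀ n, (v n).1.2 = 1 ∧ form Λ₀ Λ₁ n (v n) = 0 ∧ ∀ w, (form Λ₀ Λ₁).d n (v n) w = 0) ∧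
    (∀ n, |mvfderiv I D.ρ n.1.1 (v n).1.1| ≤ C ∧ |(v n).2| ≤ C) ∧ IsFlow v Θ := by
  obtain ⟨v, hv, h⟩ := D.exists_field
  obtain ⟨C, hC⟩ := D.exists_bound hv h
  refine ⟨v, ?_⟩
  have hs : ContMDiff ℐ ℐ ∞ fun r : ℝ => √(1 + r ^ 2) :=
    (ContDiff.sqrt (by fun_prop) fun r => (show (0 : ℝ) < 1 + r ^ 2 by positivity).ne').contMDiff
  have f1 : ContMDiff (extModel I) ℐ ∞ fun n : Ext M => D.ρ n.1.1 := D.contMDiff_ρ.comp contMDiff_base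
  have f2 : ContMDiff (extModel I) ℐ ∞ fun n : Ext M => √(1 + n.1.2 ^ 2) := hs.comp (contMDiff_time (I := I))
  have f3 : ContMDiff (extModel I) ℐ ∞ fun n : Ext M => √(1 + n.2 ^ 2) := hs.comp contMDiff_snd
  have hle : ∀ r : ℝ, |r| ≤ √(1 + r ^ 2) := fun r => Real.abs_le_sqrt (by linarith)
  obtain ⟨Θ, hΘ⟩ := exists_isFlow hv ((f1.add f2).add f3) (fun R => by
    refine (((D.isCompact_le R).prod (isCompact_Icc (a := -R) (b := R))).prod
      (isCompact_Icc (a := -R) (b := R))).of_isClosed_subset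
        (isClosed_le ((f1.add f2).add f3).continuous continuous_const) ?_
    rintro ⟨⟨x, t⟩, z⟩ hn
    have hn : D.ρ x + √(1 + t ^ 2) + √(1 + z ^ 2) ≤ R := hn
    have h1 := D.nonneg x
    have h2 := hle t
    have h3 := hle z
    have h4 := abs_nonneg t
    have h5 := abs_nonneg z
    exact ⟨⟨show D.ρ x ≤ R by linarith, abs_le.1 (by linarith)⟩, abs_le.1 (by linarith)⟩)
    (C := C + 1 + C) fun n => by
      have e1 : mvfderiv (extModel I) (fun n : Ext M => D.ρ n.1.1) n (v n) = mvfderiv I D.ρ n.1.1 (v n).1.1 := by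
        have h1 := HasMFDerivAt.comp n (D.contMDiff_ρ.mdifferentiableAt (x := n.1.1) (by simp)).hasMFDerivAt
          (contMDiff_base.mdifferentiableAt (x := n) (by simp)).hasMFDerivAt
        refine (DFunLike.congr_fun h1.mfderiv (v n)).trans ?_
        exact congrArg (mvfderiv I D.ρ n.1.1) (mfderiv_components n (v n)).1
      have b2 := abs_mvfderiv_sqrt (contMDiff_time.mdifferentiableAt (x := n) (by simp)) (v n)
      have b3 := abs_mvfderiv_sqrt ((contMDiff_height (I := I)).mdifferentiableAt (x := n) (by simp)) (v n)
      rw [(mfderiv_components n (v n)).2.1, (h n).1, abs_one] at b2; rw [(mfderiv_components n (v n)).2.2] at b3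
      have b1 := (hC n).1
      have b4 := (hC n).2
      rw [← e1] at b1
      have g1 := (f1.mdifferentiableAt (x := n) (by simp)).hasMFDerivAt
      have g2 := (f2.mdifferentiableAt (x := n) (by simp)).hasMFDerivAt
      have g3 := (f3.mdifferentiableAt (x := n) (by simp)).hasMFDerivAt
      have e : mvfderiv (extModel I) (fun n : Ext M => D.ρ n.1.1 + √(1 + n.1.2 ^ 2) + √(1 + n.2 ^ 2)) n (v n) =
          mvfderiv (extModel I) (fun n : Ext M => D.ρ n.1.1) n (v n) +
            mvfderiv (extModel I) (fun n : Ext M => √(1 + n.1.2 ^ 2)) n (v n) +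
            mvfderiv (extModel I) (fun n : Ext M => √(1 + n.2 ^ 2)) n (v n) :=
        DFunLike.congr_fun ((g1.add g2).add g3).mfderiv (v n)
      refine (le_of_eq (congrArg (abs : ℝ → ℝ) e)).trans ((abs_add_three _ _ _).trans ?_)
      exact add_le_add (add_le_add b1 b2) (b3.trans b4)
  exact ⟨Θ, C, hv, h, hC, hΘ⟩

include D in
theorem exactlyConjugate : ExactlyConjugate Λ₁ Λ₀ := by
  obtain ⟨v, Θ, C, hv, h, hC, hΘ⟩ := D.exists_flow
  have hsm : ∀ s, ContMDiff (extModel I) (extModel I) ∞ (Θ s) := fun s =>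
    (hΘ.contMDiff hv).comp (contMDiff_const.prodMk contMDiff_id)
  have hC0 : 0 ≤ C ∨ IsEmpty M := by
    rcases isEmpty_or_nonempty M with hW | ⟨⟨x⟩⟩
    · exact Or.inr hW
    · exact Or.inl ((abs_nonneg _).trans (hC ((x, 0), 0)).2)
  have htime : ∀ s n, (Θ s n).1.2 = n.1.2 + s := fun s n => by
    have h1 : ∀ s, HasDerivAt (fun s => (Θ s n).1.2 - s) 0 s := fun s => by
      have := hΘ.hasDerivAt (contMDiff_time (I := I)) n s
      rw [(mfderiv_components _ _).2.1, (h _).1] at this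
      exact (this.sub (hasDerivAt_id s)).congr_deriv (sub_self 1)
    have := is_const_of_deriv_eq_zero (fun s => (h1 s).differentiableAt) (fun s => (h1 s).deriv) s 0
    simp only [hΘ.init] at this; linarith
  have hshift : ∀ (s z : ℝ) (n : Ext M), Θ s (n.1, n.2 + z) = ((Θ s n).1, (Θ s n).2 + z) :=
    fun s z n => hΘ.apply_eq hv (contMDiff_shift z) (fun n => by
      refine (mfderiv_shift z n (v n)).trans ?_
      exact D.invariant h n.1.1 n.1.2 n.2 (n.2 + z)) s n
  have hfst : ∀ (s z z' : ℝ) (y : M × ℝ), (Θ s (y, z)).1 = (Θ s (y, z')).1 := fun s z z' y => by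
    have := congrArg Prod.fst (hshift s (z' - z) (y, z))
    simp only [add_sub_cancel] at this; exact this.symm
  have hinv : ∀ s n, Θ (-s) (Θ s n) = n := fun s n => by rw [← hΘ.add hv, neg_add_cancel, hΘ.init]
  set φ : M → M := fun x => (Θ 1 ((x, 0), 0)).1.1 with hφ
  set ψ : M → M := fun x => (Θ (-1) ((x, 1), 0)).1.1 with hψ
  have e1 : ∀ x, (Θ 1 ((x, 0), 0)).1 = (φ x, 1) := fun x => Prod.ext rfl (by rw [htime]; simp)
  have e2 : ∀ x, (Θ (-1) ((x, 1), 0)).1 = (ψ x, 0) := fun x => Prod.ext rfl (by rw [htime]; simp)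
  have hφs : ContMDiff I I ∞ φ := contMDiff_base.comp ((hsm 1).comp contMDiff_vert)
  have hψs : ContMDiff I I ∞ ψ := contMDiff_base.comp ((hsm (-1)).comp
    ((contMDiff_id.prodMk contMDiff_const).prodMk contMDiff_const))
  have l1 : ∀ x, ψ (φ x) = x := fun x => by
    have h1 : Θ 1 ((x, 0), 0) = ((φ x, 1), (Θ 1 ((x, 0), 0)).2) := Prod.ext (e1 x) rfl
    have h2 := hinv 1 ((x, 0), 0)
    rw [h1] at h2
    have h3 := hfst (-1) 0 (Θ 1 ((x, 0), 0)).2 (φ x, 1)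
    rw [h2] at h3; exact congrArg Prod.fst h3
  have l2 : ∀ x, φ (ψ x) = x := fun x => by
    have h1 : Θ (-1) ((x, 1), 0) = ((ψ x, 0), (Θ (-1) ((x, 1), 0)).2) := Prod.ext (e2 x) rfl
    have h2 := hinv (-1) ((x, 1), 0)
    rw [h1, neg_neg] at h2
    have h3 := hfst 1 0 (Θ (-1) ((x, 1), 0)).2 (ψ x, 0)
    rw [h2] at h3; exact congrArg Prod.fst h3
  set F : M → ℝ := fun x => (Θ 1 ((x, 0), 0)).2 with hF
  have hFs : ContMDiff I ℐ ∞ F := contMDiff_snd.comp ((hsm 1).comp contMDiff_vert)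
  refine ⟨⟨⟨φ, ψ, l1, l2⟩, hφs, hψs⟩, fun x => -F x, hFs.neg, ?_, fun x w => ?_⟩
  · refine HasCompactSupport.of_support_subset_isCompact (D.isCompact_le (D.R + C)) fun x hx => ?_
    by_contra hx'
    have hx' : D.R + C < D.ρ x := not_le.1 hx'
    refine hx (neg_eq_zero.2 ?_)
    have hC0 : 0 ≤ C := hC0.resolve_right fun hW => hW.elim x
    have f1 : ContMDiff (extModel I) ℐ ∞ fun n : Ext M => D.ρ n.1.1 := D.contMDiff_ρ.comp contMDiff_base
    have hd : ∀ s, HasDerivAt (fun s => D.ρ (Θ s ((x, 0), 0)).1.1)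
        (mvfderiv I D.ρ (Θ s ((x, 0), 0)).1.1 (v (Θ s ((x, 0), 0))).1.1) s := fun s => by
      refine (hΘ.hasDerivAt f1 ((x, 0), 0) s).congr_deriv ?_
      set n := Θ s ((x, 0), 0)
      have h1 := HasMFDerivAt.comp n (D.contMDiff_ρ.mdifferentiableAt (x := n.1.1) (by simp)).hasMFDerivAt
        (contMDiff_base.mdifferentiableAt (x := n) (by simp)).hasMFDerivAt
      refine (DFunLike.congr_fun h1.mfderiv (v n)).trans ?_
      exact congrArg (mvfderiv I D.ρ n.1.1) (mfderiv_components n (v n)).1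
    have hfar : ∀ s ∈ Icc (0 : ℝ) 1, D.R < D.ρ (Θ s ((x, 0), 0)).1.1 := fun s hs => by
      have := (convex_univ (𝕜 := ℝ) (E := ℝ)).norm_image_sub_le_of_norm_hasDerivWithin_le
        (fun r _ => (hd r).hasDerivWithinAt) (fun r _ => (hC (Θ r ((x, 0), 0))).1) (mem_univ 0) (mem_univ s)
      rw [hΘ.init, sub_zero, Real.norm_eq_abs, Real.norm_eq_abs, abs_of_nonneg hs.1] at this
      have h1 := (abs_le.1 this).1
      have h2 : C * s ≤ C := mul_le_of_le_one_right hC0 hs.2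
      simp only at h1; linarith
    have hz : ∀ s ∈ Icc (0 : ℝ) 1, HasDerivWithinAt (fun s => (Θ s ((x, 0), 0)).2) 0 (Icc 0 1) s := fun s hs => by
        have := hΘ.hasDerivAt (contMDiff_height (I := I)) ((x, 0), 0) s
        rw [(mfderiv_components _ _).2.2, (D.end_bound h _ (hfar s hs)).2] at this; exact this.hasDerivWithinAt
    have := (convex_Icc (0 : ℝ) 1).norm_image_sub_le_of_norm_hasDerivWithin_le (C := 0)
      hz (fun s _ => by simp) (left_mem_Icc.2 zero_le_one) (right_mem_Icc.2 zero_le_one)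
    rw [hΘ.init, zero_mul] at this; simpa using this
  · set n₀ : Ext M := ((x, 0), 0) with hn₀
    set u : Tan (extModel I) (Θ 1 n₀) := mfderiv (extModel I) (extModel I) (Θ 1) n₀ (vec n₀ w 0 0) with hu
    have h1 := (hΘ.isSemiflow 1).form_eq_exp (hΘ.contMDiff hv).contMDiffOn (α := form Λ₀ Λ₁) (c := 0)
      (fun n => (h n).2.1) (fun n w => by rw [(h n).2.2, zero_mul]) n₀ (vec n₀ w 0 0)
      (right_mem_Icc.2 zero_le_one)
    rw [zero_mul, Real.exp_zero, one_mul] at h1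
    have h2 : Λ₁ (φ x) (u.1.1 : E) - u.2 = Λ₀ x w := by
      have h3 := (form_apply (Θ 1 n₀) u).symm.trans (h1.trans (form_apply n₀ (vec n₀ w 0 0)))
      have ht : (Θ 1 n₀).1.2 = 1 := by rw [e1]
      rw [ht, smoothTransition.one] at h3
      have h4 : Λ₀ x w + smoothTransition 0 * (Λ₁ x w - Λ₀ x w) - 0 = Λ₀ x w := by rw [smoothTransition.zero]; ring
      rw [← h4]
      refine Eq.trans ?_ h3
      change Λ₁ (φ x) (u.1.1 : E) - u.2 = Λ₀ (φ x) (u.1.1 : E) + 1 * (Λ₁ (φ x) (u.1.1 : E) - Λ₀ (φ x) (u.1.1 : E)) - u.2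
      ring
    have hι := (contMDiff_vert.mdifferentiableAt (I := I) (x := x) (by simp)).hasMFDerivAt
    have hc := HasMFDerivAt.comp x ((hsm 1).mdifferentiableAt (x := n₀) (by simp)).hasMFDerivAt hι
    have hc' : mfderiv I (extModel I) (Θ 1 ∘ fun x : M => ((x, (0 : ℝ)), (0 : ℝ))) x w = u := by
      refine (DFunLike.congr_fun hc.mfderiv w).trans ?_
      exact congrArg (mfderiv (extModel I) (extModel I) (Θ 1) n₀) (mfderiv_vert x w)
    have hc := hc.mdifferentiableAt.hasMFDerivAt
    have h5 : mfderiv I I φ x w = u.1.1 := by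
      have h6 := HasMFDerivAt.comp x (contMDiff_base.mdifferentiableAt (x := Θ 1 n₀) (by simp)).hasMFDerivAt hc
      refine (DFunLike.congr_fun h6.mfderiv w).trans ?_
      refine Eq.trans ?_ (mfderiv_components (Θ 1 n₀) u).1
      exact congrArg (mfderiv (extModel I) I (fun n : Ext M => n.1.1) (Θ 1 n₀)) hc'
    have h7 : mvfderiv I F x w = u.2 := by
      have h6 := HasMFDerivAt.comp x ((contMDiff_height (I := I)).mdifferentiableAt (x := Θ 1 n₀) (by simp)).hasMFDerivAt hc
      refine (DFunLike.congr_fun h6.mfderiv w).trans ?_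
      refine Eq.trans ?_ (mfderiv_components (Θ 1 n₀) u).2.2
      exact congrArg (mvfderiv (extModel I) (fun n : Ext M => n.2) (Θ 1 n₀)) hc'
    have h8 : mvfderiv I (fun x => -F x) x w = -u.2 := by
      rw [← h7]; exact DFunLike.congr_fun ((hFs.mdifferentiableAt (x := x) (by simp)).hasMFDerivAt.neg).mfderiv w
    rw [h8, ← h2, sub_eq_add_neg]; exact congrArg (fun a => Λ₁ (φ x) a + -u.2) h5.symm

end MoserData

end Moser

end Manifolds

section Boundary

variable {M : Type v} [TopologicalSpace M] [ChartedSpace ℝ³ M] [IsManifold (𝓡 3) ∞ M]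
  {V : Type u} [TopologicalSpace V] [ChartedSpace (EuclideanHalfSpace 4) V] [IsManifold ℋ ∞ V]
  {bd : BoundaryIdentification M V} {o : FourOrientation V}
  {E : Type} [NormedAddCommGroup E] [NormedSpace ℝ E] [FiniteDimensional ℝ E]
  {H : Type*} [TopologicalSpace H] {I : ModelWithCorners ℝ E H}
  {N : Type*} [TopologicalSpace N] [ChartedSpace H N] [IsManifold I ∞ N]

theorem finrank_tangentSpace (x : V) : finrank ℝ (Tan ℋ x) = 4 := by change finrank ℝ ℝ⁴ = 4; simp

theorem FourOrientation.exists_positive_basis (o : FourOrientation V) (x : V) :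
    ∃ b : Basis (Fin 4) ℝ (Tan ℋ x), b.orientation = o.orient x := by
  haveI : FiniteDimensional ℝ (Tan ℋ x) := inferInstanceAs (FiniteDimensional ℝ ℝ⁴)
  exact ⟨(o.orient x).someBasis (by rw [finrank_tangentSpace]; rfl), (o.orient x).someBasis_orientation _⟩

theorem IsPositiveSymplectic.pf_pos {lam : OneForm ℋ V} (h : IsPositiveSymplectic o lam) (x : V)
    {b : Basis (Fin 4) ℝ (Tan ℋ x)} (hb : b.orientation = o.orient x) : 0 < pf (lam.dLin x) b := h.2 x b ⟨b, rfl, hb⟩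

theorem IsPositiveSymplectic.pf_ne_zero {lam : OneForm ℋ V} (h : IsPositiveSymplectic o lam)
    (x : V) (b : Basis (Fin 4) ℝ (Tan ℋ x)) : pf (lam.dLin x) b ≠ 0 := by
  obtain ⟨b', hb'⟩ := o.exists_positive_basis x
  have h1 := pf2_eq_det_mul (lam.dLin_self x) (lam.dLin_self x) b b'
  rw [pf2_self, pf2_self] at h1
  have h2 := h.pf_pos x hb'
  rintro h3; rw [h3] at h1; linarith

theorem isPositiveSymplectic_of_pf_pos {lam : OneForm ℋ V} (h : ∀ (x : V) (b : Basis (Fin 4) ℝ (Tan ℋ x)),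
      b.orientation = o.orient x → 0 < pf (lam.dLin x) b) : IsPositiveSymplectic o lam := by
  refine ⟨fun x u hu => ?_, ?_⟩
  · obtain ⟨b, hb⟩ := o.exists_positive_basis x
    exact eq_zero_of_pf_ne_zero (lam.dLin_self x) b (h x b hb).ne' hu
  · rintro x v ⟨b, rfl, hb⟩; exact h x b hb

theorem IsPositiveSymplectic.of_volRatio_pos {lam lam' : OneForm ℋ V} (h : IsPositiveSymplectic o lam)
    (hr : ∀ x, 0 < volRatio (lam'.dLin x) (lam'.dLin x) (lam.dLin x)) : IsPositiveSymplectic o lam' := by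
  refine isPositiveSymplectic_of_pf_pos fun x b hb => ?_
  have := (volRatio_pos_iff (lam'.dLin_self x) (lam'.dLin_self x) (lam.dLin_self x) (h.pf_pos x hb)).1 (hr x)
  rw [pf2_self] at this; linarith

section BoundaryFunction

theorem extChartAt_zero_nonneg (x₀ : V) {x : V} (hx : x ∈ (crd ℋ x₀).source) : 0 ≤ crd ℋ x₀ x 0 := by
  have h := extChartAt_target_subset_range (I := ℋ) x₀ ((crd ℋ x₀).map_source hx)
  rwa [range_modelWithCornersEuclideanHalfSpace] at h

theorem isBoundaryPoint_iff_coord {x₀ x : V} (hx : x ∈ (crd ℋ x₀).source) : x ∈ (ℋ).boundary V ↔ crd ℋ x₀ x 0 = 0 := by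
  have h1 : x ∈ (ℋ).boundary V ↔ _ := ModelWithCorners.isBoundaryPoint_iff_of_mem_atlas
    (n := ∞) (by simp) (chart_mem_atlas (EuclideanHalfSpace 4) x₀)
    (show x ∈ (chartAt (EuclideanHalfSpace 4) x₀).source by rwa [extChartAt_source] at hx)
  have hx' := (crd ℋ x₀).map_source hx
  obtain ⟨U, hU, hT⟩ := isOpen_target_inter ℋ x₀
  change crd ℋ x₀ x ∈ _ at hx'
  have h2 : crd ℋ x₀ x ∈ frontier (crd ℋ x₀).target ↔ crd ℋ x₀ x ∈ frontier (range ℋ) := by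
    have hy := hx'
    rw [hT] at hy
    have hi : ∀ y ∈ U, (y ∈ interior (range ℋ ∩ U) ↔ y ∈ interior (range ℋ)) := by
      intro y hy; rw [interior_inter, hU.interior_eq]; simp [hy]
    rw [← not_iff_not, ← mem_interior_iff_notMem_frontier hx', ← mem_interior_iff_notMem_frontier hy.1, hT, hi _ hy.2]
  rw [h1]
  refine h2.trans ?_
  rw [frontier_range_modelWithCornersEuclideanHalfSpace]; exact eq_comm

theorem mvfderiv_nonneg_of_inward {x : V} (hx : x ∈ (ℋ).boundary V) {F : V → ℝ}
    (hF : MDifferentiableAt ℋ ℐ F x) (h0 : F x = 0) (hpos : ∀ᶠ y in 𝓝 x, 0 ≤ F y)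
    {w : ℝ⁴} (hw : 0 ≤ w 0) : 0 ≤ mvfderiv ℋ F x w := by
  set φ := crd ℋ x with hφ
  have hx0 : φ x 0 = 0 := (isBoundaryPoint_iff_coord (mem_extChartAt_source x)).1 hx
  have h1 : HasFDerivWithinAt (F ∘ φ.symm) (mvfderiv ℋ F x) (range ℋ) (φ x) := hF.hasMFDerivAt.2
  have h2 : HasDerivWithinAt (fun t : ℝ => φ x + t • w) w (Ici 0) 0 := by
    simpa using (((hasDerivAt_id (0 : ℝ)).smul_const w).const_add (φ x)).hasDerivWithinAt
  have hm : MapsTo (fun t : ℝ => φ x + t • w) (Ici 0) (range ℋ) := by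
    intro t ht; rw [range_modelWithCornersEuclideanHalfSpace]
    have : 0 ≤ t * w 0 := mul_nonneg ht hw
    simpa [hx0] using this
  have h3 : HasDerivWithinAt (fun t : ℝ => F (φ.symm (φ x + t • w))) (mvfderiv ℋ F x w) (Ici 0) 0 := by
    have h1' : HasFDerivWithinAt (F ∘ φ.symm) (mvfderiv ℋ F x) (range ℋ) (φ x + (0 : ℝ) • w) := by simpa using h1
    exact h1'.comp_hasDerivWithinAt (0 : ℝ) h2 hm
  have hc : Tendsto (fun t : ℝ => φ.symm (φ x + t • w)) (𝓝[Ici 0] 0) (𝓝 x) := by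
    have h4 : ContinuousWithinAt φ.symm (range ℋ) (φ x) := (continuousAt_extChartAt_symm x).continuousWithinAt
    have h5 : Tendsto (fun t : ℝ => φ x + t • w) (𝓝[Ici 0] 0) (𝓝[range ℋ] (φ x)) := by
      have := h2.continuousWithinAt.tendsto_nhdsWithin hm
      simpa using this
    have h6 := h4.tendsto.comp h5
    rwa [φ.left_inv (mem_extChartAt_source x)] at h6
  have h7 : F (φ.symm (φ x + (0 : ℝ) • w)) = 0 := by rw [zero_smul, add_zero, φ.left_inv (mem_extChartAt_source x), h0]
  have h3' := h3.Ioi_of_Ici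
  rw [hasDerivWithinAt_iff_tendsto_slope' (by simp)] at h3'
  refine ge_of_tendsto h3' ?_
  have h8 : ∀ᶠ t in 𝓝[>] (0 : ℝ), 0 ≤ F (φ.symm (φ x + t • w)) :=
    (hc.mono_left (nhdsWithin_mono _ Ioi_subset_Ici_self)).eventually hpos
  filter_upwards [h8, self_mem_nhdsWithin] with t ht ht'
  rw [slope_def_field, h7, sub_zero, sub_zero]; exact div_nonneg ht (le_of_lt ht')

theorem mvfderiv_coord_pos {x₀ x : V} (hx : x ∈ (crd ℋ x₀).source)
    (hb : x ∈ (ℋ).boundary V) {w : ℝ⁴} (hw : 0 < w 0) : 0 < mvfderiv ℋ (fun y => crd ℋ x₀ y 0) x w := by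
  have hd : MDifferentiableAt ℋ 𝓘(ℝ, ℝ⁴) (crd ℋ x₀) x := mdifferentiableAt_extChartAt (by rwa [extChartAt_source] at hx)
  set p : ℝ⁴ →L[ℝ] ℝ := EuclideanSpace.proj (0 : Fin 4) with hp
  have h1 : HasMFDerivAt ℋ ℐ (fun y => crd ℋ x₀ y 0) x (p.comp (chartD ℋ x₀ x)) :=
    HasMFDerivAt.comp x (p.hasMFDerivAt (x := crd ℋ x₀ x)) hd.hasMFDerivAt
  have h2 : ∀ u : ℝ⁴, mvfderiv ℋ (fun y => crd ℋ x₀ y 0) x u = chartD ℋ x₀ x u 0 := fun u =>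
    DFunLike.congr_fun h1.mfderiv u
  have h3 : ∀ u : ℝ⁴, 0 ≤ u 0 → 0 ≤ chartD ℋ x₀ x u 0 := by
    intro u hu; rw [← h2]
    refine mvfderiv_nonneg_of_inward hb h1.mdifferentiableAt ((isBoundaryPoint_iff_coord hx).1 hb) ?_ hu
    filter_upwards [(isOpen_extChartAt_source x₀).mem_nhds hx] with y hy using extChartAt_zero_nonneg x₀ hy
  rw [h2]
  refine lt_of_le_of_ne (h3 w hw.le) fun h0 => ?_
  obtain ⟨u, hu⟩ := chartD_surjective (I := ℋ) hx (-EuclideanSpace.single 0 1)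
  have h4 := h3 (u + ((|u 0| + 1) / w 0) • w) (by
    have : (|u 0| + 1) / w 0 * w 0 = |u 0| + 1 := div_mul_cancel₀ _ hw.ne'
    simp only [PiLp.add_apply, PiLp.smul_apply, smul_eq_mul, this]
    linarith [neg_abs_le (u 0)])
  rw [map_add, map_smul, hu] at h4; simp [← h0] at h4; linarith

variable [T2Space V] [CompactSpace V]

variable (V) in
theorem exists_boundaryFunction : ∃ s : V → ℝ, ContMDiff ℋ ℐ ∞ s ∧ (∀ x, s x ≤ 0) ∧
    (∀ x, s x = 0 ↔ x ∈ (ℋ).boundary V) ∧ ∀ x ∈ (ℋ).boundary V, ∀ n : ℝ⁴, n 0 < 0 → 0 < mvfderiv ℋ s x n := by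
  obtain ⟨f, hf⟩ := SmoothPartitionOfUnity.exists_isSubordinate_chartAt_source ℋ V
  set g : V → V → ℝ := fun i x => crd ℋ i x 0 with hg
  have hgs : ∀ i, ContMDiffOn ℋ ℐ ∞ (g i) (chartAt (EuclideanHalfSpace 4) i).source :=
    fun i => (EuclideanSpace.proj (0 : Fin 4) : ℝ⁴ →L[ℝ] ℝ).contMDiff.comp_contMDiffOn contMDiffOn_extChartAt
  have hsm := hf.contMDiff_finsum_smul (fun i => (chartAt (EuclideanHalfSpace 4) i).open_source) hgs
  have hterm : ∀ i x, 0 ≤ f i x • g i x := by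
    intro i x
    by_cases hx : x ∈ tsupport (f i)
    · exact smul_nonneg (f.nonneg i x) (extChartAt_zero_nonneg i (by
        rw [extChartAt_source]; exact hf i hx))
    · rw [image_eq_zero_of_notMem_tsupport hx, zero_smul]
  have hfin : ∀ x, (support fun i => f i x • g i x).Finite := fun x =>
    (f.locallyFinite.point_finite x).subset fun i hi => by
      simp only [Function.mem_support] at hi ⊢; exact left_ne_zero_of_smul hi
  have hle : ∀ i x, f i x • g i x ≤ ∑ᶠ j, f j x • g j x := fun i x => single_le_finsum i (hfin x) fun j => hterm j x
  have hsrc : ∀ i x, 0 < f i x → x ∈ (crd ℋ i).source := fun i x hi => by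
    rw [extChartAt_source]; exact hf i (subset_tsupport _ hi.ne')
  have hex : ∀ x, ∃ i, 0 < f i x := fun x => f.exists_pos_of_mem (mem_univ x)
  have hb0 : ∀ x ∈ (ℋ).boundary V, ∀ i, f i x • g i x = 0 := by
    intro x hx i
    rcases (f.nonneg i x).eq_or_lt with h | h
    · rw [← h, zero_smul]
    · rw [show g i x = 0 from (isBoundaryPoint_iff_coord (hsrc i x h)).1 hx, smul_zero]
  have hz : ∀ x ∈ (ℋ).boundary V, ∑ᶠ i, f i x • g i x = 0 := fun x hx => by simp only [hb0 x hx, finsum_zero]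
  refine ⟨fun x => -∑ᶠ i, f i x • g i x, hsm.neg, fun x => ?_, fun x => ⟨fun h => ?_, fun h => ?_⟩, ?_⟩
  · exact neg_nonpos.2 (finsum_nonneg fun i => hterm i x)
  · obtain ⟨i, hi⟩ := hex x
    rw [isBoundaryPoint_iff_coord (hsrc i x hi)]
    have h1 := hle i x
    rw [neg_eq_zero.1 h] at h1
    have h2 := le_antisymm h1 (hterm i x)
    exact (smul_eq_zero.1 h2).resolve_left hi.ne'
  · simp only [hz x h, neg_zero]
  · intro x hx n hn
    obtain ⟨i, hi⟩ := hex x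
    have hxi := hsrc i x hi
    have hgi : MDifferentiableAt ℋ ℐ (g i) x :=
      ((hgs i).contMDiffAt ((chartAt (EuclideanHalfSpace 4) i).open_source.mem_nhds
        (by rwa [extChartAt_source] at hxi))).mdifferentiableAt (by simp)
    have hfi : MDifferentiableAt ℋ ℐ (f i) x := (f i).contMDiff.mdifferentiableAt (by simp)
    have hs : MDifferentiableAt ℋ ℐ (fun x => ∑ᶠ i, f i x • g i x) x := hsm.mdifferentiableAt (by simp)
    have h1 := HasMFDerivAt.sub hs.hasMFDerivAt (HasMFDerivAt.mul hfi.hasMFDerivAt hgi.hasMFDerivAt)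
    have h2 := mvfderiv_nonneg_of_inward hx h1.mdifferentiableAt (by
        have h8 := hz x hx
        rw [Pi.sub_apply, Pi.mul_apply, h8, show g i x = 0 from (isBoundaryPoint_iff_coord hxi).1 hx]
        simp)
      (Eventually.of_forall fun y => sub_nonneg.2 (hle i y)) (w := -n) (by simpa using hn.le)
    have h3 := mvfderiv_coord_pos hxi hx (w := -n) (by simpa using hn)
    have h4 : mvfderiv ℋ ((fun x => ∑ᶠ i, f i x • g i x) - (⇑(f i) * g i)) x (-n) =
        mvfderiv ℋ (fun x => ∑ᶠ i, f i x • g i x) x (-n) -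
          (f i x * mvfderiv ℋ (g i) x (-n) + g i x * mvfderiv ℋ (f i) x (-n)) :=
      DFunLike.congr_fun h1.mfderiv (-n)
    have h5 : mvfderiv ℋ (fun x => -∑ᶠ i, f i x • g i x) x n = -mvfderiv ℋ (fun x => ∑ᶠ i, f i x • g i x) x n :=
      DFunLike.congr_fun (HasMFDerivAt.neg hs.hasMFDerivAt).mfderiv n
    have h6 : mvfderiv ℋ (fun x => ∑ᶠ i, f i x • g i x) x (-n) =
        -mvfderiv ℋ (fun x => ∑ᶠ i, f i x • g i x) x n := map_neg _ _
    rw [h5, ← h6]; rw [show g i x = 0 from (isBoundaryPoint_iff_coord hxi).1 hx, zero_mul, add_zero] at h4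
    have h7 : 0 < f i x * mvfderiv ℋ (g i) x (-n) := mul_pos hi h3
    have h8 : 0 ≤ mvfderiv ℋ ((fun x => ∑ᶠ i, f i x • g i x) - (⇑(f i) * g i)) x (-n) := h2
    linarith

end BoundaryFunction

section BoundaryPositivity

/-- `s` is a defining function of the boundary of `V`. -/
structure IsBdryFun (s : V → ℝ) : Prop where
  contMDiff : ContMDiff ℋ ℐ ∞ s
  nonpos : ∀ x, s x ≤ 0
  eq_zero_iff : ∀ x, s x = 0 ↔ x ∈ (ℋ).boundary V
  outward : ∀ x ∈ (ℋ).boundary V, ∀ n : Tan ℋ x, IsOutward x n → 0 < mvfderiv ℋ s x n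

theorem isOutward_iff {x : V} (n : ℝ⁴) : IsOutward x n ↔ n 0 < 0 := by
  have h : mvfderiv ℋ (crd ℋ x) x n = n := chartD_self (I := ℋ) x n
  change mvfderiv ℋ (crd ℋ x) x n 0 < 0 ↔ _; rw [h]

variable (V) in
theorem exists_isBdry [T2Space V] [CompactSpace V] : ∃ s : V → ℝ, IsBdryFun s := by
  obtain ⟨s, h1, h2, h3, h4⟩ := exists_boundaryFunction V
  exact ⟨s, h1, h2, h3, fun x hx n hn => h4 x hx n ((isOutward_iff n).1 hn)⟩

variable {s : V → ℝ} (hs : IsBdryFun s)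

/-- The differential of a boundary function. -/
def IsBdryFun.dForm : OneForm ℋ V := OneForm.ofFun s hs.contMDiff

variable (bd)

namespace BoundaryIdentification

theorem contMDiff : ContMDiff (𝓡 3) ℋ ∞ bd.toFun := bd.isSmoothEmbedding.contMDiff

theorem mem_boundary (p : M) : bd.toFun p ∈ (ℋ).boundary V := by rw [← bd.range_eq]; exact mem_range_self p

theorem injective : Injective bd.toFun := bd.isSmoothEmbedding.isEmbedding.injective

/-- The derivative of the boundary inclusion. -/
def tangent (p : M) : Tan (𝓡 3) p →ₗ[ℝ] Tan ℋ (bd.toFun p) := (mfderiv (𝓡 3) ℋ bd.toFun p).toLinearMap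

theorem tangent_injective (p : M) : Injective (bd.tangent p) := bd.isSmoothEmbedding.injective_mfderiv p

theorem restrict_apply (lam : OneForm ℋ V) (p : M) (u : Tan (𝓡 3) p) :
    bd.restrict lam p u = lam (bd.toFun p) (bd.tangent p u) := rfl

theorem restrict_d (lam : OneForm ℋ V) (p : M) (u w : Tan (𝓡 3) p) :
    (bd.restrict lam).d p u w = lam.d (bd.toFun p) (bd.tangent p u) (bd.tangent p w) :=
  OneForm.d_pullback lam bd.toFun _ p u w

include hs in
theorem dForm_tangent (p : M) (u : Tan (𝓡 3) p) : hs.dForm (bd.toFun p) (bd.tangent p u) = 0 := by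
  have h1 : HasMFDerivAt (𝓡 3) ℐ (s ∘ bd.toFun) p ((mfderiv ℋ ℐ s (bd.toFun p)).comp (mfderiv (𝓡 3) ℋ bd.toFun p)) :=
    HasMFDerivAt.comp p (hs.contMDiff.mdifferentiableAt (by simp)).hasMFDerivAt
      (bd.contMDiff.mdifferentiableAt (by simp)).hasMFDerivAt
  have h2 : s ∘ bd.toFun = fun _ => 0 := funext fun p => (hs.eq_zero_iff _).2 (bd.mem_boundary p)
  have h3 := h1.mfderiv
  rw [h2, mfderiv_const] at h3; exact (DFunLike.congr_fun h3 u).symm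

include hs in
theorem exists_basis_cons (p : M) {n : Tan ℋ (bd.toFun p)}
    (hn : IsOutward (bd.toFun p) n) (e : Basis (Fin 3) ℝ (Tan (𝓡 3) p)) : ∃ b : Basis (Fin 4) ℝ (Tan ℋ (bd.toFun p)),
      ⇑b = ![n, bd.tangent p (e 0), bd.tangent p (e 1), bd.tangent p (e 2)] := by
  have h1 : LinearIndependent ℝ (fun i => bd.tangent p (e i)) :=
    e.linearIndependent.map' _ (LinearMap.ker_eq_bot.2 (bd.tangent_injective p))
  have h2 : n ∉ Submodule.span ℝ (range fun i => bd.tangent p (e i)) := by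
    intro hmem
    have hle : Submodule.span ℝ (range fun i => bd.tangent p (e i)) ≤ LinearMap.ker (hs.dForm.cov (bd.toFun p)) := by
      rw [Submodule.span_le]; rintro _ ⟨i, rfl⟩; exact bd.dForm_tangent hs p (e i)
    have h3 : mvfderiv ℋ s (bd.toFun p) n = 0 := hle hmem
    exact (hs.outward _ (bd.mem_boundary p) n hn).ne' h3
  have h3 := linearIndependent_finCons.2 ⟨h1, h2⟩
  refine ⟨basisOfLinearIndependentOfCardEqFinrank h3 (by rw [finrank_tangentSpace]; rfl), ?_⟩
  rw [coe_basisOfLinearIndependentOfCardEqFinrank]; funext i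
  fin_cases i <;> rfl

include hs in
theorem exists_positive_basis (o : FourOrientation V) (p : M) :
    ∃ e : Basis (Fin 3) ℝ (Tan (𝓡 3) p), bd.Positive o p e := by
  set e : Basis (Fin 3) ℝ (Tan (𝓡 3) p) := (EuclideanSpace.basisFun (Fin 3) ℝ).toBasis
  set n : Tan ℋ (bd.toFun p) := -(EuclideanSpace.single 0 1 : ℝ⁴)
  have hn : IsOutward (bd.toFun p) n := by rw [isOutward_iff]; simp [n]
  obtain ⟨b, hb⟩ := bd.exists_basis_cons hs p hn e
  rcases b.orientation_eq_or_eq_neg (o.orient (bd.toFun p)) with h | h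
  · exact ⟨e, n, hn, b, hb, h.symm⟩
  · set e' : Basis (Fin 3) ℝ (Tan (𝓡 3) p) := e.unitsSMul (fun i => if i = 0 then -1 else 1) with he'
    have e0 : e' 0 = -e 0 := by simp [he', Basis.unitsSMul_apply]
    have e1 : e' 1 = e 1 := by simp [he', Basis.unitsSMul_apply]
    have e2 : e' 2 = e 2 := by simp [he', Basis.unitsSMul_apply]
    obtain ⟨b', hb'⟩ := bd.exists_basis_cons hs p hn e'
    refine ⟨e', n, hn, b', hb', ?_⟩
    rcases b'.orientation_eq_or_eq_neg (o.orient (bd.toFun p)) with h' | h'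
    · exact h'.symm
    · exfalso
      have h1 := (b.orientation_eq_iff_det_pos b').1 (neg_injective (h.symm.trans h'))
      have h2 : ⇑b' = update b 1 (-b 1) := by
        rw [hb', hb, e0, e1, e2]; funext i
        fin_cases i <;> simp
      rw [h2, AlternatingMap.map_update_neg, Function.update_eq_self, b.det_self] at h1; linarith

include hs in
theorem t3_pos_iff {lam : OneForm ℋ V} (hlam : IsPositiveSymplectic o lam) (p : M) {τ : Tan ℋ (bd.toFun p) →ₗ[ℝ] ℝ}
    {B : Tan ℋ (bd.toFun p) →ₗ[ℝ] Tan ℋ (bd.toFun p) →ₗ[ℝ] ℝ}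
    (hB : ∀ u, B u u = 0) {a : Tan (𝓡 3) p →ₗ[ℝ] ℝ}
    {B' : Tan (𝓡 3) p →ₗ[ℝ] Tan (𝓡 3) p →ₗ[ℝ] ℝ}
    (ha : ∀ u, τ (bd.tangent p u) = a u) (hB' : ∀ u w, B (bd.tangent p u) (bd.tangent p w) = B' u w) :
    (∀ v, bd.Positive o p v → 0 < t3 a B' v) ↔
      0 < volRatio (wedge (hs.dForm.cov (bd.toFun p)) τ) B (lam.dLin (bd.toFun p)) := by
  have key : ∀ v, bd.Positive o p v → (0 < volRatio (wedge (hs.dForm.cov (bd.toFun p)) τ) B (lam.dLin (bd.toFun p)) ↔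
        0 < t3 a B' v) := by
    rintro v ⟨n, hn, b, hb, hbo⟩
    rw [volRatio_pos_iff (wedge_self _ _) hB (lam.dLin_self _) (hlam.pf_pos _ hbo), hb]
    have h1 := pf2_wedge_boundary B (hs.dForm.cov (bd.toFun p)) τ (n := n)
      (bd.dForm_tangent hs p (v 0)) (bd.dForm_tangent hs p (v 1)) (bd.dForm_tangent hs p (v 2))
    have h2 : t3 τ B ![bd.tangent p (v 0), bd.tangent p (v 1), bd.tangent p (v 2)] = t3 a B' v := by simp [t3, ha, hB']
    rw [h2] at h1
    have h3 : 0 < hs.dForm.cov (bd.toFun p) n := hs.outward _ (bd.mem_boundary p) n hn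
    change 0 < pf2 _ B ![n, bd.tangent p (v 0), bd.tangent p (v 1), bd.tangent p (v 2)] ↔ _
    rw [h1, mul_pos_iff_of_pos_left h3]
  refine ⟨fun h => ?_, fun h v hv => (key v hv).1 h⟩
  obtain ⟨e, he⟩ := bd.exists_positive_basis hs o p
  exact (key e he).2 (h e he)

/-- The form `α ∧ dβ` is positive on the boundary. -/
def WedgePos (o : FourOrientation V) (α β : OneForm (𝓡 3) M) : Prop :=
  ∀ p v, bd.Positive o p v → 0 < t3 (α.cov p) (β.dLin p) v

include hs in
theorem wedgePos_iff {lam : OneForm ℋ V} (hlam : IsPositiveSymplectic o lam)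
    (α β : OneForm ℋ V) : bd.WedgePos o (bd.restrict α) (bd.restrict β) ↔
      ∀ p, 0 < volRatio (wedge (hs.dForm.cov (bd.toFun p)) (α.cov (bd.toFun p)))
        (β.dLin (bd.toFun p)) (lam.dLin (bd.toFun p)) :=
  forall_congr' fun p => bd.t3_pos_iff hs hlam p (β.dLin_self _) (fun _ => rfl)
    (fun u w => (bd.restrict_d β p u w).symm)

theorem WedgePos.smul_left {α α' β : OneForm (𝓡 3) M} (h : bd.WedgePos o α β)
    (hα : ∀ p, ∃ c : ℝ, 0 < c ∧ α' p = c • α p) : bd.WedgePos o α' β := by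
  intro p v hv
  obtain ⟨c, hc, e⟩ := hα p
  have h1 : t3 (α'.cov p) (β.dLin p) v = c * t3 (α.cov p) (β.dLin p) v := by
    simp only [t3, OneForm.cov_apply, e, ContinuousLinearMap.smul_apply, smul_eq_mul]; ring
  rw [h1]; exact mul_pos hc (h p v hv)

include hs in
theorem dominates_iff {lam : OneForm ℋ V} {α : bd.ContactForm o} :
    Dominates bd o lam ⟦α⟧ ↔ bd.WedgePos o α.1 (bd.restrict lam) := by
  constructor
  · rintro ⟨α', h1, h2⟩
    have h3 : bd.WedgePos o α'.1 (bd.restrict lam) := fun p v hv =>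
      t3_pos_of_dominates (α'.1.dLin_self p) ((bd.restrict lam).dLin_self p) (α'.2 p v hv) (h2 p)
    exact h3.smul_left bd (Quotient.exact h1)
  · intro h
    refine ⟨α, rfl, fun p u w hu hw huw => ?_⟩
    obtain ⟨e, he⟩ := bd.exists_positive_basis hs o p
    exact dominates_of_t3_pos (α.1.dLin_self p) ((bd.restrict lam).dLin_self p) (α.2 p e he) (h p e he) hu hw huw

end BoundaryIdentification

end BoundaryPositivity

section Collar

theorem range_euclideanHalfSpace_eq : range ℋ = affineHalf 0 (EuclideanSpace.proj (0 : Fin 4) : ℝ⁴ →L[ℝ] ℝ) := by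
  rw [range_modelWithCornersEuclideanHalfSpace]; ext y; simp [mem_affineHalf]

variable {s : V → ℝ} (hs : IsBdryFun s)

include hs in
theorem IsBdryFun.inward {x : V} (hx : x ∈ (ℋ).boundary V) {w : ℝ⁴} (hw : mvfderiv ℋ s x w < 0) : 0 < w 0 := by
  by_contra! h
  have h1 := HasMFDerivAt.neg (hs.contMDiff.mdifferentiableAt (x := x) (by simp)).hasMFDerivAt
  have h2 := mvfderiv_nonneg_of_inward hx h1.mdifferentiableAt
    (by simp [(hs.eq_zero_iff x).2 hx]) (Eventually.of_forall fun y => by simpa using hs.nonpos y)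
    (w := -w) (by simpa using h)
  have h3 : mvfderiv ℋ (-s) x (-w) = -mvfderiv ℋ s x (-w) := DFunLike.congr_fun h1.mfderiv (-w)
  have h4 : mvfderiv ℋ s x (-w) = -mvfderiv ℋ s x w := map_neg _ _
  change 0 ≤ mvfderiv ℋ (-s) x (-w) at h2; rw [h3, h4] at h2; linarith

/-- `X` is a smooth vector field pointing inward along the boundary. -/
structure IsInwardField (s : V → ℝ) (X : ∀ x : V, Tan ℋ x) : Prop where
  contMDiff : SmoothField X
  inward : ∀ x ∈ (ℋ).boundary V, mvfderiv ℋ s x (X x) < 0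

include hs in
theorem exists_isInwardField [T2Space V] [CompactSpace V] : ∃ X : ∀ x : V, Tan ℋ x, IsInwardField s X := by
  set t : ∀ x : V, Set (Tan ℋ x) := fun x => {w | x ∈ (ℋ).boundary V → mvfderiv ℋ s x w < 0} with ht
  suffices h : (∀ x, Convex ℝ (t x)) ∧ ∀ x₀ : V, ∃ U ∈ 𝓝 x₀, ∃ Y : ∀ x : V, Tan ℋ x,
      ContMDiffOn ℋ (ℋ).tangent ∞ (fun x => (⟨x, Y x⟩ : TangentBundle ℋ V)) U ∧ ∀ y ∈ U, Y y ∈ t y by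
    obtain ⟨X, hX⟩ := exists_contMDiffSection_forall_mem_convex_of_local (n := ⊤)
      (F_fiber := ℝ⁴) ℋ (fun x : V => Tan ℋ x) t h.1 h.2
    exact ⟨X, X.contMDiff, fun x hx => hX x hx⟩
  refine ⟨fun x => ?_, fun x₀ => ?_⟩
  · intro w hw w' hw' a b ha hb hab hx
    have h1 : mvfderiv ℋ s x (a • w + b • w') = a * mvfderiv ℋ s x w + b * mvfderiv ℋ s x w' := by
      rw [map_add, map_smul, map_smul]; rfl
    change mvfderiv ℋ s x (a • w + b • w') < 0; rw [h1]
    rcases ha.eq_or_lt with h | h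
    · have : b = 1 := by linarith
      rw [← h, this]; simpa using hw' hx
    · have h2 := mul_neg_of_pos_of_neg h (hw hx)
      have h3 := mul_nonpos_of_nonneg_of_nonpos hb (hw' hx).le
      linarith
  · set e : ℝ⁴ := EuclideanSpace.single 0 1
    have hc : ContinuousOn (fun x => hs.dForm x (OneForm.constSection ℋ x₀ e x)) (crd ℋ x₀).source :=
      (OneForm.continuousOn_apply (T := Unit) (F := fun _ => hs.dForm) continuous_const x₀ e).comp
        (f := fun x => ((), x)) (by fun_prop) fun x hx => ⟨mem_univ _, hx⟩
    by_cases hb : x₀ ∈ (ℋ).boundary V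
    · have h1 : OneForm.constSection ℋ x₀ e x₀ = e := by
        have := chartDSymm_chartD (I := ℋ) (mem_extChartAt_source x₀) e
        rwa [chartD_self] at this
      have h0 : hs.dForm x₀ (OneForm.constSection ℋ x₀ e x₀) < 0 := by
        rw [h1]
        have h2 := hs.outward x₀ hb (-e) ((isOutward_iff _).2 (by simp [e]))
        have h4 : mvfderiv ℋ s x₀ (-e) = -mvfderiv ℋ s x₀ e := map_neg _ _
        change mvfderiv ℋ s x₀ e < 0; linarith
      have h2 := (hc.continuousAt (extChartAt_source_mem_nhds x₀)).eventually_lt_const h0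
      refine ⟨{x | hs.dForm x (OneForm.constSection ℋ x₀ e x) < 0} ∩ (chartAt (EuclideanHalfSpace 4) x₀).source,
        inter_mem h2 (chart_source_mem_nhds _ x₀), OneForm.constSection ℋ x₀ e,
        (OneForm.contMDiffOn_constSection x₀ e).mono inter_subset_right, fun y hy _ => hy.1⟩
    · refine ⟨(chartAt (EuclideanHalfSpace 4) x₀).source ∩ ((ℋ).boundary V)ᶜ, inter_mem (chart_source_mem_nhds _ x₀)
          ((ModelWithCorners.isClosed_boundary (I := ℋ) (M := V) (n := ∞) (by simp)).isOpen_compl.mem_nhds hb),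
        OneForm.constSection ℋ x₀ e,
        (OneForm.contMDiffOn_constSection x₀ e).mono inter_subset_left, fun y hy h => absurd h hy.2⟩

variable {X : ∀ x : V, Tan ℋ x} (hX : IsInwardField s X)

include hs hX in
theorem IsInwardField.coord_pos (x : V) : 0 < 0 + (EuclideanSpace.proj (0 : Fin 4) : ℝ⁴ →L[ℝ] ℝ) (crd ℋ x x) ∨
    0 < (EuclideanSpace.proj (0 : Fin 4) : ℝ⁴ →L[ℝ] ℝ) (X x) := by
  by_cases hx : x ∈ (ℋ).boundary V
  · exact Or.inr (hs.inward hx (hX.inward x hx))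
  · left
    have h1 := extChartAt_zero_nonneg x (mem_extChartAt_source (I := ℋ) x)
    rw [isBoundaryPoint_iff_coord (mem_extChartAt_source x)] at hx; rw [zero_add]
    exact lt_of_le_of_ne h1 (Ne.symm hx)

/-- `Φ` is a smooth forward flow of `X` into the interior, up to the time `T`. -/
structure IsInwardFlow (X : ∀ x : V, Tan ℋ x) (T : ℝ) (Φ : ℝ → V → V) : Prop where
  pos : 0 < T
  isSemiflow : IsSemiflow X T Φ
  interior : ∀ x, ∀ t ∈ Ioc 0 T, Φ t x ∈ (ℋ).interior V
  contMDiffOn : ContMDiffOn ((ℐ).prod ℋ) ℋ ∞ (fun p : ℝ × V => Φ p.1 p.2) (Icc 0 T ×ˢ univ)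
  injective_mfderiv : ∀ t ∈ Icc 0 T, ∀ x, Injective (mfderiv ℋ ℋ (Φ t) x)

include hs hX in
theorem IsInwardField.exists_isInwardFlow [T2Space V] [CompactSpace V] :
    ∃ (T : ℝ) (Φ : ℝ → V → V), IsInwardFlow X T Φ := by
  obtain ⟨T, Φ, h1, h2, h3⟩ := exists_isSemiflow range_euclideanHalfSpace_eq hX.contMDiff (hX.coord_pos hs)
  exact ⟨T, Φ, h1, h2, h3, h2.contMDiffOn range_euclideanHalfSpace_eq hX.contMDiff (hX.coord_pos hs),
    fun t ht x => h2.injective_mfderiv range_euclideanHalfSpace_eq hX.contMDiff (hX.coord_pos hs) ht x⟩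

variable {T : ℝ} {Φ : ℝ → V → V} (hΦ : IsInwardFlow X T Φ) (bd : BoundaryIdentification M V)

include hΦ in
theorem IsInwardFlow.contMDiff {t : ℝ} (ht : t ∈ Icc 0 T) : ContMDiff ℋ ℋ ∞ (Φ t) := contMDiff_slice hΦ.contMDiffOn ht

/-- The collar of the boundary defined by a flow. -/
def collar (Φ : ℝ → V → V) (q : ℝ × M) : V := Φ q.1 (bd.toFun q.2)

include hΦ in
theorem IsInwardFlow.contMDiffAt {q : ℝ × V} (hq : q.1 ∈ Ioo 0 T) :
    ContMDiffAt ((ℐ).prod ℋ) ℋ ∞ (fun p : ℝ × V => Φ p.1 p.2) q :=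
  hΦ.contMDiffOn.contMDiffAt (prod_mem_nhds (Icc_mem_nhds hq.1 hq.2) univ_mem)

include hΦ in
theorem contMDiffAt_collar {q : ℝ × M} (hq : q.1 ∈ Ioo 0 T) : ContMDiffAt ((ℐ).prod (𝓡 3)) ℋ ∞ (collar bd Φ) q := by
  have h1 : ContMDiffAt ((ℐ).prod (𝓡 3)) ((ℐ).prod ℋ) ∞ (fun q : ℝ × M => (q.1, bd.toFun q.2)) q :=
    (contMDiff_fst.prodMk (bd.contMDiff.comp contMDiff_snd)).contMDiffAt
  exact ContMDiffAt.comp q (g := fun p : ℝ × V => Φ p.1 p.2) (hΦ.contMDiffAt (q := (q.1, bd.toFun q.2)) hq) h1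

include hΦ in
theorem mfderiv_collar {q : ℝ × M} (hq : q.1 ∈ Ioo 0 T) (τ : ℝ) (u : Tan (𝓡 3) q.2) :
    mfderiv ((ℐ).prod (𝓡 3)) ℋ (collar bd Φ) q (τ, u) = τ • X (Φ q.1 (bd.toFun q.2)) +
        mfderiv ℋ ℋ (Φ q.1) (bd.toFun q.2) (bd.tangent q.2 u) := by
  refine (mfderiv_prod_eq_add_apply (v := ((τ, u) : Tan ((ℐ).prod (𝓡 3)) q))
    ((contMDiffAt_collar hΦ bd hq).mdifferentiableAt (by simp))).trans ?_
  have h1 : HasMFDerivAt ℐ ℋ (fun t => collar bd Φ (t, q.2)) q.1 _ :=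
    HasMFDerivWithinAt.hasMFDerivAt (hΦ.isSemiflow.curve (bd.toFun q.2) q.1 ⟨hq.1.le, hq.2.le⟩) (Icc_mem_nhds hq.1 hq.2)
  have h2 : HasMFDerivAt (𝓡 3) ℋ (fun p => collar bd Φ (q.1, p)) q.2 _ :=
    HasMFDerivAt.comp q.2 ((hΦ.contMDiff ⟨hq.1.le, hq.2.le⟩).mdifferentiableAt
      (x := bd.toFun q.2) (by simp)).hasMFDerivAt
      (bd.contMDiff.mdifferentiableAt (by simp)).hasMFDerivAt
  congr 1
  · exact DFunLike.congr_fun h1.mfderiv τ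
  · exact DFunLike.congr_fun h2.mfderiv u

include hs hX hΦ in
theorem injective_mfderiv_collar [T2Space V] {q : ℝ × M} (hq : q.1 ∈ Ioo 0 T) :
    Injective (mfderiv ((ℐ).prod (𝓡 3)) ℋ (collar bd Φ) q) := by
  have hq' : q.1 ∈ Icc 0 T := ⟨hq.1.le, hq.2.le⟩
  rw [injective_iff_map_eq_zero]; rintro ⟨τ, u'⟩ h
  obtain ⟨u, rfl⟩ : ∃ u : Tan (𝓡 3) q.2, u = u' := ⟨_, rfl⟩
  replace h := (mfderiv_collar hΦ bd hq τ u).symm.trans h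
  have h1 := hΦ.isSemiflow.mfderiv_apply_self range_euclideanHalfSpace_eq hX.contMDiff
    ⟨hq.1.le, hq.2⟩ (x := bd.toFun q.2) ((hΦ.contMDiff hq').mdifferentiableAt (by simp))
  have h2 : mfderiv ℋ ℋ (Φ q.1) (bd.toFun q.2) (τ • X (bd.toFun q.2) + bd.tangent q.2 u) = 0 := by
    rw [map_add, map_smul, h1]; exact h
  have h3 : τ • X (bd.toFun q.2) + bd.tangent q.2 u = 0 := hΦ.injective_mfderiv q.1 hq' _ (h2.trans (map_zero _).symm)
  have e0 : hs.dForm (bd.toFun q.2) (bd.tangent q.2 u) = 0 := bd.dForm_tangent hs q.2 u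
  have h4 : τ * hs.dForm (bd.toFun q.2) (X (bd.toFun q.2)) = 0 := by
    have := congrArg (hs.dForm (bd.toFun q.2)) h3
    rwa [map_add, map_smul, e0, map_zero, add_zero, smul_eq_mul] at this
  have h5 : τ = 0 := (mul_eq_zero.1 h4).resolve_right (hX.inward _ (bd.mem_boundary q.2)).ne
  rw [h5, zero_smul, zero_add] at h3
  have h6 : u = 0 := bd.tangent_injective q.2 (h3.trans (map_zero _).symm)
  rw [h5, h6]; rfl

include hX hΦ in
theorem injOn_collar [T2Space V] : InjOn (collar bd Φ) (Icc 0 T ×ˢ univ) := by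
  have key : ∀ q ∈ (Icc 0 T ×ˢ univ : Set (ℝ × M)), ∀ q' ∈ (Icc 0 T ×ˢ univ : Set (ℝ × M)),
      q.1 ≤ q'.1 → collar bd Φ q = collar bd Φ q' → q = q' := by
    rintro ⟨t, p⟩ ⟨ht, -⟩ ⟨t', p'⟩ ⟨ht', -⟩ hle h; simp only at ht ht' hle
    have h1 : Φ t' (bd.toFun p') = Φ t (Φ (t' - t) (bd.toFun p')) := by
      rw [← hΦ.isSemiflow.add range_euclideanHalfSpace_eq hX.contMDiff ht.1 (sub_nonneg.2 hle) (by linarith [ht'.2])]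
      congr 1; ring
    have h2 : bd.toFun p = Φ (t' - t) (bd.toFun p') :=
      hΦ.isSemiflow.injective range_euclideanHalfSpace_eq hX.contMDiff ht (h.trans h1)
    rcases hle.eq_or_lt with rfl | hlt
    · rw [sub_self, hΦ.isSemiflow.init] at h2; rw [bd.injective h2]
    · have h3 := hΦ.interior (bd.toFun p') (t' - t) ⟨by linarith, by linarith [ht.1, ht'.2]⟩
      rw [← h2] at h3; exact absurd (bd.mem_boundary p) (by rw [← ModelWithCorners.compl_interior]; simpa using h3)
  intro q hq q' hq' h
  rcases le_total q.1 q'.1 with hle | hle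
  · exact key q hq q' hq' hle h
  · exact (key q' hq' q hq hle h.symm).symm

include hs hX hΦ in
theorem exists_collar_inverse [T2Space V] [Nonempty M] : ∃ g : V → ℝ × M, ∀ q : ℝ × M, q.1 ∈ Ioo 0 T →
    ContMDiffAt ℋ ((ℐ).prod (𝓡 3)) ∞ g (collar bd Φ q) ∧ g (collar bd Φ q) = q ∧
    ∀ᶠ z in 𝓝 (collar bd Φ q), collar bd Φ (g z) = z ∧ (g z).1 ∈ Ioo 0 T := by
  set g : V → ℝ × M := Function.invFunOn (collar bd Φ) (Ioo 0 T ×ˢ univ) with hg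
  have hinj : InjOn (collar bd Φ) (Ioo 0 T ×ˢ univ) :=
    (injOn_collar hX hΦ bd).mono (prod_mono Ioo_subset_Icc_self le_rfl)
  have hgq : ∀ q : ℝ × M, q.1 ∈ Ioo 0 T → g (collar bd Φ q) = q := fun q hq => hinj.leftInvOn_invFunOn ⟨hq, mem_univ _⟩
  refine ⟨g, fun q hq => ?_⟩
  obtain ⟨g', h1, h2, h3, -⟩ := exists_contMDiffAt_localInverse (contMDiffAt_collar hΦ bd hq)
    (injective_mfderiv_collar hs hX hΦ bd hq) (by simp)
  have h4 : ∀ᶠ z in 𝓝 (collar bd Φ q), (g' z).1 ∈ Ioo 0 T := by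
    have : Tendsto (fun z => (g' z).1) (𝓝 (collar bd Φ q)) (𝓝 q.1) := by
      have := (continuous_fst.continuousAt.comp h1.continuousAt).tendsto
      simpa only [Function.comp_def, h2] using this
    exact this.eventually (isOpen_Ioo.mem_nhds hq)
  have h5 : ∀ᶠ z in 𝓝 (collar bd Φ q), g z = g' z := by
    filter_upwards [h3, h4] with z hz hz'
    rw [← hgq (g' z) hz', hz]
  refine ⟨h1.congr_of_eventuallyEq h5, hgq q hq, ?_⟩
  filter_upwards [h3, h4, h5] with z hz hz' hz''
  rw [hz'']; exact ⟨hz, hz'⟩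

end Collar

section BoundaryData

/-- A boundary function, an inward field, and an extension of 1-forms from the boundary, such that
the extended forms are pulled back along the inward field near the boundary. -/
structure BoundaryData (bd : BoundaryIdentification M V) where
  s : V → ℝ
  isBdry : IsBdryFun s
  X : ∀ x : V, Tan ℋ x
  isInwardField : IsInwardField s X
  ext : OneForm (𝓡 3) M → OneForm ℋ V
  continuous_ext : Continuous ext
  restrict_ext : ∀ β, bd.restrict (ext β) = β
  U : Set V
  isOpen_U : IsOpen U
  boundary_subset : (ℋ).boundary V ⊆ U
  ext_field : ∀ β, ∀ x ∈ U, ext β x (X x) = 0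
  d_ext_field : ∀ β, ∀ x ∈ U, ∀ w, (ext β).d x (X x) w = 0

theorem mfderiv_eq_zero_of_const_along {f : V → N} {X : ∀ x : V, Tan ℋ x} {T : ℝ} (hT : 0 < T) {Φ : ℝ → V → V}
    (hΦ : IsSemiflow X T Φ) {x : V} (hf : MDifferentiableAt ℋ I f x)
    (hconst : ∀ᶠ r in 𝓝[Icc 0 T] (0 : ℝ), f (Φ r x) = f x) : mfderiv ℋ I f x (X x) = 0 := by
  set F : V → E := fun y => crd I (f x) (f y) with hF
  have h1 : HasMFDerivAt ℋ 𝓘(ℝ, E) F x ((chartD I (f x) (f x)).comp (show ℝ⁴ →L[ℝ] E from mfderiv ℋ I f x)) :=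
    HasMFDerivAt.comp x (mdifferentiableAt_extChartAt (mem_chart_source _ (f x))).hasMFDerivAt hf.hasMFDerivAt
  have h2 : HasDerivWithinAt (fun r => F (Φ r x)) (mvfderiv ℋ F (Φ 0 x) (X (Φ 0 x))) (Icc 0 T) 0 :=
    (hΦ.curve x 0 ⟨le_rfl, hT.le⟩).hasDerivWithinAt_comp (by rw [hΦ.init]; exact h1.mdifferentiableAt)
  have h3 : HasDerivWithinAt (fun r => F (Φ r x)) (0 : E) (Icc 0 T) 0 := by
    refine (hasDerivWithinAt_const (0 : ℝ) (Icc 0 T) (F x)).congr_of_eventuallyEq ?_ (by rw [hΦ.init])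
    filter_upwards [hconst] with r hr
    simp only [hF, hr]
  have h4 := (uniqueDiffOn_Icc hT 0 ⟨le_rfl, hT.le⟩).eq_deriv _ h2 h3
  have h5 : ∀ y, y = x → mvfderiv ℋ F y (X y) = 0 → mvfderiv ℋ F x (X x) = 0 := by rintro _ rfl h; exact h
  have h6 := h5 _ (hΦ.init x) h4
  have h7 : chartD I (f x) (f x) (mfderiv ℋ I f x (X x)) = 0 := (DFunLike.congr_fun h1.mfderiv (X x)).symm.trans h6
  exact chartD_injective (I := I) (mem_extChartAt_source (f x)) (h7.trans (map_zero _).symm)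

variable (bd) [T2Space V] [CompactSpace V]

theorem exists_boundaryData_of_nonempty [Nonempty M] : Nonempty (BoundaryData bd) := by
  obtain ⟨s, hs⟩ := exists_isBdry V
  obtain ⟨X, hX⟩ := exists_isInwardField hs
  obtain ⟨T, Φ, hΦ⟩ := hX.exists_isInwardFlow hs
  obtain ⟨g, hg⟩ := exists_collar_inverse hs hX hΦ bd
  have hT := hΦ.pos
  set τ := T / 2 with hτ
  have hτT : τ ∈ Ioo 0 T := ⟨by positivity, by linarith⟩
  set U' : Set V := collar bd Φ '' (Ioo 0 T ×ˢ univ) with hU'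
  have hU'o : IsOpen U' := by
    rw [isOpen_iff_mem_nhds]; rintro _ ⟨q, hq, rfl⟩
    filter_upwards [(hg q hq.1).2.2] with z hz
    exact ⟨g z, ⟨hz.2, mem_univ _⟩, hz.1⟩
  have hΦs := hΦ.contMDiff (t := τ) ⟨hτT.1.le, hτT.2.le⟩
  set U : Set V := Φ τ ⁻¹' U' with hU
  have hUo : IsOpen U := hU'o.preimage hΦs.continuous
  set π : V → M := fun x => (g (Φ τ x)).2 with hπ
  have hπs : ContMDiffOn ℋ (𝓡 3) ∞ π U := by
    rintro x ⟨q, hq, hqx⟩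
    have h1 := (hg q hq.1).1
    rw [hqx] at h1; exact ((contMDiff_snd.contMDiffAt.comp _ h1).comp x hΦs.contMDiffAt).contMDiffWithinAt
  have hbU : ∀ p, bd.toFun p ∈ U := fun p => ⟨(τ, p), ⟨hτT, mem_univ _⟩, rfl⟩
  have hπb : π ∘ bd.toFun = id := funext fun p => by change (g (collar bd Φ (τ, p))).2 = p; rw [(hg (τ, p) hτT).2.1]
  have hsub : (ℋ).boundary V ⊆ U := by rw [← bd.range_eq]; rintro _ ⟨p, rfl⟩; exact hbU p
  have hπX : ∀ x ∈ U, mfderiv ℋ (𝓡 3) π x (X x) = 0 := by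
    intro x hx
    refine mfderiv_eq_zero_of_const_along hT hΦ.isSemiflow
      ((hπs.contMDiffAt (hUo.mem_nhds hx)).mdifferentiableAt (by simp)) ?_
    obtain ⟨q, hq, hqx⟩ := hx
    have h1 : ∀ᶠ r in 𝓝[Icc 0 T] (0 : ℝ), r < min (T - q.1) (T - τ) :=
      (eventually_lt_nhds (lt_min (by linarith [hq.1.2]) (by linarith [hτT.2]))).filter_mono nhdsWithin_le_nhds
    filter_upwards [h1, self_mem_nhdsWithin] with r hr hr'
    have hr1 := lt_of_lt_of_le hr (min_le_left _ _)
    have hr2 := lt_of_lt_of_le hr (min_le_right _ _)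
    have e1 : Φ τ (Φ r x) = collar bd Φ (q.1 + r, q.2) := by
      rw [← hΦ.isSemiflow.add range_euclideanHalfSpace_eq hX.contMDiff hτT.1.le hr'.1 (by linarith),
        add_comm, hΦ.isSemiflow.add range_euclideanHalfSpace_eq hX.contMDiff hr'.1 hτT.1.le (by linarith),
        ← hqx, add_comm q.1 r]
      exact (hΦ.isSemiflow.add range_euclideanHalfSpace_eq hX.contMDiff hr'.1 hq.1.1.le (by linarith) _).symm
    have hin : q.1 + r ∈ Ioo 0 T := ⟨by linarith [hq.1.1, hr'.1], by linarith⟩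
    change (g (Φ τ (Φ r x))).2 = (g (Φ τ x)).2; rw [e1, (hg _ hin).2.1, ← hqx, (hg q hq.1).2.1]
  obtain ⟨η, hη0, hη1, -⟩ := exists_contMDiffMap_zero_one_nhds_of_isClosed ℋ (n := ⊤)
    hUo.isClosed_compl (ModelWithCorners.isClosed_boundary (I := ℋ) (M := V) (n := ∞) (by simp))
    (disjoint_compl_left_iff_subset.2 hsub)
  have hsupp : tsupport η ⊆ U := by
    intro x hx
    by_contra hxU
    exact (notMem_tsupport_iff_eventuallyEq.2 (hη0.filter_mono (nhds_le_nhdsSet hxU))) hx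
  obtain ⟨W, hWo, hbW, hW⟩ := (eventually_nhdsSet_iff_exists).1 hη1
  have hηW : ∀ x ∈ W, ∀ᶠ y in 𝓝 x, η y = 1 := fun x hx => eventually_of_mem (hWo.mem_nhds hx) hW
  refine ⟨⟨s, hs, X, hX, fun β => β.weightedPullback η η.contMDiff π hUo hπs hsupp,
    OneForm.continuous_weightedPullback continuous_id _ _ _ _, fun β => ?_, W ∩ U,
    hWo.inter hUo, subset_inter hbW hsub, fun β x hx => ?_, fun β x hx w => ?_⟩⟩
  · ext p u
    have h1 : ∀ f : M → M, f = id → β (f p) (mfderiv (𝓡 3) (𝓡 3) f p u) = β p u := by rintro _ rfl; rw [mfderiv_id]; rfl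
    have h2 := h1 _ hπb
    rw [mfderiv_comp p ((hπs.contMDiffAt (hUo.mem_nhds (hbU p))).mdifferentiableAt (by simp))
      (bd.contMDiff.mdifferentiableAt (by simp))] at h2
    rw [bd.restrict_apply, OneForm.weightedPullback_apply, (hηW _ (hbW (bd.mem_boundary p))).self_of_nhds, one_mul]
    exact h2
  · rw [OneForm.weightedPullback_apply, hπX x hx.2, map_zero, mul_zero]
  · have h1 : mvfderiv ℋ η x = 0 := by
      have h : (⇑η) =ᶠ[𝓝 x] fun _ => (1 : ℝ) := hηW x hx.1
      have := h.mfderiv_eq (I := ℋ) (I' := ℐ)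
      rw [mfderiv_const] at this; exact this
    rw [OneForm.d_weightedPullback _ _ _ _ _ hx.2, hπX x hx.2, h1]
    have h2 : β.d (π x) (0 : Tan (𝓡 3) (π x)) (mfderiv ℋ (𝓡 3) π x w) = 0 :=
      congrArg (fun f => f (mfderiv ℋ (𝓡 3) π x w)) (map_zero (β.dLin (π x)))
    simp [h2]

theorem exists_boundaryData : Nonempty (BoundaryData bd) := by
  rcases isEmpty_or_nonempty M with h | h
  · obtain ⟨s, hs⟩ := exists_isBdry V
    obtain ⟨X, hX⟩ := exists_isInwardField hs
    have hb : (ℋ).boundary V = ∅ := by rw [← bd.range_eq, range_eq_empty]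
    exact ⟨⟨s, hs, X, hX, fun _ => (0 : ℝ) • hs.dForm, continuous_const,
      fun β => by ext p; exact h.elim p, ∅, isOpen_empty, by rw [hb], fun _ _ h => h.elim, fun _ _ h => h.elim⟩⟩
  · exact exists_boundaryData_of_nonempty bd

end BoundaryData

section NormalizedForms

variable (bd)

namespace BoundaryIdentification

include bd in
theorem t2Space [T2Space V] : T2Space M := bd.isSmoothEmbedding.isEmbedding.t2Space

include bd in
theorem compactSpace [CompactSpace V] : CompactSpace M := by
  have h : IsClosedEmbedding bd.toFun := ⟨bd.isSmoothEmbedding.isEmbedding, by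
    rw [bd.range_eq]
    exact ModelWithCorners.isClosed_boundary (I := ℋ) (M := V) (n := ∞) (by simp)⟩
  exact h.compactSpace

theorem isContactForm_fmul {α : OneForm (𝓡 3) M} (hα : bd.IsContactForm o α) {h : M → ℝ}
    (hh : ContMDiff (𝓡 3) ℐ ∞ h) (hpos : ∀ p, 0 < h p) : bd.IsContactForm o (OneForm.fmul h hh α) := by
  intro p v hv
  have h1 : (OneForm.fmul h hh α).cov p = h p • α.cov p := LinearMap.ext fun u => OneForm.fmul_apply h hh α p u
  have h2 : (OneForm.fmul h hh α).dLin p = wedge (mvfderiv (𝓡 3) h p).toLinearMap (α.cov p) + h p • α.dLin p :=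
    LinearMap.ext fun u => LinearMap.ext fun w => OneForm.d_fmul h hh α p u w
  have h3 := t3_smul_wedge (α.cov p) (mvfderiv (𝓡 3) h p).toLinearMap (α.dLin p) (h p) v
  rw [← h1, ← h2] at h3; change 0 < t3 ((OneForm.fmul h hh α).cov p) ((OneForm.fmul h hh α).dLin p) v; rw [h3]
  exact mul_pos (pow_pos (hpos p) 2) (hα p v hv)

variable [T2Space V] [CompactSpace V]

theorem contactForm_ne_zero {α : OneForm (𝓡 3) M} (hα : bd.IsContactForm o α) (p : M) : α p ≠ 0 := by
  obtain ⟨s, hs⟩ := exists_isBdry V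
  obtain ⟨e, he⟩ := bd.exists_positive_basis hs o p
  intro h
  have := hα p e he
  simp [h] at this

theorem exists_continuous_section (o : FourOrientation V) :
    ∃ σ : bd.ContactStructure o → bd.ContactForm o, Continuous σ ∧ ∀ ξ, ⟦σ ξ⟧ = ξ := by
  haveI := bd.t2Space
  haveI := bd.compactSpace
  obtain ⟨m, Y, hY, hspan⟩ := exists_spanning_vectorFields (𝓡 3) M
  set N : OneForm (𝓡 3) M → M → ℝ := fun α p => ∑ i, α p (Y i p) * α p (Y i p) with hN
  have hNs : ∀ α, ContMDiff (𝓡 3) ℐ ∞ (N α) := fun α =>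
    contMDiff_finsetSum fun i _ => (α.contMDiff_apply (hY i)).mul (α.contMDiff_apply (hY i))
  have hNpos : ∀ α : bd.ContactForm o, ∀ p, 0 < N α.1 p := by
    intro α p
    have h0 : 0 ≤ N α.1 p := Finset.sum_nonneg fun i _ => mul_self_nonneg _
    refine lt_of_le_of_ne h0 fun h => bd.contactForm_ne_zero α.2 p (hspan α.1 p fun i => ?_)
    have := (Finset.sum_eq_zero_iff_of_nonneg fun i _ => mul_self_nonneg (α.1 p (Y i p))).1 h.symm i (Finset.mem_univ i)
    exact mul_self_eq_zero.1 this
  have hg : ContDiffOn ℝ ∞ (fun x : ℝ => (√x)⁻¹) (Ioi 0) := fun x hx =>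
    ((Real.contDiffAt_sqrt (ne_of_gt hx)).inv (Real.sqrt_pos.2 hx).ne').contDiffWithinAt
  have hh : ∀ α : bd.ContactForm o, ContMDiff (𝓡 3) ℐ ∞ (fun p => (√(N α.1 p))⁻¹) :=
    fun α p => ((hg.contDiffAt (Ioi_mem_nhds (hNpos α p))).contMDiffAt).comp p (hNs α.1 p)
  have hhpos : ∀ (α : bd.ContactForm o) p, 0 < (√(N α.1 p))⁻¹ := fun α p => inv_pos.2 (Real.sqrt_pos.2 (hNpos α p))
  set n : bd.ContactForm o → bd.ContactForm o := fun α =>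
    ⟨OneForm.fmul _ (hh α) α.1, bd.isContactForm_fmul α.2 (hh α) (hhpos α)⟩ with hn
  have hcont : Continuous n := by
    refine Continuous.subtype_mk (OneForm.continuous_fmul continuous_subtype_val hh fun x₀ k => ?_) _
    have hu := OneForm.uniqueDiffOn_target (I := 𝓡 3) x₀
    refine Fam.comp_outer hu (f := fun (α : bd.ContactForm o) y => N α.1 ((crd (𝓡 3) x₀).symm y))
      (g := fun x => (√x)⁻¹) (O := Ioi 0) ?_ isOpen_Ioi hg fun α y _ => hNpos α _
    refine Fam.sum _ hu fun i _ => ?_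
    have := OneForm.fam_apply (T := bd.ContactForm o) continuous_subtype_val (hY i) x₀ k
    exact this.smul hu this
  have hinv : ∀ α β : bd.ContactForm o, α ≈ β → n α = n β := by
    intro α β h
    refine Subtype.ext (OneForm.ext (funext fun p => ContinuousLinearMap.ext fun w => ?_))
    obtain ⟨c, hc, e⟩ := h p
    change OneForm.fmul _ (hh α) α.1 p w = OneForm.fmul _ (hh β) β.1 p w
    rw [OneForm.fmul_apply, OneForm.fmul_apply]
    have h1 : N β.1 p = c ^ 2 * N α.1 p := by
      simp only [hN, e, ContinuousLinearMap.smul_apply, smul_eq_mul, Finset.mul_sum]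
      exact Finset.sum_congr rfl fun i _ => by ring
    rw [h1, Real.sqrt_mul (by positivity), Real.sqrt_sq hc.le, e, ContinuousLinearMap.smul_apply, smul_eq_mul, mul_inv]
    field_simp
  refine ⟨Quotient.lift n hinv, hcont.quotient_lift hinv, fun ξ => ?_⟩
  induction ξ using Quotient.inductionOn with
  | h α =>
    refine Quotient.sound fun p => ⟨√(N α.1 p), Real.sqrt_pos.2 (hNpos α p), ?_⟩
    ext w; change α.1 p w = √(N α.1 p) * OneForm.fmul _ (hh α) α.1 p w
    rw [OneForm.fmul_apply, ← mul_assoc, mul_inv_cancel₀ (Real.sqrt_pos.2 (hNpos α p)).ne', one_mul]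

end BoundaryIdentification

end NormalizedForms

section Thickening

theorem exists_abs_le_of_compact {Z : Type*} [TopologicalSpace Z] [CompactSpace Z] {f : Z → ℝ}
    (hf : Continuous f) : ∃ D : ℝ, 0 ≤ D ∧ ∀ z, |f z| ≤ D := by
  obtain ⟨D, hD⟩ := isCompact_univ.exists_bound_of_continuousOn hf.continuousOn
  exact ⟨max D 0, le_max_right _ _, fun z => (hD z (mem_univ z)).trans (le_max_left _ _)⟩

theorem exists_le_near_zero {Z : Type*} [TopologicalSpace Z] [CompactSpace Z] {f s : Z → ℝ}
    (hf : Continuous f) (hs : Continuous s) (hs0 : ∀ z, s z ≤ 0) (hpos : ∀ z, s z = 0 → 0 < f z) :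
    ∃ a > (0 : ℝ), ∃ δ > (0 : ℝ), ∀ z, -δ ≤ s z → a ≤ f z := by
  by_contra! hcon
  have h : ∀ n : ℕ, ∃ z, -(1 / ((n : ℝ) + 1)) ≤ s z ∧ f z < 1 / ((n : ℝ) + 1) := fun n =>
    hcon _ Nat.one_div_pos_of_nat _ Nat.one_div_pos_of_nat
  choose z hz1 hz2 using h
  obtain ⟨z₀, hz₀⟩ := exists_clusterPt_of_compactSpace (map z atTop)
  have hc : MapClusterPt z₀ atTop z := hz₀
  have h1 : 0 ≤ s z₀ := by
    by_contra! h
    have h2 : ∀ᶠ y in 𝓝 z₀, s y < s z₀ / 2 := hs.continuousAt.eventually_lt_const (by linarith)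
    have h3 := hc.frequently h2
    obtain ⟨n, hn⟩ := exists_nat_one_div_lt (show (0 : ℝ) < -(s z₀ / 2) by linarith)
    obtain ⟨m, hm, hm'⟩ := (h3.and_eventually (eventually_ge_atTop n)).exists
    have := Nat.one_div_le_one_div (α := ℝ) hm'
    linarith [hz1 m]
  have h4 := hpos z₀ (le_antisymm (hs0 z₀) h1)
  have h2 : ∀ᶠ y in 𝓝 z₀, f z₀ / 2 < f y := hf.continuousAt.eventually_const_lt (by linarith)
  obtain ⟨n, hn⟩ := exists_nat_one_div_lt (show (0 : ℝ) < f z₀ / 2 by linarith)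
  obtain ⟨m, hm, hm'⟩ := ((hc.frequently h2).and_eventually (eventually_ge_atTop n)).exists
  have := Nat.one_div_le_one_div (α := ℝ) hm'
  linarith [hz2 m]

variable {T : Type*} [TopologicalSpace T] [CompactSpace T] [CompactSpace V]

variable (D : BoundaryData bd)

/-- The covector and bilinear form at a point entering the boundary estimates. -/
def BoundaryData.ds (x : V) : Tan ℋ x →ₗ[ℝ] ℝ := D.isBdry.dForm.cov x

theorem BoundaryData.continuous_ratio {lam F G : T → OneForm ℋ V} (hF : Continuous F)
    (hG : Continuous G) (hlam : Continuous lam) (hpos : ∀ t, IsPositiveSymplectic o (lam t)) :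
    Continuous fun p : T × V =>
      volRatio (wedge (D.ds p.2) ((F p.1).cov p.2)) ((G p.1).dLin p.2) ((lam p.1).dLin p.2) := by
  have h1 : OneForm.ContBilin (I := ℋ) (M := V) fun (t : T) x =>
      wedge (D.isBdry.dForm.cov x) ((F t).cov x) :=
    OneForm.contBilin_wedge (F := fun _ : T => D.isBdry.dForm) continuous_const hF
  have bE : Basis (Fin 4) ℝ ℝ⁴ := (EuclideanSpace.basisFun (Fin 4) ℝ).toBasis
  have b2 := fun t x => (G t).dLin_self x
  have b3 := fun t x => (lam t).dLin_self x
  have c := fun t x b => (hpos t).pf_ne_zero x b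
  have h2 := OneForm.contBilin_dLin hG
  have h3 := OneForm.contBilin_dLin hlam
  have h := OneForm.continuous_volRatio bE h1 h2 h3 (fun _ _ => wedge_self _ _) b2 b3
  exact h c

theorem continuous_dRatio {lam F G : T → OneForm ℋ V} (hF : Continuous F)
    (hG : Continuous G) (hlam : Continuous lam) (hpos : ∀ t, IsPositiveSymplectic o (lam t)) :
    Continuous fun p : T × V => volRatio ((F p.1).dLin p.2) ((G p.1).dLin p.2) ((lam p.1).dLin p.2) := by
  have bE : Basis (Fin 4) ℝ ℝ⁴ := (EuclideanSpace.basisFun (Fin 4) ℝ).toBasis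
  have b1 := fun t x => (F t).dLin_self x
  have b2 := fun t x => (G t).dLin_self x
  have b3 := fun t x => (lam t).dLin_self x
  have c := fun t x b => (hpos t).pf_ne_zero x b
  have h1 := OneForm.contBilin_dLin hF
  have h2 := OneForm.contBilin_dLin hG
  have h3 := OneForm.contBilin_dLin hlam
  have h := OneForm.continuous_volRatio bE h1 h2 h3 b1 b2 b3
  exact h c

/-- The form `g(s) α` extended from the boundary. -/
def BoundaryData.cone (g : ℝ → ℝ) (hg : ContDiff ℝ ∞ g) (α : OneForm (𝓡 3) M) : OneForm ℋ V :=
  OneForm.fmul (fun x => g (D.s x)) (hg.contMDiff.comp D.isBdry.contMDiff) (D.ext α)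

theorem BoundaryData.cone_apply (g : ℝ → ℝ) (hg : ContDiff ℝ ∞ g) (α : OneForm (𝓡 3) M) (x : V)
    (w : Tan ℋ x) : D.cone g hg α x w = g (D.s x) * D.ext α x w :=
  OneForm.fmul_apply _ _ _ _ _

theorem BoundaryData.dLin_cone (g : ℝ → ℝ) (hg : ContDiff ℝ ∞ g) (α : OneForm (𝓡 3) M) (x : V) :
    (D.cone g hg α).dLin x = deriv g (D.s x) • wedge (D.ds x) ((D.ext α).cov x) + g (D.s x) • (D.ext α).dLin x := by
  refine LinearMap.ext fun u => LinearMap.ext fun w => ?_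
  have h : ∀ u, mvfderiv ℋ (fun x => g (D.s x)) x u = deriv g (D.s x) * mvfderiv ℋ D.s x u :=
    mvfderiv_comp_real hg (D.isBdry.contMDiff.mdifferentiableAt (by simp))
  refine (OneForm.d_fmul _ _ _ x u w).trans ?_
  rw [h, h]; simp only [LinearMap.add_apply, LinearMap.smul_apply, wedge_apply, smul_eq_mul]
  change _ = deriv g (D.s x) * (mvfderiv ℋ D.s x u * D.ext α x w -
    mvfderiv ℋ D.s x w * D.ext α x u) + g (D.s x) * (D.ext α).d x u w
  ring

theorem BoundaryData.restrict_cone (g : ℝ → ℝ) (hg : ContDiff ℝ ∞ g) (α : OneForm (𝓡 3) M) :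
    bd.restrict (D.cone g hg α) = g 0 • α := by
  ext p u
  have h1 : D.s (bd.toFun p) = 0 := (D.isBdry.eq_zero_iff _).2 (bd.mem_boundary p)
  rw [bd.restrict_apply, D.cone_apply, h1, OneForm.smul_apply]
  have h2 := congrArg (fun β : OneForm (𝓡 3) M => β p u) (D.restrict_ext α)
  simp only [bd.restrict_apply] at h2; rw [h2]

theorem BoundaryData.continuous_cone (g : ℝ → ℝ) (hg : ContDiff ℝ ∞ g) : Continuous (D.cone g hg) :=
  OneForm.continuous_fmul D.continuous_ext (fun _ => hg.contMDiff.comp D.isBdry.contMDiff)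
    fun x₀ n => Fam.const (OneForm.uniqueDiffOn_target x₀)
      (contMDiffOn_iff_contDiffOn.1 ((hg.contMDiff.comp D.isBdry.contMDiff).comp_contMDiffOn
        (contMDiffOn_extChartAt_symm x₀)))

theorem restrict_add (α β : OneForm ℋ V) : bd.restrict (α + β) = bd.restrict α + bd.restrict β := rfl

theorem restrict_smul (c : ℝ) (α : OneForm ℋ V) : bd.restrict (c • α) = c • bd.restrict α := rfl

theorem wedgePos_congr_smul {α β : OneForm (𝓡 3) M} (h : bd.WedgePos o α β) {c c' : ℝ} (hc : 0 < c)
    (hc' : 0 < c') : bd.WedgePos o (c • α) (c' • β) := by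
  intro p v hv
  have h1 : t3 ((c • α).cov p) ((c' • β).dLin p) v = c * c' * t3 (α.cov p) (β.dLin p) v := by
    have e : ∀ u w, (c' • β).dLin p u w = c' * β.dLin p u w := fun u w => OneForm.d_smul c' β p u w
    have e' : ∀ u, (c • α).cov p u = c * α.cov p u := fun u => rfl
    simp only [t3, e, e']; ring
  rw [h1]; exact mul_pos (mul_pos hc hc') (h p v hv)

variable [T2Space V]

theorem BoundaryData.exists_thickening {lam : T → OneForm ℋ V} {α : T → OneForm (𝓡 3) M}
    (hlam : Continuous lam) (hα : Continuous α) (hpos : ∀ t, IsPositiveSymplectic o (lam t))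
    (hdom : ∀ t, bd.WedgePos o (α t) (bd.restrict (lam t))) (hcon : ∀ t, bd.IsContactForm o (α t)) :
    ∃ δ > (0 : ℝ), ∃ ε > (0 : ℝ),
      (∀ t, ∀ C ≥ (0 : ℝ), IsPositiveSymplectic o (lam t + D.cone (profile δ C) (contDiff_profile δ C) (α t))) ∧
      ∀ t, ∀ c ∈ Icc (0 : ℝ) ε, ∀ c' ∈ Icc (0 : ℝ) ε,
        bd.WedgePos o (α t + c • bd.restrict (lam t)) (α t + c' • bd.restrict (lam t)) := by
  have hext : Continuous fun t => D.ext (α t) := D.continuous_ext.comp hα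
  set s : T × V → ℝ := fun p => D.s p.2
  have hs : Continuous s := D.isBdry.contMDiff.continuous.comp continuous_snd
  have hs0 : ∀ p, s p ≤ 0 := fun p => D.isBdry.nonpos p.2
  have hbd : ∀ x : V, D.s x = 0 → ∃ p, bd.toFun p = x := fun x hx => by
    have := (D.isBdry.eq_zero_iff x).1 hx
    rwa [← bd.range_eq] at this
  have hc1 := D.continuous_ratio hext hlam hlam hpos
  have hc2 := D.continuous_ratio hext hext hlam hpos
  have hc0 := D.continuous_ratio hlam hlam hlam hpos
  have hc0' := D.continuous_ratio hlam hext hlam hpos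
  have hc3 := continuous_dRatio hlam hext hlam hpos
  have hc4 := continuous_dRatio hext hext hlam hpos
  have hR1 : ∀ z, s z = 0 → 0 < volRatio (wedge (D.ds z.2) ((D.ext (α z.1)).cov z.2))
      ((lam z.1).dLin z.2) ((lam z.1).dLin z.2) := fun z hz => by
    obtain ⟨p, hp⟩ := hbd z.2 hz
    have := (bd.wedgePos_iff D.isBdry (hpos z.1) (D.ext (α z.1)) (lam z.1)).1 (by rw [D.restrict_ext]; exact hdom z.1) p
    rw [hp] at this; exact this
  have hR2 : ∀ z, s z = 0 → 0 < volRatio (wedge (D.ds z.2) ((D.ext (α z.1)).cov z.2))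
      ((D.ext (α z.1)).dLin z.2) ((lam z.1).dLin z.2) := fun z hz => by
    obtain ⟨p, hp⟩ := hbd z.2 hz
    have := (bd.wedgePos_iff D.isBdry (hpos z.1) (D.ext (α z.1)) (D.ext (α z.1))).1
      (by rw [D.restrict_ext]; exact hcon z.1) p
    rw [hp] at this; exact this
  obtain ⟨a1, ha1, δ1, hδ1, h1⟩ := exists_le_near_zero hc1 hs hs0 hR1
  obtain ⟨a2, ha2, δ2, hδ2, h2⟩ := exists_le_near_zero hc2 hs hs0 hR2
  obtain ⟨D0, hD0, h0⟩ := exists_abs_le_of_compact hc0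
  obtain ⟨D0', hD0', h0'⟩ := exists_abs_le_of_compact hc0'
  obtain ⟨D3, hD3, h3⟩ := exists_abs_le_of_compact hc3
  obtain ⟨D4, hD4, h4⟩ := exists_abs_le_of_compact hc4
  obtain ⟨δ, hδ, hδ1', hδ2', hK1, hK2⟩ : ∃ δ > (0 : ℝ), δ ≤ δ1 ∧ δ ≤ δ2 ∧ δ ^ 2 * D3 ≤ a1 ∧ δ ^ 2 * D4 ≤ a2 := by
    have hlim : ∀ D : ℝ, Tendsto (fun δ : ℝ => δ ^ 2 * D) (𝓝[>] 0) (𝓝 0) := fun D => by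
      have : ContinuousAt (fun δ : ℝ => δ ^ 2 * D) 0 := by fun_prop
      have := this.tendsto
      simp only [ne_eq, OfNat.ofNat_ne_zero, not_false_eq_true, zero_pow, zero_mul] at this
      exact this.mono_left nhdsWithin_le_nhds
    have e1 : ∀ᶠ δ in 𝓝[>] (0 : ℝ), δ ≤ min δ1 δ2 :=
      (eventually_le_nhds (lt_min hδ1 hδ2)).filter_mono nhdsWithin_le_nhds
    obtain ⟨δ, e1, e2, e3, e4⟩ := (e1.and (((hlim D3).eventually (eventually_le_nhds ha1)).and
      (((hlim D4).eventually (eventually_le_nhds ha2)).and self_mem_nhdsWithin))).exists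
    exact ⟨δ, e4, e1.trans (min_le_left _ _), e1.trans (min_le_right _ _), e2, e3⟩
  obtain ⟨ε, hε, hε1⟩ : ∃ ε > (0 : ℝ), ε * (D0' + ε * D0) < a2 := by
    have : ContinuousAt (fun ε : ℝ => ε * (D0' + ε * D0)) 0 := by fun_prop
    have h := this.tendsto
    simp only [zero_mul] at h
    obtain ⟨ε, e1, e2⟩ := (((h.mono_left nhdsWithin_le_nhds).eventually (eventually_lt_nhds ha2)).and
      (self_mem_nhdsWithin (s := Ioi (0 : ℝ)))).exists
    exact ⟨ε, e2, e1⟩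
  refine ⟨δ, hδ, ε, hε, fun t C hC => (hpos t).of_volRatio_pos fun x => ?_, fun t c hc c' hc' => ?_⟩
  · set g := profile δ C
    set y := D.s x
    have e1 : (lam t + D.cone g (contDiff_profile δ C) (α t)).dLin x =
        (lam t).dLin x + deriv g y • wedge (D.ds x) ((D.ext (α t)).cov x) + g y • (D.ext (α t)).dLin x := by
      rw [add_assoc, ← D.dLin_cone g (contDiff_profile δ C)]
      exact LinearMap.ext fun u => LinearMap.ext fun w => OneForm.d_add _ _ x u w
    obtain ⟨b, hb⟩ := o.exists_positive_basis x
    rw [e1, volRatio_self_expand ((lam t).dLin_self x) ((D.ext (α t)).dLin_self x) b ((hpos t).pf_pos x hb).ne']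
    rcases le_or_gt y (-δ) with hy | hy
    · rw [show g y = 0 from profile_eq_zero hy, show deriv g y = 0 from deriv_profile_eq_zero hy]; norm_num
    · have hy0 : y ≤ 0 := hs0 (t, x)
      have hg := profile_nonneg δ hC y
      have r1 := h1 (t, x) (by change -δ1 ≤ y; linarith)
      have r2 := h2 (t, x) (by change -δ2 ≤ y; linarith)
      have r3 := (abs_le.1 (h3 (t, x))).1
      have r4 := (abs_le.1 (h4 (t, x))).1
      simp only at r1 r2 r3 r4
      have hg' : deriv g y = g y / (y + δ) ^ 2 := deriv_profile hy
      have hyδ : 0 < y + δ := by linarith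
      have hg'' : g y ≤ δ ^ 2 * deriv g y := by
        rw [hg', mul_div_assoc', le_div_iff₀ (by positivity)]
        nlinarith [mul_le_mul_of_nonneg_left (show (y + δ) ^ 2 ≤ δ ^ 2 by nlinarith) hg]
      have hg0 : 0 ≤ deriv g y := by rw [hg']; positivity
      change 0 ≤ g y at hg
      set G := g y
      set G' := deriv g y
      have q1 : G * D3 ≤ G' * a1 := by
        have := mul_le_mul_of_nonneg_right hg'' hD3
        have := mul_le_mul_of_nonneg_left hK1 hg0
        nlinarith
      have q2 : G * D4 ≤ G' * a2 := by
        have := mul_le_mul_of_nonneg_right hg'' hD4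
        have := mul_le_mul_of_nonneg_left hK2 hg0
        nlinarith
      have p1 := mul_le_mul_of_nonneg_left r1 hg0
      have p2 := mul_le_mul_of_nonneg_left r2 (mul_nonneg hg0 hg)
      have p3 := mul_le_mul_of_nonneg_left r3 hg
      have p4 := mul_le_mul_of_nonneg_left r4 (mul_nonneg hg hg)
      have p5 := mul_le_mul_of_nonneg_left q2 hg
      have p6 : 0 ≤ G * (G' * a2) := by positivity
      nlinarith
  · rw [← D.restrict_ext (α t), ← restrict_smul, ← restrict_smul, ← restrict_add, ← restrict_add,
      bd.wedgePos_iff D.isBdry (hpos t)]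
    intro p
    set x := bd.toFun p
    have hx : s (t, x) = 0 := (D.isBdry.eq_zero_iff _).2 (bd.mem_boundary p)
    have e1 : (D.ext (α t) + c • lam t).cov x = (1 : ℝ) • (D.ext (α t)).cov x + c • (lam t).cov x := by
      rw [one_smul]; rfl
    have e2 : (D.ext (α t) + c' • lam t).dLin x = (1 : ℝ) • (D.ext (α t)).dLin x + c' • (lam t).dLin x := by
      rw [one_smul]
      exact LinearMap.ext fun u => LinearMap.ext fun w => (OneForm.d_add _ _ x u w).trans
        (congrArg _ (OneForm.d_smul _ _ x u w))
    obtain ⟨b, hb⟩ := o.exists_positive_basis x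
    rw [e1, e2, volRatio_wedge_expand ((D.ext (α t)).dLin_self x) ((lam t).dLin_self x) ((lam t).dLin_self x) b]
    have r1 := hR1 (t, x) hx
    have r2 := h2 (t, x) (by rw [hx]; linarith)
    have r0 := (abs_le.1 (h0 (t, x))).1
    have r0' := (abs_le.1 (h0' (t, x))).1
    simp only at r1 r2 r0 r0'
    change 0 < _ * _ * volRatio (wedge (D.ds x) _) _ _ + _ * _ * volRatio (wedge (D.ds x) _) _ _ +
      _ * _ * volRatio (wedge (D.ds x) _) _ _ + _ * _ * volRatio (wedge (D.ds x) _) _ _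
    have p1 := mul_nonneg hc'.1 r1.le
    have p2 := mul_le_mul_of_nonneg_left r0' hc.1
    have p3 := mul_le_mul_of_nonneg_left r0 (mul_nonneg hc.1 hc'.1)
    have p4 := mul_le_mul_of_nonneg_right hc.2 hD0'
    have p5 := mul_le_mul_of_nonneg_right (mul_le_mul hc.2 hc'.2 hc'.1 hε.le) hD0
    nlinarith

end Thickening

section PathComponents

theorem joined_of_continuous {X : Type*} [TopologicalSpace X] {f : unitInterval → X}
    (hf : Continuous f) {x y : X} (h0 : f 0 = x) (h1 : f 1 = y) : Joined x y :=
  ⟨⟨⟨f, hf⟩, h0, h1⟩⟩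

namespace BoundaryIdentification

theorem t3_combination (p : M) (α α' β β' : OneForm (𝓡 3) M) (c d : ℝ) (v : Fin 3 → Tan (𝓡 3) p) :
    t3 ((α + c • α').cov p) ((β + d • β').dLin p) v = t3 (α.cov p) (β.dLin p) v + d * t3 (α.cov p) (β'.dLin p) v
        + c * t3 (α'.cov p) (β.dLin p) v + c * d * t3 (α'.cov p) (β'.dLin p) v := by
  have e : ∀ u w, (β + d • β').dLin p u w = β.dLin p u w + d * β'.dLin p u w := fun u w =>
    (OneForm.d_add β (d • β') p u w).trans (congrArg _ (OneForm.d_smul d β' p u w))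
  have e' : ∀ u, (α + c • α').cov p u = α.cov p u + c * α'.cov p u := fun u => rfl
  simp only [t3, e, e']; ring

theorem WedgePos.add_right {α β β' : OneForm (𝓡 3) M} (h : bd.WedgePos o α β)
    (h' : bd.WedgePos o α β') {c : ℝ} (hc : 0 ≤ c) : bd.WedgePos o α (β + c • β') := fun p v hv => by
  have h1 := t3_combination p α α β β' 0 c v
  rw [show α + (0 : ℝ) • α = α by ext; simp [OneForm.add_apply, OneForm.smul_apply]] at h1; rw [h1]
  nlinarith [h p v hv, mul_nonneg hc (h' p v hv).le]

theorem WedgePos.combination {α β : OneForm (𝓡 3) M} (h1 : bd.WedgePos o α α)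
    (h2 : bd.WedgePos o α β) (h3 : bd.WedgePos o β α) (h4 : bd.WedgePos o β β) {c : ℝ} (hc : 0 ≤ c) :
    bd.WedgePos o (α + c • β) (α + c • β) := fun p v hv => by
  rw [t3_combination]
  have := h1 p v hv
  have := mul_nonneg hc (h2 p v hv).le
  have := mul_nonneg hc (h3 p v hv).le
  have := mul_nonneg (mul_nonneg hc hc) (h4 p v hv).le
  linarith

end BoundaryIdentification

theorem continuous_toPreLiouville : Continuous fun ℓ : LiouvilleStructure bd o => ℓ.toPreLiouville bd o := by
  refine Continuous.subtype_mk (continuous_subtype_val.prodMk ?_) _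
  exact continuous_quotient_mk'.comp (Continuous.subtype_mk (OneForm.continuous_pullback continuous_subtype_val _) _)

variable [CompactSpace V]

theorem cone_profile_eq_smul (D : BoundaryData bd) (δ C : ℝ) (α : OneForm (𝓡 3) M) :
    D.cone (profile δ C) (contDiff_profile δ C) α = C • D.cone (profile δ 1) (contDiff_profile δ 1) α := by
  ext x w; rw [OneForm.smul_apply, D.cone_apply, D.cone_apply, profile, profile, one_mul, mul_assoc]

theorem restrict_add_cone (D : BoundaryData bd) (δ C : ℝ) (lam : OneForm ℋ V) (α : OneForm (𝓡 3) M) :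
    bd.restrict (lam + D.cone (profile δ C) (contDiff_profile δ C) α) =
      bd.restrict lam + (C * expNegInvGlue δ) • α := by rw [restrict_add, D.restrict_cone, profile, zero_add]

theorem continuous_add_cone (D : BoundaryData bd) (δ : ℝ) (lam : OneForm ℋ V)
    (α : OneForm (𝓡 3) M) {T : Type*} [TopologicalSpace T] {c : T → ℝ} (hc : Continuous c) :
    Continuous fun t => lam + D.cone (profile δ (c t)) (contDiff_profile δ (c t)) α := by
  have h : (fun t => lam + D.cone (profile δ (c t)) (contDiff_profile δ (c t)) α) =
      fun t => lam + c t • D.cone (profile δ 1) (contDiff_profile δ 1) α :=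
    funext fun t => congrArg _ (cone_profile_eq_smul D δ (c t) α)
  rw [h]; exact OneForm.continuous_add continuous_const (OneForm.continuous_smul hc continuous_const)

theorem add_cone_zero (D : BoundaryData bd) (δ : ℝ) (lam : OneForm ℋ V) (α : OneForm (𝓡 3) M) :
    lam + D.cone (profile δ 0) (contDiff_profile δ 0) α = lam := by
  ext x w; rw [OneForm.add_apply, D.cone_apply, profile]; simp

variable [T2Space V]

theorem exists_joined_toPreLiouville (q : PreLiouvilleStructure bd o) :
    ∃ ℓ : LiouvilleStructure bd o, Joined (ℓ.toPreLiouville bd o) q := by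
  obtain ⟨⟨lam, ξ⟩, hpos, hdom⟩ := q
  obtain ⟨⟨α, hα⟩, rfl⟩ := Quotient.exists_rep ξ
  obtain ⟨D⟩ := exists_boundaryData bd
  have hdom' : bd.WedgePos o α (bd.restrict lam) := (bd.dominates_iff D.isBdry).1 hdom
  obtain ⟨δ, hδ, ε, hε, h1, h2⟩ := D.exists_thickening (T := Unit) (lam := fun _ => lam)
    (α := fun _ => α) continuous_const continuous_const (fun _ => hpos) (fun _ => hdom') fun _ => hα
  have hh : 0 < expNegInvGlue δ := expNegInvGlue.pos_of_pos hδ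
  set β := bd.restrict lam with hβ
  set F : ℝ → OneForm ℋ V := fun C => lam + D.cone (profile δ C) (contDiff_profile δ C) α with hF
  have hFc : Continuous F := continuous_add_cone D δ lam α continuous_id
  have hFr : ∀ C, bd.restrict (F C) = β + (C * expNegInvGlue δ) • α := fun C => restrict_add_cone D δ C lam α
  have hF0 : F 0 = lam := add_cone_zero D δ lam α
  set C₁ : ℝ := ε⁻¹ * (expNegInvGlue δ)⁻¹ with hC₁
  have hC₁p : 0 < C₁ := by positivity
  have hC₁h : C₁ * expNegInvGlue δ = ε⁻¹ := by rw [hC₁]; field_simp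
  have hr1 : bd.restrict (F C₁) = ε⁻¹ • (α + ε • β) := by
    rw [hFr, hC₁h]; ext p w; simp only [OneForm.add_apply, OneForm.smul_apply]; field_simp; ring
  have hcon : ∀ c ∈ Icc (0 : ℝ) ε, bd.IsContactForm o (α + c • β) := fun c hc => h2 () c hc c hc
  have hL : bd.IsContactForm o (bd.restrict (F C₁)) := by
    rw [hr1]; exact wedgePos_congr_smul (hcon ε ⟨hε.le, le_rfl⟩) (inv_pos.2 hε) (inv_pos.2 hε)
  have hq1 : ∀ t : unitInterval, Dominates bd o (F (t * C₁)) ⟦⟨α, hα⟩⟧ := fun t => (bd.dominates_iff D.isBdry).2 (by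
      rw [hFr]
      exact hdom'.add_right hα (mul_nonneg (mul_nonneg t.2.1 hC₁p.le) hh.le))
  have hm : ∀ t : unitInterval, (t : ℝ) * ε ∈ Icc (0 : ℝ) ε := fun t =>
    ⟨mul_nonneg t.2.1 hε.le, mul_le_of_le_one_left hε.le t.2.2⟩
  have hq2 : ∀ t : unitInterval, Dominates bd o (F C₁) ⟦⟨α + ((t : ℝ) * ε) • β, hcon _ (hm t)⟩⟧ := fun t =>
    (bd.dominates_iff D.isBdry).2 (by
      have := wedgePos_congr_smul (h2 () _ (hm t) ε ⟨hε.le, le_rfl⟩) one_pos (inv_pos.2 hε)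
      rw [hr1]
      rwa [show (1 : ℝ) • (α + ((t : ℝ) * ε) • β) = α + ((t : ℝ) * ε) • β by ext; simp [OneForm.smul_apply]] at this)
  refine ⟨⟨F C₁, h1 () C₁ hC₁p.le, hL⟩, Joined.symm (Joined.trans (y := ⟨(F C₁, ⟦⟨α, hα⟩⟧),
    h1 () C₁ hC₁p.le, by simpa using hq1 1⟩) ?_ ?_)⟩
  · refine joined_of_continuous (f := fun t => ⟨(F (t * C₁), ⟦⟨α, hα⟩⟧),
      h1 () _ (mul_nonneg t.2.1 hC₁p.le), hq1 t⟩) ?_ ?_ ?_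
    · exact Continuous.subtype_mk ((hFc.comp (by fun_prop)).prodMk continuous_const) _
    · exact Subtype.ext (Prod.ext (by simp [hF0]) rfl)
    · exact Subtype.ext (Prod.ext (by simp) rfl)
  · refine joined_of_continuous (f := fun t => ⟨(F C₁, ⟦⟨α + ((t : ℝ) * ε) • β, hcon _ (hm t)⟩⟧),
      h1 () C₁ hC₁p.le, hq2 t⟩) ?_ ?_ ?_
    · exact Continuous.subtype_mk (continuous_const.prodMk (continuous_quotient_mk'.comp
        (Continuous.subtype_mk (OneForm.continuous_add continuous_const
          (OneForm.continuous_smul (by fun_prop) continuous_const)) _))) _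
    · refine Subtype.ext (Prod.ext rfl (congrArg (Quotient.mk _) (Subtype.ext ?_)))
      ext; simp [OneForm.add_apply, OneForm.smul_apply]
    · refine Subtype.ext (Prod.ext rfl (Quotient.sound fun p => ⟨ε⁻¹, inv_pos.2 hε, ?_⟩))
      change bd.restrict (F C₁) p = _; rw [hr1]; simp only [Set.Icc.coe_one, one_mul]; rfl

theorem joined_thickening (D : BoundaryData bd) (ℓ : LiouvilleStructure bd o) (α : bd.ContactForm o)
    (hξ : (⟦α⟧ : bd.ContactStructure o) = ⟦⟨bd.restrict ℓ.1, ℓ.2.2⟩⟧) {δ : ℝ} (hδ : 0 < δ)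
    (h1 : ∀ C ≥ (0 : ℝ), IsPositiveSymplectic o (ℓ.1 + D.cone (profile δ C) (contDiff_profile δ C) α.1))
    {C₁ : ℝ} (hC₁ : 0 ≤ C₁) (ℓ' : LiouvilleStructure bd o)
    (hℓ' : ℓ'.1 = ℓ.1 + D.cone (profile δ C₁) (contDiff_profile δ C₁) α.1) : Joined ℓ ℓ' := by
  have hh : 0 < expNegInvGlue δ := expNegInvGlue.pos_of_pos hδ
  have hr : ∀ p, ∃ c : ℝ, 0 < c ∧ bd.restrict ℓ.1 p = c • α.1 p := Quotient.exact hξ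
  have hr' : ∀ p, ∃ c : ℝ, 0 < c ∧ α.1 p = c • bd.restrict ℓ.1 p := Quotient.exact hξ.symm
  have h12 : bd.WedgePos o (bd.restrict ℓ.1) α.1 := BoundaryIdentification.WedgePos.smul_left bd α.2 hr
  have h21 : bd.WedgePos o α.1 (bd.restrict ℓ.1) := BoundaryIdentification.WedgePos.smul_left bd ℓ.2.2 hr'
  have hcon : ∀ C ≥ (0 : ℝ), bd.IsContactForm o
      (bd.restrict (ℓ.1 + D.cone (profile δ C) (contDiff_profile δ C) α.1)) := fun C hC => by
    rw [restrict_add_cone]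
    exact BoundaryIdentification.WedgePos.combination ℓ.2.2 h12 h21 α.2 (mul_nonneg hC hh.le)
  have hC : ∀ t : unitInterval, 0 ≤ (t : ℝ) * C₁ := fun t => mul_nonneg t.2.1 hC₁
  refine joined_of_continuous (f := fun t => ⟨_, h1 _ (hC t), hcon _ (hC t)⟩) ?_ ?_ ?_
  · exact Continuous.subtype_mk (continuous_add_cone D δ ℓ.1 α.1 (by fun_prop)) _
  · refine Subtype.ext ?_
    simp only [Set.Icc.coe_zero, zero_mul]; exact add_cone_zero D δ ℓ.1 α.1
  · refine Subtype.ext ?_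
    simp only [Set.Icc.coe_one, one_mul]; exact hℓ'.symm

theorem joined_of_joined_toPreLiouville {ℓ₀ ℓ₁ : LiouvilleStructure bd o}
    (h : Joined (ℓ₀.toPreLiouville bd o) (ℓ₁.toPreLiouville bd o)) : Joined ℓ₀ ℓ₁ := by
  obtain ⟨γ⟩ := h
  obtain ⟨σ, hσ, hσ'⟩ := bd.exists_continuous_section o
  obtain ⟨D⟩ := exists_boundaryData bd
  set lam : unitInterval → OneForm ℋ V := fun t => (γ t).1.1 with hlamdef
  set A : unitInterval → bd.ContactForm o := fun t => σ (γ t).1.2 with hAdef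
  have hγ : Continuous fun t => (γ t).1 := continuous_subtype_val.comp γ.continuous
  have hlam : Continuous lam := continuous_fst.comp hγ
  have hA : Continuous fun t => (A t).1 := continuous_subtype_val.comp (hσ.comp (continuous_snd.comp hγ))
  have hdom : ∀ t, bd.WedgePos o (A t).1 (bd.restrict (lam t)) := fun t =>
    (bd.dominates_iff D.isBdry).1 (by rw [hσ']; exact (γ t).2.2)
  obtain ⟨δ, hδ, ε, hε, h1, h2⟩ := D.exists_thickening hlam hA (fun t => (γ t).2.1) hdom fun t => (A t).2
  have hh : 0 < expNegInvGlue δ := expNegInvGlue.pos_of_pos hδ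
  set C₁ : ℝ := ε⁻¹ * (expNegInvGlue δ)⁻¹ with hC₁
  have hC₁p : 0 < C₁ := by positivity
  have hC₁h : C₁ * expNegInvGlue δ = ε⁻¹ := by rw [hC₁]; field_simp
  have hcon : ∀ t, bd.IsContactForm o
      (bd.restrict (lam t + D.cone (profile δ C₁) (contDiff_profile δ C₁) (A t).1)) := fun t => by
    have h3 : bd.restrict (lam t + D.cone (profile δ C₁) (contDiff_profile δ C₁) (A t).1) =
        ε⁻¹ • ((A t).1 + ε • bd.restrict (lam t)) := by
      rw [restrict_add_cone, hC₁h]; ext p w; simp only [OneForm.add_apply, OneForm.smul_apply]; field_simp; ring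
    rw [h3]; exact wedgePos_congr_smul (h2 t ε ⟨hε.le, le_rfl⟩ ε ⟨hε.le, le_rfl⟩) (inv_pos.2 hε) (inv_pos.2 hε)
  set L : unitInterval → LiouvilleStructure bd o := fun t =>
    ⟨lam t + D.cone (profile δ C₁) (contDiff_profile δ C₁) (A t).1, h1 t C₁ hC₁p.le, hcon t⟩ with hL
  have hLc : Continuous L := Continuous.subtype_mk (OneForm.continuous_add hlam ((D.continuous_cone _ _).comp hA)) _
  have e0 : (γ 0).1 = (ℓ₀.toPreLiouville bd o).1 := congrArg Subtype.val γ.source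
  have e1 : (γ 1).1 = (ℓ₁.toPreLiouville bd o).1 := congrArg Subtype.val γ.target
  have l0 : lam 0 = ℓ₀.1 := congrArg Prod.fst e0
  have l1 : lam 1 = ℓ₁.1 := congrArg Prod.fst e1
  have j0 : Joined ℓ₀ (L 0) := joined_thickening D ℓ₀ (A 0)
    ((hσ' _).trans (congrArg Prod.snd e0)) hδ (by rw [← l0]; exact h1 0) hC₁p.le (L 0)
    (by rw [← l0])
  have j1 : Joined ℓ₁ (L 1) := joined_thickening D ℓ₁ (A 1)
    ((hσ' _).trans (congrArg Prod.snd e1)) hδ (by rw [← l1]; exact h1 1) hC₁p.le (L 1)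
    (by rw [← l1])
  exact (j0.trans (joined_of_continuous hLc rfl rfl)).trans j1.symm

theorem exists_bijective_zerothHomotopy :
    ∃ P : ZerothHomotopy (LiouvilleStructure bd o) → ZerothHomotopy (PreLiouvilleStructure bd o),
      (∀ ℓ : LiouvilleStructure bd o, P (ZerothHomotopy.mk ℓ) = ZerothHomotopy.mk (ℓ.toPreLiouville bd o)) ∧
      Bijective P := by
  refine ⟨Quotient.map' (fun ℓ => ℓ.toPreLiouville bd o) fun a b h =>
    ⟨h.some.map continuous_toPreLiouville⟩, fun _ => rfl, ?_, ?_⟩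
  · intro a b
    refine Quotient.inductionOn₂' a b fun a b h => ?_
    exact Quotient.sound' (joined_of_joined_toPreLiouville (Quotient.exact' h))
  · intro q
    obtain ⟨q, rfl⟩ := Quotient.exists_rep q
    obtain ⟨ℓ, hℓ⟩ := exists_joined_toPreLiouville q
    exact ⟨ZerothHomotopy.mk ℓ, Quotient.sound' hℓ⟩

end PathComponents

/-! ### The interior, as a manifold without boundary -/

section

/-- The open part of the half-space, as a partial homeomorphism to Euclidean space. -/
def halfSpaceInterior : OpenPartialHomeomorph (EuclideanHalfSpace 4) ℝ⁴ where
  toFun := ℋ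
  invFun := (ℋ).symm
  source := {h | 0 < h.1 0}
  target := {y | 0 < y 0}
  map_source' _ h := h
  map_target' y (hy : 0 < y 0) := by
    have h1 : ℋ ((ℋ).symm y) = y := (ℋ).right_inv (by
      rw [range_modelWithCornersEuclideanHalfSpace]; exact hy.le)
    change 0 < (ℋ ((ℋ).symm y)) 0; rwa [h1]
  left_inv' _ _ := (ℋ).left_inv _
  right_inv' y (hy : 0 < y 0) := (ℋ).right_inv (by
      rw [range_modelWithCornersEuclideanHalfSpace]; exact hy.le)
  open_source := isOpen_lt continuous_const (by fun_prop)
  open_target := isOpen_lt continuous_const (by fun_prop)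
  continuousOn_toFun := (ℋ).continuous.continuousOn
  continuousOn_invFun := (ℋ).continuous_symm.continuousOn

variable (V) in
/-- The interior of `V`. -/
def Interior : Type u := {x : V // x ∈ (ℋ).interior V}

namespace Interior

instance : TopologicalSpace (Interior V) := instTopologicalSpaceSubtype

instance [T2Space V] : T2Space (Interior V) := inferInstanceAs (T2Space {x : V // x ∈ (ℋ).interior V})

/-- The inclusion of the interior. -/
def val (x : Interior V) : V := x.1

theorem isOpenEmbedding_val : IsOpenEmbedding (val : Interior V → V) :=
  ((ℋ).isOpen_interior (M := V) (n := ∞) (by simp)).isOpenEmbedding_subtypeVal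

/-- The chart of the interior at a point. -/
def chart (x : Interior V) : OpenPartialHomeomorph (Interior V) ℝ⁴ := haveI : Nonempty (Interior V) := ⟨x⟩
  (isOpenEmbedding_val.toOpenPartialHomeomorph val ≫ₕ chartAt _ x.val) ≫ₕ halfSpaceInterior

theorem chart_apply (x y : Interior V) : chart x y = crd ℋ x.val y.val := rfl

theorem chart_source (x : Interior V) : (chart x).source = val ⁻¹' (crd ℋ x.val).source := by
  ext y
  have h1 : y ∈ (chart x).source ↔ (y.val ∈ (crd ℋ x.val).source ∧ 0 < crd ℋ x.val y.val 0) := by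
    rw [extChartAt_source, chart]; simp [OpenPartialHomeomorph.trans_source, halfSpaceInterior]
  rw [h1]
  refine ⟨fun h => h.1, fun h => ⟨h, lt_of_le_of_ne (extChartAt_zero_nonneg _ h) fun h0 => ?_⟩⟩
  have := (isBoundaryPoint_iff_coord h).2 h0.symm
  exact (ModelWithCorners.disjoint_interior_boundary (I := ℋ) (M := V)).le_bot ⟨y.2, this⟩

theorem val_chart_symm (x : Interior V) {y : ℝ⁴} (hy : y ∈ (chart x).target) :
    ((chart x).symm y).val = (crd ℋ x.val).symm y := by
  have h1 := (chart x).map_target hy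
  rw [chart_source] at h1; rw [← (crd ℋ x.val).left_inv h1, ← chart_apply, (chart x).right_inv hy]

instance : ChartedSpace ℝ⁴ (Interior V) where
  atlas := range chart
  chartAt := chart
  mem_chart_source x := by rw [chart_source]; exact mem_extChartAt_source _
  chart_mem_atlas x := ⟨x, rfl⟩

instance : IsManifold (𝓡 4) ∞ (Interior V) := isManifold_of_contDiffOn _ _ _ (by
  rintro _ _ ⟨x, rfl⟩ ⟨x', rfl⟩
  have h := contDiffOn_ext_coord_change (I := ℋ) (n := ∞) x'.val x.val
  refine (h.mono ?_).congr ?_ <;> rintro y ⟨hy, -⟩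
  all_goals
    have hy' : y ∈ ((chart x).symm ≫ₕ chart x').source := hy
    rw [OpenPartialHomeomorph.trans_source] at hy'
    obtain ⟨h1, h2⟩ := hy'
    have h3 := val_chart_symm x h1
  · have h5 := (chart x).map_target h1
    rw [mem_preimage, chart_source, mem_preimage, h3] at h2; rw [chart_source, mem_preimage] at h5
    have h4 := (crd ℋ x.val).map_source h5
    rw [← chart_apply, (chart x).right_inv h1] at h4; rw [PartialEquiv.trans_source]; exact ⟨h4, h2⟩
  · change chart x' ((chart x).symm y) = _
    rw [chart_apply, h3]; rfl)

theorem contMDiff_val : ContMDiff (𝓡 4) ℋ ∞ (val : Interior V → V) := fun x => by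
  have h1 : ContMDiffAt (𝓡 4) (𝓡 4) ∞ (chart x) x :=
    contMDiffAt_of_mem_maximalAtlas (IsManifold.chart_mem_maximalAtlas x) (mem_chart_source _ x)
  have hx : x ∈ (chart x).source := mem_chart_source _ x
  have hev : ∀ᶠ y in 𝓝 x, val y = (crd ℋ x.val).symm (chart x y) := by
    filter_upwards [(chart x).open_source.mem_nhds hx] with y hy
    rw [chart_source] at hy; exact ((crd ℋ x.val).left_inv hy).symm
  have h2 : ∀ᶠ y in 𝓝 (chart x x), y ∈ (crd ℋ x.val).target := by
    filter_upwards [(chart x).open_target.mem_nhds ((chart x).map_source hx)] with y hy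
    have h5 := (chart x).map_target hy
    rw [chart_source, mem_preimage] at h5
    have h4 := (crd ℋ x.val).map_source h5
    rwa [← chart_apply, (chart x).right_inv hy] at h4
  exact (((contMDiffOn_extChartAt_symm x.val).contMDiffAt h2).comp x h1).congr_of_eventuallyEq hev

theorem injective_mfderiv_val (x : Interior V) : Injective (mfderiv (𝓡 4) ℋ val x) := by
  have hx : x ∈ (chart x).source := mem_chart_source _ x
  refine injective_mfderiv_of_charts (F := PUnit) (IsManifold.chart_mem_maximalAtlas (I := 𝓡 4) x)
    (IsManifold.chart_mem_maximalAtlas (I := ℋ) x.val)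
    (.prodUnique ℝ ℝ⁴ PUnit) hx (mem_chart_source _ x.val) ?_
    (contMDiff_val.mdifferentiableAt (by simp))
  exact fun y hy => rfl

theorem surjective_mfderiv_val (x : Interior V) : Surjective (mfderiv (𝓡 4) ℋ val x) := by
  let L : ℝ⁴ →ₗ[ℝ] ℝ⁴ := (mfderiv (𝓡 4) ℋ val x).toLinearMap
  exact (LinearMap.injective_iff_surjective (f := L)).1 (injective_mfderiv_val x)

theorem contMDiffAt_of_val {f : N → Interior V} {x : N} {n : ℕ∞ω} (hn : n ≤ ∞)
    (h : ContMDiffAt I ℋ n (fun y => (f y).val) x) : ContMDiffAt I (𝓡 4) n f x := by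
  obtain ⟨g, h1, -, -, h4⟩ := exists_contMDiffAt_localInverse (contMDiff_val (f x)) (injective_mfderiv_val (f x)) rfl
  have hc : ContinuousAt f x := (isOpenEmbedding_val.isInducing.continuousAt_iff).2 h.continuousAt
  refine ((h1.of_le hn).comp x h).congr_of_eventuallyEq ?_
  filter_upwards [hc.eventually h4] with y hy
  exact hy.symm

theorem mfderiv_val_comp {f : N → Interior V} {g : N → V} {x : N} (hfg : ∀ y, (f y).val = g y)
    (hf : MDifferentiableAt I (𝓡 4) f x) (w : Tan I x) : mfderiv (𝓡 4) ℋ val (f x) (mfderiv I (𝓡 4) f x w) =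
      mfderiv I ℋ (fun y => (f y).val) x w :=
  (DFunLike.congr_fun (mfderiv_comp x (contMDiff_val.mdifferentiableAt (by simp)) hf) w).symm

end Interior

variable [I.Boundaryless] {W : Type*} [TopologicalSpace W] [ChartedSpace ℝ⁴ W] [IsManifold (𝓡 4) ∞ W]

theorem isImmersionAt_of_extension {b : N → W} (hb : ContMDiff I (𝓡 4) ∞ b)
    (hinj : Injective b) (himm : ∀ x, Injective (mfderiv I (𝓡 4) b x))
    (hdim : finrank ℝ E = finrank ℝ ℝ⁴)
    {κ : OpenPartialHomeomorph N ℝ⁴}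
    (hκ : ContMDiffOn I (𝓡 4) ∞ κ κ.source) (hκ' : ContMDiffOn (𝓡 4) I ∞ κ.symm κ.target)
    {f : V → W} (hf : ContMDiff ℋ (𝓡 4) ∞ f) (hfi : Injective f)
    (hpos : ∀ z, ∀ n ∈ κ.source, f z = b n → 0 ≤ κ n 0) {r : ℝ⁴ → V}
    (hr : ∀ y ∈ κ.target, 0 ≤ y 0 → f (r y) = b (κ.symm y))
    (hr' : ContMDiffOn (𝓡 4) ℋ ∞ r (κ.target ∩ {y | 0 ≤ y 0}))
    {x : V} {n : N} (hn : n ∈ κ.source) (hx : f x = b n) :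
    Manifold.IsImmersionAtOfComplement PUnit.{1} ℋ (𝓡 4) ∞ f x := by
  haveI : Nonempty N := ⟨n⟩
  have ho : IsOpenEmbedding b := .of_continuous_injective_isOpenMap hb.continuous hinj
    (isOpenMap_of_injective_mfderiv hb himm hdim)
  set β := ho.toOpenPartialHomeomorph b with hβ
  have hβb : ∀ n, β.symm (b n) = n := fun n => ho.toOpenPartialHomeomorph_left_inv b
  have hβs : ∀ n, ContMDiffAt (𝓡 4) I ∞ β.symm (b n) := contMDiffAt_of_leftInverse hb hinj himm hdim hβb
  have hβ1 : ∀ n, β n = b n := fun _ => rfl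
  set ψ := β.symm ≫ₕ κ with hψ
  have hsrc : ∀ w, w ∈ ψ.source ↔ ∃ n ∈ κ.source, b n = w := fun w => by
    rw [hψ, OpenPartialHomeomorph.trans_source]; constructor
    · rintro ⟨h1, h2⟩; exact ⟨_, h2, β.right_inv h1⟩
    · rintro ⟨n, hn, rfl⟩
      refine ⟨β.map_source (x := n) (by simp [hβ]), ?_⟩
      change β.symm (b n) ∈ κ.source; rwa [hβb]
  have htgt : ∀ y, y ∈ ψ.target ↔ y ∈ κ.target := fun y => by rw [hψ, OpenPartialHomeomorph.trans_target]; simp [hβ]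
  have hψb : ∀ n, ψ (b n) = κ n := fun n => congrArg κ (hβb n)
  have hψs : ∀ y, ψ.symm y = b (κ.symm y) := fun y => rfl
  have hψm : ψ ∈ IsManifold.maximalAtlas (𝓡 4) ∞ W := by
    refine mem_maximalAtlas_of_contMDiffOn (fun w hw => ?_) fun y hy => ?_
    · obtain ⟨n, hn, rfl⟩ := (hsrc w).1 hw
      have h1 : ContMDiffAt I (𝓡 4) ∞ κ (β.symm (b n)) := by rw [hβb]; exact hκ.contMDiffAt (κ.open_source.mem_nhds hn)
      exact (h1.comp (b n) (hβs n)).contMDiffWithinAt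
    · exact (hb.comp_contMDiffOn hκ').mono (fun y hy => (htgt y).1 hy) y hy
  set S := f ⁻¹' ψ.source with hS
  have hI : ∀ y : ℝ⁴, 0 ≤ y 0 → ℋ ((ℋ).symm y) = y := fun y hy =>
    (ℋ).right_inv (by rw [range_modelWithCornersEuclideanHalfSpace]; exact hy)
  have hI0 : ∀ h : EuclideanHalfSpace 4, 0 ≤ ℋ h 0 := fun h => h.2
  have hψS : ∀ z ∈ S, 0 ≤ ψ (f z) 0 := fun z hz => by
    obtain ⟨n, hn, h⟩ := (hsrc _).1 hz
    rw [← h, hψb]; exact hpos z n hn h.symm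
  have hfr : ∀ y ∈ ψ.target, 0 ≤ y 0 → f (r y) = ψ.symm y := fun y hy h0 => (hr y ((htgt y).1 hy) h0).trans (hψs y).symm
  have hrf : ∀ z ∈ S, r (ψ (f z)) = z := fun z hz => hfi (by
    rw [hfr _ (ψ.map_source hz) (hψS z hz), ψ.left_inv hz])
  have hψf : ContMDiffOn ℋ (𝓡 4) ∞ (fun z => ψ (f z)) S :=
    (contMDiffOn_of_mem_maximalAtlas hψm).comp hf.contMDiffOn fun z hz => hz
  have hrI : ContMDiffOn ℋ ℋ ∞ (fun h => r (ℋ h)) (ℋ ⁻¹' ψ.target) :=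
    hr'.comp (ℋ).contMDiff.contMDiffOn fun h hh => ⟨(htgt _).1 hh, hI0 h⟩
  have hsψf : ContMDiffOn ℋ ℋ ∞ (fun z => (ℋ).symm (ψ (f z))) S := (ℋ).contMDiffOn_symm.comp hψf fun z hz => by
      rw [range_modelWithCornersEuclideanHalfSpace]; exact hψS z hz
  let φ : OpenPartialHomeomorph V (EuclideanHalfSpace 4) :=
    { toFun := fun z => (ℋ).symm (ψ (f z))
      invFun := fun h => r (ℋ h)
      source := S
      target := ℋ ⁻¹' ψ.target
      map_source' := fun z hz => by rw [mem_preimage, hI _ (hψS z hz)]; exact ψ.map_source hz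
      map_target' := fun h hh => by rw [hS, mem_preimage, hfr _ hh (hI0 h)]; exact ψ.map_target hh
      left_inv' := fun z hz => by simp only [hI _ (hψS z hz)]; exact hrf z hz
      right_inv' := fun h hh => by simp only [hfr _ hh (hI0 h), ψ.right_inv hh]; exact (ℋ).left_inv h
      open_source := ψ.open_source.preimage hf.continuous
      open_target := ψ.open_target.preimage (ℋ).continuous
      continuousOn_toFun := hsψf.continuousOn
      continuousOn_invFun := hrI.continuousOn }
  have hφm : φ ∈ IsManifold.maximalAtlas ℋ ∞ V := mem_maximalAtlas_of_contMDiffOn hsψf hrI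
  have hxs : f x ∈ ψ.source := (hsrc _).2 ⟨n, hn, hx.symm⟩
  refine Manifold.IsImmersionAtOfComplement.mk_of_charts (F := PUnit.{1})
    (.prodUnique ℝ ℝ⁴ PUnit) φ ψ hxs hxs hφm hψm (fun z hz => hz) ?_
  intro y hy; rw [OpenPartialHomeomorph.extend_target] at hy
  have h0 : 0 ≤ y 0 := by
    have := hy.2
    rwa [range_modelWithCornersEuclideanHalfSpace] at this
  have hy1 : y ∈ ψ.target := by
    have : ℋ ((ℋ).symm y) ∈ ψ.target := hy.1
    rwa [hI y h0] at this
  change ψ (f (r (ℋ ((ℋ).symm y)))) = y; rw [hI y h0, hfr y hy1 h0, ψ.right_inv hy1]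

/-- Coordinates `(-r, p)` on a cylinder, as a linear map. -/
def cylinderCoord : (ℝ³ × ℝ) ≃L[ℝ] ℝ⁴ := LinearEquiv.toContinuousLinearEquiv
    { toFun := fun q => WithLp.toLp 2 (Fin.cons (-q.2) q.1)
      invFun := fun y => (WithLp.toLp 2 (Fin.tail y), -y 0)
      map_add' := fun q q' => by ext i; refine Fin.cases ?_ (fun j => ?_) i <;> simp [add_comm]
      map_smul' := fun c q => by ext i; refine Fin.cases ?_ (fun j => ?_) i <;> simp
      left_inv := fun q => by ext i <;> simp [Fin.tail]
      right_inv := fun y => by ext i; refine Fin.cases ?_ (fun j => ?_) i <;> simp [Fin.tail] }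

/-- A chart of the cylinder over `M`. -/
def cylinderChart (p : M) : OpenPartialHomeomorph (M × ℝ) ℝ⁴ := ((chartAt ℝ³ p).prod (OpenPartialHomeomorph.refl ℝ)) ≫ₕ
    cylinderCoord.toHomeomorph.toOpenPartialHomeomorph

theorem mem_cylinderChart_source {p : M} {q : M × ℝ} : q ∈ (cylinderChart p).source ↔ q.1 ∈ (chartAt ℝ³ p).source := by
  simp [cylinderChart]

theorem cylinderChart_symm_snd (p : M) (y : ℝ⁴) : ((cylinderChart p).symm y).2 = -y 0 := rfl

theorem contMDiffOn_cylinderChart (p : M) :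
    ContMDiffOn ((𝓡 3).prod ℐ) (𝓡 4) ∞ (cylinderChart p) (cylinderChart p).source := by
  have h1 : ContMDiffOn (𝓡 3) (𝓡 3) ∞ (chartAt ℝ³ p) _ :=
    contMDiffOn_of_mem_maximalAtlas (IsManifold.chart_mem_maximalAtlas p)
  have h2 : ContMDiffOn ((𝓡 3).prod ℐ) 𝓘(ℝ, ℝ³ × ℝ) ∞
      (fun q : M × ℝ => (chartAt ℝ³ p q.1, q.2)) (cylinderChart p).source :=
    ContMDiffOn.prodMk_space (h1.comp contMDiff_fst.contMDiffOn fun q hq => mem_cylinderChart_source.1 hq)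
      contMDiff_snd.contMDiffOn
  exact cylinderCoord.contDiff.contMDiff.comp_contMDiffOn h2

theorem contMDiffOn_cylinderChart_symm (p : M) :
    ContMDiffOn (𝓡 4) ((𝓡 3).prod ℐ) ∞ (cylinderChart p).symm (cylinderChart p).target := by
  have h1 : ContMDiffOn (𝓡 3) (𝓡 3) ∞ (chartAt ℝ³ p).symm _ :=
    contMDiffOn_symm_of_mem_maximalAtlas (IsManifold.chart_mem_maximalAtlas p)
  have h2 : ContMDiff (𝓡 4) (𝓡 3) ∞ fun y => (cylinderCoord.symm y).1 :=
    (contDiff_fst.comp cylinderCoord.symm.contDiff).contMDiff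
  have h3 : ContMDiff (𝓡 4) ℐ ∞ fun y => (cylinderCoord.symm y).2 :=
    (contDiff_snd.comp cylinderCoord.symm.contDiff).contMDiff
  refine (h1.comp h2.contMDiffOn fun y hy => ?_).prodMk h3.contMDiffOn
  have := (cylinderChart p).map_target hy
  rw [cylinderChart, OpenPartialHomeomorph.trans_target] at hy; exact hy.2.1

end

section Completion

/-- A complete Liouville form on the interior which extends a Liouville structure on a shrunken
copy of `V`. -/
structure CompletionData (lam : OneForm ℋ V) (Λ : OneForm (𝓡 4) (Interior V)) (τ : ℝ) where
  s : V → ℝ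
  hs : IsBdryFun s
  X : ∀ x : V, Tan ℋ x
  hX : IsInwardField s X
  d_X : ∀ x w, lam.d x (X x) w = -lam x w
  T : ℝ
  Φ : ℝ → V → V
  hΦ : IsInwardFlow X T Φ
  hτ : τ ∈ Ioo 0 T
  Z : ∀ x : Interior V, Tan (𝓡 4) x
  hZ : SmoothField Z
  d_Z : ∀ x w, Λ.d x (Z x) w = Λ x w
  Ψ : ℝ → Interior V → Interior V
  hΨ : IsFlow Z Ψ
  c : ℝ
  lt_c : ∀ x, s (Φ τ x) < c
  form_eq : ∀ x : Interior V, s x.val < c → ∀ w, Λ x w = lam x.val (mfderiv (𝓡 4) ℋ Interior.val x w)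
  Z_eq : ∀ x : Interior V, s x.val < c → mfderiv (𝓡 4) ℋ Interior.val x (Z x) = -X x.val
  c₀ : ℝ
  Z_pos : ∀ x : Interior V, c₀ < s x.val → 0 < mvfderiv (𝓡 4) (fun x : Interior V => s x.val) x (Z x)
  mem_range : ∀ x, s x ≤ c₀ → x ∈ range (Φ τ)

theorem IsBdryFun.lt_zero {s : V → ℝ} (hs : IsBdryFun s) (x : Interior V) : s x.val < 0 :=
  lt_of_le_of_ne (hs.nonpos _) fun h =>
    (ModelWithCorners.disjoint_interior_boundary (I := ℋ) (M := V)).le_bot ⟨x.2, (hs.eq_zero_iff _).1 h⟩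

theorem IsBdryFun.isCompact_le {s : V → ℝ} (hs : IsBdryFun s) [CompactSpace V]
    {c : ℝ} (hc : c < 0) : IsCompact {x : Interior V | s x.val ≤ c} := by
  refine Interior.isOpenEmbedding_val.isInducing.isCompact_preimage' (K := {x | s x ≤ c})
    (isClosed_le hs.contMDiff.continuous continuous_const).isCompact fun x (hx : s x ≤ c) => ?_
  have h : x ∈ (ℋ).interior V := by
    rw [← ModelWithCorners.compl_boundary]
    exact fun hb => by linarith [(hs.eq_zero_iff x).2 hb]
  exact ⟨⟨x, h⟩, rfl⟩

namespace CompletionData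

variable {lam : OneForm ℋ V} {Λ : OneForm (𝓡 4) (Interior V)} {τ : ℝ} (D : CompletionData lam Λ τ)

theorem mem_Icc : τ ∈ Icc 0 D.T := ⟨D.hτ.1.le, D.hτ.2.le⟩

/-- The embedding of `V` in its interior. -/
def e (x : V) : Interior V := ⟨D.Φ τ x, D.hΦ.interior x τ ⟨D.hτ.1, D.hτ.2.le⟩⟩

theorem contMDiff_e : ContMDiff ℋ (𝓡 4) ∞ D.e := fun x =>
  Interior.contMDiffAt_of_val le_rfl (D.hΦ.contMDiff D.mem_Icc x)

theorem mfderiv_val_e (x : V) (w : Tan ℋ x) : mfderiv (𝓡 4) ℋ Interior.val (D.e x) (mfderiv ℋ (𝓡 4) D.e x w) =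
      mfderiv ℋ ℋ (D.Φ τ) x w :=
  Interior.mfderiv_val_comp (g := D.Φ τ) (fun _ => rfl) (D.contMDiff_e.mdifferentiableAt (by simp)) w

theorem injective_mfderiv_e (x : V) : Injective (mfderiv ℋ (𝓡 4) D.e x) := by
  intro u w h
  refine D.hΦ.injective_mfderiv τ D.mem_Icc x ?_
  rw [← D.mfderiv_val_e, ← D.mfderiv_val_e, h]

theorem form_e (x : V) (w : Tan ℋ x) : Λ (D.e x) (mfderiv ℋ (𝓡 4) D.e x w) = Real.exp (-τ) * lam x w := by
  rw [D.form_eq (D.e x) (D.lt_c x), D.mfderiv_val_e]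
  have h := D.hΦ.isSemiflow.form_eq_exp D.hΦ.contMDiffOn (α := lam) (c := -1) (fun x => by
    have := D.d_X x (D.X x)
    rw [OneForm.d_self] at this; linarith) (fun x w => by rw [D.d_X]; ring) x w D.mem_Icc
  rw [neg_one_mul] at h; exact h

theorem form_Z (x : Interior V) : Λ x (D.Z x) = 0 := by rw [← D.d_Z, OneForm.d_self]

variable [T2Space V]

theorem mfderiv_e_X (x : V) : mfderiv ℋ (𝓡 4) D.e x (D.X x) = -D.Z (D.e x) := by
  refine Interior.injective_mfderiv_val _ ((D.mfderiv_val_e x _).trans ?_)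
  rw [D.hΦ.isSemiflow.mfderiv_apply_self range_euclideanHalfSpace_eq D.hX.contMDiff
    ⟨D.hτ.1.le, D.hτ.2⟩ ((D.hΦ.contMDiff D.mem_Icc).mdifferentiableAt (by simp)), map_neg,
    D.Z_eq (D.e x) (D.lt_c x), neg_neg]
  rfl

theorem injective_e : Injective D.e := fun _ _ h =>
  D.hΦ.isSemiflow.injective range_euclideanHalfSpace_eq D.hX.contMDiff D.mem_Icc (congrArg Subtype.val h)

theorem flow_neg_e (x : V) {t : ℝ} (ht : t ∈ Icc 0 (D.T - τ)) : D.Ψ (-t) (D.e x) = D.e (D.Φ t x) := by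
  refine eqOn_of_hasVelocity (I := 𝓡 4) range_eq_affineHalf (contMDiff_neg_vectorField D.hZ)
    (γ := fun t => D.Ψ (-t) (D.e x)) (γ' := fun t => D.e (D.Φ t x)) (a := 0) (b := D.T - τ)
    (fun t _ => (D.hΨ.neg.curve _ t).mono (subset_univ _)) (fun t ht => ?_) ?_ ht
  · have h1 := (D.hΦ.isSemiflow.curve x t ⟨ht.1, by linarith [ht.2, D.hτ.1]⟩).mono
      (Icc_subset_Icc le_rfl (show D.T - τ ≤ D.T by linarith [D.hτ.1]))
    have h2 := h1.map (D.contMDiff_e.mdifferentiableAt (x := D.Φ t x) (by simp))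
    rwa [D.mfderiv_e_X] at h2
  · simp only [neg_zero]; rw [D.hΨ.init, D.hΦ.isSemiflow.init]

theorem flow_neg_mem {t : ℝ} (ht : 0 < t) (x : V) : ∃ y : Interior V, D.Ψ (-t) (D.e x) = D.e y.val := by
  have hη : 0 < D.T - τ := by linarith [D.hτ.2]
  have h1 : ∀ n : ℕ, ∀ t ∈ Icc 0 (n * (D.T - τ)), ∃ y, D.Ψ (-t) (D.e x) = D.e y := by
    intro n
    induction n with
    | zero =>
      intro t ht
      have : t = 0 := le_antisymm (by simpa using ht.2) ht.1
      exact ⟨x, by rw [this, neg_zero, D.hΨ.init]⟩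
    | succ n ih =>
      intro t ht
      rcases le_total t (D.T - τ) with h | h
      · exact ⟨_, D.flow_neg_e x ⟨ht.1, h⟩⟩
      · obtain ⟨y, hy⟩ := ih (t - (D.T - τ)) ⟨by linarith, by have := ht.2; push_cast at this; linarith⟩
        refine ⟨_, (?_ : _ = D.Ψ (-(D.T - τ)) (D.e y)).trans (D.flow_neg_e y ⟨hη.le, le_rfl⟩)⟩
        rw [← hy, ← D.hΨ.add D.hZ]; congr 1; ring
  obtain ⟨n, hn⟩ := exists_nat_ge (t / (D.T - τ))
  set h := min t (D.T - τ) with hh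
  have h0 : 0 < h := lt_min ht hη
  obtain ⟨y, hy⟩ := h1 n (t - h) ⟨by linarith [min_le_left t (D.T - τ)], by rw [div_le_iff₀ hη] at hn; linarith⟩
  refine ⟨⟨D.Φ h y, D.hΦ.interior y h ⟨h0, by linarith [min_le_right t (D.T - τ), D.hτ.1]⟩⟩, ?_⟩
  refine (?_ : _ = D.Ψ (-h) (D.e y)).trans (D.flow_neg_e y ⟨h0.le, min_le_right _ _⟩)
  rw [← hy, ← D.hΨ.add D.hZ]; congr 1; ring

theorem contMDiff_e_val : ContMDiff (𝓡 4) (𝓡 4) ∞ fun x : Interior V => D.e x.val :=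
  D.contMDiff_e.comp Interior.contMDiff_val

theorem injective_mfderiv_e_val (x : Interior V) :
    Injective (mfderiv (𝓡 4) (𝓡 4) (fun x : Interior V => D.e x.val) x) := by
  have h : mfderiv (𝓡 4) (𝓡 4) (fun x : Interior V => D.e x.val) x = (mfderiv ℋ (𝓡 4) D.e x.val).comp _ :=
    mfderiv_comp x (D.contMDiff_e.mdifferentiableAt (by simp)) (Interior.contMDiff_val.mdifferentiableAt (by simp))
  rw [h]; exact (D.injective_mfderiv_e _).comp (Interior.injective_mfderiv_val x)

theorem isOpen_range : IsOpen (range fun x : Interior V => D.e x.val) :=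
  (isOpenMap_of_injective_mfderiv D.contMDiff_e_val D.injective_mfderiv_e_val rfl).isOpen_range

theorem continuous_flow : Continuous fun p : ℝ × Interior V => D.Ψ p.1 p.2 := (D.hΨ.contMDiff D.hZ).continuous

theorem exists_flow_neg_mem [CompactSpace V] (z : Interior V) :
    ∃ t, 0 ≤ t ∧ D.Ψ (-t) z ∈ range fun x : Interior V => D.e x.val := by
  set R := range fun x : Interior V => D.e x.val with hR
  by_contra hz
  set S : Set (Interior V) := {z | ∃ t, 0 ≤ t ∧ D.Ψ (-t) z ∈ R} with hS
  have hSo : IsOpen S := by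
    have : S = ⋃ t ∈ Ici (0 : ℝ), (fun z => D.Ψ (-t) z) ⁻¹' R := by ext z; simp [hS]
    rw [this]
    exact isOpen_biUnion fun t _ => D.isOpen_range.preimage (D.continuous_flow.comp (Continuous.prodMk_right (-t)))
  have hSe : ∀ x : V, ∀ t : ℝ, 0 ≤ t → D.Ψ t (D.e x) ∈ S := fun x t ht => by
    obtain ⟨y, hy⟩ := D.flow_neg_mem one_pos x
    refine ⟨t + 1, by linarith, y, ?_⟩
    simp only [← hy]; rw [← D.hΨ.add D.hZ]; congr 1; ring
  have hinv : ∀ z ∉ S, ∀ t, D.Ψ t z ∉ S := by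
    rintro z hz t ⟨t', ht', ⟨y, hy⟩⟩
    replace hy : D.e y.val = _ := hy
    rw [← D.hΨ.add D.hZ] at hy
    rcases le_total t t' with h | h
    · exact hz ⟨t' - t, by linarith, y, hy.trans (by congr 1; ring)⟩
    · apply hz
      have h1 : z = D.Ψ (t' - t) (D.e y.val) := by rw [hy, ← D.hΨ.add D.hZ]; ring_nf; rw [D.hΨ.init]
      rcases h.eq_or_lt with h | h
      · rw [h1, h, sub_self]; exact hSe _ 0 le_rfl
      · obtain ⟨y', hy'⟩ := D.flow_neg_mem (show 0 < t - t' by linarith) y.val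
        rw [h1, ← neg_sub, hy', ← D.hΨ.init (D.e y'.val)]; exact hSe _ 0 le_rfl
  have hK : IsCompact ({x : Interior V | D.s x.val ≤ D.s z.val} ∩ Sᶜ) :=
    (D.hs.isCompact_le (D.hs.lt_zero z)).inter_right hSo.isClosed_compl
  have hsc : Continuous fun x : Interior V => D.s x.val :=
    D.hs.contMDiff.continuous.comp Interior.contMDiff_val.continuous
  obtain ⟨w, ⟨hw1, hw2⟩, hw⟩ := hK.exists_isMinOn ⟨z, le_refl (D.s z.val), hz⟩ hsc.continuousOn
  have hc : D.c₀ < D.s w.val := by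
    by_contra! h
    obtain ⟨y, hy⟩ := D.mem_range _ h
    have : D.e y = w := Subtype.ext hy
    apply hw2; rw [← this, ← D.hΨ.init (D.e y)]; exact hSe y 0 le_rfl
  have hd : HasDerivAt (fun t => D.s (D.Ψ t w).val)
      (mvfderiv (𝓡 4) (fun x : Interior V => D.s x.val) (D.Ψ 0 w) (D.Z (D.Ψ 0 w))) 0 :=
    ((D.hΨ.curve w 0).hasDerivWithinAt_comp (g := fun x : Interior V => D.s x.val)
      ((D.hs.contMDiff.comp Interior.contMDiff_val).mdifferentiableAt (by simp))).hasDerivAt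
      univ_mem
  have hmin : IsLocalMin (fun t => D.s (D.Ψ t w).val) 0 := Eventually.of_forall fun t => by
    simp only [D.hΨ.init]
    rcases le_total (D.s (D.Ψ t w).val) (D.s z.val) with h | h
    · exact hw ⟨h, hinv w hw2 t⟩
    · exact le_trans hw1 h
  have h0 := hmin.hasDerivAt_eq_zero hd
  have h1 : ∀ y, y = w → 0 < mvfderiv (𝓡 4) (fun x : Interior V => D.s x.val) y (D.Z y) := by
    rintro _ rfl; exact D.Z_pos _ hc
  exact (h1 _ (D.hΨ.init w)).ne' h0

variable (bd)

/-- The parametrization of the end. -/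
def cyl (q : M × ℝ) : Interior V := D.Ψ q.2 (D.e (bd.toFun q.1))

theorem contMDiff_cyl : ContMDiff ((𝓡 3).prod ℐ) (𝓡 4) ∞ (D.cyl bd) := by
  have h : ContMDiff ((𝓡 3).prod ℐ) ((ℐ).prod (𝓡 4)) ∞ (fun q : M × ℝ => (q.2, D.e (bd.toFun q.1))) :=
    contMDiff_snd.prodMk (D.contMDiff_e.comp (bd.contMDiff.comp contMDiff_fst))
  exact (D.hΨ.contMDiff D.hZ).comp h

theorem cyl_notMem (p : M) {r : ℝ} (hr : 0 < r) : D.cyl bd (p, r) ∉ range D.e := by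
  rintro ⟨x, hx⟩
  obtain ⟨y, hy⟩ := D.flow_neg_mem hr x
  have h1 : D.e (bd.toFun p) = D.e y.val := by rw [← hy, hx, cyl, ← D.hΨ.add D.hZ, neg_add_cancel, D.hΨ.init]
  have h2 := D.hs.lt_zero y
  rw [← D.injective_e h1, (D.hs.eq_zero_iff _).2 (bd.mem_boundary p)] at h2; exact lt_irrefl _ h2

theorem injective_cyl : Injective (D.cyl bd) := by
  have key : ∀ p p' : M, ∀ r r' : ℝ, r ≤ r' → D.cyl bd (p, r) = D.cyl bd (p', r') → (p, r) = (p', r') := by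
    intro p p' r r' hr h
    have h1 : D.e (bd.toFun p) = D.cyl bd (p', r' - r) := by
      have := congrArg (D.Ψ (-r)) h
      simp only [cyl] at this ⊢; rw [← D.hΨ.add D.hZ, ← D.hΨ.add D.hZ, neg_add_cancel, D.hΨ.init] at this
      rw [this]; congr 1; ring
    rcases hr.eq_or_lt with rfl | hlt
    · rw [sub_self, cyl, D.hΨ.init] at h1; rw [bd.injective (D.injective_e h1)]
    · exact absurd ⟨_, h1⟩ (D.cyl_notMem bd p' (sub_pos.2 hlt))
  rintro ⟨p, r⟩ ⟨p', r'⟩ h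
  rcases le_total r r' with hr | hr
  · exact key _ _ _ _ hr h
  · exact (key _ _ _ _ hr h.symm).symm

theorem contMDiff_flow (r : ℝ) : ContMDiff (𝓡 4) (𝓡 4) ∞ (D.Ψ r) := by
  have h : ContMDiff (𝓡 4) ((ℐ).prod (𝓡 4)) ∞ fun w : Interior V => (r, w) := contMDiff_const.prodMk contMDiff_id
  exact (D.hΨ.contMDiff D.hZ).comp h

theorem mfderiv_flow_Z (r : ℝ) (x : Interior V) : mfderiv (𝓡 4) (𝓡 4) (D.Ψ r) x (D.Z x) = D.Z (D.Ψ r x) := by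
  have hd : ∀ r, MDifferentiableAt (𝓡 4) (𝓡 4) (D.Ψ r) x := fun r => (D.contMDiff_flow r).mdifferentiableAt (by simp)
  rcases le_total 0 r with hr | hr
  · exact (D.hΨ.isSemiflow (r + 1)).mfderiv_apply_self range_eq_affineHalf D.hZ ⟨hr, by linarith⟩ (hd r)
  · obtain ⟨r, rfl⟩ : ∃ r', r = -r' := ⟨-r, (neg_neg r).symm⟩
    have h := (D.hΨ.neg.isSemiflow (r + 1)).mfderiv_apply_self range_eq_affineHalf
      (contMDiff_neg_vectorField D.hZ) (t := r) ⟨by linarith, by linarith⟩ (x := x) (hd (-r))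
    simp only [map_neg] at h; exact neg_injective h

theorem mfderiv_cyl (q : M × ℝ) (u : Tan (𝓡 3) q.1) (a : ℝ) :
    mfderiv ((𝓡 3).prod ℐ) (𝓡 4) (D.cyl bd) q (u, a) = mfderiv (𝓡 4) (𝓡 4) (D.Ψ q.2) (D.e (bd.toFun q.1))
        (mfderiv ℋ (𝓡 4) D.e (bd.toFun q.1) (bd.tangent q.1 u - a • D.X (bd.toFun q.1))) := by
  refine (mfderiv_prod_eq_add_apply (v := ((u, a) : Tan ((𝓡 3).prod ℐ) q))
    ((D.contMDiff_cyl bd).mdifferentiableAt (by simp))).trans ?_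
  have h1 : HasMFDerivAt ℐ (𝓡 4) (fun t => D.cyl bd (q.1, t)) q.2 _ :=
    HasMFDerivWithinAt.hasMFDerivAt (D.hΨ.curve (D.e (bd.toFun q.1)) q.2) univ_mem
  have h2 : HasMFDerivAt (𝓡 3) (𝓡 4) (fun p => D.cyl bd (p, q.2)) q.1 _ :=
    HasMFDerivAt.comp q.1 ((D.contMDiff_flow q.2).mdifferentiableAt (x := D.e (bd.toFun q.1)) (by simp)).hasMFDerivAt
      (HasMFDerivAt.comp q.1 (D.contMDiff_e.mdifferentiableAt (by simp)).hasMFDerivAt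
        (bd.contMDiff.mdifferentiableAt (by simp)).hasMFDerivAt)
  rw [map_sub, map_smul, D.mfderiv_e_X, smul_neg, sub_neg_eq_add, map_add, map_smul, D.mfderiv_flow_Z]; congr 1
  · exact DFunLike.congr_fun h2.mfderiv u
  · exact DFunLike.congr_fun h1.mfderiv a

theorem form_flow (r : ℝ) (x : Interior V) (w : Tan (𝓡 4) x) :
    Λ (D.Ψ r x) (mfderiv (𝓡 4) (𝓡 4) (D.Ψ r) x w) = Real.exp r * Λ x w := by
  rcases le_total 0 r with hr | hr
  · have h := (D.hΨ.isSemiflow r).form_eq_exp (D.hΨ.contMDiff D.hZ).contMDiffOn (α := Λ) (c := 1) D.form_Z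
      (fun x w => by rw [D.d_Z, one_mul]) x w ⟨hr, le_rfl⟩
    rwa [one_mul] at h
  · obtain ⟨r, rfl⟩ : ∃ r', r = -r' := ⟨-r, (neg_neg r).symm⟩
    have hsm : ContMDiff ((ℐ).prod (𝓡 4)) (𝓡 4) ∞ (fun p : ℝ × Interior V => D.Ψ (-p.1) p.2) :=
      (D.hΨ.neg.contMDiff (contMDiff_neg_vectorField D.hZ))
    have h := (D.hΨ.neg.isSemiflow r).form_eq_exp hsm.contMDiffOn (α := Λ) (c := -1)
      (fun x => by rw [map_neg, D.form_Z, neg_zero])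
      (fun x w => by
        have := OneForm.d_smul_left Λ x (-1) (D.Z x) w
        rw [neg_one_smul] at this
        rw [this, D.d_Z]) x w (r := r) ⟨by linarith, le_rfl⟩
    rwa [neg_one_mul] at h

theorem injective_mfderiv_cyl (q : M × ℝ) : Injective (mfderiv ((𝓡 3).prod ℐ) (𝓡 4) (D.cyl bd) q) := by
  rw [injective_iff_map_eq_zero]; rintro ⟨u', a⟩ h
  obtain ⟨u, rfl⟩ : ∃ u : Tan (𝓡 3) q.1, u = u' := ⟨_, rfl⟩
  replace h := (D.mfderiv_cyl bd q u a).symm.trans h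
  have h3 : bd.tangent q.1 u - a • D.X (bd.toFun q.1) = 0 := D.injective_mfderiv_e _
    ((D.hΨ.injective_mfderiv D.hZ q.2 _ (h.trans (map_zero _).symm)).trans (map_zero _).symm)
  have e0 : D.hs.dForm (bd.toFun q.1) (bd.tangent q.1 u) = 0 := bd.dForm_tangent D.hs q.1 u
  have h4 : a * D.hs.dForm (bd.toFun q.1) (D.X (bd.toFun q.1)) = 0 := by
    have := congrArg (D.hs.dForm (bd.toFun q.1)) h3
    rwa [map_sub, map_smul, e0, map_zero, zero_sub, neg_eq_zero, smul_eq_mul] at this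
  have h5 : a = 0 := (mul_eq_zero.1 h4).resolve_right (D.hX.inward _ (bd.mem_boundary q.1)).ne
  rw [h5, zero_smul, sub_zero] at h3
  have h6 : u = 0 := bd.tangent_injective q.1 (h3.trans (map_zero _).symm)
  rw [h5, h6]; rfl

theorem form_cyl (q : M × ℝ) (w : Tan ((𝓡 3).prod ℐ) q) :
    Λ (D.cyl bd q) (mfderiv ((𝓡 3).prod ℐ) (𝓡 4) (D.cyl bd) q w) = Real.exp q.2 * (Real.exp (-τ) * bd.restrict lam q.1
        (mfderiv ((𝓡 3).prod ℐ) (𝓡 3) (Prod.fst : M × ℝ → M) q w)) := by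
  obtain ⟨u', a⟩ := w
  obtain ⟨u, rfl⟩ : ∃ u : Tan (𝓡 3) q.1, u = u' := ⟨_, rfl⟩
  have h1 : mfderiv ((𝓡 3).prod ℐ) (𝓡 3) (Prod.fst : M × ℝ → M) q (u, a) = u := by rw [mfderiv_fst]; rfl
  have h2 : lam (bd.toFun q.1) (D.X (bd.toFun q.1)) = 0 := by
    have := D.d_X (bd.toFun q.1) (D.X (bd.toFun q.1))
    rw [OneForm.d_self] at this; linarith
  refine (congrArg (Λ (D.cyl bd q)) (D.mfderiv_cyl bd q u a)).trans ((D.form_flow q.2 _ _).trans ?_)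
  rw [D.form_e, map_sub, map_smul, h2, smul_zero, sub_zero, h1]; rfl

include bd in
theorem isImmersionAt_e [CompactSpace V] (x : V) : Manifold.IsImmersionAtOfComplement PUnit.{1} ℋ (𝓡 4) ∞ D.e x := by
  by_cases hx : x ∈ (ℋ).boundary V
  · rw [← bd.range_eq] at hx
    obtain ⟨p, rfl⟩ := hx
    have hη : 0 < D.T - τ := by linarith [D.hτ.2]
    set κ := (cylinderChart p).restrOpen {q | -q.2 < D.T - τ} (isOpen_lt (by fun_prop) continuous_const)
    have hsrc : ∀ q, q ∈ κ.source ↔ q ∈ (cylinderChart p).source ∧ -q.2 < D.T - τ := fun q => Iff.rfl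
    have htgt : ∀ y ∈ κ.target, y ∈ (cylinderChart p).target ∧ y 0 < D.T - τ := fun y hy => by
      have h := (hsrc _).1 (κ.map_target hy)
      have h2 : -((cylinderChart p).symm y).2 < D.T - τ := h.2
      rw [cylinderChart_symm_snd, neg_neg] at h2; exact ⟨hy.1, h2⟩
    have hsm : ContMDiffOn (𝓡 4) ((ℐ).prod ℋ) ∞ (fun y => (y 0, bd.toFun ((cylinderChart p).symm y).1)) κ.target :=
      ContMDiffOn.prodMk (by
          have : ContDiff ℝ ∞ fun y : ℝ⁴ => y 0 := by fun_prop
          exact this.contMDiff.contMDiffOn)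
        (bd.contMDiff.comp_contMDiffOn (contMDiff_fst.comp_contMDiffOn
          ((contMDiffOn_cylinderChart_symm p).mono fun y hy => (htgt y hy).1)))
    refine isImmersionAt_of_extension (D.contMDiff_cyl bd) (D.injective_cyl bd)
      (D.injective_mfderiv_cyl bd) (by simp) (κ := κ)
      ((contMDiffOn_cylinderChart p).mono fun q hq => hq.1)
      ((contMDiffOn_cylinderChart_symm p).mono fun y hy => hy.1) D.contMDiff_e D.injective_e ?_
      (r := fun y => D.Φ (y 0) (bd.toFun ((cylinderChart p).symm y).1)) ?_ ?_ (n := (p, 0)) ?_ ?_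
    · rintro z ⟨p', r⟩ - h; change 0 ≤ -r
      by_contra! hr
      exact D.cyl_notMem bd p' (by linarith) ⟨z, h⟩
    · intro y hy h0; rw [← D.flow_neg_e _ ⟨h0, (htgt y hy).2.le⟩]; rfl
    · exact D.hΦ.contMDiffOn.comp (hsm.mono inter_subset_left) fun y hy =>
        ⟨⟨hy.2, by linarith [(htgt y hy.1).2, D.hτ.1]⟩, mem_univ _⟩
    · exact (hsrc _).2 ⟨mem_cylinderChart_source.2 (mem_chart_source _ p), by simpa using hη⟩
    · rw [cyl, D.hΨ.init]
  · have hx' : x ∈ (ℋ).interior V := by rwa [← ModelWithCorners.compl_boundary]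
    set w : Interior V := ⟨x, hx'⟩
    have hm : Interior.chart w ∈ IsManifold.maximalAtlas (𝓡 4) ∞ (Interior V) := IsManifold.chart_mem_maximalAtlas w
    have h2 := contMDiffOn_symm_of_mem_maximalAtlas hm
    refine isImmersionAt_of_extension D.contMDiff_e_val
      (D.injective_e.comp Subtype.val_injective) D.injective_mfderiv_e_val rfl
      (contMDiffOn_of_mem_maximalAtlas hm) h2 D.contMDiff_e D.injective_e (fun z n hn _ => ?_)
      (r := fun y => ((Interior.chart w).symm y).val) (fun y _ _ => rfl)
      ((Interior.contMDiff_val.comp_contMDiffOn h2).mono inter_subset_left)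
      (n := w) (mem_chart_source _ w) rfl
    rw [Interior.chart_source] at hn; rw [Interior.chart_apply]; exact extChartAt_zero_nonneg _ hn

include bd in
theorem isSmoothEmbedding_e [CompactSpace V] : Manifold.IsSmoothEmbedding ℋ (𝓡 4) ∞ D.e :=
  ⟨Manifold.IsImmersionOfComplement.isImmersion (F := PUnit.{1}) (D.isImmersionAt_e bd),
    (D.contMDiff_e.continuous.isClosedEmbedding D.injective_e).isEmbedding⟩

theorem exists_flow_eq [CompactSpace V] (z : Interior V) :
    z ∈ range D.e ∨ ∃ (p : M) (r : ℝ), 0 ≤ r ∧ z = D.cyl bd (p, r) := by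
  set A : Set ℝ := Ici 0 ∩ {t | D.Ψ (-t) z ∈ range D.e} with hA
  have hcont : Continuous fun t => D.Ψ (-t) z := D.continuous_flow.comp (continuous_neg.prodMk continuous_const)
  have hAc : IsClosed A := isClosed_Ici.inter ((isCompact_range D.contMDiff_e.continuous).isClosed.preimage hcont)
  obtain ⟨t, ht, y, hy⟩ := D.exists_flow_neg_mem z
  have hAn : A.Nonempty := ⟨t, ht, y.val, hy⟩
  have hAb : BddBelow A := ⟨0, fun t ht => ht.1⟩
  obtain ⟨h0, x, hx⟩ := hAc.csInf_mem hAn hAb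
  set t₀ := sInf A with ht₀
  have hz : z = D.Ψ t₀ (D.e x) := by rw [hx, ← D.hΨ.add D.hZ, add_neg_cancel, D.hΨ.init]
  by_cases hb : x ∈ (ℋ).boundary V
  · rw [← bd.range_eq] at hb
    obtain ⟨p, rfl⟩ := hb
    exact Or.inr ⟨p, t₀, h0, hz⟩
  · left
    rcases (show (0 : ℝ) ≤ t₀ from h0).eq_or_lt with h | h
    · exact ⟨x, by rw [hz, ← h, D.hΨ.init]⟩
    · exfalso
      have hx' : x ∈ (ℋ).interior V := by rwa [← ModelWithCorners.compl_boundary]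
      have h1 : ∀ᶠ t in 𝓝 t₀, D.Ψ (-t) z ∈ range fun x : Interior V => D.e x.val :=
        hcont.continuousAt.eventually (D.isOpen_range.mem_nhds ⟨⟨x, hx'⟩, hx⟩)
      have h2 : ∀ᶠ t in 𝓝 t₀, 0 < t := eventually_gt_nhds h
      obtain ⟨t, ⟨⟨y, hy⟩, h3⟩, h4⟩ := (((h1.and h2).filter_mono nhdsWithin_le_nhds).and
        (self_mem_nhdsWithin (s := Iio t₀))).exists
      exact absurd (csInf_le hAb ⟨h3.le, y.val, hy⟩) (not_le.2 h4)

/-- The completion. -/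
def completion [CompactSpace V] : LiouvilleCompletion bd lam where
  W := Interior V
  form := Real.exp τ • Λ
  incl := D.e
  incl_isSmoothEmbedding := D.isSmoothEmbedding_e bd
  incl_form x w := by
    rw [OneForm.smul_apply, D.form_e, ← mul_assoc, ← Real.exp_add, add_neg_cancel, Real.exp_zero, one_mul]
  ε := 1
  ε_pos := one_pos
  cyl := D.cyl bd
  cyl_smooth := (D.contMDiff_cyl bd).contMDiffOn
  cyl_injOn := (D.injective_cyl bd).injOn
  cyl_immersion q _ := D.injective_mfderiv_cyl bd q
  cyl_form q _ w := by
    rw [OneForm.smul_apply, D.form_cyl, mul_left_comm, ← mul_assoc (Real.exp τ), ← Real.exp_add,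
      add_neg_cancel, Real.exp_zero, one_mul]
  cyl_zero p := D.hΨ.init _
  cyl_notMem p r hr := D.cyl_notMem bd p hr
  cover z := D.exists_flow_eq bd z

end CompletionData

end Completion

open Interior OneForm

section EndForms

/-- The differential of the inclusion of the interior. -/
abbrev dval (x : Interior V) : Tan (𝓡 4) x →L[ℝ] Tan ℋ x.val := mfderiv (𝓡 4) ℋ val x

theorem mvfderiv_comp_val {f : V → ℝ} (hf : ContMDiff ℋ ℐ ∞ f) (x : Interior V) (w : Tan (𝓡 4) x) :
    mvfderiv (𝓡 4) (fun x : Interior V => f x.val) x w = mvfderiv ℋ f x.val (dval x w) :=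
  DFunLike.congr_fun (HasMFDerivAt.comp x (hf.mdifferentiableAt (x := x.val) (by simp)).hasMFDerivAt
    (contMDiff_val.mdifferentiableAt (x := x) (by simp)).hasMFDerivAt).mfderiv w

variable {s : V → ℝ} (hs : IsBdryFun s) {a K δ : ℝ} (p : EndProfile a K δ)

include hs in
theorem IsBdryFun.contMDiff_val : ContMDiff (𝓡 4) ℐ ∞ fun x : Interior V => s x.val :=
  hs.contMDiff.comp Interior.contMDiff_val

include hs in
theorem EndProfile.contMDiff_g : ContMDiff (𝓡 4) ℐ ∞ fun x : Interior V => p.g (s x.val) :=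
  fun x => ContMDiffAt.comp x ((p.contDiffOn_g.contDiffAt (Iio_mem_nhds (hs.lt_zero x))).contMDiffAt)
    (hs.contMDiff_val x)

/-- The form `χ(s) μ + g(s) β` on the interior. -/
def endForm (μ β : OneForm ℋ V) : OneForm (𝓡 4) (Interior V) :=
  fmul (fun x => p.χ (s x.val)) (p.contDiff_χ.contMDiff.comp hs.contMDiff_val) (μ.pullback val Interior.contMDiff_val) +
  fmul (fun x => p.g (s x.val)) (p.contMDiff_g hs) (β.pullback val Interior.contMDiff_val)

theorem endForm_apply (μ β : OneForm ℋ V) (x : Interior V) (w : Tan (𝓡 4) x) :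
    endForm hs p μ β x w = p.χ (s x.val) * μ x.val (dval x w) + p.g (s x.val) * β x.val (dval x w) := by
  rw [endForm, OneForm.add_apply, fmul_apply, fmul_apply, pullback_apply, pullback_apply]

/-- The differential of `endForm` at a point of `V`. -/
def endD (μ β : OneForm ℋ V) (x : V) :=
  endBilin (p.χ (s x)) (p.g (s x)) (deriv p.χ (s x)) (p.g' (s x)) (hs.dForm.cov x) (μ.cov x) (β.cov x)
    (μ.dLin x) (β.dLin x)

theorem endD_self (μ β : OneForm ℋ V) (x : V) (u : Tan ℋ x) : endD hs p μ β x u u = 0 := by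
  simp [endD, endBilin, dLin_self, wedge_self]

theorem d_endForm (μ β : OneForm ℋ V) (x : Interior V) (u w : Tan (𝓡 4) x) :
    (endForm hs p μ β).d x u w = endD hs p μ β x.val (dval x u) (dval x w) := by
  have h1 : ∀ w : Tan (𝓡 4) x, mvfderiv (𝓡 4) (fun x : Interior V => p.χ (s x.val)) x w =
      deriv p.χ (s x.val) * hs.dForm.cov x.val (dval x w) := fun w =>
    (mvfderiv_comp_real p.contDiff_χ (hs.contMDiff_val.mdifferentiableAt (by simp)) w).trans
      (congrArg _ (mvfderiv_comp_val hs.contMDiff x w))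
  have h2 : ∀ w : Tan (𝓡 4) x, mvfderiv (𝓡 4) (fun x : Interior V => p.g (s x.val)) x w =
      p.g' (s x.val) * hs.dForm.cov x.val (dval x w) := fun w =>
    (mvfderiv_comp_hasDerivAt (s := fun x : Interior V => s x.val) (p.hasDerivAt_g _ (hs.lt_zero x))
      (hs.contMDiff_val.mdifferentiableAt (by simp)) w).trans
      (congrArg _ (mvfderiv_comp_val hs.contMDiff x w))
  rw [endForm, d_add, d_fmul, d_fmul, d_pullback, d_pullback, pullback_apply, pullback_apply,
    pullback_apply, pullback_apply, h1, h1, h2, h2]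
  simp only [endD, endBilin, LinearMap.add_apply, LinearMap.smul_apply, wedge_apply, smul_eq_mul, dLin_apply, cov_apply]
  ring

/-- The affine combination of two 1-forms. -/
def mix (κ : ℝ) (α β : OneForm I N) : OneForm I N := α + κ • (β + (-1 : ℝ) • α)

theorem mix_self (κ : ℝ) (α : OneForm ℋ V) : mix κ α α = α := by
  ext x w; rw [mix, OneForm.add_apply, OneForm.smul_apply, OneForm.add_apply, OneForm.smul_apply]; ring

theorem endForm_mix (κ : ℝ) (μ μ' β β' : OneForm ℋ V) :
    endForm hs p (mix κ μ μ') (mix κ β β') = mix κ (endForm hs p μ β) (endForm hs p μ' β') := by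
  ext x w; rw [endForm_apply]; simp only [mix, OneForm.add_apply, OneForm.smul_apply]
  rw [endForm_apply, endForm_apply]; ring

/-- The estimates for the pair `μ, β` on `V`, which are stronger where `-η ≤ s`. -/
def EndBounded (a K η : ℝ) (μ β γ : OneForm ℋ V) : Prop := ∀ x : V, ∃ (b : Basis (Fin 4) ℝ (Tan ℋ x)) (P : ℝ),
    EndBound a K P (-η ≤ s x) (hs.dForm.cov x) (μ.cov x) (β.cov x) (γ.cov x) (μ.dLin x) (β.dLin x) b

variable [CompactSpace V] [T2Space V] (D : BoundaryData bd)

theorem BoundaryData.exists_endBound {lam : unitInterval → OneForm ℋ V} (hlam : Continuous lam)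
    (hpos : ∀ t, IsPositiveSymplectic o (lam t)) (hcon : ∀ t, bd.IsContactForm o (bd.restrict (lam t))) :
    ∃ a > (0 : ℝ), ∃ K > (0 : ℝ), ∃ η > (0 : ℝ), ∀ t t' : unitInterval, |(t : ℝ) - t'| ≤ η →
      ∀ κ ∈ Icc (0 : ℝ) 1, EndBounded D.isBdry a K η (mix κ (lam t) (lam t'))
        (mix κ (D.ext (bd.restrict (lam t))) (D.ext (bd.restrict (lam t'))))
        (D.ext (bd.restrict (lam t)) + (-1 : ℝ) • D.ext (bd.restrict (lam t'))) := by
  set β : unitInterval → OneForm ℋ V := fun t => D.ext (bd.restrict (lam t)) with hβdef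
  have hβ : Continuous β := D.continuous_ext.comp ((OneForm.continuous_pullback continuous_id _).comp hlam)
  have hmix : ∀ {F : unitInterval → OneForm ℋ V}, Continuous F →
      Continuous fun z : unitInterval × unitInterval × unitInterval => mix (z.2.2 : ℝ) (F z.1) (F z.2.1) := fun hF =>
    OneForm.continuous_add (hF.comp continuous_fst) (OneForm.continuous_smul
      (continuous_subtype_val.comp (continuous_snd.comp continuous_snd)) (OneForm.continuous_add
        (hF.comp (continuous_fst.comp continuous_snd)) (OneForm.continuous_smul continuous_const
          (hF.comp continuous_fst))))
  have hμc := hmix hlam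
  have hβc := hmix hβ
  set μ' : unitInterval × unitInterval × unitInterval → OneForm ℋ V := fun z => mix (z.2.2 : ℝ) (lam z.1) (lam z.2.1)
  set β' : unitInterval × unitInterval × unitInterval → OneForm ℋ V := fun z => mix (z.2.2 : ℝ) (β z.1) (β z.2.1)
  have hγc : Continuous fun z : unitInterval × unitInterval × unitInterval => β z.1 + (-1 : ℝ) • β z.2.1 :=
    OneForm.continuous_add (hβ.comp continuous_fst) (OneForm.continuous_smul continuous_const
      (hβ.comp (continuous_fst.comp continuous_snd)))
  have hl : Continuous fun z : unitInterval × unitInterval × unitInterval => lam z.1 := hlam.comp continuous_fst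
  have hp := fun z : unitInterval × unitInterval × unitInterval => hpos z.1
  have c0 := continuous_dRatio hμc hμc hl hp
  have c1 := D.continuous_ratio hμc hμc hl hp
  have c2 := D.continuous_ratio hμc hβc hl hp
  have c3 := D.continuous_ratio hβc hμc hl hp
  have c4 := D.continuous_ratio hβc hβc hl hp
  have c5 := continuous_dRatio hμc hβc hl hp
  have c6 := continuous_dRatio hβc hβc hl hp
  have c7 := D.continuous_ratio hγc hβc hl hp
  have hn : Continuous fun q : (unitInterval × unitInterval × unitInterval) × V => -|(q.1.1 : ℝ) - q.1.2.1| := by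
    fun_prop
  have hn' : Continuous fun q : (unitInterval × unitInterval × unitInterval) × V =>
      -|(q.1.1 : ℝ) - q.1.2.1| + D.s q.2 :=
    hn.add (D.isBdry.contMDiff.continuous.comp continuous_snd)
  have heq : ∀ q : (unitInterval × unitInterval × unitInterval) × V, |(q.1.1 : ℝ) - q.1.2.1| = 0 →
      μ' q.1 = lam q.1.1 ∧ β' q.1 = β q.1.1 := fun q hq => by
    have : q.1.2.1 = q.1.1 := Subtype.ext (sub_eq_zero.1 (abs_eq_zero.1 hq)).symm
    simp only [μ', β', this, mix_self, and_self]
  obtain ⟨a₀, ha₀, δ₀, hδ₀, h0⟩ := exists_le_near_zero c0 hn (fun q => neg_nonpos.2 (abs_nonneg _)) (fun q hq => by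
      obtain ⟨b, hb⟩ := o.exists_positive_basis q.2
      have := (hpos q.1.1).pf_pos q.2 hb
      rw [(heq q (neg_eq_zero.1 hq)).1, volRatio_pos_iff (dLin_self _ _) (dLin_self _ _) (dLin_self _ _) this, pf2_self]
      linarith)
  obtain ⟨a₁, ha₁, δ₁, hδ₁, h1⟩ := exists_le_near_zero ((c1.min c2).min (c3.min c4)) hn'
    (fun q => by linarith [abs_nonneg ((q.1.1 : ℝ) - q.1.2.1), D.isBdry.nonpos q.2])
    (fun q hq => by
      have e1 := abs_nonneg ((q.1.1 : ℝ) - q.1.2.1)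
      have e2 := D.isBdry.nonpos q.2
      obtain ⟨e3, e4⟩ := heq q (by linarith)
      obtain ⟨y, hy⟩ : q.2 ∈ range bd.toFun := by rw [bd.range_eq]; exact (D.isBdry.eq_zero_iff _).1 (by linarith)
      have key : ∀ α α' : OneForm ℋ V, bd.restrict α = bd.restrict (lam q.1.1) →
          bd.restrict α' = bd.restrict (lam q.1.1) →
          0 < volRatio (wedge (D.ds q.2) (α.cov q.2)) (α'.dLin q.2) ((lam q.1.1).dLin q.2) := fun α α' h h' => by
        have := (bd.wedgePos_iff D.isBdry (hpos q.1.1) α α').1 (by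
          rw [h, h']; exact hcon q.1.1) y
        rwa [hy] at this
      rw [e3, e4]
      exact lt_min (lt_min (key _ _ rfl rfl) (key _ _ rfl (D.restrict_ext _)))
        (lt_min (key _ _ (D.restrict_ext _) rfl) (key _ _ (D.restrict_ext _) (D.restrict_ext _))))
  obtain ⟨K, hK, hb⟩ := exists_abs_le_of_compact ((c1.abs.add c2.abs).add ((c5.abs.add c6.abs).add c7.abs))
  refine ⟨min (a₀ / 2) a₁, by positivity, K + 1, by positivity, min δ₀ (δ₁ / 2), by positivity,
    fun t t' ht κ hκ x => ?_⟩
  obtain ⟨b, hbo⟩ := o.exists_positive_basis x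
  have hP := (hpos t).pf_pos x hbo
  have b0 := h0 ((t, t', ⟨κ, hκ⟩), x) (neg_le_neg (ht.trans (min_le_left _ _)))
  have b1 := fun hx : -(min δ₀ (δ₁ / 2)) ≤ D.s x => h1 ((t, t', ⟨κ, hκ⟩), x) (by
    have := ht.trans (min_le_right _ _)
    have := min_le_right δ₀ (δ₁ / 2)
    change -δ₁ ≤ -|(t : ℝ) - t'| + D.s x
    linarith)
  have b2 := (le_abs_self _).trans (hb ((t, t', ⟨κ, hκ⟩), x))
  set A := (mix κ (lam t) (lam t')).dLin x with hA
  set B := (mix κ (β t) (β t')).dLin x with hB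
  have hA' : ∀ u, A u u = 0 := dLin_self _ _
  have hB' : ∀ u, B u u = 0 := dLin_self _ _
  have hL' : ∀ u, (lam t).dLin x u u = 0 := dLin_self _ _
  simp only [le_min_iff] at b1; change a₀ ≤ volRatio A A ((lam t).dLin x) at b0
  rw [volRatio_eq hA' hA' hL' b, le_div_iff₀ hP, pf2_self] at b0
  have b1' := fun hx => (show (a₁ ≤ volRatio (wedge (D.isBdry.dForm.cov x) ((mix κ (lam t) (lam t')).cov x)) A ((lam t).dLin x) ∧
    a₁ ≤ volRatio (wedge (D.isBdry.dForm.cov x) ((mix κ (lam t) (lam t')).cov x)) B ((lam t).dLin x)) ∧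
    a₁ ≤ volRatio (wedge (D.isBdry.dForm.cov x) ((mix κ (β t) (β t')).cov x)) A ((lam t).dLin x) ∧
    a₁ ≤ volRatio (wedge (D.isBdry.dForm.cov x) ((mix κ (β t) (β t')).cov x)) B ((lam t).dLin x) from b1 hx)
  change |volRatio (wedge (D.isBdry.dForm.cov x) ((mix κ (lam t) (lam t')).cov x)) A ((lam t).dLin x)| +
    |volRatio (wedge (D.isBdry.dForm.cov x) ((mix κ (lam t) (lam t')).cov x)) B ((lam t).dLin x)| +
    (|volRatio A B ((lam t).dLin x)| + |volRatio B B ((lam t).dLin x)| +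
      |volRatio (wedge (D.isBdry.dForm.cov x) ((β t + (-1 : ℝ) • β t').cov x)) B ((lam t).dLin x)|) ≤ K at b2
  have w := fun θ : Tan ℋ x →ₗ[ℝ] ℝ => wedge_self (D.isBdry.dForm.cov x) θ
  rw [volRatio_eq (w _) hA' hL' b, volRatio_eq (w _) hB' hL' b, volRatio_eq hA' hB' hL' b,
    volRatio_eq hB' hB' hL' b, volRatio_eq (w _) hB' hL' b, pf2_self] at b2
  rw [volRatio_eq (w _) hA' hL' b, volRatio_eq (w _) hB' hL' b, volRatio_eq (w _) hA' hL' b,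
    volRatio_eq (w _) hB' hL' b, le_div_iff₀ hP, le_div_iff₀ hP, le_div_iff₀ hP, le_div_iff₀ hP] at b1'
  simp only [abs_div, abs_of_pos hP, ← add_div, div_le_iff₀ hP, abs_mul, abs_two] at b2
  have m1 : min (a₀ / 2) a₁ * pf ((lam t).dLin x) b ≤ a₀ / 2 * pf ((lam t).dLin x) b := by gcongr; exact min_le_left _ _
  have m2 : min (a₀ / 2) a₁ * pf ((lam t).dLin x) b ≤ a₁ * pf ((lam t).dLin x) b := by gcongr; exact min_le_right _ _
  have n1 := abs_nonneg (pf2 (wedge (D.isBdry.dForm.cov x) ((mix κ (lam t) (lam t')).cov x)) A b)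
  have n2 := abs_nonneg (pf2 (wedge (D.isBdry.dForm.cov x) ((mix κ (lam t) (lam t')).cov x)) B b)
  have n3 := abs_nonneg (pf2 A B b)
  have n4 := abs_nonneg (pf B b)
  have n5 := abs_nonneg (pf2 (wedge (D.isBdry.dForm.cov x) ((β t + (-1 : ℝ) • β t').cov x)) B b)
  exact ⟨b, pf ((lam t).dLin x) b, hP, by linarith, by linarith, by linarith, by linarith, by linarith, by linarith,
    fun hx => m2.trans (b1' hx).1.1, fun hx => m2.trans (b1' hx).1.2, fun hx => m2.trans (b1' hx).2.1,
    fun hx => m2.trans (b1' hx).2.2⟩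

end EndForms

section EndData

variable {s : V → ℝ} {hs : IsBdryFun s} {a K δ η : ℝ} {μ β γ : OneForm ℋ V}

theorem EndBounded.exists_basis (h : EndBounded hs a K η μ β γ) (p : EndProfile a K δ) (ha : 0 < a) (hK : 0 < K)
    (hδ : δ ≤ η) {x : V} (hx : s x < 0) : ∃ b : Basis (Fin 4) ℝ (Tan ℋ x), 0 < pf (endD hs p μ β x) b ∧
      (-η ≤ s x → 0 < pf2 (wedge (hs.dForm.cov x) (p.χ (s x) • μ.cov x + p.g (s x) • β.cov x))
        (endD hs p μ β x) b) := by
  obtain ⟨b, P, hb⟩ := h x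
  rcases le_or_gt (s x) (-δ) with h1 | h1
  · obtain ⟨e1, e2, e3, e4⟩ := p.of_le _ h1
    refine ⟨b, ?_, fun hn => ?_⟩
    · have : endD hs p μ β x = μ.dLin x := by
        rw [endD, e1, e2, e3, e4]
        refine LinearMap.ext fun u => LinearMap.ext fun w => ?_
        simp [endBilin, wedge_apply]
      rw [this]; exact (mul_pos ha hb.pos).trans_le hb.pf_A
    · exact hb.pf2_pos hn ha (by rw [e1]; exact zero_le_one) e3.ge (by rw [e1, e3]; norm_num)
  · obtain ⟨e1, e2, e3, e4, e5, -⟩ := p.of_lt _ ⟨h1, hx⟩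
    have hn : -η ≤ s x := by linarith
    refine ⟨b, lt_of_lt_of_le ?_ (hb.pf_ge hn ha hK e1 e2.le e3.le e4 e5), fun _ => hb.pf2_pos hn ha e1 e2.le
      (by linarith)⟩
    have := hb.pos
    positivity

theorem EndBounded.eq_zero (h : EndBounded hs a K η μ β γ) (p : EndProfile a K δ) (ha : 0 < a) (hK : 0 < K)
    (hδ : δ ≤ η) (x : Interior V) {u : Tan (𝓡 4) x}
    (hu : ∀ w, (endForm hs p μ β).d x u w = 0) : u = 0 := by
  obtain ⟨b, hb, -⟩ := h.exists_basis p ha hK hδ (hs.lt_zero x)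
  refine injective_mfderiv_val x ((eq_zero_of_pf_ne_zero (endD_self hs p μ β x.val) b hb.ne' fun w => ?_).trans
    (map_zero _).symm)
  obtain ⟨w, rfl⟩ := surjective_mfderiv_val x w
  rw [← d_endForm, hu]

theorem EndBounded.ds_pos (h : EndBounded hs a K η μ β γ) (p : EndProfile a K δ) (ha : 0 < a) (hK : 0 < K)
    (hδ : δ ≤ η) (x : Interior V) (hx : -η ≤ s x.val) {u : Tan (𝓡 4) x}
    (hu : ∀ w, (endForm hs p μ β).d x u w = endForm hs p μ β x w) :
    0 < mvfderiv (𝓡 4) (fun x : Interior V => s x.val) x u := by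
  obtain ⟨b, hb, hb'⟩ := h.exists_basis p ha hK hδ (hs.lt_zero x)
  have := mul_pf_eq_pf2 (endD_self hs p μ β x.val) (hs.dForm.cov x.val)
    (p.χ (s x.val) • μ.cov x.val + p.g (s x.val) • β.cov x.val) (Z := dval x u) (fun w => by
      obtain ⟨w, rfl⟩ := surjective_mfderiv_val x w
      rw [← d_endForm, hu, endForm_apply]; rfl) b
  rw [mvfderiv_comp_val hs.contMDiff]; exact pos_of_mul_pos_left (this.symm ▸ hb' hx) hb.le

/-- A field with which `β` and `dβ` contract to zero near the boundary. -/
structure IsConeField (s : V → ℝ) (δ : ℝ) (X : ∀ x : V, Tan ℋ x) (β : OneForm ℋ V) : Prop where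
  ne_zero : ∀ x, -δ ≤ s x → mvfderiv ℋ s x (X x) ≠ 0
  apply : ∀ x, -δ ≤ s x → β x (X x) = 0
  d_apply : ∀ x, -δ ≤ s x → ∀ w, β.d x (X x) w = 0

variable {X : ∀ x : V, Tan ℋ x} (p : EndProfile a K δ)

theorem exists_end_liouville (hδ : 0 < δ) (x : Interior V) (hx : -(δ / 3) < s x.val)
    (hX : mvfderiv ℋ s x.val (X x.val) ≠ 0) : ∃ ζ : Tan (𝓡 4) x,
      mvfderiv ℋ s x.val (dval x ζ) = p.g (s x.val) / p.g' (s x.val) ∧ ∀ μ β : OneForm ℋ V, IsConeField s δ X β → ∀ w,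
        (endForm hs p μ β).d x ζ w = endForm hs p μ β x w := by
  obtain ⟨ζ, hζ⟩ := surjective_mfderiv_val x ((p.g (s x.val) / p.g' (s x.val) / mvfderiv ℋ s x.val (X x.val)) • X x.val)
  obtain ⟨-, -, e3, -⟩ := p.of_lt _ ⟨by linarith, hs.lt_zero x⟩
  obtain ⟨e1, e2⟩ := p.of_end _ hx
  refine ⟨ζ, ?_, fun μ β hβ w => ?_⟩
  · rw [hζ, map_smul, smul_eq_mul, div_mul_cancel₀ _ hX]
  · rw [d_endForm, endForm_apply, hζ, endD, e1, e2]
    have h1 := hβ.apply x.val (by linarith)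
    have h2 := hβ.d_apply x.val (by linarith)
    have h3 : hs.dForm.cov x.val (X x.val) = mvfderiv ℋ s x.val (X x.val) := rfl
    simp only [endBilin, LinearMap.add_apply, LinearMap.smul_apply, map_smul, wedge_apply, smul_eq_mul, cov_apply,
      dLin_apply, h1, h2]
    rw [← cov_apply, ← cov_apply, h3]; field_simp; ring

/-- The exhaustion function `-1/s` of the interior. -/
def endHeight (s : V → ℝ) (x : Interior V) : ℝ := -(s x.val)⁻¹

theorem mvfderiv_endHeight (hs : IsBdryFun s) (x : Interior V) (w : Tan (𝓡 4) x) :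
    mvfderiv (𝓡 4) (endHeight s) x w = (s x.val ^ 2)⁻¹ * mvfderiv ℋ s x.val (dval x w) := by
  have h := (hasDerivAt_inv (hs.lt_zero x).ne).neg
  rw [neg_neg] at h
  exact (mvfderiv_comp_hasDerivAt (s := fun x : Interior V => s x.val) h
    (hs.contMDiff_val.mdifferentiableAt (by simp)) w).trans (congrArg _ (mvfderiv_comp_val hs.contMDiff x w))

theorem contMDiff_endHeight (hs : IsBdryFun s) : ContMDiff (𝓡 4) ℐ ∞ (endHeight s) := fun x =>
  ContMDiffAt.comp (g := fun r : ℝ => -r⁻¹) x (contDiffAt_inv ℝ (hs.lt_zero x).ne).neg.contMDiffAt (hs.contMDiff_val x)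

theorem endHeight_pos (hs : IsBdryFun s) (x : Interior V) : 0 < endHeight s x :=
  neg_pos.2 (inv_lt_zero.2 (hs.lt_zero x))

theorem lt_endHeight_iff (hs : IsBdryFun s) (x : Interior V) {R : ℝ} (hR : 0 < R) :
    R < endHeight s x ↔ -R⁻¹ < s x.val := by
  have h := hs.lt_zero x
  rw [endHeight, ← inv_neg, lt_inv_comm₀ hR (neg_pos.2 h)]; exact ⟨fun h => by linarith, fun h => by linarith⟩

theorem isCompact_endHeight_le (hs : IsBdryFun s) [CompactSpace V] (R : ℝ) :
    IsCompact {x : Interior V | endHeight s x ≤ R} := by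
  have hR : 0 < |R| + 1 := by positivity
  refine (hs.isCompact_le (neg_lt_zero.2 (inv_pos.2 hR))).of_isClosed_subset
    (isClosed_le (contMDiff_endHeight hs).continuous continuous_const) fun x hx => ?_
  by_contra hx'
  have h1 := (lt_endHeight_iff hs x hR).2 (not_le.1 hx')
  have h2 : endHeight s x ≤ R := hx
  linarith [le_abs_self R]

theorem lt_endHeight_iff' (hs : IsBdryFun s) (hδ : 0 < δ) (x : Interior V) :
    3 / δ < endHeight s x ↔ -(δ / 3) < s x.val := by rw [lt_endHeight_iff hs x (by positivity), inv_div]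

theorem abs_mvfderiv_endHeight_le (hs : IsBdryFun s) (hδ : 0 < δ) (x : Interior V)
    (hx : -(δ / 3) < s x.val) {w : Tan (𝓡 4) x} {C : ℝ} (hC : 0 ≤ C)
    (hw : |mvfderiv ℋ s x.val (dval x w)| ≤ C * (p.g (s x.val) / p.g' (s x.val))) :
    |mvfderiv (𝓡 4) (endHeight s) x w| ≤ C := by
  obtain ⟨-, -, e3, -, -, e6⟩ := p.of_lt _ ⟨by linarith, hs.lt_zero x⟩
  have h0 : 0 < s x.val ^ 2 := by have := (hs.lt_zero x).ne; positivity
  rw [mvfderiv_endHeight hs, abs_mul, abs_of_pos (inv_pos.2 h0), inv_mul_le_iff₀ h0, mul_comm]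
  exact hw.trans (mul_le_mul_of_nonneg_left ((div_le_iff₀ e3).2 e6) hC)

/-- The forms of two pairs which can be joined by pairs with uniform estimates satisfy the
hypotheses of Moser's theorem. -/
def moserData [CompactSpace V] {μ' β' : OneForm ℋ V} (h : ∀ κ ∈ Icc (0 : ℝ) 1,
      EndBounded hs a K η (mix κ μ μ') (mix κ β β') (β + (-1 : ℝ) • β')) (ha : 0 < a) (hK : 0 < K)
    (hδ : 0 < δ) (hδη : δ ≤ η) (hX : IsConeField s δ X β) (hX' : IsConeField s δ X β') :
    MoserData (endForm hs p μ β) (endForm hs p μ' β') where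
  nondegenerate κ hκ x u hu := (h κ hκ).eq_zero p ha hK hδη x fun w => by
    rw [endForm_mix, mix, d_add, d_smul, d_add, d_smul, ← hu w]; ring
  ρ := endHeight s
  contMDiff_ρ := contMDiff_endHeight hs
  nonneg x := (endHeight_pos hs x).le
  isCompact_le := isCompact_endHeight_le hs
  R := 3 / δ
  liouville x hx := by
    rw [lt_endHeight_iff' hs hδ] at hx
    obtain ⟨ζ, -, hζ⟩ := exists_end_liouville (hs := hs) p hδ x hx (hX.ne_zero _ (by linarith))
    exact ⟨ζ, fun w => ⟨hζ _ _ hX w, hζ _ _ hX' w⟩⟩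
  B := 2 * K / a
  bound x hx κ hκ y hy := by
    rw [lt_endHeight_iff' hs hδ] at hx
    obtain ⟨e1, e2⟩ := p.of_end _ hx
    obtain ⟨-, e3, e4, e5, -⟩ := p.of_lt _ ⟨by linarith, hs.lt_zero x⟩
    obtain ⟨b, P, hb⟩ := h κ hκ x.val
    refine abs_mvfderiv_endHeight_le p hs hδ x hx (by positivity) ?_
    refine hb.abs_le (dLin_self _ _) (dLin_self _ _) (by linarith) ha hK e3 e4 e5 fun w => ?_
    obtain ⟨w, rfl⟩ := surjective_mfderiv_val x w
    have h1 : (endForm hs p (mix κ μ μ') (mix κ β β')).d x y w = p.g (s x.val) *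
        (β + (-1 : ℝ) • β') x.val (dval x w) := by
      rw [endForm_mix, mix, d_add, d_smul, d_add, d_smul, OneForm.add_apply, OneForm.smul_apply]
      have := hy w
      rw [endForm_apply, endForm_apply, e1] at this; linarith
    rw [d_endForm, endD, e1, e2] at h1; exact h1

theorem EndBounded.exists_flow [CompactSpace V] [T2Space V] (h : EndBounded hs a K η μ β γ) (ha : 0 < a) (hK : 0 < K)
    (hδ : 0 < δ) (hδη : δ ≤ η) (hX : IsConeField s δ X β) :
    ∃ (Z : ∀ x : Interior V, Tan (𝓡 4) x) (Ψ : ℝ → Interior V → Interior V), SmoothField Z ∧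
      (∀ x w, (endForm hs p μ β).d x (Z x) w = endForm hs p μ β x w) ∧ IsFlow Z Ψ := by
  obtain ⟨Z, hZ, hd⟩ := exists_vectorField (endForm hs p μ β) ((0 : ℝ) • endForm hs p μ β) ((0 : ℝ) • endForm hs p μ β)
    ((0 : ℝ) • endForm hs p μ β) ((0 : ℝ) • endForm hs p μ β) (endForm hs p μ β) (fun x u hu =>
      h.eq_zero p ha hK hδη x fun w => by
        have := hu w
        simp only [OneForm.smul_apply] at this; linarith)
  have hd : ∀ x w, (endForm hs p μ β).d x (Z x) w = endForm hs p μ β x w := fun x w => by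
    have := hd x w
    simp only [OneForm.smul_apply] at this; linarith
  obtain ⟨C, hC⟩ := (isCompact_endHeight_le hs (3 / δ)).exists_bound_of_continuousOn
    (OneForm.contMDiff_apply (OneForm.ofFun _ (contMDiff_endHeight hs)) hZ).continuous.continuousOn
  obtain ⟨Ψ, hΨ⟩ := exists_isFlow hZ (contMDiff_endHeight hs) (isCompact_endHeight_le hs) (C := max C 1) fun x => by
    rcases le_or_gt (endHeight s x) (3 / δ) with hx | hx
    · exact (hC x hx).trans (le_max_left _ _)
    · rw [lt_endHeight_iff' hs hδ] at hx
      obtain ⟨ζ, h1, h2⟩ := exists_end_liouville (hs := hs) p hδ x hx (hX.ne_zero _ (by linarith))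
      have e : Z x = ζ := sub_eq_zero.1 (h.eq_zero p ha hK hδη x fun w => by
        have e1 := d_smul_left (endForm hs p μ β) x (-1) ζ w
        rw [sub_eq_add_neg, ← neg_one_smul ℝ ζ, d_add_left, e1, hd, h2 _ _ hX]; ring)
      obtain ⟨-, e3, e4, -⟩ := p.of_lt _ ⟨by linarith, hs.lt_zero x⟩
      rw [e]
      refine (abs_mvfderiv_endHeight_le p hs hδ x hx zero_le_one ?_).trans (le_max_right _ _)
      rw [h1, one_mul, abs_of_pos (div_pos e3 e4)]
  exact ⟨Z, Ψ, hZ, hd, hΨ⟩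

theorem EndBounded.exists_liouvilleField [CompactSpace V] [T2Space V] (h : EndBounded hs a K η μ β γ) (ha : 0 < a)
    (hη : 0 ≤ η) (hμ : IsPositiveSymplectic o μ) :
    ∃ X : ∀ x : V, Tan ℋ x, IsInwardField s X ∧ ∀ x w, μ.d x (X x) w = -μ x w := by
  obtain ⟨X, hX, hd⟩ := exists_vectorField μ ((0 : ℝ) • μ) ((0 : ℝ) • μ) ((0 : ℝ) • μ) ((0 : ℝ) • μ) ((-1 : ℝ) • μ)
    (fun x u hu => hμ.1 x u fun w => by
      have := hu w
      simp only [OneForm.smul_apply] at this; linarith)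
  have hd : ∀ x w, μ.d x (X x) w = -μ x w := fun x w => by
    have := hd x w
    simp only [OneForm.smul_apply] at this; linarith
  refine ⟨X, ⟨hX, fun x hx => ?_⟩, hd⟩
  obtain ⟨b, P, hb⟩ := h x
  have h1 := mul_pf_eq_pf2 (μ.dLin_self x) (hs.dForm.cov x) (-μ.cov x) (Z := X x) (hd x) b
  have h2 : pf2 (wedge (hs.dForm.cov x) (-μ.cov x)) (μ.dLin x) b =
      -pf2 (wedge (hs.dForm.cov x) (μ.cov x)) (μ.dLin x) b := by simp only [pf2, wedge_apply, LinearMap.neg_apply]; ring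
  have h3 := hb.near_μ_A (by rw [(hs.eq_zero_iff x).2 hx]; linarith)
  have h4 := hb.pf_A
  have h5 := mul_pos ha hb.pos
  have h6 : hs.dForm.cov x (X x) * pf (μ.dLin x) b < 0 := by rw [h1, h2]; linarith
  exact neg_of_mul_neg_left h6 (by linarith)

theorem EndBounded.exists_completionData [CompactSpace V] [T2Space V] (h : EndBounded hs a K η μ β γ) (ha : 0 < a)
    (hK : 0 < K) (hδ : 0 < δ) (hδη : δ ≤ η) (hX : IsConeField s δ X β) (hμ : IsPositiveSymplectic o μ)
    {Y : ∀ x : V, Tan ℋ x} (hY : IsInwardField s Y) (hd : ∀ x w, μ.d x (Y x) w = -μ x w)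
    {T τ : ℝ} {Φ : ℝ → V → V} (hΦ : IsInwardFlow Y T Φ) (hτ : τ ∈ Ioo 0 T) (hτs : ∀ x, s (Φ τ x) < -δ) {B : ℝ}
    (hB : ∀ x, |mvfderiv ℋ s x (Y x)| < B) (hτB : τ * B < η - δ) :
    Nonempty (CompletionData μ (endForm hs p μ β) τ) := by
  obtain ⟨Z, Ψ, hZ, hdZ, hΨ⟩ := h.exists_flow p ha hK hδ hδη hX
  have hform : ∀ x : Interior V, s x.val < -δ → ∀ w, endForm hs p μ β x w = μ x.val (dval x w) := fun x hx w => by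
      obtain ⟨e1, -, e3, -⟩ := p.of_le _ hx.le
      rw [endForm_apply, e1, e3]; ring
  have hZY : ∀ x : Interior V, s x.val < -δ → dval x (Z x) = -Y x.val := fun x hx => by
    obtain ⟨e1, e2, e3, e4⟩ := p.of_le _ hx.le
    refine eq_neg_of_add_eq_zero_left (hμ.1 x.val _ fun w => ?_)
    obtain ⟨w, rfl⟩ := surjective_mfderiv_val x w
    have h1 := (d_endForm hs p μ β x (Z x) w).symm.trans ((hdZ x w).trans (hform x hx w))
    rw [endD, e1, e2, e3, e4] at h1
    simp only [endBilin, wedge_apply, LinearMap.add_apply, LinearMap.smul_apply, smul_eq_mul, zero_mul, one_mul,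
      mul_zero, sub_zero, add_zero] at h1
    rw [d_add_left, hd]; exact (congrArg (· + _) h1).trans (add_neg_cancel _)
  refine ⟨⟨s, hs, Y, hY, hd, T, Φ, hΦ, hτ, Z, hZ, hdZ, Ψ, hΨ, -δ, hτs, hform, hZY, -η,
    fun x hx => h.ds_pos p ha hK hδη x hx.le (hdZ x), fun x hx => ?_⟩⟩
  have hx0 : x ∈ (ℋ).interior V := by
    rw [← ModelWithCorners.compl_boundary]
    exact fun hb => by linarith [(hs.eq_zero_iff x).2 hb]
  obtain ⟨z, rfl⟩ : ∃ z : Interior V, z.val = x := ⟨⟨x, hx0⟩, rfl⟩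
  have hB0 : 0 < B := (abs_nonneg _).trans_lt (hB z.val)
  have hder := hΨ.hasDerivAt hs.contMDiff_val z
  have hlt : ∀ r ∈ Icc 0 τ, -η + r * B < -δ := fun r hr => by
    have := mul_le_mul_of_nonneg_right hr.2 hB0.le
    linarith
  have hle : ∀ r ∈ Icc 0 τ, s (Ψ r z).val ≤ -η + r * B :=
    image_le_of_deriv_right_lt_deriv_boundary (fun r _ => (hder r).continuousAt.continuousWithinAt)
      (fun r _ => (hder r).hasDerivWithinAt) (by rw [hΨ.init]; linarith)
      (fun r => by simpa using ((hasDerivAt_id r).mul_const B).const_add (-η)) fun r hr e => by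
        have h1 : s (Ψ r z).val < -δ := e.trans_lt (hlt r ⟨hr.1, hr.2.le⟩)
        rw [mvfderiv_comp_val hs.contMDiff, hZY _ h1, map_neg]; linarith [(abs_lt.1 (hB (Ψ r z).val)).1]
  refine ⟨(Ψ τ z).val, ?_⟩
  have := eqOn_of_hasVelocity range_euclideanHalfSpace_eq hY.contMDiff (γ := fun r => Φ r (Ψ τ z).val)
    (γ' := fun r => (Ψ (τ - r) z).val) (a := 0) (b := τ)
    (fun r hr => (hΦ.isSemiflow.curve _ r ⟨hr.1, hr.2.trans hτ.2.le⟩).mono (Icc_subset_Icc_right hτ.2.le))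
    (fun r hr => by
      have h1 := ((hΨ.curve z (τ - r)).mono (subset_univ (Icc 0 τ))).comp_real (f := fun r => τ - r)
        ((hasDerivWithinAt_id r (Icc 0 τ)).const_sub τ) fun r hr => ⟨by linarith [hr.2], by linarith [hr.1]⟩
      have h2 := h1.map (Interior.contMDiff_val.mdifferentiableAt (x := Ψ (τ - r) z) (by simp))
      have hr' : τ - r ∈ Icc 0 τ := ⟨by linarith [hr.2], by linarith [hr.1]⟩
      have e : dval _ ((-1 : ℝ) • Z (Ψ (τ - r) z)) = Y (Ψ (τ - r) z).val := by
        rw [map_smul, hZY _ ((hle _ hr').trans_lt (hlt _ hr')), neg_one_smul, neg_neg]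
      exact e ▸ h2)
    (by simp [hΦ.isSemiflow.init]) (right_mem_Icc.2 hτ.1.le)
  simpa [hΨ.init] using this

end EndData

section ExactSymplectomorphism

variable [CompactSpace V] [T2Space V]

theorem ExactlyConjugate.smul {Λ₀ Λ₁ : OneForm I N} (h : ExactlyConjugate Λ₀ Λ₁) (c : ℝ) : ExactlyConjugate (c • Λ₀) (c • Λ₁) := by
  obtain ⟨Φ, f, hf, hfs, h⟩ := h
  refine ⟨Φ, fun x => c * f x, contMDiff_const.mul hf, hfs.mul_left, fun z w => ?_⟩
  have h1 : mvfderiv I (fun x => c * f x) z w = c * mvfderiv I f z w :=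
    mvfderiv_comp_hasDerivAt (by simpa using (hasDerivAt_id (f z)).const_mul c) (hf.mdifferentiableAt (by simp)) w
  rw [h1, OneForm.smul_apply, OneForm.smul_apply, h, mul_add]

theorem IsBdryFun.exists_collar {s : V → ℝ} (hs : IsBdryFun s) {U : Set V} (hU : IsOpen U)
    (hb : (ℋ).boundary V ⊆ U) : ∃ δ > (0 : ℝ), ∀ x, -δ ≤ s x → x ∈ U := by
  rcases (Uᶜ).eq_empty_or_nonempty with h | h
  · exact ⟨1, one_pos, fun x _ => by_contra fun hx => (h ▸ hx : x ∈ (∅ : Set V))⟩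
  · obtain ⟨x₀, hx₀, h0⟩ := hU.isClosed_compl.isCompact.exists_isMaxOn h hs.contMDiff.continuous.continuousOn
    have h1 : s x₀ < 0 := lt_of_le_of_ne (hs.nonpos _) fun h => hx₀ (hb ((hs.eq_zero_iff _).1 h))
    refine ⟨-s x₀ / 2, by linarith, fun x hx => by_contra fun hx' => ?_⟩
    have h2 : s x ≤ s x₀ := h0 hx'
    linarith

theorem BoundaryData.exists_isConeField (D : BoundaryData bd) :
    ∃ δ₀ > (0 : ℝ), ∀ δ ≤ δ₀, ∀ β, IsConeField D.s δ D.X (D.ext β) := by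
  have hc := OneForm.contMDiff_apply D.isBdry.dForm D.isInwardField.contMDiff
  obtain ⟨δ₀, h0, h⟩ := D.isBdry.exists_collar (D.isOpen_U.inter (isOpen_lt hc.continuous continuous_const))
    (subset_inter D.boundary_subset D.isInwardField.inward)
  exact ⟨δ₀, h0, fun δ hδ β => ⟨fun x hx => (h x (by linarith)).2.ne, fun x hx => D.ext_field β x (h x (by linarith)).1,
    fun x hx => D.d_ext_field β x (h x (by linarith)).1⟩⟩

theorem IsInwardFlow.exists_lt {s : V → ℝ} (hs : IsBdryFun s) {X : ∀ x : V, Tan ℋ x}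
    {T τ : ℝ} {Φ : ℝ → V → V} (hΦ : IsInwardFlow X T Φ) (hτ : τ ∈ Ioo 0 T) : ∃ δ > (0 : ℝ), ∀ x, s (Φ τ x) < -δ := by
  rcases isEmpty_or_nonempty V with hV | hV
  · exact ⟨1, one_pos, fun x => hV.elim x⟩
  · obtain ⟨x₀, -, h0⟩ := isCompact_univ.exists_isMaxOn univ_nonempty
      (hs.contMDiff.continuous.comp (hΦ.contMDiff ⟨hτ.1.le, hτ.2.le⟩).continuous).continuousOn
    have h1 : s (Φ τ x₀) < 0 := hs.lt_zero ⟨_, hΦ.interior x₀ τ ⟨hτ.1, hτ.2.le⟩⟩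
    refine ⟨-s (Φ τ x₀) / 2, by linarith, fun x => ?_⟩
    have : s (Φ τ x) ≤ s (Φ τ x₀) := h0 (mem_univ x)
    linarith

theorem exactSymplectomorphic_of_joined {ℓ₀ ℓ₁ : LiouvilleStructure bd o} (h : Joined ℓ₀ ℓ₁) :
    ExactSymplectomorphic bd ℓ₀.1 ℓ₁.1 := by
  obtain ⟨ℓ⟩ := h
  obtain ⟨D⟩ := exists_boundaryData bd
  set lam : unitInterval → OneForm ℋ V := fun t => (ℓ t).1
  obtain ⟨a, ha, K, hK, η, hη, hE⟩ := D.exists_endBound (lam := lam) (continuous_subtype_val.comp ℓ.continuous)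
    (fun t => (ℓ t).2.1) fun t => (ℓ t).2.2
  have hs := D.isBdry
  have hE' : ∀ t, EndBounded hs a K η (lam t) (D.ext (bd.restrict (lam t)))
      (D.ext (bd.restrict (lam t)) + (-1 : ℝ) • D.ext (bd.restrict (lam t))) := fun t => by
    have := hE t t (by simpa using hη.le) 0 (left_mem_Icc.2 zero_le_one)
    rwa [mix_self, mix_self] at this
  obtain ⟨δ₀, hδ₀, hcone⟩ := D.exists_isConeField
  choose X hX hXd using fun t => (hE' t).exists_liouvilleField ha hη.le (ℓ t).2.1
  choose T Φ hΦ using fun t => (hX t).exists_isInwardFlow hs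
  choose B hB0 hB using fun t => exists_abs_le_of_compact (OneForm.contMDiff_apply hs.dForm (hX t).contMDiff).continuous
  obtain ⟨τ, hτ0, hτ⟩ : ∃ τ > (0 : ℝ), ∀ t : unitInterval, t = 0 ∨ t = 1 → τ < T t ∧ τ * (B t + 1) < η / 2 := by
    have key : ∀ t, ∀ᶠ τ in 𝓝[>] (0 : ℝ), τ < T t ∧ τ * (B t + 1) < η / 2 := fun t => by
      have h1 : ContinuousAt (fun τ : ℝ => τ * (B t + 1)) 0 := by fun_prop
      exact ((eventually_lt_nhds (hΦ t).pos).and (h1.eventually_lt_const (by simpa using hη))).filter_mono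
        nhdsWithin_le_nhds
    obtain ⟨τ, ⟨h1, h2⟩, h3⟩ := (((key 0).and (key 1)).and self_mem_nhdsWithin).exists
    exact ⟨τ, h3, by rintro t (rfl | rfl) <;> assumption⟩
  have hδe : ∀ t : unitInterval, t = 0 ∨ t = 1 → ∃ δ > (0 : ℝ), ∀ x, D.s (Φ t τ x) < -δ := fun t ht =>
    (hΦ t).exists_lt hs ⟨hτ0, (hτ t ht).1⟩
  obtain ⟨d0, hd0, hd0'⟩ := hδe 0 (Or.inl rfl)
  obtain ⟨d1, hd1, hd1'⟩ := hδe 1 (Or.inr rfl)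
  obtain ⟨δ, hδ, g1, g2, g3, g4, g5⟩ : ∃ δ > (0 : ℝ), δ ≤ δ₀ ∧ δ ≤ η / 2 ∧ δ ≤ d0 ∧ δ ≤ d1 ∧ 4 * K * δ ^ 2 ≤ a := by
    have h1 : ContinuousAt (fun δ : ℝ => 4 * K * δ ^ 2) 0 := by fun_prop
    have e : ∀ c > (0 : ℝ), ∀ᶠ δ in 𝓝 (0 : ℝ), δ ≤ c := fun c hc => eventually_le_nhds hc
    obtain ⟨δ, h, hδ⟩ := (((((e _ hδ₀).and ((e _ (half_pos hη)).and ((e _ hd0).and ((e _ hd1).and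
      (h1.eventually_lt_const (by simpa using ha))))))).filter_mono nhdsWithin_le_nhds).and
        (self_mem_nhdsWithin (s := Ioi (0 : ℝ)))).exists
    exact ⟨δ, hδ, h.1, h.2.1, h.2.2.1, h.2.2.2.1, h.2.2.2.2.le⟩
  obtain ⟨p⟩ := exists_endProfile ha hK hδ g5
  set Λ : unitInterval → OneForm (𝓡 4) (Interior V) := fun t =>
    endForm hs p (lam t) (D.ext (bd.restrict (lam t)))
  have hC : ∀ t : unitInterval, t = 0 ∨ t = 1 → (∀ x, D.s (Φ t τ x) < -δ) →
      Nonempty (CompletionData (lam t) (Λ t) τ) := fun t ht hlt =>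
    (hE' t).exists_completionData p ha hK hδ (by linarith) (hcone δ g1 _) (ℓ t).2.1 (hX t) (hXd t) (hΦ t)
      ⟨hτ0, (hτ t ht).1⟩ hlt (B := B t + 1) (fun x => (hB t x).trans_lt (lt_add_one _)) (by linarith [(hτ t ht).2])
  obtain ⟨C₀⟩ := hC 0 (Or.inl rfl) fun x => (hd0' x).trans_le (by linarith)
  obtain ⟨C₁⟩ := hC 1 (Or.inr rfl) fun x => (hd1' x).trans_le (by linarith)
  have hstep : ∀ t t' : unitInterval, dist t t' < η → ExactlyConjugate (Λ t') (Λ t) := fun t t' ht =>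
    (moserData p (hE t t' ht.le) ha hK hδ (by linarith) (hcone δ g1 _) (hcone δ g1 _)).exactlyConjugate
  have hclopen : IsClopen {t | ExactlyConjugate (Λ 0) (Λ t)} := by
    refine ⟨⟨isOpen_iff.2 fun t ht => ⟨η, hη, fun t' ht' h => ht ?_⟩⟩,
      isOpen_iff.2 fun t ht => ⟨η, hη, fun t' ht' => ExactlyConjugate.trans ht (hstep t' t ht')⟩⟩
    exact ExactlyConjugate.trans h (hstep t t' (by rwa [dist_comm]))
  have hconj : ExactlyConjugate (Λ 0) (Λ 1) := by
    have h1 : (1 : unitInterval) ∈ {t | ExactlyConjugate (Λ 0) (Λ t)} := by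
      rw [hclopen.eq_univ ⟨0, ExactlyConjugate.refl _⟩]; exact mem_univ _
    exact h1
  obtain ⟨F, f, hf, hfs, hF⟩ := hconj.smul (Real.exp τ)
  have e0 : ℓ₀.1 = lam 0 := congrArg Subtype.val ℓ.source.symm
  have e1 : ℓ₁.1 = lam 1 := congrArg Subtype.val ℓ.target.symm
  rw [e0, e1]; exact ⟨C₀.completion bd, C₁.completion bd, F, f, hf, hfs, hF⟩

end ExactSymplectomorphism

end Boundary

end

theorem mainTheorem8 {V : Type*} [TopologicalSpace V] [T2Space V] [CompactSpace V]
    [ChartedSpace (EuclideanHalfSpace 4) V] [IsManifold (𝓡∂ 4) ∞ V]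
    {M : Type*} [TopologicalSpace M]
    [ChartedSpace (EuclideanSpace ℝ (Fin 3)) M] [IsManifold (𝓡 3) ∞ M]
    (bd : BoundaryIdentification M V) (o : FourOrientation V) :
    (∃ P : ZerothHomotopy (LiouvilleStructure bd o) → ZerothHomotopy (PreLiouvilleStructure bd o),
      (∀ ℓ : LiouvilleStructure bd o, P (ZerothHomotopy.mk ℓ) = ZerothHomotopy.mk (ℓ.toPreLiouville bd o)) ∧
      Function.Bijective P) ∧ ∀ ℓ₀ ℓ₁ : LiouvilleStructure bd o,
      Joined (ℓ₀.toPreLiouville bd o) (ℓ₁.toPreLiouville bd o) → Joined ℓ₀ ℓ₁ ∧ ExactSymplectomorphic bd ℓ₀.1 ℓ₁.1 := by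
  exact ⟨exists_bijective_zerothHomotopy, fun ℓ₀ ℓ₁ h => ⟨joined_of_joined_toPreLiouville h,
      exactSymplectomorphic_of_joined (joined_of_joined_toPreLiouville h)⟩⟩
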